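/- \textbf{Conventions.} $\mathcal U\subset\mathcal U'$ are universes. A \emph{$\mathcal U$-category} is a category equivalent to one whose objects and arrows belong to $\mathcal U$, with $\mathcal U$-small hom-sets. A \emph{sink} on $X$ is a set of arrows with target $X$. A \emph{presite} $(\mathcal C,\tau)$ is a category with a pretopology $\tau$, i.e. a class of sinks (coverings) whose members are pullbackable, which is stable under base change and composition and contains all isomorphisms, and such that a sink of clopen arrows refined by a covering is itself a covering; here an arrow is \emph{clopen} if it belongs to some covering, and a sink $R$ refines $S$ if every arrow of $R$ factors through an arrow of $S$. A \emph{continuous} functor between presites (an arrow of presites) respects coverings and pullbacks of clopen arrows along arbitrary arrows; $[\mathcal C,\mathcal D]$ is the category of continuous functors and all natural transformations. A presite is a \emph{$\mathcal U$-presite} if it is a $\mathcal U$-category and for each object $X$ there is a $\mathcal U$-small set $G_X$ of objects such that for every clopen $U\to X$ there is a covering of $U$ by objects of $G_X$. A \emph{DG-presite} is a presite with subcanonical pretopology in which all clopen arrows are monomorphisms and every sink of clopen arrows on $X$ factors as a covering of some $V$ followed by a clopen arrow $V\to X$; a \emph{DG-$\mathcal U$-presite} is moreover a $\mathcal U$-presite.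 \textbf{Glutoses.} A \emph{$\mathcal U$-glutos} is a $\mathcal U$-category $\mathcal G$ with a class $\mathcal O$ of pullbackable arrows, containing isomorphisms and stable under composition and pullback, such that: (1) $fg,f\in\mathcal O$ implies $g\in\mathcal O$; (2) for every $X$ the full subcategory $\mathcal O/X\subset\mathcal G/X$ is a $\mathcal U$-topos, and for every $f\colon X\to Y$ the functor $f^*\colon\mathcal O/Y\to\mathcal O/X$ is an inverse image functor of a geometric morphism; (3) $\mathcal G$ has $\mathcal U$-small disjoint universal coproducts with injections in $\mathcal O$, and for a $\mathcal U$-small family $U_i\to X$ in $\mathcal O$ the arrow $\coprod U_i\to X$ is in $\mathcal O$; (4) epimorphisms in $\mathcal O$ are effective; $fp,p\in\mathcal O$ with $p$ epi implies $f\in\mathcal O$; every equivalence relation $r,s\colon R\rightrightarrows X$ with $r,s\in\mathcal O$ such that, for some jointly epimorphic sink of arrows $u_i\colon U_i\to X$ of $\mathcal O$, each induced relation $u_i^*(r,s)$ on $U_i$ is coequalized by some arrow of $\mathcal O$, is effective and has a universal coequalizer lying in $\mathcal O$; (5) if $r\colon X\to R$ is an epimorphism in $\mathcal O$ and $f\colon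 Y\to S$ has a pullback along $gr$, where $g\colon R\to S$, then $f$ has a pullback along $g$. A $\mathcal U$-glutos is a presite whose coverings are the jointly epimorphic sinks of arrows of $\mathcal O$. A \emph{universal $\mathcal U$-glutos} for a presite $\mathcal B$ is a $\mathcal U$-glutos $\mathcal G$ with a continuous $Y\colon\mathcal B\to\mathcal G$ such that $[\mathcal G,\mathcal E]\to[\mathcal B,\mathcal E]$, $F\mapsto FY$, is an equivalence for every $\mathcal U$-glutos $\mathcal E$. For a presite $\mathcal G$ let $\mathcal M\mathcal G$ be the same category with only those coverings that consist of monomorphisms. A \emph{nearly $\mathcal U$-glutos} is a $\mathcal U$-presite equivalent, by continuous mutually inverse equivalences, to $\mathcal M\mathcal G$ for $\mathcal G$ the universal $\mathcal U$-glutos of some $\mathcal U$-presite. \textbf{Charts and atlases.} Let $\mathcal C$ be a DG-$\mathcal U$-presite, $\mathcal D$ a DG-$\mathcal U'$-presite and $J\colon\mathcal C\to\mathcal D$ a continuous functor which \emph{admits atlases}: $J$ is faithful, and a sink of clopen arrows of $\mathcal C$ whose $J$-image is a covering is a covering. A \emph{$J$-atlas} on $X\in\mathcal D$ is a $\mathcal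 U$-small family $(U_i)$ of objects of $\mathcal C$ with a covering $\{u_i\colon JU_i\to X\}$ such that for all $i,j$ there are clopen arrows $a\colon W\to U_i$, $b\colon W\to U_j$ of $\mathcal C$ for which $(Ja,Jb)$ is a pullback of $(u_i,u_j)$. Atlases on $X$ are \emph{compatible} if their union is an atlas; this is an equivalence relation. For atlases $A=\{u_i\colon JU_i\to X\}$ and $B=\{v_k\colon JV_k\to Y\}$, an arrow $f\colon X\to Y$ is \emph{admissible} if for all $i,k$ there are $w_{ik}\colon W_{ik}\to U_i$, $f_{ik}\colon W_{ik}\to V_k$ in $\mathcal C$ with $w_{ik}$ clopen and $(Jw_{ik},Jf_{ik})$ a pullback of $(fu_i,v_k)$; this depends only on the classes $[A],[B]$. The category $\mathcal C_J$ has as objects the pairs $\langle X,[A]\rangle$ and as arrows the admissible arrows. A monic $f$ is \emph{$J$-clopen} if all the $f_{ik}$ can be taken clopen. Coverings of $\mathcal C_J$ are the sinks of $J$-clopen arrows whose image in $\mathcal D$ is a covering. Finally $J_{\mathcal C}\colon\mathcal C\to\mathcal C_J$ sends $X$ to $\langle JX,[\{\mathrm{id}_{JX}\}]\rangle$ and $f$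 to $Jf$. \textbf{Theorem.} With these notations, $\mathcal C_J$ is a DG-$\mathcal U$-presite. If moreover $\mathcal D$ is a nearly $\mathcal U'$-glutos, then $\mathcal C_J$ is a universal nearly $\mathcal U$-glutos for $\mathcal C$ with universal arrow $J_{\mathcal C}$: $\mathcal C_J$ is a nearly $\mathcal U$-glutos, $J_{\mathcal C}$ is continuous, and for every nearly $\mathcal U$-glutos $\mathcal E$ the functor $[\mathcal C_J,\mathcal E]\to[\mathcal C,\mathcal E]$, $F\mapsto FJ_{\mathcal C}$, is an equivalence of categories. -/

import Mathlib

open CategoryTheory CategoryTheory.Limits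

universe w w' v₀ v₁ v₂ v₃ u₀ u₁ u₂ u₃

namespace Charts

/-! ### Presites

A sink with vertex `X` is a `Presieve X` (a set of arrows with target `X`) and a presite is a
category together with a pretopology, given here as a `Precoverage`. The universe of small sets
is `Type w`. -/

section Presites

variable {C : Type u₁} [Category.{v₁} C]

/-- The clopen arrows of a presite: those which belong to some covering. -/
def clopen (τ : Precoverage C) : MorphismProperty C :=
  fun _ X f ↦ ∃ S ∈ τ X, S f

/-- All arrows of a sink are clopen. -/
def IsClopenSink (τ : Precoverage C) {X : C} (S : Presieve X) : Prop :=
  ∀ ⦃Y : C⦄ (f : Y ⟶ X), S f → clopen τ f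

/-- `R` is a refinement of `S`: every arrow of `R` factors through an arrow of `S`. -/
def IsRefinement {X : C} (R S : Presieve X) : Prop :=
  ∀ ⦃Y : C⦄ (f : Y ⟶ X), R f → ∃ (Z : C) (s : Z ⟶ X) (g : Y ⟶ Z), S s ∧ g ≫ s = f

/-- A sink is epi if its arrows are jointly epimorphic. -/
def IsEpiSink {X : C} (S : Presieve X) : Prop :=
  ∀ ⦃Z : C⦄ (a b : X ⟶ Z), (∀ ⦃Y : C⦄ (f : Y ⟶ X), S f → f ≫ a = f ≫ b) → a = b

/-- `τ` is a pretopology: members of coverings are pullbackable, coverings are stable under base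
change and composition, isomorphisms are coverings, and a sink of clopen arrows which has a
covering refinement is a covering. -/
class IsPresite (τ : Precoverage C) : Prop extends
    τ.HasPullbacks, τ.IsStableUnderBaseChange, τ.IsStableUnderComposition, τ.HasIsos where
  mem_of_refinement : ∀ {X : C} (S R : Presieve X),
    IsClopenSink τ S → R ∈ τ X → IsRefinement R S → S ∈ τ X

/-- The Grothendieck topology generated by the pretopology is subcanonical. -/
def IsSubcanonical (τ : Precoverage C) : Prop :=
  τ.toGrothendieck.Subcanonical

variable (C) in
/-- A `U`-category for `U = Type w`: a category equivalent to one whose objects form a subset of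
the universe (the class of sets `ZFSet.{w}`), with hom-sets in the universe. -/
def IsUCategory : Prop :=
  ∃ (A : Set ZFSet.{w}) (_ : Category.{w} A), Nonempty (C ≌ A)

/-- A `U`-presite for `U = Type w`: a presite on a `U`-category with small local sets of
topological generators. -/
structure IsUPresite (τ : Precoverage C) : Prop where
  isPresite : IsPresite τ
  isUCategory : IsUCategory.{w} C
  exists_generators : ∀ X : C, ∃ G : Set C, Small.{w} G ∧
    ∀ ⦃U : C⦄ (u : U ⟶ X), clopen τ u →
      ∃ S ∈ τ U, ∀ ⦃V : C⦄ (f : V ⟶ U), S f → V ∈ G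

/-- The coverings consisting of monomorphisms. -/
def monoCoverings (τ : Precoverage C) : Precoverage C where
  coverings X := {S | S ∈ τ X ∧ ∀ ⦃Y : C⦄ (f : Y ⟶ X), S f → Mono f}

/-- A DG-presite: a presite with subcanonical pretopology, all of whose coverings consist of
monomorphisms, such that every sink of clopen arrows factors as a covering followed by
a clopen arrow. -/
structure IsDGPresite (τ : Precoverage C) : Prop where
  isPresite : IsPresite τ
  mono : ∀ {X Y : C} (f : X ⟶ Y), clopen τ f → Mono f
  subcanonical : IsSubcanonical τ
  exists_factorization : ∀ {X : C} (S : Presieve X), IsClopenSink τ S →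
    ∃ (U : C) (u : U ⟶ X) (R : Presieve U), clopen τ u ∧ R ∈ τ U ∧
      ∀ ⦃Y : C⦄ (f : Y ⟶ X), S f ↔ ∃ g : Y ⟶ U, R g ∧ g ≫ u = f

/-- A DG-`U`-presite for `U = Type w`. -/
structure IsDGUPresite (τ : Precoverage C) : Prop extends IsDGPresite τ where
  isUPresite : IsUPresite.{w} τ

end Presites

/-! ### Continuous functors and universal arrows -/

section Continuous

variable {C : Type u₁} [Category.{v₁} C] {D : Type u₂} [Category.{v₂} D]
  {E : Type u₃} [Category.{v₃} E]

/-- A morphism of presites (continuous functor): it respects coverings, and pullbacks of clopen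
arrows along arbitrary arrows. -/
structure IsContinuous (τ : Precoverage C) (σ : Precoverage D) (F : C ⥤ D) : Prop where
  map_mem : ∀ {X : C} (S : Presieve X), S ∈ τ X → S.map F ∈ σ (F.obj X)
  map_isPullback : ∀ {P X Y Z : C} {p : P ⟶ X} {q : P ⟶ Y} {f : X ⟶ Z} {u : Y ⟶ Z},
    clopen τ u → IsPullback p q f u → IsPullback (F.map p) (F.map q) (F.map f) (F.map u)

theorem IsContinuous.map_clopen {τ : Precoverage C} {σ : Precoverage D} {F : C ⥤ D}
    (hF : IsContinuous τ σ F) {X Y : C} {f : X ⟶ Y} (hf : clopen τ f) : clopen σ (F.map f) := by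
  obtain ⟨S, hS, hSf⟩ := hf
  exact ⟨S.map F, hF.map_mem S hS, Presieve.map_map hSf⟩

theorem IsContinuous.comp {τ : Precoverage C} {σ : Precoverage D} {ρ : Precoverage E}
    {F : C ⥤ D} {G : D ⥤ E} (hF : IsContinuous τ σ F) (hG : IsContinuous σ ρ G) :
    IsContinuous τ ρ (F ⋙ G) where
  map_mem S hS := by
    have h := hG.map_mem _ (hF.map_mem S hS)
    have e : (S.map F).map G = S.map (F ⋙ G) := by
      funext Y
      ext f
      constructor
      · rintro ⟨⟨hu⟩⟩
        exact Presieve.map.of (F := F ⋙ G) hu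
      · rintro ⟨hu⟩
        exact Presieve.map.of (F := G) (Presieve.map.of (F := F) hu)
    rwa [e] at h
  map_isPullback hu h := hG.map_isPullback (hF.map_clopen hu) (hF.map_isPullback hu h)

/-- The category `[C, D]` of continuous functors and arbitrary natural transformations. -/
abbrev ContinuousFunctors (τ : Precoverage C) (σ : Precoverage D) :=
  ObjectProperty.FullSubcategory (fun F : C ⥤ D ↦ IsContinuous τ σ F)

/-- Precomposition `[D, E] ⥤ [C, E]` with a continuous functor `C ⥤ D`. -/
def precomp {τ : Precoverage C} {σ : Precoverage D} {F : C ⥤ D} (hF : IsContinuous τ σ F)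
    (ρ : Precoverage E) : ContinuousFunctors σ ρ ⥤ ContinuousFunctors τ ρ :=
  ObjectProperty.lift _
    (ObjectProperty.ι _ ⋙ (Functor.whiskeringLeft C D E).obj F)
    (fun G ↦ hF.comp G.property)

/-- Equivalence of presites: an equivalence of categories, continuous in both directions. -/
def ArePresiteEquivalent (τ : Precoverage C) (σ : Precoverage D) : Prop :=
  ∃ e : C ≌ D, IsContinuous τ σ e.functor ∧ IsContinuous σ τ e.inverse

end Continuous

/-! ### Glutoses -/

section Glutos

variable {C : Type u₁} [Category.{v₁} C]

/-- A class of arrows of pullbackable arrows, containing isomorphisms and stable under composition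
and pullbacks. (Isomorphisms are base changes of identities.) -/
class IsClopos (O : MorphismProperty C) : Prop extends
    O.IsMultiplicative, O.IsStableUnderBaseChange, O.HasPullbacks

variable (C) in
/-- A `U`-topos for `U = Type w`: sheaves of sets on a small site. -/
def IsUTopos : Prop :=
  ∃ (S : Type w) (_ : SmallCategory S) (J : GrothendieckTopology S),
    Nonempty (C ≌ Sheaf J (Type w))

/-- Inverse image functors of geometric morphisms. -/
def IsInverseImage {D : Type u₂} [Category.{v₂} D] (F : C ⥤ D) : Prop :=
  PreservesFiniteLimits F ∧ F.IsLeftAdjoint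

/-- `r` and `s` form an equivalence relation on `X`. -/
structure IsEquivRel {R X : C} (r s : R ⟶ X) : Prop where
  jointly_mono : ∀ ⦃T : C⦄ (a b : T ⟶ R), a ≫ r = b ≫ r → a ≫ s = b ≫ s → a = b
  equivalence : ∀ T : C,
    Equivalence (fun a b : T ⟶ X ↦ ∃ t : T ⟶ R, t ≫ r = a ∧ t ≫ s = b)

/-- The equivalence relation induced by `(r, s)` along `f : Y ⟶ X` is `O`-coequalizable. The
induced relation represents pairs of generalized elements of `Y` whose images under `f` are
related by `(r, s)`. -/
def IsInducedCoequalizable (O : MorphismProperty C) {R X Y : C} (r s : R ⟶ X) (f : Y ⟶ X) : Prop :=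
  ∃ (Q : C) (q : Y ⟶ Q), O q ∧
    ∀ ⦃T : C⦄ (a b : T ⟶ Y) (t : T ⟶ R), t ≫ r = a ≫ f → t ≫ s = b ≫ f → a ≫ q = b ≫ q

/-- There is an epi sink of arrows of `O` such that the equivalence relations induced along its
members are `O`-coequalizable. -/
def IsLocallyCoequalizable (O : MorphismProperty C) {R X : C} (r s : R ⟶ X) : Prop :=
  ∃ S : Presieve X, IsEpiSink S ∧
    ∀ ⦃Y : C⦄ (f : Y ⟶ X), S f → O f ∧ IsInducedCoequalizable O r s f

/-- `(C, O)` is a `U`-glutos for `U = Type w`. (A `U`-topos is in particular an elementary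
topos, so that the latter is not required separately.) -/
structure IsGlutos (O : MorphismProperty C) : Prop where
  isUCategory : IsUCategory.{w} C
  isClopos : IsClopos O
  of_comp : ∀ {X Y Z : C} (g : X ⟶ Y) (f : Y ⟶ Z), O (g ≫ f) → O f → O g
  isUTopos_over : ∀ X : C, IsUTopos.{w} (O.Over ⊤ X)
  isInverseImage_pullback : ∀ {X Y : C} (f : X ⟶ Y),
    IsInverseImage (MorphismProperty.Over.pullback O ⊤ f)
  exists_coproduct : ∀ {ι : Type w} (X : ι → C), CoproductDisjoint X ∧
    ∃ c : Cofan X, IsUniversalColimit c ∧ ∀ i, O (c.inj i)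
  desc_mem : ∀ {ι : Type w} {U : ι → C} {X : C} (u : ∀ i, U i ⟶ X), (∀ i, O (u i)) →
    ∀ (c : Cofan U) (hc : IsColimit c), O (Cofan.IsColimit.desc hc u)
  effectiveEpi : ∀ {X Y : C} (f : X ⟶ Y), O f → Epi f → EffectiveEpi f
  of_epi_comp : ∀ {X Y Z : C} (p : X ⟶ Y) (f : Y ⟶ Z), O (p ≫ f) → O p → Epi p → O f
  exists_coequalizer : ∀ {R X : C} (r s : R ⟶ X), IsEquivRel r s → O r → O s →
    IsLocallyCoequalizable O r s →
      ∃ (Q : C) (q : X ⟶ Q) (h : r ≫ q = s ≫ q), O q ∧ IsPullback r s q q ∧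
        IsUniversalColimit (Cofork.ofπ q h)
  hasPullback_of_epi : ∀ {V X Y R S : C} (a : V ⟶ X) (b : V ⟶ Y) (r : X ⟶ R) (g : R ⟶ S)
    (f : Y ⟶ S), IsPullback a b (r ≫ g) f → O r → Epi r → HasPullback g f

/-- The pretopology of a glutos: the epi sinks consisting of arrows of `O`. -/
def epiCoverings (O : MorphismProperty C) : Precoverage C where
  coverings X := {S | (∀ ⦃Y : C⦄ (f : Y ⟶ X), S f → O f) ∧ IsEpiSink S}

/-- `(G, O)` together with `Y : C ⥤ G` is the universal `U`-glutos for the presite `(C, τ)`. (Every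
`U`-glutos is equivalent to one whose underlying category has objects in `Type (w + 1)` and
arrows in `Type w`.) -/
def IsUniversalGlutos {G : Type u₂} [Category.{v₂} G] (τ : Precoverage C)
    (O : MorphismProperty G) (Y : C ⥤ G) : Prop :=
  IsGlutos.{w} O ∧ ∃ hY : IsContinuous τ (epiCoverings O) Y,
    ∀ (E : Type (w + 1)) [Category.{w} E] (P : MorphismProperty E), IsGlutos.{w} P →
      (precomp hY (epiCoverings P)).IsEquivalence

/-- A nearly `U`-glutos: a `U`-presite which, for the universal `U`-glutos `G` of some
`U`-presite, is equivalent to the presite formed by `G` and its coverings by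
monomorphisms. -/
def IsNearlyGlutos (τ : Precoverage C) : Prop :=
  IsUPresite.{w} τ ∧
    ∃ (B : Type u₁) (_ : Category.{v₁} B) (β : Precoverage B)
      (G : Type u₁) (_ : Category.{v₁} G) (O : MorphismProperty G) (Y : B ⥤ G),
      IsUPresite.{w} β ∧ IsUniversalGlutos.{w} β O Y ∧
        ArePresiteEquivalent τ (monoCoverings (epiCoverings O))

/-- `(N, σ)` together with `Y : C ⥤ N` is a universal nearly `U`-glutos for the presite `(C, τ)`:
for every nearly `U`-glutos `E`, precomposition with `Y` is an equivalence `[N, E] ⥤ [C, E]`. -/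
def IsUniversalNearlyGlutos {N : Type u₂} [Category.{v₂} N] (τ : Precoverage C)
    (σ : Precoverage N) (Y : C ⥤ N) : Prop :=
  IsNearlyGlutos.{w} σ ∧ ∃ hY : IsContinuous τ σ Y,
    ∀ (E : Type u₃) [Category.{v₃} E] (ρ : Precoverage E), IsNearlyGlutos.{w} ρ →
      (precomp hY ρ).IsEquivalence

end Glutos

/-! ### Charts and atlases -/

section Atlases

variable {C : Type u₁} [Category.{v₁} C] {D : Type u₂} [Category.{v₂} D]

/-- A sink of clopen arrows whose image under `J` is a covering is itself a covering. -/
def ReflectsCoverings (τ : Precoverage C) (σ : Precoverage D) (J : C ⥤ D) : Prop :=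
  ∀ {X : C} (S : Presieve X), IsClopenSink τ S → S.map J ∈ σ (J.obj X) → S ∈ τ X

/-- The arrow `J` of presites admits atlases. -/
structure AdmitsAtlases (τ : Precoverage C) (σ : Precoverage D) (J : C ⥤ D) : Prop where
  isPresite : IsPresite τ
  mono : ∀ {X Y : C} (f : X ⟶ Y), clopen τ f → Mono f
  subcanonical : IsSubcanonical τ
  isPresite_target : IsPresite σ
  isContinuous : IsContinuous τ σ J
  reflectsCoverings : ReflectsCoverings τ σ J
  faithful : J.Faithful

/-- A family of arrows `u i : J U_i ⟶ X` is a `J`-atlas: it is a covering, and the intersections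
of its members are `J`-images of objects which are clopen in both charts. -/
structure IsAtlas (τ : Precoverage C) (σ : Precoverage D) (J : C ⥤ D) {X : D} {ι : Type w}
    (U : ι → C) (u : ∀ i, J.obj (U i) ⟶ X) : Prop where
  covering : Presieve.ofArrows (fun i ↦ J.obj (U i)) u ∈ σ X
  overlap : ∀ i j, ∃ (W : C) (a : W ⟶ U i) (b : W ⟶ U j), clopen τ a ∧ clopen τ b ∧
    IsPullback (J.map a) (J.map b) (u i) (u j)

/-- A `J`-atlas on `X`, with small index set. -/
structure Atlas (τ : Precoverage C) (σ : Precoverage D) (J : C ⥤ D) (X : D) where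
  /-- The index set. -/
  ι : Type w
  /-- The domains of the charts. -/
  U : ι → C
  /-- The charts. -/
  u : ∀ i, J.obj (U i) ⟶ X
  isAtlas : IsAtlas τ σ J U u

variable {τ : Precoverage C} {σ : Precoverage D} {J : C ⥤ D}

/-- The charts of the union of two atlases. -/
def unionCharts {X : D} (A B : Atlas.{w} τ σ J X) :
    ∀ s : A.ι ⊕ B.ι, J.obj (Sum.elim A.U B.U s) ⟶ X
  | Sum.inl i => A.u i
  | Sum.inr k => B.u k

/-- Two atlases are compatible if their union is an atlas. -/
def Compatible {X : D} (A B : Atlas.{w} τ σ J X) : Prop :=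
  IsAtlas τ σ J (Sum.elim A.U B.U) (unionCharts A B)

/-- `A`-`B`-admissible arrows. -/
def Admissible {X Y : D} (A : Atlas.{w} τ σ J X) (B : Atlas.{w} τ σ J Y) (f : X ⟶ Y) : Prop :=
  ∀ i k, ∃ (W : C) (a : W ⟶ A.U i) (g : W ⟶ B.U k), clopen τ a ∧
    IsPullback (J.map a) (J.map g) (A.u i ≫ f) (B.u k)

/-- A monic arrow, whose local representations in the charts of `A` and `B` are clopen. -/
def ChartClopen {X Y : D} (A : Atlas.{w} τ σ J X) (B : Atlas.{w} τ σ J Y) (f : X ⟶ Y) : Prop :=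
  Mono f ∧ ∀ i k, ∃ (W : C) (a : W ⟶ A.U i) (g : W ⟶ B.U k), clopen τ a ∧ clopen τ g ∧
    IsPullback (J.map a) (J.map g) (A.u i ≫ f) (B.u k)

variable (τ σ J) in
/-- The data from which the category of objects with atlases is built: an arrow admitting atlases
between DG-presites. -/
structure Setting : Prop where
  source : IsDGPresite τ
  target : IsDGPresite σ
  admitsAtlases : AdmitsAtlases τ σ J

/-! Facts needed for the composition of admissible arrows and the equivalence relation on
atlases. -/

theorem IsSubcanonical.existsUnique_glue {τ : Precoverage C} (h : IsSubcanonical τ)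
    {ι : Type*} {T Z : C} {S : ι → C} (t : ∀ k, S k ⟶ T)
    (ht : Presieve.ofArrows S t ∈ τ T) (f : ∀ k, S k ⟶ Z)
    (hf : ∀ k l (Q : C) (a : Q ⟶ S k) (b : Q ⟶ S l), a ≫ t k = b ≫ t l → a ≫ f k = b ≫ f l) :
    ∃! g : T ⟶ Z, ∀ k, t k ≫ g = f k := by
  have : τ.toGrothendieck.Subcanonical := h
  have h1 : Presieve.IsSheafFor (yoneda.obj Z) (Presieve.ofArrows S t) :=
    (GrothendieckTopology.Subcanonical.isSheaf_of_isRepresentable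
      (yoneda.obj Z)).isSheafFor_of_mem_precoverage ht
  rw [Presieve.isSheafFor_arrows_iff] at h1
  exact h1 f (fun k l Q a b hab ↦ hf k l Q a b hab)

theorem IsSubcanonical.hom_ext {τ : Precoverage C} (h : IsSubcanonical τ)
    {ι : Type*} {T Z : C} {S : ι → C} (t : ∀ k, S k ⟶ T)
    (ht : Presieve.ofArrows S t ∈ τ T) (f g : T ⟶ Z) (hfg : ∀ k, t k ≫ f = t k ≫ g) : f = g :=
  (h.existsUnique_glue t ht (fun k ↦ t k ≫ f)
    (fun k l Q a b hab ↦ by rw [← Category.assoc, hab, Category.assoc])).unique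
    (fun _ ↦ rfl) (fun k ↦ (hfg k).symm)

theorem IsDGPresite.exists_family_factorization {τ : Precoverage C} (h : IsDGPresite τ)
    {ι : Type*} {X : C} {S : ι → C} (s : ∀ k, S k ⟶ X) (hs : ∀ k, clopen τ (s k)) :
    ∃ (T : C) (t : T ⟶ X) (r : ∀ k, S k ⟶ T), clopen τ t ∧ Presieve.ofArrows S r ∈ τ T ∧
      ∀ k, r k ≫ t = s k := by
  obtain ⟨T, t, R, ht, hR, hSR⟩ := h.exists_factorization (Presieve.ofArrows S s)
    (by rintro Y f ⟨k⟩; exact hs k)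
  choose r hr hrt using fun k ↦ (hSR (s k)).1 (Presieve.ofArrows.mk k)
  refine ⟨T, t, r, ht, ?_, hrt⟩
  have := h.mono t ht
  convert hR using 1
  refine le_antisymm ?_ ?_
  · rintro Y f ⟨k⟩
    exact hr k
  · intro Y g hg
    obtain ⟨k, hk, e⟩ := Presieve.ofArrows_surj _ _ ((hSR (g ≫ t)).2 ⟨g, hg, rfl⟩)
    subst hk
    have : g = r k := by
      rw [← cancel_mono t, hrt]
      simpa using e
    rw [this]
    exact Presieve.ofArrows.mk k

theorem Atlas.clopen_chart {X : D} (A : Atlas.{w} τ σ J X) (i : A.ι) : clopen σ (A.u i) :=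
  ⟨_, A.isAtlas.covering, Presieve.ofArrows.mk i⟩

theorem clopen.hasPullback (hτ : IsPresite τ) {X Y Z : C} {f : X ⟶ Z} (hf : clopen τ f)
    (g : Y ⟶ Z) : HasPullback f g := by
  obtain ⟨S, hS, hSf⟩ := hf
  exact (τ.hasPullbacks_of_mem g hS).hasPullback hSf

theorem clopen.of_isPullback (hτ : IsPresite τ) {P X Y Z : C} {p : P ⟶ X} {q : P ⟶ Y} {f : X ⟶ Z}
    {g : Y ⟶ Z} (h : IsPullback p q f g) (hf : clopen τ f) : clopen τ q := by
  obtain ⟨S, hS, hSf⟩ := hf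
  have hb := τ.hasPullbacks_of_mem g hS
  obtain ⟨ι, A, a, rfl⟩ := S.exists_eq_ofArrows
  have (i : ι) : HasPullback (a i) g := hb.hasPullback (Presieve.ofArrows.mk i)
  obtain ⟨i, rfl, e⟩ := Presieve.ofArrows_surj _ _ hSf
  obtain rfl : f = a i := by simpa using e
  refine ⟨Presieve.ofArrows
    (fun o : Option ι ↦ o.elim P (fun j ↦ pullback (a j) g))
    (fun o ↦ match o with
      | none => q
      | some j => pullback.snd (a j) g), ?_, Presieve.ofArrows.mk (none : Option ι)⟩
  refine Precoverage.mem_coverings_of_isPullback (J := τ)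
    (X := fun o : Option ι ↦ A (o.elim i id)) (fun o ↦ a (o.elim i id)) ?_ g _
    (fun o ↦ match o with
      | none => p
      | some j => pullback.fst (a j) g) ?_
  · have e := Presieve.ofArrows_comp_eq_of_surjective a (a := fun o : Option ι ↦ o.elim i id)
      (fun j ↦ ⟨some j, rfl⟩)
    exact e ▸ hS
  · rintro (_ | j)
    · exact h.flip
    · exact (IsPullback.of_hasPullback (a j) g).flip

theorem clopen.comp (hτ : IsPresite τ) {X Y Z : C} {f : X ⟶ Y} {g : Y ⟶ Z}
    (hf : clopen τ f) (hg : clopen τ g) : clopen τ (f ≫ g) := by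
  obtain ⟨S, hS, hSg⟩ := hg
  obtain ⟨R, hR, hRf⟩ := hf
  obtain ⟨ι, A, a, rfl⟩ := S.exists_eq_ofArrows
  obtain ⟨κ, B, b, rfl⟩ := R.exists_eq_ofArrows
  obtain ⟨i, rfl, e⟩ := Presieve.ofArrows_surj _ _ hSg
  obtain rfl : g = a i := by simpa using e
  obtain ⟨k, rfl, e⟩ := Presieve.ofArrows_surj _ _ hRf
  obtain rfl : f = b k := by simpa using e
  have hid (Y : C) : Presieve.ofArrows (fun _ : κ ↦ Y) (fun _ ↦ 𝟙 Y) ∈ τ Y := by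
    have h1 := τ.mem_coverings_of_isIso (𝟙 Y)
    have h2 := Presieve.ofArrows_comp_eq_of_surjective (fun _ : PUnit.{1} ↦ 𝟙 Y)
      (a := fun _ : κ ↦ PUnit.unit) (fun _ ↦ ⟨k, rfl⟩)
    rw [Presieve.ofArrows_pUnit] at h2
    exact h2 ▸ h1
  have e := Presieve.ofArrows_comp_eq_of_surjective a (a := fun o : Option ι ↦ o.elim i id)
    (fun j ↦ ⟨some j, rfl⟩)
  have h1 := Precoverage.comp_mem_coverings (J := τ) (X := fun o : Option ι ↦ A (o.elim i id))
    (fun o ↦ a (o.elim i id)) (e ▸ hS) (σ := fun _ ↦ κ)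
    (Y := fun o l ↦ match o with
      | none => B l
      | some j => A j)
    (fun o l ↦ match o with
      | none => b l
      | some j => 𝟙 (A j)) (by
        rintro (_ | j)
        · exact hR
        · exact hid _)
  exact ⟨_, h1, Presieve.ofArrows.mk (⟨none, k⟩ : Σ _ : Option ι, κ)⟩

theorem isPullback_of_exists_lift {P X Y Z : D} {p : P ⟶ X} {q : P ⟶ Y} {f : X ⟶ Z} {g : Y ⟶ Z}
    [Mono p] (w : p ≫ f = q ≫ g)
    (h : ∀ (T : D) (a : T ⟶ X) (b : T ⟶ Y), a ≫ f = b ≫ g → ∃ l : T ⟶ P, l ≫ p = a ∧ l ≫ q = b) :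
    IsPullback p q f g := by
  choose l h1 h2 using h
  refine ⟨⟨w⟩, ⟨PullbackCone.IsLimit.mk _ (fun s ↦ l _ s.fst s.snd s.condition)
    (fun s ↦ h1 _ _ _ _) (fun s ↦ h2 _ _ _ _) (fun s m hm _ ↦ ?_)⟩⟩
  rw [← cancel_mono p, hm, h1]

/-- The composition of admissible arrows is admissible. -/
theorem Admissible.comp (h : Setting τ σ J) {X Y Z : D} {A : Atlas.{w} τ σ J X}
    {B : Atlas.{w} τ σ J Y} {E : Atlas.{w} τ σ J Z} {f : X ⟶ Y} {g : Y ⟶ Z}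
    (hf : Admissible A B f) (hg : Admissible B E g) : Admissible A E (f ≫ g) := by
  intro i m
  have hJ := h.admitsAtlases.isContinuous
  have := h.admitsAtlases.faithful
  have hτ := h.source.isPresite
  have hσ := h.target.isPresite
  choose W a p ha hp using hf i
  choose V b q hb hq using fun k ↦ hg k m
  have (k : B.ι) : HasPullback (b k) (p k) := clopen.hasPullback hτ (hb k) (p k)
  have hpb (k : B.ι) := IsPullback.of_hasPullback (b k) (p k)
  have hs (k : B.ι) : clopen τ (pullback.snd (b k) (p k) ≫ a k) :=
    clopen.comp hτ (clopen.of_isPullback hτ (hpb k) (hb k)) (ha k)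
  obtain ⟨T, t, r, ht, hr, hrt⟩ := h.source.exists_family_factorization _ hs
  have : Mono (E.u m) := h.target.mono _ (E.clopen_chart m)
  have : Mono (J.map t) := h.target.mono _ (hJ.map_clopen ht)
  have hw (k : B.ι) : J.map (pullback.fst (b k) (p k) ≫ q k) ≫ E.u m =
      J.map (r k ≫ t) ≫ A.u i ≫ f ≫ g := by
    have e1 := (hq k).w
    have e2 := (hp k).w
    have e3 : J.map (pullback.fst (b k) (p k)) ≫ J.map (b k) =
        J.map (pullback.snd (b k) (p k)) ≫ J.map (p k) := by
      rw [← J.map_comp, ← J.map_comp, pullback.condition]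
    rw [J.map_comp, Category.assoc, ← e1, reassoc_of% e3, ← reassoc_of% e2, hrt,
      J.map_comp, Category.assoc]
  obtain ⟨c, hc, -⟩ := h.source.subcanonical.existsUnique_glue r hr
    (fun k ↦ pullback.fst (b k) (p k) ≫ q k) (by
      intro k l Q x y hxy
      apply J.map_injective
      rw [← cancel_mono (E.u m), J.map_comp x, J.map_comp y, Category.assoc, Category.assoc,
        hw, hw, ← J.map_comp_assoc, ← J.map_comp_assoc, reassoc_of% hxy])
  have hJr : Presieve.ofArrows (fun k ↦ J.obj (pullback (b k) (p k))) (fun k ↦ J.map (r k)) ∈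
      σ (J.obj T) := by
    have := hJ.map_mem _ hr
    rwa [Presieve.map_ofArrows] at this
  have hcomm : J.map t ≫ A.u i ≫ f ≫ g = J.map c ≫ E.u m := by
    refine h.target.subcanonical.hom_ext _ hJr _ _ (fun k ↦ ?_)
    rw [← J.map_comp_assoc, ← hw, ← hc, J.map_comp, Category.assoc]
  refine ⟨T, t, c, ht, isPullback_of_exists_lift hcomm (fun P x y hxy ↦ ?_)⟩
  -- lift locally on `P`, over the charts of `B`
  have (k : B.ι) : HasPullback (B.u k) (x ≫ A.u i ≫ f) :=
    clopen.hasPullback hσ (B.clopen_chart k) _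
  have hP : Presieve.ofArrows _ (fun k ↦ pullback.snd (B.u k) (x ≫ A.u i ≫ f)) ∈ σ P :=
    Precoverage.mem_coverings_of_isPullback _ B.isAtlas.covering _ _ _
      (fun k ↦ (IsPullback.of_hasPullback (B.u k) (x ≫ A.u i ≫ f)).flip)
  have hl (k : B.ι) : ∃ l : pullback (B.u k) (x ≫ A.u i ≫ f) ⟶ J.obj T,
      l ≫ J.map t = pullback.snd (B.u k) (x ≫ A.u i ≫ f) ≫ x := by
    have e0 := pullback.condition (f := B.u k) (g := x ≫ A.u i ≫ f)
    let l1 := (hp k).lift (pullback.snd (B.u k) (x ≫ A.u i ≫ f) ≫ x)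
      (pullback.fst (B.u k) (x ≫ A.u i ≫ f)) (by rw [e0, Category.assoc])
    let l2 := (hq k).lift (pullback.fst (B.u k) (x ≫ A.u i ≫ f))
      (pullback.snd (B.u k) (x ≫ A.u i ≫ f) ≫ y)
      (by rw [reassoc_of% e0, Category.assoc, ← hxy])
    let l3 := (hJ.map_isPullback (hb k) (hpb k).flip).lift l1 l2
      (by rw [IsPullback.lift_snd, IsPullback.lift_fst])
    refine ⟨l3 ≫ J.map (r k), ?_⟩
    rw [Category.assoc, ← J.map_comp, hrt, J.map_comp, IsPullback.lift_fst_assoc,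
      IsPullback.lift_fst]
  choose l hl using hl
  obtain ⟨g', hg', -⟩ := h.target.subcanonical.existsUnique_glue _ hP l (by
    intro k k' Q c c' hcc
    rw [← cancel_mono (J.map t), Category.assoc, Category.assoc, hl, hl, reassoc_of% hcc])
  have e1 : g' ≫ J.map t = x := by
    refine h.target.subcanonical.hom_ext _ hP _ _ (fun k ↦ ?_)
    rw [reassoc_of% (hg' k), hl]
  refine ⟨g', e1, ?_⟩
  rw [← cancel_mono (E.u m), Category.assoc, ← hcomm, reassoc_of% e1, hxy]

theorem Compatible.admissible {X : D} {A B : Atlas.{w} τ σ J X} (h : Compatible A B) :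
    Admissible A B (𝟙 X) := by
  intro i k
  obtain ⟨W, a, b, ha, -, hab⟩ := h.overlap (Sum.inl i) (Sum.inr k)
  exact ⟨W, a, b, ha, by simpa [unionCharts] using hab⟩

theorem Atlas.admissible_id {X : D} (A : Atlas.{w} τ σ J X) : Admissible A A (𝟙 X) := by
  intro i k
  obtain ⟨W, a, b, ha, -, hab⟩ := A.isAtlas.overlap i k
  exact ⟨W, a, b, ha, by simpa using hab⟩

theorem Compatible.symm {X : D} {A B : Atlas.{w} τ σ J X} (h : Compatible A B) :
    Compatible B A := by
  constructor
  · have e : Presieve.ofArrows _ (unionCharts B A) = Presieve.ofArrows _ (unionCharts A B) := by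
      refine le_antisymm ?_ ?_
      · rintro Y f ⟨i | k⟩
        · exact Presieve.ofArrows.mk (Y := fun s ↦ J.obj (Sum.elim A.U B.U s)) (Sum.inr i)
        · exact Presieve.ofArrows.mk (Y := fun s ↦ J.obj (Sum.elim A.U B.U s)) (Sum.inl k)
      · rintro Y f ⟨i | k⟩
        · exact Presieve.ofArrows.mk (Y := fun s ↦ J.obj (Sum.elim B.U A.U s)) (Sum.inr i)
        · exact Presieve.ofArrows.mk (Y := fun s ↦ J.obj (Sum.elim B.U A.U s)) (Sum.inl k)
    exact e ▸ h.covering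
  · rintro (i | i) (k | k)
    · exact h.overlap (Sum.inr i) (Sum.inr k)
    · exact h.overlap (Sum.inr i) (Sum.inl k)
    · exact h.overlap (Sum.inl i) (Sum.inr k)
    · exact h.overlap (Sum.inl i) (Sum.inl k)

theorem clopen_of_isIso (hτ : IsPresite τ) {X Y : C} (f : X ⟶ Y) [IsIso f] : clopen τ f :=
  ⟨_, τ.mem_coverings_of_isIso f, Presieve.singleton_self f⟩

/-- A clopen arrow `b` through which `g` factors after applying `J` is one through which `g`
factors. -/
theorem AdmitsAtlases.exists_factorization (h : AdmitsAtlases τ σ J) {W V U : C} {b : V ⟶ U}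
    (hb : clopen τ b) (g : W ⟶ U) (θ : J.obj W ⟶ J.obj V) (hθ : θ ≫ J.map b = J.map g) :
    ∃ l : W ⟶ V, l ≫ b = g := by
  have hτ := h.isPresite
  have hσ := h.isPresite_target
  have : HasPullback b g := clopen.hasPullback hτ hb g
  have hP := IsPullback.of_hasPullback b g
  have hJP := h.isContinuous.map_isPullback hb hP.flip
  have hc : clopen τ (pullback.snd b g) := clopen.of_isPullback hτ hP hb
  have hm : Mono (pullback.snd b g) := h.mono _ hc
  have hJm : Mono (J.map (pullback.snd b g)) := by
    have hmb : Mono b := h.mono b hb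
    have : Mono (J.map b) := by
      have hk : IsPullback (𝟙 V) (𝟙 V) b b := IsKernelPair.id_of_mono b
      have hk' := h.isContinuous.map_isPullback hb hk
      rw [J.map_id] at hk'
      constructor
      intro Z x y hxy
      rw [← hk'.lift_fst x y hxy, Category.comp_id]
      conv_rhs => rw [← hk'.lift_snd x y hxy, Category.comp_id]
    exact MorphismProperty.of_isPullback (P := MorphismProperty.monomorphisms D) hJP.flip this
  have hs : hJP.lift (𝟙 _) θ (by rw [Category.id_comp, hθ]) ≫ J.map (pullback.snd b g) = 𝟙 _ :=
    hJP.lift_fst _ _ _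
  have : IsIso (J.map (pullback.snd b g)) :=
    ⟨_, by rw [← cancel_mono (J.map (pullback.snd b g)), Category.assoc, hs]; simp, hs⟩
  have hcov : Presieve.ofArrows (fun _ : PUnit.{1} ↦ pullback b g)
      (fun _ ↦ pullback.snd b g) ∈ τ W := by
    refine h.reflectsCoverings _ (by rintro Y f ⟨⟩; exact hc) ?_
    rw [Presieve.map_ofArrows, Presieve.ofArrows_pUnit]
    exact σ.mem_coverings_of_isIso _
  obtain ⟨r, hr, -⟩ := h.subcanonical.existsUnique_glue _ hcov (fun _ ↦ 𝟙 (pullback b g))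
    (fun _ _ Q x y hxy ↦ by simpa [cancel_mono] using hxy)
  have hr' : r ≫ pullback.snd b g = 𝟙 W := by
    refine h.subcanonical.hom_ext _ hcov _ _ (fun k ↦ ?_)
    rw [reassoc_of% (hr k), Category.comp_id]
  exact ⟨r ≫ pullback.fst b g, by rw [Category.assoc, pullback.condition, reassoc_of% hr']⟩

theorem Compatible.of_admissible (h : Setting τ σ J) {X : D} {A B : Atlas.{w} τ σ J X}
    (h1 : Admissible A B (𝟙 X)) (h2 : Admissible B A (𝟙 X)) : Compatible A B := by
  have hτ := h.source.isPresite
  have hσ := h.target.isPresite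
  have := h.admitsAtlases.faithful
  have key : ∀ i k, ∃ (W : C) (a : W ⟶ A.U i) (b : W ⟶ B.U k), clopen τ a ∧ clopen τ b ∧
      IsPullback (J.map a) (J.map b) (A.u i) (B.u k) := by
    intro i k
    obtain ⟨W, a, g, ha, hag⟩ := h1 i k
    obtain ⟨V, b, g', hb, hbg⟩ := h2 k i
    rw [Category.comp_id] at hag hbg
    have : Mono a := h.source.mono _ ha
    have : Mono b := h.source.mono _ hb
    have : Mono (A.u i) := h.target.mono _ (A.clopen_chart i)
    have : Mono (B.u k) := h.target.mono _ (B.clopen_chart k)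
    obtain ⟨l, hl⟩ := h.admitsAtlases.exists_factorization hb g
      (hbg.lift (J.map g) (J.map a) hag.w.symm) (hbg.lift_fst _ _ _)
    obtain ⟨l', hl'⟩ := h.admitsAtlases.exists_factorization ha g'
      (hag.lift (J.map g') (J.map b) hbg.w.symm) (hag.lift_fst _ _ _)
    have e1 : l ≫ g' = a := by
      apply J.map_injective
      rw [← cancel_mono (A.u i), J.map_comp, Category.assoc, ← hbg.w, ← J.map_comp_assoc, hl, hag.w]
    have e2 : l' ≫ g = b := by
      apply J.map_injective
      rw [← cancel_mono (B.u k), J.map_comp, Category.assoc, ← hag.w, ← J.map_comp_assoc, hl',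
        hbg.w]
    have : IsIso l := by
      refine ⟨l', ?_, ?_⟩
      · rw [← cancel_mono a, Category.assoc, hl', e1, Category.id_comp]
      · rw [← cancel_mono b, Category.assoc, hl, e2, Category.id_comp]
    exact ⟨W, a, g, ha, hl ▸ clopen.comp hτ (clopen_of_isIso hτ l) hb, hag⟩
  constructor
  · refine hσ.mem_of_refinement _ _ ?_ A.isAtlas.covering ?_
    · rintro Y f ⟨i | k⟩
      · exact A.clopen_chart i
      · exact B.clopen_chart k
    · rintro Y f ⟨i⟩
      exact ⟨_, A.u i, 𝟙 _,
        Presieve.ofArrows.mk (Y := fun s ↦ J.obj (Sum.elim A.U B.U s)) (f := unionCharts A B)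
          (Sum.inl i), Category.id_comp _⟩
  · rintro (i | i) (k | k)
    · exact A.isAtlas.overlap i k
    · exact key i k
    · obtain ⟨W, a, b, ha, hb, hab⟩ := key k i
      exact ⟨W, b, a, hb, ha, hab.flip⟩
    · exact B.isAtlas.overlap i k

/-- Compatibility of atlases is an equivalence relation. -/
theorem compatible_equivalence (h : Setting τ σ J) (X : D) :
    Equivalence (Compatible : Atlas.{w} τ σ J X → Atlas.{w} τ σ J X → Prop) where
  refl A := .of_admissible h A.admissible_id A.admissible_id
  symm h1 := h1.symm
  trans {A B E} h1 h2 := by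
    refine .of_admissible h ?_ ?_
    · simpa using Admissible.comp h h1.admissible h2.admissible
    · simpa using Admissible.comp h h2.symm.admissible h1.symm.admissible

/-- Admissibility of an arrow depends on the equivalence classes of the atlases only. -/
theorem Admissible.congr (h : Setting τ σ J) {X Y : D} {A A' : Atlas.{w} τ σ J X}
    {B B' : Atlas.{w} τ σ J Y} {f : X ⟶ Y} (hA : Compatible A A') (hB : Compatible B B')
    (hf : Admissible A B f) : Admissible A' B' f := by
  simpa using Admissible.comp h (Admissible.comp h hA.symm.admissible hf) hB.admissible

/-- The setoid of atlases on `X` up to compatibility. -/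
def atlasSetoid (h : Setting τ σ J) (X : D) : Setoid (Atlas.{w} τ σ J X) where
  r := Compatible
  iseqv := compatible_equivalence h X

/-- The category `C_J`: an object is an object of `D` together with an equivalence class of
`J`-atlases on it. -/
structure ChartCat (h : Setting τ σ J) where
  /-- The underlying object of `D`. -/
  X : D
  /-- The equivalence class of atlases. -/
  cls : Quotient (atlasSetoid.{w} h X)

/-- An arrow of `D` is an admissible arrow of `C_J` if it is admissible with respect to atlases
representing the given equivalence classes. -/
def ChartCat.IsAdmissible {h : Setting τ σ J} (P Q : ChartCat.{w} h) (f : P.X ⟶ Q.X) : Prop :=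
  Quotient.liftOn₂ P.cls Q.cls (fun A B ↦ Admissible A B f) (fun _ _ _ _ hA hB ↦
    propext ⟨Admissible.congr h hA hB, Admissible.congr h (Compatible.symm hA)
      (Compatible.symm hB)⟩)

/-- Arrows of `C_J`. -/
@[ext]
structure ChartCat.Hom {h : Setting τ σ J} (P Q : ChartCat.{w} h) where
  /-- The underlying arrow of `D`. -/
  f : P.X ⟶ Q.X
  admissible : P.IsAdmissible Q f

instance (h : Setting τ σ J) : Category (ChartCat.{w} h) where
  Hom P Q := ChartCat.Hom P Q
  id P := ⟨𝟙 P.X, by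
    obtain ⟨X, c⟩ := P
    induction c using Quotient.ind with | _ A => exact A.admissible_id⟩
  comp {P Q R} f g := ⟨f.f ≫ g.f, by
    obtain ⟨X, c⟩ := P
    obtain ⟨Y, d⟩ := Q
    obtain ⟨Z, e⟩ := R
    obtain ⟨f, hf⟩ := f
    obtain ⟨g, hg⟩ := g
    induction c using Quotient.ind with | _ A =>
    induction d using Quotient.ind with | _ B =>
    induction e using Quotient.ind with | _ E =>
    exact Admissible.comp h hf hg⟩
  id_comp f := ChartCat.Hom.ext (Category.id_comp f.f)
  comp_id f := ChartCat.Hom.ext (Category.comp_id f.f)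
  assoc f g k := ChartCat.Hom.ext (Category.assoc f.f g.f k.f)

/-- The forgetful functor `J' : C_J ⥤ D`. -/
def chartForget (h : Setting τ σ J) : ChartCat.{w} h ⥤ D where
  obj P := P.X
  map f := ChartCat.Hom.f f

/-- `J`-clopen arrows of `C_J`. (The choice of the atlases which represent the two equivalence
classes does not matter.) -/
def IsJClopen {h : Setting τ σ J} {P Q : ChartCat.{w} h} (f : P ⟶ Q) : Prop :=
  ∀ (A : Atlas.{w} τ σ J P.X) (B : Atlas.{w} τ σ J Q.X),
    Quotient.mk (atlasSetoid h P.X) A = P.cls → Quotient.mk (atlasSetoid h Q.X) B = Q.cls →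
      ChartClopen A B ((chartForget h).map f)

/-- The pretopology of `C_J`: sinks of `J`-clopen arrows whose image in `D` is a covering. -/
def chartCoverings (h : Setting τ σ J) : Precoverage (ChartCat.{w} h) where
  coverings P := {S | (∀ ⦃Q : ChartCat.{w} h⦄ (f : Q ⟶ P), S f → IsJClopen f) ∧
    S.map (chartForget h) ∈ σ P.X}

/-- The atlas on `J X` with the identity as its only chart. -/
def idAtlas (h : Setting τ σ J) (X : C) : Atlas.{w} τ σ J (J.obj X) where
  ι := PUnit
  U _ := X
  u _ := 𝟙 _
  isAtlas :=
    have hτ := h.source.isPresite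
    have hσ := h.target.isPresite
    { covering := by
        rw [Presieve.ofArrows_pUnit]
        exact σ.mem_coverings_of_isIso _
      overlap := fun _ _ ↦ ⟨X, 𝟙 X, 𝟙 X, clopen_of_isIso hτ _, clopen_of_isIso hτ _, by
        rw [J.map_id]
        exact IsKernelPair.id_of_mono _⟩ }

/-- The functor `J_C : C ⥤ C_J`, which sends `X` to `J X` with the class of its identity atlas. -/
def chartFunctor (h : Setting τ σ J) : C ⥤ ChartCat.{w} h where
  obj X := ⟨J.obj X, Quotient.mk _ (idAtlas h X)⟩
  map {X Y} f := ⟨J.map f, fun _ _ ↦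
    ⟨X, 𝟙 X, f, clopen_of_isIso h.source.isPresite (𝟙 X), by
      have e : IsPullback (J.map (𝟙 X)) (J.map f) (𝟙 (J.obj X) ≫ J.map f) (𝟙 (J.obj Y)) := by
        rw [J.map_id]
        exact IsPullback.of_horiz_isIso ⟨by simp⟩
      exact e⟩⟩
  map_id X := ChartCat.Hom.ext (J.map_id X)
  map_comp f g := ChartCat.Hom.ext (J.map_comp f g)

end Atlases

end Charts

namespace Charts

open Opposite

/-! ### Local arguments in subcanonical presites -/

section Local

variable {C : Type u₁} [Category.{v₁} C] {τ : Precoverage C}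

/-! The proof replaces nearly glutoses by an intrinsic notion. Say that a DG-presite has gluing
(`HasGluing`) if small families of objects can be glued along clopen overlaps. The nearly U-glutoses
are then the DG-U-presites with gluing, and the theorem splits into three facts: C_J is a dense
extension of C and inherits smallness from it; C_J inherits gluing from D; continuous functors into
a presite with gluing extend uniquely along dense extensions.

From gluing to glutoses. In a DG-U-presite with gluing, the étale arrows (those clopen locally on
the source) form a glutos (`etale.isGlutos`). Pullbacks, disjoint sums and quotients by locally
coequalizable equivalence relations are obtained by gluing small coverings. The étale objects over X
are the sheaves on the small poset of clopen subobjects of X, just as local homeomorphisms over a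
space are sheaves on it; the étale space of a sheaf is one more gluing. Base change has a right
adjoint because the sections over base changed clopens form a sheaf. Gluing two copies of X along a
clopen subobject shows that an epimorphic clopen arrow is invertible. Hence jointly epimorphic étale
sinks generate covering sieves, and the étale coverings by monomorphisms are the original coverings.
As a glutos is universal for its own presite, the original presite is a nearly glutos
(`HasGluing.isNearlyGlutos`).

From glutoses to gluing. In a glutos, objects U_i with overlaps W_ij are glued by dividing the
coproduct of the U_i by the equivalence relation which is the coproduct of the W_ij. The quotient
exists because the relation induced on each U_i is equality (`IsGlutos.exists_isGlue`). This passes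
to the monic coverings and through an equivalence of presites (`IsNearlyGlutos.hasGluing`,
`IsNearlyGlutos.isDGUPresite`).

Extension. Let K : C ⥤ N be dense and G : C ⥤ E continuous, where E has gluing. If P is glued from
charts U_i with overlaps W_ij, the extension at P is glued from the G U_i along the G W_ij. It
receives a compatible family of arrows from all G U with K U ⟶ P and is universal for this, whence
functoriality, continuity and uniqueness (`IsDenseEmbedding.isEquivalence_precomp`).

Charts. Unions, pullbacks and gluings in C_J are formed in D. They carry atlases because the pieces
seen in one chart are clopen subobjects in C, whose union is formed in C; arrows of C on the pieces
glue since C is subcanonical and J is faithful. As J reflects coverings, a clopen arrow of C with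
invertible image is invertible, so J_C is fully faithful and dense
(`isDenseEmbedding_chartFunctor`); gluing is `hasGluing_chartCoverings`. Finally, an object of C_J
is determined up to isomorphism by small gluing data in C, which can be coded by sets of the
universe (`IsDenseEmbedding.isUCategory`). -/

theorem IsPresite.mem_toGrothendieck_iff (hτ : IsPresite τ) {X : C} {S : Sieve X} :
    S ∈ τ.toGrothendieck X ↔ ∃ R ∈ τ X, R ≤ S.arrows :=
  Precoverage.mem_toGrothendieck_iff_of_isStableUnderComposition

/-- This is the refinement axiom: if the sieve generated by S contains a covering R, then R refines
S. Checking a covering thus splits into clopenness and a condition on sieves. -/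
theorem IsPresite.mem_iff (hτ : IsPresite τ) {X : C} {S : Presieve X} :
    S ∈ τ X ↔ IsClopenSink τ S ∧ Sieve.generate S ∈ τ.toGrothendieck X := by
  refine ⟨fun h ↦ ⟨fun _ _ hf ↦ ⟨S, h, hf⟩, Precoverage.generate_mem_toGrothendieck h⟩, ?_⟩
  rintro ⟨h, hS⟩
  obtain ⟨R, hR, hle⟩ := hτ.mem_toGrothendieck_iff.1 hS
  refine hτ.mem_of_refinement S R h hR (fun Y f hf ↦ ?_)
  obtain ⟨Z, g, s, hs, e⟩ := hle _ _ hf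
  exact ⟨Z, s, g, hs, e⟩

theorem IsPresite.ofArrows_mem_iff (hτ : IsPresite τ) {ι : Type*} {X : C} {U : ι → C}
    {u : ∀ i, U i ⟶ X} : Presieve.ofArrows U u ∈ τ X ↔
      (∀ i, clopen τ (u i)) ∧ Sieve.ofArrows U u ∈ τ.toGrothendieck X := by
  rw [hτ.mem_iff]
  exact and_congr_left fun _ ↦
    ⟨fun h i ↦ h _ (Presieve.ofArrows.mk i), fun h Y f hf ↦ by obtain ⟨i⟩ := hf; exact h i⟩

/-- A sieve of a topology, described by a property of its elements, as seen from a covering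
family. -/
theorem IsPresite.exists_sieve {ι : Type*} {X : C} {U : ι → C} {u : ∀ i, U i ⟶ X}
    (hu : Sieve.ofArrows U u ∈ τ.toGrothendieck X) {T : C} (x : T ⟶ X) :
    ∃ R ∈ τ.toGrothendieck T, ∀ ⦃V : C⦄ (k : V ⟶ T), R k → ∃ i, ∃ y : V ⟶ U i, y ≫ u i = k ≫ x := by
  refine ⟨_, τ.toGrothendieck.pullback_stable x hu, fun _ k hk ↦ ?_⟩
  obtain ⟨i, a, e⟩ := (Sieve.mem_ofArrows_iff U u _).1 hk
  exact ⟨i, a, e.symm⟩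

/-- Transitivity of the topology, phrased with generalized elements: a family covers as soon as,
after two successive refinements, every element lifts to a member. -/
theorem ofArrows_mem_of_local {ι : Type*} {X : C} {U : ι → C} {u : ∀ i, U i ⟶ X}
    {R : Sieve X} (hR : R ∈ τ.toGrothendieck X)
    (h : ∀ ⦃V : C⦄ (k : V ⟶ X), R k → ∃ Q ∈ τ.toGrothendieck V, ∀ ⦃V' : C⦄ (l : V' ⟶ V), Q l →
      ∃ i, ∃ y : V' ⟶ U i, y ≫ u i = l ≫ k) :
    Sieve.ofArrows U u ∈ τ.toGrothendieck X := by
  refine τ.toGrothendieck.transitive hR _ (fun V k hk ↦ ?_)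
  obtain ⟨Q, hQ, hQ'⟩ := h k hk
  refine τ.toGrothendieck.superset_covering (fun V' l hl ↦ ?_) hQ
  obtain ⟨i, y, e⟩ := hQ' l hl
  exact (Sieve.mem_ofArrows_iff U u _).2 ⟨i, y, e.symm⟩

theorem IsSubcanonical.isSheaf (h : IsSubcanonical τ) (Z : C) :
    Presieve.IsSheaf τ.toGrothendieck (yoneda.obj Z) :=
  have : τ.toGrothendieck.Subcanonical := h
  GrothendieckTopology.Subcanonical.isSheaf_of_isRepresentable (yoneda.obj Z)

theorem IsSubcanonical.hom_ext_of_sieve (h : IsSubcanonical τ) {T Z : C} {R : Sieve T}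
    (hR : R ∈ τ.toGrothendieck T) {f g : T ⟶ Z}
    (hfg : ∀ ⦃V : C⦄ (k : V ⟶ T), R k → k ≫ f = k ≫ g) : f = g :=
  ((h.isSheaf Z) R hR).isSeparatedFor.ext (fun _ k hk ↦ hfg k hk)

theorem IsSubcanonical.hom_ext_of_cover (h : IsSubcanonical τ) {ι : Type*} {X : C} {U : ι → C}
    {u : ∀ i, U i ⟶ X} (hu : Sieve.ofArrows U u ∈ τ.toGrothendieck X) {Z : C} {f g : X ⟶ Z}
    (hfg : ∀ i, u i ≫ f = u i ≫ g) : f = g :=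
  h.hom_ext_of_sieve hu (fun V k hk ↦ by
    obtain ⟨i, a, rfl⟩ := (Sieve.mem_ofArrows_iff U u _).1 hk
    rw [Category.assoc, hfg, Category.assoc])

/-- An arrow determined by a property of its restrictions exists if it exists locally. -/
theorem IsSubcanonical.exists_of_local (h : IsSubcanonical τ) {T Z : C} {R : Sieve T}
    (hR : R ∈ τ.toGrothendieck T) (φ : ∀ ⦃V : C⦄, (V ⟶ T) → (V ⟶ Z) → Prop)
    (stable : ∀ ⦃V V' : C⦄ (k : V ⟶ T) (z : V ⟶ Z) (l : V' ⟶ V), φ k z → φ (l ≫ k) (l ≫ z))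
    (uniq : ∀ ⦃V : C⦄ (k : V ⟶ T) (z z' : V ⟶ Z), φ k z → φ k z' → z = z')
    (ex : ∀ ⦃V : C⦄ (k : V ⟶ T), R k → ∃ z, φ k z) :
    ∃ g : T ⟶ Z, ∀ ⦃V : C⦄ (k : V ⟶ T) (z : V ⟶ Z), φ k z → k ≫ g = z := by
  -- Since φ determines its second argument and is stable under restriction, arbitrary local choices
  -- form a matching family.
  choose z hz using ex
  let x : Presieve.FamilyOfElements (yoneda.obj Z) R.arrows := fun V k hk ↦ z k hk
  have hx : x.Compatible := by
    intro Y₁ Y₂ V g₁ g₂ f₁ f₂ h₁ h₂ e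
    have e1 := stable f₁ _ g₁ (hz f₁ h₁)
    have e2 := stable f₂ _ g₂ (hz f₂ h₂)
    rw [e] at e1
    exact uniq _ _ _ e1 e2
  obtain ⟨g, hg, -⟩ := ((h.isSheaf Z) R hR) x hx
  refine ⟨g, fun V k y hy ↦ ?_⟩
  refine h.hom_ext_of_sieve (τ.toGrothendieck.pullback_stable k hR) (fun V' l hl ↦ ?_)
  have h1 : (l ≫ k) ≫ g = z (l ≫ k) hl := hg _ hl
  rw [← Category.assoc, h1]
  exact uniq _ _ _ (hz _ _) (stable _ _ _ hy)

theorem IsSubcanonical.exists_of_local' (h : IsSubcanonical τ) {T Z : C} {R : Sieve T}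
    (hR : R ∈ τ.toGrothendieck T) (φ : ∀ ⦃V : C⦄, (V ⟶ T) → (V ⟶ Z) → Prop)
    (stable : ∀ ⦃V V' : C⦄ (k : V ⟶ T) (z : V ⟶ Z) (l : V' ⟶ V), φ k z → φ (l ≫ k) (l ≫ z))
    (uniq : ∀ ⦃V : C⦄ (k : V ⟶ T) (z z' : V ⟶ Z), φ k z → φ k z' → z = z')
    (ex : ∀ ⦃V : C⦄ (k : V ⟶ T), R k → ∃ z, φ k z) :
    ∃ g : T ⟶ Z, ∀ ⦃V : C⦄ (k : V ⟶ T), R k → φ k (k ≫ g) := by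
  obtain ⟨g, hg⟩ := h.exists_of_local hR φ stable uniq ex
  refine ⟨g, fun V k hk ↦ ?_⟩
  obtain ⟨z, hz⟩ := ex k hk
  rwa [hg k z hz]

/-- Gluing along a covering family. -/
theorem IsSubcanonical.exists_desc (h : IsSubcanonical τ) {ι : Type*} {X : C} {U : ι → C}
    {u : ∀ i, U i ⟶ X} (hu : Sieve.ofArrows U u ∈ τ.toGrothendieck X) {Z : C} (f : ∀ i, U i ⟶ Z)
    (hf : ∀ i j (Q : C) (a : Q ⟶ U i) (b : Q ⟶ U j), a ≫ u i = b ≫ u j → a ≫ f i = b ≫ f j) :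
    ∃ g : X ⟶ Z, ∀ i, u i ≫ g = f i := by
  obtain ⟨g, hg⟩ := h.exists_of_local hu
    (fun V k z ↦ ∃ i, ∃ y : V ⟶ U i, y ≫ u i = k ∧ y ≫ f i = z)
    (fun _ _ k z l ⟨i, y, e1, e2⟩ ↦ ⟨i, l ≫ y, by rw [Category.assoc, e1],
      by rw [Category.assoc, e2]⟩)
    (fun V k z z' ⟨i, y, e1, e2⟩ ⟨j, y', e1', e2'⟩ ↦ by
      rw [← e2, ← e2']
      exact hf _ _ _ _ _ (by rw [e1, e1']))
    (fun V k hk ↦ by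
      obtain ⟨i, a, rfl⟩ := (Sieve.mem_ofArrows_iff U u _).1 hk
      exact ⟨_, i, a, rfl, rfl⟩)
  exact ⟨g, fun i ↦ hg _ _ ⟨i, 𝟙 _, Category.id_comp _, Category.id_comp _⟩⟩

/-- Factorization through a monomorphism is a local question. -/
theorem IsSubcanonical.exists_lift_of_local (h : IsSubcanonical τ) {T Y Z : C} {R : Sieve T}
    (hR : R ∈ τ.toGrothendieck T) (m : Z ⟶ Y) [Mono m] (x : T ⟶ Y)
    (ex : ∀ ⦃V : C⦄ (k : V ⟶ T), R k → ∃ z, z ≫ m = k ≫ x) : ∃ l, l ≫ m = x := by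
  obtain ⟨g, hg⟩ := h.exists_of_local hR (fun V k z ↦ z ≫ m = k ≫ x)
    (fun V V' k z l e ↦ by rw [Category.assoc, e, Category.assoc])
    (fun V k z z' e e' ↦ by rw [← cancel_mono m, e, e']) ex
  refine ⟨g, h.hom_ext_of_sieve hR (fun V k hk ↦ ?_)⟩
  obtain ⟨z, hz⟩ := ex k hk
  rw [← Category.assoc, hg k z hz, hz]

/-- A presite is subcanonical as soon as compatible families of arrows on coverings glue. -/
theorem IsPresite.isSubcanonical (hτ : IsPresite τ)
    (h : ∀ {ι : Type (max u₁ v₁)} {X : C} (U : ι → C) (u : ∀ i, U i ⟶ X),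
      Presieve.ofArrows U u ∈ τ X → ∀ {Z : C},
      (∀ f g : X ⟶ Z, (∀ i, u i ≫ f = u i ≫ g) → f = g) ∧
      ∀ (f : ∀ i, U i ⟶ Z), (∀ i j (Q : C) (a : Q ⟶ U i) (b : Q ⟶ U j),
        a ≫ u i = b ≫ u j → a ≫ f i = b ≫ f j) → ∃ g : X ⟶ Z, ∀ i, u i ≫ g = f i) :
    IsSubcanonical τ := by
  refine GrothendieckTopology.Subcanonical.of_isSheaf_yoneda_obj _ (fun Z ↦ ?_)
  rw [Precoverage.isSheaf_toGrothendieck_iff]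
  intro X Y f R hR
  -- The sheaf condition for the generated topology concerns pullbacks of coverings; these are
  -- coverings again, so the hypothesis applies to them.
  have := τ.hasPullbacks_of_mem f hR
  rw [← Sieve.pullbackArrows_comm, ← Presieve.isSheafFor_iff_generate]
  have hm := Precoverage.pullbackArrows_mem (J := τ) f hR
  generalize Presieve.pullbackArrows f R = S at hm
  obtain ⟨ι, U, u, rfl⟩ := S.exists_eq_ofArrows
  rw [Presieve.isSheafFor_arrows_iff]
  intro x hx
  obtain ⟨h1, h2⟩ := h U u hm (Z := Z)
  obtain ⟨g, hg⟩ := h2 x (fun i j Q a b e ↦ hx i j Q a b e)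
  exact ⟨g, hg, fun g' hg' ↦ h1 _ _ (fun i ↦ (hg' i).trans (hg i).symm)⟩

end Local

/-! ### Clopen arrows of DG-presites -/

section Clopen

variable {C : Type u₁} [Category.{v₁} C] {τ : Precoverage C}

/-- As f is monic, g is the base change of g ≫ f along f. -/
theorem IsDGPresite.clopen_of_comp (h : IsDGPresite τ) {X Y Z : C} {g : X ⟶ Y} {f : Y ⟶ Z}
    (hgf : clopen τ (g ≫ f)) (hf : clopen τ f) : clopen τ g := by
  have := h.mono f hf
  refine clopen.of_isPullback h.isPresite (p := 𝟙 X) (f := g ≫ f) (g := f) ?_ hgf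
  exact isPullback_of_exists_lift (by simp) (fun T a b e ↦ ⟨a, by simp, by
    rw [← cancel_mono f, Category.assoc, e]⟩)

/-- For monomorphisms, being clopen is local on the source. -/
theorem IsDGPresite.clopen_of_source (h : IsDGPresite τ) {ι : Type*} {X Y : C} {U : ι → C}
    {u : ∀ i, U i ⟶ X} (hu : Sieve.ofArrows U u ∈ τ.toGrothendieck X) (f : X ⟶ Y) [Mono f]
    (huf : ∀ i, clopen τ (u i ≫ f)) : clopen τ f := by
  -- The union t of the images of the u i ≫ f is the same subobject of Y as f: each factors through
  -- the other locally, hence globally, both being monic.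
  obtain ⟨T, t, r, ht, hr, hrt⟩ := h.exists_family_factorization _ huf
  have := h.mono t ht
  have hr' := (h.isPresite.ofArrows_mem_iff.1 hr).2
  obtain ⟨a, ha⟩ := h.subcanonical.exists_lift_of_local hu t f (fun V k hk ↦ by
    obtain ⟨i, a, rfl⟩ := (Sieve.mem_ofArrows_iff U u _).1 hk
    exact ⟨a ≫ r i, by rw [Category.assoc, Category.assoc, hrt]⟩)
  obtain ⟨b, hb⟩ := h.subcanonical.exists_lift_of_local hr' f t (fun V k hk ↦ by
    obtain ⟨i, a, rfl⟩ := (Sieve.mem_ofArrows_iff U r _).1 hk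
    exact ⟨a ≫ u i, by rw [Category.assoc, Category.assoc, hrt]⟩)
  have : IsIso a := ⟨b, by rw [← cancel_mono f, Category.assoc, hb, ha, Category.id_comp],
    by rw [← cancel_mono t, Category.assoc, ha, hb, Category.id_comp]⟩
  rw [← ha]
  exact clopen.comp h.isPresite (clopen_of_isIso h.isPresite a) ht

/-- Being clopen is local on the target. -/
theorem IsDGPresite.clopen_of_target (h : IsDGPresite τ) {ι : Type*} {X Y : C} {U : ι → C}
    {u : ∀ i, U i ⟶ Y} (hu : Presieve.ofArrows U u ∈ τ Y) (f : X ⟶ Y) {P : ι → C}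
    {p : ∀ i, P i ⟶ X} {q : ∀ i, P i ⟶ U i} (hP : ∀ i, IsPullback (p i) (q i) f (u i))
    (hq : ∀ i, clopen τ (q i)) : clopen τ f := by
  have hτ := h.isPresite
  obtain ⟨hu1, hu2⟩ := hτ.ofArrows_mem_iff.1 hu
  -- Monicity is local on the target too: two arrows with equal composites are compared over each U
  -- i, where f restricts to the monic q i.
  have hmono : Mono f := ⟨fun {T} a b e ↦ by
    obtain ⟨R, hR, hR'⟩ := IsPresite.exists_sieve hu2 (a ≫ f)
    refine h.subcanonical.hom_ext_of_sieve hR (fun V k hk ↦ ?_)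
    obtain ⟨i, y, hy⟩ := hR' k hk
    have := h.mono _ (hq i)
    have e1 := (hP i).lift_fst (k ≫ a) y (by rw [hy, Category.assoc])
    have e2 := (hP i).lift_fst (k ≫ b) y (by rw [hy, Category.assoc, e])
    rw [← e1, ← e2]
    congr 1
    rw [← cancel_mono (q i), IsPullback.lift_snd, IsPullback.lift_snd]⟩
  have hp := hτ.ofArrows_mem_iff.1
    (Precoverage.mem_coverings_of_isPullback (J := τ) _ hu f p q hP)
  refine h.clopen_of_source hp.2 f (fun i ↦ ?_)
  rw [(hP i).w]
  exact clopen.comp hτ (hq i) (hu1 i)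

/-- Unions of clopen arrows. -/
theorem IsDGPresite.exists_union (h : IsDGPresite τ) {ι : Type*} {X : C} {U : ι → C}
    (u : ∀ i, U i ⟶ X) (hu : ∀ i, clopen τ (u i)) :
    ∃ (T : C) (t : T ⟶ X) (r : ∀ i, U i ⟶ T), clopen τ t ∧ (∀ i, clopen τ (r i)) ∧
      Sieve.ofArrows U r ∈ τ.toGrothendieck T ∧ ∀ i, r i ≫ t = u i := by
  obtain ⟨T, t, r, ht, hr, hrt⟩ := h.exists_family_factorization u hu
  obtain ⟨h1, h2⟩ := h.isPresite.ofArrows_mem_iff.1 hr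
  exact ⟨T, t, r, ht, h1, h2, hrt⟩

/-- The members u i need not be clopen: the sieve contains a covering, and the image of that
covering lies in the image sieve. -/
theorem IsContinuous.cover_map {D : Type u₂} [Category.{v₂} D] {σ : Precoverage D} {F : C ⥤ D}
    (hσ : IsPresite σ) (hF : IsContinuous τ σ F)
    (hτ : IsPresite τ) {ι : Type*} {X : C} {U : ι → C} {u : ∀ i, U i ⟶ X}
    (hu : Sieve.ofArrows U u ∈ τ.toGrothendieck X) :
    Sieve.ofArrows (fun i ↦ F.obj (U i)) (fun i ↦ F.map (u i)) ∈ σ.toGrothendieck (F.obj X) := by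
  obtain ⟨R, hR, hle⟩ := hτ.mem_toGrothendieck_iff.1 hu
  refine hσ.mem_toGrothendieck_iff.2 ⟨_, hF.map_mem R hR, ?_⟩
  rintro Y f ⟨hf⟩
  obtain ⟨i, a, rfl⟩ := (Sieve.mem_ofArrows_iff U u _).1 (hle _ _ hf)
  exact (Sieve.mem_ofArrows_iff _ _ _).2 ⟨i, F.map a, F.map_comp _ _⟩

end Clopen

/-! ### Smallness -/

section Small

variable {C : Type u₁} [Category.{v₁} C] {τ : Precoverage C}

theorem IsUCategory.small_hom (h : IsUCategory.{w} C) (X Y : C) : Small.{w} (X ⟶ Y) := by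
  obtain ⟨A, _, ⟨e⟩⟩ := h
  exact ⟨_, ⟨e.fullyFaithfulFunctor.homEquiv⟩⟩

/-- The clopen subobjects of a given object form a small set. -/
theorem IsDGUPresite.exists_small_clopens (h : IsDGUPresite.{w} τ) (X : C) :
    ∃ (I : Type w) (U : I → C) (u : ∀ i, U i ⟶ X), (∀ i, clopen τ (u i)) ∧
      ∀ ⦃V : C⦄ (v : V ⟶ X), clopen τ v → ∃ i, ∃ e : V ≅ U i, e.hom ≫ u i = v := by
  obtain ⟨G, hG, hG'⟩ := h.isUPresite.exists_generators X
  have hs (V W : C) := h.isUPresite.isUCategory.small_hom V W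
  let S := Σ V : G, ((V : C) ⟶ X)
  have : Small.{w} S := inferInstance
  let K := {v : Over X // clopen τ v.hom}
  let φ : K → Set S := fun v ↦ {s | ∃ l : (s.1 : C) ⟶ v.1.left, l ≫ v.1.hom = s.2}
  have key (v v' : K) (hv : φ v ⊆ φ v') : ∃ l : v.1.left ⟶ v'.1.left, l ≫ v'.1.hom = v.1.hom := by
    obtain ⟨R, hR, hRG⟩ := hG' v.1.hom v.2
    have := h.mono _ v'.2
    refine h.subcanonical.exists_lift_of_local
      (Precoverage.generate_mem_toGrothendieck hR) _ _ ?_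
    rintro V k ⟨W, g, f, hf, rfl⟩
    obtain ⟨l, hl⟩ := @hv ⟨⟨W, hRG f hf⟩, f ≫ v.1.hom⟩ ⟨f, rfl⟩
    exact ⟨g ≫ l, by rw [Category.assoc, hl, Category.assoc]⟩
  have : Small.{w} (Set S) := inferInstance
  have : Small.{w} (Set.range φ) := small_subset (Set.subset_univ _)
  let I := Shrink.{w} (Set.range φ)
  let c : I → K := fun i ↦ ((equivShrink.{w} (Set.range φ)).symm i).2.choose
  have hc (i : I) : φ (c i) = ((equivShrink.{w} (Set.range φ)).symm i).1 :=
    ((equivShrink.{w} (Set.range φ)).symm i).2.choose_spec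
  refine ⟨I, fun i ↦ (c i).1.left, fun i ↦ (c i).1.hom, fun i ↦ (c i).2, fun V v hv ↦ ?_⟩
  let v' : K := ⟨Over.mk v, hv⟩
  let i : I := equivShrink.{w} (Set.range φ) ⟨φ v', Set.mem_range_self v'⟩
  have e : φ (c i) = φ v' := by rw [hc]; simp [i]
  obtain ⟨a, ha⟩ := key v' (c i) e.ge
  obtain ⟨b, hb⟩ := key (c i) v' e.le
  have := h.mono _ hv
  have := h.mono _ (c i).2
  refine ⟨i, ⟨a, b, ?_, ?_⟩, ha⟩
  · have e1 : a ≫ b ≫ v = v := (congrArg (a ≫ ·) hb).trans ha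
    exact (cancel_mono v).1 ((Category.assoc _ _ _).trans (e1.trans (Category.id_comp v).symm))
  · have e1 : b ≫ a ≫ (c i).1.hom = (c i).1.hom := (congrArg (b ≫ ·) ha).trans hb
    rw [← cancel_mono (c i).1.hom, Category.assoc, e1]; simp

/-- Every family of clopen arrows can be replaced by a small one. -/
theorem IsDGUPresite.exists_small_family (h : IsDGUPresite.{w} τ) {X : C} {κ : Type*} {U : κ → C}
    (u : ∀ i, U i ⟶ X) (hu : ∀ i, clopen τ (u i)) :
    ∃ (I : Type w) (c : I → κ), ∀ k, ∃ i, ∃ a : U k ⟶ U (c i), a ≫ u (c i) = u k := by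
  obtain ⟨I, W, w, -, hw⟩ := h.exists_small_clopens X
  -- One index for each clopen subobject of X that occurs in the family; the family may be a proper
  -- class, its subobjects are not.
  let I' := {i : I // ∃ k, ∃ e : U k ≅ W i, e.hom ≫ w i = u k}
  refine ⟨I', fun i ↦ i.2.choose, fun k ↦ ?_⟩
  obtain ⟨i, e, he⟩ := hw (u k) (hu k)
  let i' : I' := ⟨i, k, e, he⟩
  obtain ⟨e', he'⟩ := i'.2.choose_spec
  exact ⟨i', e.hom ≫ e'.inv, by rw [Category.assoc, ← he', Iso.inv_hom_id_assoc, he]⟩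

theorem IsDGUPresite.exists_small_cover (h : IsDGUPresite.{w} τ) {X : C} {κ : Type*} {U : κ → C}
    {u : ∀ i, U i ⟶ X} (hu : Presieve.ofArrows U u ∈ τ X) :
    ∃ (I : Type w) (c : I → κ), Presieve.ofArrows (fun i ↦ U (c i)) (fun i ↦ u (c i)) ∈ τ X := by
  have hτ := h.isPresite
  obtain ⟨h1, h2⟩ := hτ.ofArrows_mem_iff.1 hu
  obtain ⟨I, c, hc⟩ := h.exists_small_family u h1
  refine ⟨I, c, hτ.ofArrows_mem_iff.2 ⟨fun i ↦ h1 _, ?_⟩⟩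
  refine τ.toGrothendieck.superset_covering (fun V k hk ↦ ?_) h2
  obtain ⟨i, a, rfl⟩ := (Sieve.mem_ofArrows_iff U u _).1 hk
  obtain ⟨j, b, hb⟩ := hc i
  exact (Sieve.mem_ofArrows_iff _ _ _).2 ⟨j, a ≫ b, by rw [Category.assoc, hb]⟩

end Small

/-! ### Gluing -/

section Gluing

variable {C : Type u₁} [Category.{v₁} C] (τ : Precoverage C)

/-- Gluing data for a family of objects, given by the relation between generalized elements which
shall become equal in the glued object. -/
structure IsGlueRel {ι : Type w} (U : ι → C)
    (rel : ∀ ⦃T : C⦄ (i j : ι), (T ⟶ U i) → (T ⟶ U j) → Prop) : Prop where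
  self_iff : ∀ ⦃T : C⦄ (i : ι) (x y : T ⟶ U i), rel i i x y ↔ x = y
  symm : ∀ ⦃T : C⦄ (i j : ι) (x : T ⟶ U i) (y : T ⟶ U j), rel i j x y → rel j i y x
  trans : ∀ ⦃T : C⦄ (i j k : ι) (x : T ⟶ U i) (y : T ⟶ U j) (z : T ⟶ U k),
    rel i j x y → rel j k y z → rel i k x z
  exists_rep : ∀ i j, ∃ (W : C) (a : W ⟶ U i) (b : W ⟶ U j), clopen τ a ∧ clopen τ b ∧
    ∀ ⦃T : C⦄ (x : T ⟶ U i) (y : T ⟶ U j), rel i j x y ↔ ∃ t : T ⟶ W, t ≫ a = x ∧ t ≫ b = y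

/-- `X` is obtained by gluing the objects `U i`. -/
structure IsGlue {ι : Type w} (U : ι → C)
    (rel : ∀ ⦃T : C⦄ (i j : ι), (T ⟶ U i) → (T ⟶ U j) → Prop) (X : C) (u : ∀ i, U i ⟶ X) :
    Prop where
  mem : Presieve.ofArrows U u ∈ τ X
  rel_iff : ∀ ⦃T : C⦄ (i j : ι) (x : T ⟶ U i) (y : T ⟶ U j),
    rel i j x y ↔ x ≫ u i = y ≫ u j

/-- Small families of objects can be glued along clopen arrows. -/
def HasGluing : Prop :=
  ∀ ⦃ι : Type w⦄ (U : ι → C) (rel : ∀ ⦃T : C⦄ (i j : ι), (T ⟶ U i) → (T ⟶ U j) → Prop),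
    IsGlueRel τ U rel → ∃ (X : C) (u : ∀ i, U i ⟶ X), IsGlue τ U rel X u

end Gluing

/-! ### Étale arrows -/

section Etale

variable {C : Type u₁} [Category.{v₁} C] {τ : Precoverage C}

variable (τ) in
/-- Étale arrows: those which are clopen locally on the source. -/
def etale : MorphismProperty C :=
  fun X _ f ↦ ∃ S ∈ τ X, ∀ ⦃U : C⦄ (s : U ⟶ X), S s → clopen τ (s ≫ f)

theorem etale.exists_cover {X Y : C} {f : X ⟶ Y} (hf : etale τ f) :
    ∃ (ι : Type (max u₁ v₁)) (U : ι → C) (u : ∀ i, U i ⟶ X), Presieve.ofArrows U u ∈ τ X ∧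
      ∀ i, clopen τ (u i ≫ f) := by
  obtain ⟨S, hS, h⟩ := hf
  obtain ⟨ι, U, u, rfl⟩ := S.exists_eq_ofArrows
  exact ⟨ι, U, u, hS, fun i ↦ h _ (Presieve.ofArrows.mk i)⟩

theorem etale.exists_small_cover (h : IsDGUPresite.{w} τ) {X Y : C} {f : X ⟶ Y}
    (hf : etale τ f) : ∃ (ι : Type w) (U : ι → C) (u : ∀ i, U i ⟶ X),
      Presieve.ofArrows U u ∈ τ X ∧ ∀ i, clopen τ (u i ≫ f) := by
  obtain ⟨ι, U, u, hu, huf⟩ := hf.exists_cover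
  obtain ⟨I, c, hc⟩ := h.exists_small_cover hu
  exact ⟨I, _, _, hc, fun i ↦ huf _⟩

theorem etale_of_cover {ι : Type*} {X Y : C} {U : ι → C} {u : ∀ i, U i ⟶ X}
    (hu : Presieve.ofArrows U u ∈ τ X) {f : X ⟶ Y} (huf : ∀ i, clopen τ (u i ≫ f)) :
    etale τ f :=
  ⟨_, hu, by rintro V s ⟨i⟩; exact huf i⟩

theorem etale_of_clopen (hτ : IsPresite τ) {X Y : C} {f : X ⟶ Y} (hf : clopen τ f) :
    etale τ f :=
  ⟨_, τ.mem_coverings_of_isIso (𝟙 X), by rintro V s ⟨⟩; simpa using hf⟩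

/-- Being étale is local on the source. -/
theorem etale_of_source (hτ : IsPresite τ) {ι : Type*} {X Y : C} {U : ι → C} {u : ∀ i, U i ⟶ X}
    (hu : Sieve.ofArrows U u ∈ τ.toGrothendieck X) (h1 : ∀ i, etale τ (u i)) {f : X ⟶ Y}
    (h2 : ∀ i, etale τ (u i ≫ f)) : etale τ f := by
  choose κ A a ha hau using fun i ↦ (h1 i).exists_cover
  choose κ' B b hb hbu using fun i ↦ (h2 i).exists_cover
  have hca (i : ι) (k : κ i) : clopen τ (a i k) := (hτ.ofArrows_mem_iff.1 (ha i)).1 k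
  have hcb (i : ι) (k : κ' i) : clopen τ (b i k) := (hτ.ofArrows_mem_iff.1 (hb i)).1 k
  have hp (i : ι) (k : κ i) (l : κ' i) : HasPullback (a i k) (b i l) :=
    clopen.hasPullback hτ (hca i k) _
  have hP (i : ι) (k : κ i) (l : κ' i) := IsPullback.of_hasPullback (a i k) (b i l)
  -- The common refinement of the coverings of U i witnessing that u i and u i ≫ f are étale; its
  -- members are clopen over X and over Y alike.
  refine etale_of_cover (ι := Σ i, κ i × κ' i)
    (u := fun s ↦ pullback.fst (a s.1 s.2.1) (b s.1 s.2.2) ≫ a s.1 s.2.1 ≫ u s.1)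
    (hτ.ofArrows_mem_iff.2 ⟨fun s ↦ ?_, ?_⟩) (fun s ↦ ?_)
  · exact clopen.comp hτ (clopen.of_isPullback hτ (hP _ _ _).flip (hcb _ _)) (hau _ _)
  · refine ofArrows_mem_of_local hu (fun V k hk ↦ ?_)
    obtain ⟨i, x, rfl⟩ := (Sieve.mem_ofArrows_iff U u _).1 hk
    obtain ⟨R, hR, hR'⟩ := IsPresite.exists_sieve (hτ.ofArrows_mem_iff.1 (ha i)).2 x
    obtain ⟨Q, hQ, hQ'⟩ := IsPresite.exists_sieve (hτ.ofArrows_mem_iff.1 (hb i)).2 x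
    refine ⟨R ⊓ Q, τ.toGrothendieck.intersection_covering hR hQ, fun V' l hl ↦ ?_⟩
    obtain ⟨k, y, hy⟩ := hR' l hl.1
    obtain ⟨k', y', hy'⟩ := hQ' l hl.2
    refine ⟨⟨i, k, k'⟩, (hP i k k').lift y y' (by rw [hy, hy']), ?_⟩
    rw [IsPullback.lift_fst_assoc, reassoc_of% hy]
  · rw [Category.assoc, Category.assoc, pullback.condition_assoc]
    exact clopen.comp hτ (clopen.of_isPullback hτ (hP _ _ _) (hca _ _)) (hbu _ _)

/-- On the members A k of a covering where f is clopen, pull back the covering of Y where g is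
clopen. The projections to that covering are base changes of clopen arrows a k ≫ f. -/
theorem etale.comp (hτ : IsPresite τ) {X Y Z : C} {f : X ⟶ Y} {g : Y ⟶ Z} (hf : etale τ f)
    (hg : etale τ g) : etale τ (f ≫ g) := by
  obtain ⟨κ, A, a, ha, haf⟩ := hf.exists_cover
  obtain ⟨κ', B, b, hb, hbg⟩ := hg.exists_cover
  have hca (k : κ) : clopen τ (a k) := (hτ.ofArrows_mem_iff.1 ha).1 k
  have hcb (k : κ') : clopen τ (b k) := (hτ.ofArrows_mem_iff.1 hb).1 k
  have hp (k : κ) (l : κ') : HasPullback (b l) (a k ≫ f) := clopen.hasPullback hτ (hcb _) _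
  have hP (k : κ) (l : κ') := IsPullback.of_hasPullback (b l) (a k ≫ f)
  refine etale_of_cover (ι := κ × κ') (u := fun s ↦ pullback.snd (b s.2) (a s.1 ≫ f) ≫ a s.1)
    (hτ.ofArrows_mem_iff.2 ⟨fun s ↦ ?_, ?_⟩) (fun s ↦ ?_)
  · exact clopen.comp hτ (clopen.of_isPullback hτ (hP _ _) (hcb _)) (hca _)
  · refine ofArrows_mem_of_local (hτ.ofArrows_mem_iff.1 ha).2 (fun V k hk ↦ ?_)
    obtain ⟨i, x, rfl⟩ := (Sieve.mem_ofArrows_iff A a _).1 hk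
    obtain ⟨R, hR, hR'⟩ := IsPresite.exists_sieve (hτ.ofArrows_mem_iff.1 hb).2 (x ≫ a i ≫ f)
    refine ⟨R, hR, fun V' l hl ↦ ?_⟩
    obtain ⟨j, y, hy⟩ := hR' l hl
    refine ⟨⟨i, j⟩, (hP i j).lift y (l ≫ x) (by rw [hy, Category.assoc]), ?_⟩
    rw [IsPullback.lift_snd_assoc, Category.assoc]
  · have e : pullback.fst (b s.2) (a s.1 ≫ f) ≫ b s.2 ≫ g =
        (pullback.snd (b s.2) (a s.1 ≫ f) ≫ a s.1) ≫ f ≫ g := by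
      rw [pullback.condition_assoc, Category.assoc, Category.assoc]
    rw [← e]
    exact clopen.comp hτ (clopen.of_isPullback hτ (hP _ _).flip (haf _)) (hbg _)

/-- The covering is refined as for composites; on its members the claim is cancellation for clopen
arrows, `IsDGPresite.clopen_of_comp`. -/
theorem etale.of_comp (h : IsDGPresite τ) {X Y Z : C} {g : X ⟶ Y} {f : Y ⟶ Z}
    (hgf : etale τ (g ≫ f)) (hf : etale τ f) : etale τ g := by
  have hτ := h.isPresite
  obtain ⟨κ, A, a, ha, haf⟩ := hgf.exists_cover
  obtain ⟨κ', B, b, hb, hbf⟩ := hf.exists_cover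
  have hca (k : κ) : clopen τ (a k) := (hτ.ofArrows_mem_iff.1 ha).1 k
  have hcb (k : κ') : clopen τ (b k) := (hτ.ofArrows_mem_iff.1 hb).1 k
  have hp (k : κ) (l : κ') : HasPullback (b l) (a k ≫ g) := clopen.hasPullback hτ (hcb _) _
  have hP (k : κ) (l : κ') := IsPullback.of_hasPullback (b l) (a k ≫ g)
  refine etale_of_cover (ι := κ × κ') (u := fun s ↦ pullback.snd (b s.2) (a s.1 ≫ g) ≫ a s.1)
    (hτ.ofArrows_mem_iff.2 ⟨fun s ↦ ?_, ?_⟩) (fun s ↦ ?_)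
  · exact clopen.comp hτ (clopen.of_isPullback hτ (hP _ _) (hcb _)) (hca _)
  · refine ofArrows_mem_of_local (hτ.ofArrows_mem_iff.1 ha).2 (fun V k hk ↦ ?_)
    obtain ⟨i, x, rfl⟩ := (Sieve.mem_ofArrows_iff A a _).1 hk
    obtain ⟨R, hR, hR'⟩ := IsPresite.exists_sieve (hτ.ofArrows_mem_iff.1 hb).2 (x ≫ a i ≫ g)
    refine ⟨R, hR, fun V' l hl ↦ ?_⟩
    obtain ⟨j, y, hy⟩ := hR' l hl
    refine ⟨⟨i, j⟩, (hP i j).lift y (l ≫ x) (by rw [hy, Category.assoc]), ?_⟩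
    rw [IsPullback.lift_snd_assoc, Category.assoc]
  · rw [Category.assoc, ← pullback.condition]
    refine clopen.comp hτ (h.clopen_of_comp ?_ (hbf s.2)) (hcb _)
    have e : pullback.fst (b s.2) (a s.1 ≫ g) ≫ b s.2 ≫ f =
        pullback.snd (b s.2) (a s.1 ≫ g) ≫ a s.1 ≫ g ≫ f := by
      rw [pullback.condition_assoc, Category.assoc]
    rw [e]
    exact clopen.comp hτ (clopen.of_isPullback hτ (hP _ _) (hcb _)) (haf _)

theorem IsDGPresite.clopen_of_etale (h : IsDGPresite τ) {X Y : C} {f : X ⟶ Y} (hf : etale τ f)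
    [Mono f] : clopen τ f := by
  obtain ⟨κ, A, a, ha, haf⟩ := hf.exists_cover
  exact h.clopen_of_source (h.isPresite.ofArrows_mem_iff.1 ha).2 f haf

/-- In gluing data, it suffices to know that the left projections of the overlaps are clopen. -/
theorem IsGlueRel.of_left (h : IsDGPresite τ) {ι : Type w} {U : ι → C}
    {rel : ∀ ⦃T : C⦄ (i j : ι), (T ⟶ U i) → (T ⟶ U j) → Prop}
    (self_iff : ∀ ⦃T : C⦄ (i : ι) (x y : T ⟶ U i), rel i i x y ↔ x = y)
    (symm : ∀ ⦃T : C⦄ (i j : ι) (x : T ⟶ U i) (y : T ⟶ U j), rel i j x y → rel j i y x)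
    (trans : ∀ ⦃T : C⦄ (i j k : ι) (x : T ⟶ U i) (y : T ⟶ U j) (z : T ⟶ U k),
      rel i j x y → rel j k y z → rel i k x z)
    (exists_rep : ∀ i j, ∃ (W : C) (a : W ⟶ U i) (b : W ⟶ U j), clopen τ a ∧
      ∀ ⦃T : C⦄ (x : T ⟶ U i) (y : T ⟶ U j), rel i j x y ↔ ∃ t : T ⟶ W, t ≫ a = x ∧ t ≫ b = y) :
    IsGlueRel τ U rel where
  self_iff := self_iff
  symm := symm
  trans := trans
  exists_rep i j := by
    obtain ⟨W, a, b, ha, hW⟩ := exists_rep i j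
    obtain ⟨W', a', b', ha', hW'⟩ := exists_rep j i
    refine ⟨W, a, b, ha, ?_, hW⟩
    -- The overlap W' for (j, i) represents the opposite relation, so it is isomorphic to W, and b
    -- corresponds to the clopen arrow a'.
    obtain ⟨t, h1, h2⟩ := (hW' b a).1 (symm _ _ _ _ ((hW a b).2 ⟨𝟙 _, by simp, by simp⟩))
    obtain ⟨s, h3, h4⟩ := (hW b' a').1 (symm _ _ _ _ ((hW' a' b').2 ⟨𝟙 _, by simp, by simp⟩))
    have := h.mono a ha
    have := h.mono a' ha'
    have : IsIso t := ⟨s, by rw [← cancel_mono a, Category.assoc, h3, h2, Category.id_comp],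
      by rw [← cancel_mono a', Category.assoc, h1, h4, Category.id_comp]⟩
    rw [← h1]
    exact clopen.comp h.isPresite (clopen_of_isIso h.isPresite t) ha'

/-- Pullbacks can be glued. -/
theorem exists_isPullback_of_cover (h : IsDGPresite τ) (hg : HasGluing.{w} τ) {ι : Type w}
    {X Y Z : C} {U : ι → C} {u : ∀ i, U i ⟶ X} (hu : Presieve.ofArrows U u ∈ τ X) (f : X ⟶ Y)
    (g : Z ⟶ Y) {P : ι → C} {p : ∀ i, P i ⟶ U i} {q : ∀ i, P i ⟶ Z}
    (hP : ∀ i, IsPullback (p i) (q i) (u i ≫ f) g) :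
    ∃ (V : C) (a : V ⟶ X) (b : V ⟶ Z) (c : ∀ i, P i ⟶ V), IsPullback a b f g ∧
      Presieve.ofArrows P c ∈ τ V ∧ (∀ i, c i ≫ a = p i ≫ u i) ∧ ∀ i, c i ≫ b = q i := by
  have hτ := h.isPresite
  obtain ⟨hu1, hu2⟩ := hτ.ofArrows_mem_iff.1 hu
  have hm (i : ι) : Mono (u i) := h.mono _ (hu1 i)
  -- Elements of P i and P j are identified when they agree in X and in Z. The overlap is the part
  -- of P i lying over U j; the pullback property of P j maps it to P j.
  obtain ⟨V, c, hc, hVc⟩ := hg P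
    (fun T i j x y ↦ x ≫ p i ≫ u i = y ≫ p j ≫ u j ∧ x ≫ q i = y ≫ q j) <| by
      refine .of_left h ?_ ?_ ?_ ?_
      · intro T i x y
        refine ⟨fun ⟨h1, h2⟩ ↦ (hP i).hom_ext ?_ h2, by rintro rfl; exact ⟨rfl, rfl⟩⟩
        rw [← cancel_mono (u i), Category.assoc, Category.assoc, h1]
      · exact fun T i j x y ⟨h1, h2⟩ ↦ ⟨h1.symm, h2.symm⟩
      · exact fun T i j k x y z ⟨h1, h2⟩ ⟨h3, h4⟩ ↦ ⟨h1.trans h3, h2.trans h4⟩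
      · intro i j
        have := clopen.hasPullback hτ (hu1 j) (p i ≫ u i)
        have hW := IsPullback.of_hasPullback (u j) (p i ≫ u i)
        have ha := clopen.of_isPullback hτ hW (hu1 j)
        have := h.mono _ ha
        refine ⟨pullback (u j) (p i ≫ u i), pullback.snd _ _,
          (hP j).lift (pullback.fst _ _) (pullback.snd _ _ ≫ q i) ?_, ha, fun T x y ↦ ?_⟩
        · rw [pullback.condition_assoc, Category.assoc, Category.assoc, ← (hP i).w]
        · constructor
          · rintro ⟨h1, h2⟩
            have e := hW.lift_snd (y ≫ p j) x (by rw [h1, Category.assoc])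
            refine ⟨hW.lift (y ≫ p j) x (by rw [h1, Category.assoc]), e,
              (hP j).hom_ext ?_ ?_⟩
            · rw [Category.assoc, IsPullback.lift_fst, hW.lift_fst]
            · rw [Category.assoc, IsPullback.lift_snd, reassoc_of% e, h2]
          · rintro ⟨t, rfl, rfl⟩
            constructor
            · rw [Category.assoc, Category.assoc, (hP j).lift_fst_assoc, pullback.condition]
            · rw [Category.assoc, Category.assoc, (hP j).lift_snd]
  obtain ⟨hc1, hc2⟩ := hτ.ofArrows_mem_iff.1 hc
  obtain ⟨a, ha⟩ := h.subcanonical.exists_desc hc2 (fun i ↦ p i ≫ u i)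
    (fun i j Q x y e ↦ ((hVc i j x y).2 e).1)
  obtain ⟨b, hb⟩ := h.subcanonical.exists_desc hc2 q (fun i j Q x y e ↦ ((hVc i j x y).2 e).2)
  refine ⟨V, a, b, c, ?_, hc, ha, hb⟩
  have hw : a ≫ f = b ≫ g := by
    refine h.subcanonical.hom_ext_of_cover hc2 (fun i ↦ ?_)
    rw [reassoc_of% (ha i), reassoc_of% (hb i), (hP i).w]
  have hext {T : C} (x y : T ⟶ V) (e1 : x ≫ a = y ≫ a) (e2 : x ≫ b = y ≫ b) : x = y := by
    obtain ⟨R, hR, hR'⟩ := IsPresite.exists_sieve hc2 x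
    obtain ⟨Q, hQ, hQ'⟩ := IsPresite.exists_sieve hc2 y
    refine h.subcanonical.hom_ext_of_sieve (τ.toGrothendieck.intersection_covering hR hQ)
      (fun V' l hl ↦ ?_)
    obtain ⟨i, x', hx⟩ := hR' l hl.1
    obtain ⟨j, y', hy⟩ := hQ' l hl.2
    rw [← hx, ← hy]
    refine (hVc i j x' y').1 ⟨?_, ?_⟩
    · rw [← ha, ← ha, reassoc_of% hx, reassoc_of% hy, e1]
    · rw [← hb, ← hb, reassoc_of% hx, reassoc_of% hy, e2]
  have hex (T : C) (x : T ⟶ X) (z : T ⟶ Z) (e : x ≫ f = z ≫ g) :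
      ∃ l : T ⟶ V, l ≫ a = x ∧ l ≫ b = z := by
    obtain ⟨R, hR, hR'⟩ := IsPresite.exists_sieve hu2 x
    obtain ⟨l, hl⟩ := h.subcanonical.exists_of_local' hR
      (fun T' k l ↦ l ≫ a = k ≫ x ∧ l ≫ b = k ≫ z)
      (fun T' T'' k l m ⟨e1, e2⟩ ↦ ⟨by rw [Category.assoc, e1, Category.assoc],
        by rw [Category.assoc, e2, Category.assoc]⟩)
      (fun T' k l l' ⟨e1, e2⟩ ⟨e1', e2'⟩ ↦ hext _ _ (e1.trans e1'.symm) (e2.trans e2'.symm))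
      (fun T' k hk ↦ by
        obtain ⟨i, y, hy⟩ := hR' k hk
        have hw : y ≫ u i ≫ f = (k ≫ z) ≫ g := by rw [reassoc_of% hy, e, Category.assoc]
        refine ⟨(hP i).lift y (k ≫ z) hw ≫ c i, ?_, ?_⟩
        · rw [Category.assoc, ha, (hP i).lift_fst_assoc, hy]
        · rw [Category.assoc, hb, (hP i).lift_snd])
    simp only [Category.assoc] at hl
    exact ⟨l, h.subcanonical.hom_ext_of_sieve hR (fun _ k hk ↦ (hl k hk).1),
      h.subcanonical.hom_ext_of_sieve hR (fun _ k hk ↦ (hl k hk).2)⟩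
  choose l hl1 hl2 using hex
  exact ⟨⟨hw⟩, ⟨PullbackCone.IsLimit.mk _ (fun s ↦ l _ s.fst s.snd s.condition)
    (fun s ↦ hl1 _ _ _ _) (fun s ↦ hl2 _ _ _ _) (fun s m h1 h2 ↦ hext _ _
      (h1.trans (hl1 _ _ _ _).symm) (h2.trans (hl2 _ _ _ _).symm))⟩⟩

/-- The pullback exists over each member of a small covering on which f is clopen, and these
pullbacks are glued. -/
theorem etale.hasPullback (h : IsDGUPresite.{w} τ) (hg : HasGluing.{w} τ) {X Y Z : C}
    {f : X ⟶ Y} (hf : etale τ f) (g : Z ⟶ Y) : HasPullback f g := by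
  obtain ⟨ι, U, u, hu, huf⟩ := hf.exists_small_cover h
  have hp (i : ι) := clopen.hasPullback h.isPresite (huf i) g
  obtain ⟨V, a, b, c, hV, -⟩ := exists_isPullback_of_cover h.toIsDGPresite hg hu f g
    (fun i ↦ IsPullback.of_hasPullback (u i ≫ f) g)
  exact hV.hasPullback

theorem etale.of_isPullback (hτ : IsPresite τ) {P X Y Z : C} {p : P ⟶ X} {q : P ⟶ Y} {f : X ⟶ Z}
    {g : Y ⟶ Z} (hP : IsPullback p q f g) (hf : etale τ f) : etale τ q := by
  obtain ⟨ι, U, u, hu, huf⟩ := hf.exists_cover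
  have hc (i : ι) := (hτ.ofArrows_mem_iff.1 hu).1 i
  have hp (i : ι) := clopen.hasPullback hτ (hc i) p
  have hpb (i : ι) := IsPullback.of_hasPullback (u i) p
  refine etale_of_cover (Precoverage.mem_coverings_of_isPullback (J := τ) _ hu p _ _
    (fun i ↦ (hpb i).flip)) (fun i ↦ ?_)
  exact clopen.of_isPullback hτ ((hpb i).flip.paste_horiz hP.flip).flip (huf i)

end Etale

/-! ### Epimorphic étale arrows, effective descent and quotients by equivalence relations -/

section Descent

variable {C : Type u₁} [Category.{v₁} C] {τ : Precoverage C}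

theorem isEpiSink_of_generate_mem (h : IsSubcanonical τ) {X : C} {S : Presieve X}
    (hS : Sieve.generate S ∈ τ.toGrothendieck X) : IsEpiSink S := by
  intro Z a b e
  refine h.hom_ext_of_sieve hS (fun V k hk ↦ ?_)
  obtain ⟨Y, g, f, hf, rfl⟩ := hk
  rw [Category.assoc, e f hf, Category.assoc]

/-- In the presence of gluing, epimorphic clopen arrows are isomorphisms. -/
theorem HasGluing.isIso_of_epi (h : IsDGPresite τ) (hg : HasGluing.{w} τ) {V X : C} (v : V ⟶ X)
    (hv : clopen τ v) [Epi v] : IsIso v := by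
  have hm := h.mono v hv
  -- Two copies of X are glued along V. The two inclusions agree on V, hence are equal because v is
  -- epi; so the two copies are glued along all of X, which means that the identity of X factors
  -- through v.
  obtain ⟨Q, u, hu, hQ⟩ := hg (fun _ : ULift.{w} Bool ↦ X)
    (fun T i j x y ↦ x = y ∧ (i = j ∨ ∃ t : T ⟶ V, t ≫ v = x)) <| by
      refine ⟨fun T i x y ↦ by simp, ?_, ?_, fun i j ↦ ?_⟩
      · rintro T i j x _ ⟨rfl, h⟩
        exact ⟨rfl, h.imp_left Eq.symm⟩
      · rintro T i j k x _ _ ⟨rfl, h1⟩ ⟨rfl, h2⟩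
        refine ⟨rfl, ?_⟩
        rcases h1 with rfl | h1
        · exact h2
        · exact Or.inr h1
      · by_cases hij : i = j
        · refine ⟨X, 𝟙 X, 𝟙 X, clopen_of_isIso h.isPresite _, clopen_of_isIso h.isPresite _,
            fun T x y ↦ ?_⟩
          simp [hij, eq_comm]
        · refine ⟨V, v, v, hv, hv, fun T x y ↦ ?_⟩
          simp only [hij, false_or]
          exact ⟨fun ⟨e, t, ht⟩ ↦ ⟨t, ht, ht.trans e⟩, fun ⟨t, e1, e2⟩ ↦ ⟨e1.symm.trans e2, t, e1⟩⟩
  have e : u ⟨true⟩ = u ⟨false⟩ := by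
    rw [← cancel_epi v]
    exact (hQ _ _ v v).1 ⟨rfl, Or.inr ⟨𝟙 V, Category.id_comp v⟩⟩
  have h2 := (hQ ⟨true⟩ ⟨false⟩ (𝟙 X) (𝟙 X)).2 (by rw [e])
  obtain ⟨l, hl⟩ : ∃ l : X ⟶ V, l ≫ v = 𝟙 X := by simpa using h2.2
  exact ⟨l, by rw [← cancel_mono v, Category.assoc, hl]; simp, hl⟩

/-- In the presence of gluing, jointly epimorphic sinks of étale arrows generate covering
sieves. -/
theorem HasGluing.generate_mem_of_isEpiSink (h : IsDGPresite τ) (hg : HasGluing.{w} τ) {X : C}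
    {S : Presieve X} (hS : ∀ ⦃Y : C⦄ (f : Y ⟶ X), S f → etale τ f) (hS' : IsEpiSink S) :
    Sieve.generate S ∈ τ.toGrothendieck X := by
  obtain ⟨κ, Y, f, rfl⟩ := S.exists_eq_ofArrows
  choose ι U u hu huf using fun k : κ ↦ (hS (f k) (Presieve.ofArrows.mk k)).exists_cover
  -- The union of all clopen pieces of the sink is a clopen arrow, epi because the sink is, hence
  -- invertible; the pieces therefore cover X.
  obtain ⟨T, t, r, ht, -, hr, hrt⟩ := h.exists_union (fun s : Σ k, ι k ↦ u s.1 s.2 ≫ f s.1)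
    (fun s ↦ huf _ _)
  have : Epi t := ⟨fun {Z} a b e ↦ by
    refine hS' a b ?_
    rintro Y g ⟨k⟩
    refine h.subcanonical.hom_ext_of_cover (h.isPresite.ofArrows_mem_iff.1 (hu k)).2 (fun i ↦ ?_)
    have := hrt ⟨k, i⟩
    dsimp only at this
    rw [← Category.assoc, ← Category.assoc, ← this, Category.assoc, Category.assoc, e]⟩
  have := hg.isIso_of_epi h t ht
  refine τ.toGrothendieck.transitive (τ.toGrothendieck.pullback_stable (inv t) hr) _ ?_
  intro V k hk
  obtain ⟨s, a, e⟩ := (Sieve.mem_ofArrows_iff _ _ _).1 hk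
  have : k = (a ≫ u s.1 s.2) ≫ f s.1 := by
    rw [Category.assoc, ← hrt, ← Category.assoc, ← e]; simp
  refine τ.toGrothendieck.covering_of_eq_top (Sieve.pullback_eq_top_of_mem _ ?_)
  exact (Sieve.mem_ofArrows_iff _ _ _).2 ⟨_, _, this⟩

theorem ofArrows_mem_of_generate_singleton {X Y : C} {f : X ⟶ Y}
    (hf : Sieve.generate (Presieve.singleton f) ∈ τ.toGrothendieck Y) :
    Sieve.ofArrows (fun _ : PUnit.{1} ↦ X) (fun _ ↦ f) ∈ τ.toGrothendieck Y := by
  unfold Sieve.ofArrows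
  rwa [Presieve.ofArrows_pUnit]

/-- Étale epimorphisms become, locally on the source, coverings. -/
theorem etale.exists_small_cover_of_epi (h : IsDGUPresite.{w} τ) {X Y : C} {f : X ⟶ Y}
    (hf : etale τ f) (hf' : Sieve.generate (Presieve.singleton f) ∈ τ.toGrothendieck Y) :
    ∃ (ι : Type w) (U : ι → C) (u : ∀ i, U i ⟶ X), Presieve.ofArrows U u ∈ τ X ∧
      Presieve.ofArrows U (fun i ↦ u i ≫ f) ∈ τ Y := by
  obtain ⟨ι, U, u, hu, huf⟩ := hf.exists_small_cover h
  have hτ := h.isPresite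
  refine ⟨ι, U, u, hu, hτ.ofArrows_mem_iff.2 ⟨huf, ?_⟩⟩
  refine ofArrows_mem_of_local hf' (fun V k hk ↦ ?_)
  obtain ⟨Y, g, f, hf, rfl⟩ := hk
  cases hf
  obtain ⟨R, hR, hR'⟩ := IsPresite.exists_sieve (hτ.ofArrows_mem_iff.1 hu).2 g
  refine ⟨R, hR, fun V' l hl ↦ ?_⟩
  obtain ⟨i, y, hy⟩ := hR' l hl
  exact ⟨i, y, by rw [reassoc_of% hy]⟩

theorem epi_iff_isEpiSink {X Y : C} {f : X ⟶ Y} : Epi f ↔ IsEpiSink (Presieve.singleton f) :=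
  ⟨fun _ _ a b e ↦ by rw [← cancel_epi f]; exact e f ⟨⟩, fun h ↦ ⟨fun a b e ↦ h a b (by
    rintro _ _ ⟨⟩; exact e)⟩⟩

theorem HasGluing.generate_mem_of_epi (h : IsDGPresite τ) (hg : HasGluing.{w} τ) {X Y : C}
    {f : X ⟶ Y} (hf : etale τ f) (hf' : Epi f) :
    Sieve.generate (Presieve.singleton f) ∈ τ.toGrothendieck Y :=
  hg.generate_mem_of_isEpiSink h (by rintro _ _ ⟨⟩; exact hf) (epi_iff_isEpiSink.1 hf')

/-- Arrows which cover their target are effective epimorphisms. -/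
theorem effectiveEpi_of_generate_mem (h : IsSubcanonical τ) {X Y : C} {f : X ⟶ Y}
    (hf : Sieve.generate (Presieve.singleton f) ∈ τ.toGrothendieck Y) : EffectiveEpi f := by
  have hf' := ofArrows_mem_of_generate_singleton hf
  have key {W : C} (e : X ⟶ W)
      (he : ∀ {Z : C} (g₁ g₂ : Z ⟶ X), g₁ ≫ f = g₂ ≫ f → g₁ ≫ e = g₂ ≫ e) :
      ∃ d : Y ⟶ W, f ≫ d = e := by
    obtain ⟨d, hd⟩ := h.exists_desc hf' (fun _ ↦ e) (fun _ _ Q a b hab ↦ he a b hab)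
    exact ⟨d, hd ⟨⟩⟩
  exact ⟨⟨{
    desc := fun e he ↦ (key e he).choose
    fac := fun e he ↦ (key e he).choose_spec
    uniq := fun e he m hm ↦ h.hom_ext_of_cover hf' (fun _ ↦
      hm.trans (key e he).choose_spec.symm) }⟩⟩

/-- Quotients by étale equivalence relations which are trivial on the members of a covering. -/
theorem HasGluing.exists_quotient (h : IsDGPresite τ) (hg : HasGluing.{w} τ) {R X : C}
    {r s : R ⟶ X} (hrs : IsEquivRel r s) (hr : etale τ r) {ι : Type w} {U : ι → C}
    {u : ∀ i, U i ⟶ X} (hu : Presieve.ofArrows U u ∈ τ X)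
    (triv : ∀ ⦃T : C⦄ (i : ι) (x y : T ⟶ U i) (t : T ⟶ R), t ≫ r = x ≫ u i → t ≫ s = y ≫ u i →
      x = y) :
    ∃ (Q : C) (q : X ⟶ Q), r ≫ q = s ≫ q ∧ etale τ q ∧ IsPullback r s q q ∧
      Sieve.generate (Presieve.singleton q) ∈ τ.toGrothendieck Q := by
  have hτ := h.isPresite
  obtain ⟨hu1, hu2⟩ := hτ.ofArrows_mem_iff.1 hu
  have hm (i : ι) : Mono (u i) := h.mono _ (hu1 i)
  -- The U i are glued along R itself. By triviality, no two distinct elements of one U i become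
  -- identified.
  obtain ⟨Q, c, hc, hQ⟩ := hg U
    (fun T i j x y ↦ ∃ t : T ⟶ R, t ≫ r = x ≫ u i ∧ t ≫ s = y ≫ u j) <| by
      refine .of_left h ?_ ?_ ?_ ?_
      · intro T i x y
        refine ⟨fun ⟨t, h1, h2⟩ ↦ triv i x y t h1 h2, ?_⟩
        rintro rfl
        exact (hrs.equivalence T).refl _
      · exact fun T i j x y h ↦ (hrs.equivalence T).symm h
      · exact fun T i j k x y z h1 h2 ↦ (hrs.equivalence T).trans h1 h2
      · intro i j
        have := clopen.hasPullback hτ (hu1 i) r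
        have hA := IsPullback.of_hasPullback (u i) r
        -- The part of R with r in U i and s in U j is formed in two steps. Its projection to U i is
        -- étale, so it is clopen once it is shown to be monic.
        have := clopen.hasPullback hτ (hu1 j) (pullback.snd (u i) r ≫ s)
        have hB := IsPullback.of_hasPullback (u j) (pullback.snd (u i) r ≫ s)
        have hAe : etale τ (pullback.fst (u i) r) := etale.of_isPullback hτ hA.flip hr
        have hBe := etale_of_clopen hτ (clopen.of_isPullback hτ hB (hu1 j))
        have hmono : Mono (pullback.snd (u j) (pullback.snd (u i) r ≫ s) ≫
            pullback.fst (u i) r) := ⟨fun {T} x y e ↦ by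
          have e1 : (x ≫ pullback.snd _ _ ≫ pullback.snd (u i) r) ≫ r =
              (y ≫ pullback.snd _ _ ≫ pullback.snd (u i) r) ≫ r := by
            simp only [Category.assoc, ← pullback.condition]
            rw [reassoc_of% e]
          have hx : (x ≫ pullback.snd _ _ ≫ pullback.snd (u i) r) ≫ s =
              (x ≫ pullback.fst _ _) ≫ u j := by
            simp only [Category.assoc, pullback.condition]
          have hy : (y ≫ pullback.snd _ _ ≫ pullback.snd (u i) r) ≫ s =
              (y ≫ pullback.fst _ _) ≫ u j := by
            simp only [Category.assoc, pullback.condition]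
          -- Two pairs with the same first entry have related second entries, by symmetry and
          -- transitivity; both lie in U j, where the relation is trivial.
          obtain ⟨t, ht1, ht2⟩ := (hrs.equivalence T).trans ((hrs.equivalence T).symm
            ⟨_, rfl, hx⟩) ⟨_, e1.symm, hy⟩
          have e2 := triv j _ _ t ht1 ht2
          refine hB.hom_ext e2 (hA.hom_ext (by simpa using e) (hrs.jointly_mono _ _ ?_ ?_))
          · simpa using e1
          · simp only [Category.assoc] at hx hy ⊢
            rw [hx, hy, reassoc_of% e2]⟩
        refine ⟨_, pullback.snd _ _ ≫ pullback.fst _ _, pullback.fst _ _,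
          h.clopen_of_etale (hBe.comp hτ hAe), fun T x y ↦ ⟨?_, ?_⟩⟩
        · rintro ⟨t, h1, h2⟩
          have e1 : y ≫ u j = hA.lift x t h1.symm ≫ pullback.snd (u i) r ≫ s := by
            rw [hA.lift_snd_assoc, h2]
          refine ⟨hB.lift y (hA.lift x t h1.symm) e1, ?_, ?_⟩
          · rw [hB.lift_snd_assoc, hA.lift_fst]
          · rw [hB.lift_fst]
        · rintro ⟨t, rfl, rfl⟩
          exact ⟨t ≫ pullback.snd _ _ ≫ pullback.snd _ _, by simp [pullback.condition],
            by simp [pullback.condition]⟩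
  obtain ⟨hc1, hc2⟩ := hτ.ofArrows_mem_iff.1 hc
  -- By reflexivity of R the glued charts are compatible on the overlaps of the U i in X, and so
  -- define q on X.
  obtain ⟨q, hq⟩ := h.subcanonical.exists_desc hu2 c (fun i j T x y e ↦ (hQ i j x y).1 (by
    rw [e]; exact (hrs.equivalence T).refl _))
  have hloc {T : C} (x y : T ⟶ X) : ∃ P ∈ τ.toGrothendieck T, ∀ ⦃V : C⦄ (k : V ⟶ T), P k →
      ((k ≫ x) ≫ q = (k ≫ y) ≫ q ↔ ∃ t, t ≫ r = k ≫ x ∧ t ≫ s = k ≫ y) := by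
    obtain ⟨P, hP, hP'⟩ := IsPresite.exists_sieve hu2 x
    obtain ⟨P₂, hP₂, hP₂'⟩ := IsPresite.exists_sieve hu2 y
    refine ⟨P ⊓ P₂, τ.toGrothendieck.intersection_covering hP hP₂, fun V k hk ↦ ?_⟩
    obtain ⟨i, x', hx⟩ := hP' k hk.1
    obtain ⟨j, y', hy⟩ := hP₂' k hk.2
    rw [← hx, ← hy, Category.assoc, Category.assoc, hq, hq]
    exact (hQ i j x' y').symm
  have hw : r ≫ q = s ≫ q := by
    obtain ⟨P, hP, hP'⟩ := hloc r s
    refine h.subcanonical.hom_ext_of_sieve hP (fun V k hk ↦ ?_)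
    rw [← Category.assoc, ← Category.assoc]
    exact (hP' k hk).2 ⟨k, rfl, rfl⟩
  have hex (T : C) (x y : T ⟶ X) (e : x ≫ q = y ≫ q) : ∃ t : T ⟶ R, t ≫ r = x ∧ t ≫ s = y := by
    obtain ⟨P, hP, hP'⟩ := hloc x y
    obtain ⟨t, ht⟩ := h.subcanonical.exists_of_local' hP
      (fun V k t ↦ t ≫ r = k ≫ x ∧ t ≫ s = k ≫ y)
      (fun V V' k t l ⟨e1, e2⟩ ↦ ⟨by rw [Category.assoc, e1, Category.assoc],
        by rw [Category.assoc, e2, Category.assoc]⟩)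
      (fun V k t t' ⟨e1, e2⟩ ⟨e1', e2'⟩ ↦ hrs.jointly_mono _ _ (e1.trans e1'.symm)
        (e2.trans e2'.symm))
      (fun V k hk ↦ (hP' k hk).1 (by rw [Category.assoc, e, Category.assoc]))
    simp only [Category.assoc] at ht
    exact ⟨t, h.subcanonical.hom_ext_of_sieve hP (fun V k hk ↦ (ht k hk).1),
      h.subcanonical.hom_ext_of_sieve hP (fun V k hk ↦ (ht k hk).2)⟩
  choose l hl1 hl2 using hex
  refine ⟨Q, q, hw, etale_of_cover hu (fun i ↦ by rw [hq]; exact hc1 i),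
    ⟨⟨hw⟩, ⟨PullbackCone.IsLimit.mk _ (fun s ↦ l _ s.fst s.snd s.condition)
    (fun s ↦ hl1 _ _ _ _) (fun s ↦ hl2 _ _ _ _) (fun s m h1 h2 ↦ hrs.jointly_mono _ _
      (h1.trans (hl1 _ _ _ _).symm) (h2.trans (hl2 _ _ _ _).symm))⟩⟩, ?_⟩
  refine τ.toGrothendieck.superset_covering (fun V k hk ↦ ?_) hc2
  obtain ⟨i, x, rfl⟩ := (Sieve.mem_ofArrows_iff U c _).1 hk
  exact ⟨X, x ≫ u i, q, ⟨⟩, by rw [Category.assoc, hq]⟩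

/-- The quotient by an effective equivalence relation whose quotient map covers is a universal
colimit. -/
theorem isUniversalColimit_cofork (h : IsSubcanonical τ) {R X Q : C} {r s : R ⟶ X} {q : X ⟶ Q}
    (hw : r ≫ q = s ≫ q) (hq : IsPullback r s q q)
    (hq' : Sieve.generate (Presieve.singleton q) ∈ τ.toGrothendieck Q) :
    IsUniversalColimit (Cofork.ofπ q hw) := by
  intro F' c' α f hα _ hc'
  have hcov : Sieve.ofArrows (fun _ : PUnit.{1} ↦ F'.obj .one) (fun _ ↦ c'.ι.app .one) ∈
      τ.toGrothendieck c'.pt := by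
    refine τ.toGrothendieck.superset_covering (fun V k hk ↦ ?_)
      (τ.toGrothendieck.pullback_stable f hq')
    obtain ⟨Y, g, _, ⟨⟩, e⟩ := hk
    refine (Sieve.mem_ofArrows_iff _ _ _).2 ⟨⟨⟩, (hc' .one).lift k g ?_, ?_⟩
    · simpa using e.symm
    · simp
  -- Elements x, y of F' one with equal images in c'.pt have R-related images in X. As F' zero is
  -- the base change of R, the pair (x, y) comes from an element of F' zero, and every cocone
  -- identifies the two.
  have key (Z : Cocone F') {T : C} (x y : T ⟶ F'.obj .one)
      (e : x ≫ c'.ι.app .one = y ≫ c'.ι.app .one) : x ≫ Z.ι.app .one = y ≫ Z.ι.app .one := by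
    have hα1 : α.app .one ≫ q = c'.ι.app .one ≫ f := by
      simpa using NatTrans.congr_app hα WalkingParallelPair.one
    let t := hq.lift (x ≫ α.app .one) (y ≫ α.app .one) (by
      rw [Category.assoc, Category.assoc, hα1, reassoc_of% e])
    have ht : (x ≫ c'.ι.app .one) ≫ f = t ≫ (Cofork.ofπ q hw).ι.app .zero := by
      have : (Cofork.ofπ q hw).ι.app .zero = r ≫ q := by simp
      rw [this, hq.lift_fst_assoc, Category.assoc, Category.assoc, hα1]
    let l := (hc' .zero).lift _ t ht
    have hl1 : l ≫ c'.ι.app .zero = x ≫ c'.ι.app .one := (hc' .zero).lift_fst _ _ _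
    have hl2 : l ≫ α.app .zero = t := (hc' .zero).lift_snd _ _ _
    have e1 : l ≫ F'.map .left = x := by
      refine (hc' .one).hom_ext ?_ ?_
      · rw [Category.assoc, c'.w, hl1]
      · have := α.naturality WalkingParallelPairHom.left
        dsimp at this
        rw [Category.assoc, this, reassoc_of% hl2]
        exact hq.lift_fst _ _ _
    have e2 : l ≫ F'.map .right = y := by
      refine (hc' .one).hom_ext ?_ ?_
      · rw [Category.assoc, c'.w, hl1, e]
      · have := α.naturality WalkingParallelPairHom.right
        dsimp at this
        rw [Category.assoc, this, reassoc_of% hl2]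
        exact hq.lift_snd _ _ _
    rw [← e1, ← e2, Category.assoc, Category.assoc, Z.w, Z.w]
  have hd (Z : Cocone F') : ∃ d : c'.pt ⟶ Z.pt, c'.ι.app .one ≫ d = Z.ι.app .one := by
    obtain ⟨d, hd⟩ := h.exists_desc hcov (fun _ ↦ Z.ι.app .one)
      (fun _ _ T x y e ↦ key Z x y e)
    exact ⟨d, hd ⟨⟩⟩
  choose d hd using hd
  refine ⟨⟨d, fun Z j ↦ ?_, fun Z m hm ↦ ?_⟩⟩
  · cases j
    · rw [← c'.w .left, Category.assoc, hd, Z.w]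
    · exact hd Z
  · exact h.hom_ext_of_cover hcov (fun _ ↦ (hm .one).trans (hd Z).symm)

end Descent

/-! ### Disjoint universal coproducts -/

section Coproducts

variable {C : Type u₁} [Category.{v₁} C] {τ : Precoverage C}

/-- An object covered by the empty sieve is initial, because a sheaf has exactly one section over
it. This is the uniqueness half. -/
theorem IsSubcanonical.hom_ext_of_bot (h : IsSubcanonical τ) {T Z : C}
    (hT : (⊥ : Sieve T) ∈ τ.toGrothendieck T) (f g : T ⟶ Z) : f = g :=
  h.hom_ext_of_sieve hT (fun _ _ hk ↦ hk.elim)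

theorem IsSubcanonical.exists_hom_of_bot (h : IsSubcanonical τ) {T : C}
    (hT : (⊥ : Sieve T) ∈ τ.toGrothendieck T) (Z : C) : Nonempty (T ⟶ Z) := by
  obtain ⟨g, -⟩ := h.exists_of_local (Z := Z) hT (fun _ _ _ ↦ False)
    (fun _ _ _ _ _ h ↦ h) (fun _ _ _ _ h ↦ h.elim) (fun _ _ hk ↦ hk.elim)
  exact ⟨g⟩

theorem bot_mem_of_hom {T Z : C} (hZ : (⊥ : Sieve Z) ∈ τ.toGrothendieck Z) (f : T ⟶ Z) :
    (⊥ : Sieve T) ∈ τ.toGrothendieck T :=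
  τ.toGrothendieck.superset_covering (fun _ _ hk ↦ hk) (τ.toGrothendieck.pullback_stable f hZ)

/-- The empty subobject is the union of the empty family. -/
theorem IsDGPresite.exists_empty (h : IsDGPresite τ) (X : C) :
    ∃ (V : C) (v : V ⟶ X), clopen τ v ∧ (⊥ : Sieve V) ∈ τ.toGrothendieck V := by
  obtain ⟨V, v, r, hv, -, hr, -⟩ := h.exists_union (ι := PEmpty.{1}) (U := fun _ ↦ X)
    (fun i ↦ i.elim) (fun i ↦ i.elim)
  refine ⟨V, v, hv, τ.toGrothendieck.superset_covering (fun W k hk ↦ ?_) hr⟩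
  obtain ⟨i, -⟩ := (Sieve.mem_ofArrows_iff _ _ _).1 hk
  exact i.elim

/-- A covering family whose members are monic and have empty intersections. -/
structure IsDisjointCover (τ : Precoverage C) {ι : Type*} {U : ι → C} {X : C}
    (u : ∀ i, U i ⟶ X) : Prop where
  cover : Sieve.ofArrows U u ∈ τ.toGrothendieck X
  mono : ∀ i, Mono (u i)
  disjoint : ∀ ⦃T : C⦄ (i j : ι) (x : T ⟶ U i) (y : T ⟶ U j), x ≫ u i = y ≫ u j → i ≠ j →
    (⊥ : Sieve T) ∈ τ.toGrothendieck T

/-- Distinct summands are glued along the empty subobject. The relation has to identify all elements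
over an object covered by the empty sieve, since any two arrows out of it agree. -/
theorem HasGluing.exists_coproduct (h : IsDGPresite τ) (hg : HasGluing.{w} τ) {ι : Type w}
    (U : ι → C) : ∃ (X : C) (u : ∀ i, U i ⟶ X), (∀ i, clopen τ (u i)) ∧ IsDisjointCover τ u := by
  classical
  obtain ⟨X, u, hu, hX⟩ := hg U
    (fun T i j x y ↦ (∃ e : i = j, x ≫ eqToHom (congrArg U e) = y) ∨
      (⊥ : Sieve T) ∈ τ.toGrothendieck T) <| by
      refine .of_left h ?_ ?_ ?_ ?_
      · intro T i x y
        simp only [eqToHom_refl, Category.comp_id, exists_const, or_iff_left_iff_imp]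
        exact fun hT ↦ h.subcanonical.hom_ext_of_bot hT _ _
      · rintro T i j x _ (⟨rfl, rfl⟩ | hT)
        · exact Or.inl ⟨rfl, by simp⟩
        · exact Or.inr hT
      · rintro T i j k x _ z (⟨rfl, rfl⟩ | hT) (⟨rfl, rfl⟩ | hT')
        · exact Or.inl ⟨rfl, by simp⟩
        · exact Or.inr hT'
        · exact Or.inr hT
        · exact Or.inr hT
      · intro i j
        by_cases hij : i = j
        · subst hij
          refine ⟨U i, 𝟙 _, 𝟙 _, clopen_of_isIso h.isPresite _, fun T x y ↦ ?_⟩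
          simp only [eqToHom_refl, Category.comp_id, exists_const]
          constructor
          · rintro (rfl | hT)
            · exact ⟨x, rfl, rfl⟩
            · exact ⟨x, rfl, h.subcanonical.hom_ext_of_bot hT _ _⟩
          · rintro ⟨t, rfl, rfl⟩
            exact Or.inl rfl
        · obtain ⟨V, v, hv, hV⟩ := h.exists_empty (U i)
          obtain ⟨v'⟩ := h.subcanonical.exists_hom_of_bot hV (U j)
          refine ⟨V, v, v', hv, fun T x y ↦ ?_⟩
          simp only [hij, IsEmpty.exists_iff, false_or]
          constructor
          · intro hT
            obtain ⟨t⟩ := h.subcanonical.exists_hom_of_bot hT V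
            exact ⟨t, h.subcanonical.hom_ext_of_bot hT _ _,
              h.subcanonical.hom_ext_of_bot hT _ _⟩
          · rintro ⟨t, -⟩
            exact bot_mem_of_hom hV t
  obtain ⟨h1, h2⟩ := h.isPresite.ofArrows_mem_iff.1 hu
  refine ⟨X, u, h1, h2, fun i ↦ h.mono _ (h1 i), fun T i j x y e hij ↦ ?_⟩
  obtain ⟨rfl, -⟩ | hT := (hX i j x y).2 e
  · exact (hij rfl).elim
  · exact hT

/-- A base change of the family still covers, so arrows out of its target are compatible families.
For distinct indices compatibility is void because the test object is covered by the empty sieve;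
for equal indices it holds by monicity. -/
theorem IsDisjointCover.isUniversalColimit (h : IsSubcanonical τ) {ι : Type w} {U : ι → C} {X : C}
    {u : ∀ i, U i ⟶ X} (hu : IsDisjointCover τ u) : IsUniversalColimit (Cofan.mk X u) := by
  intro F' c' α f hα _ hc'
  have hα1 (i : ι) : α.app ⟨i⟩ ≫ u i = c'.ι.app ⟨i⟩ ≫ f := by
    simpa using NatTrans.congr_app hα ⟨i⟩
  have hcov : Sieve.ofArrows (fun i ↦ F'.obj ⟨i⟩) (fun i ↦ c'.ι.app ⟨i⟩) ∈
      τ.toGrothendieck c'.pt := by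
    refine τ.toGrothendieck.superset_covering (fun V k hk ↦ ?_)
      (τ.toGrothendieck.pullback_stable f hu.cover)
    obtain ⟨i, g, e⟩ := (Sieve.mem_ofArrows_iff _ _ _).1 hk
    exact (Sieve.mem_ofArrows_iff _ _ _).2 ⟨i, (hc' ⟨i⟩).lift k g e, by simp⟩
  have hd (Z : Cocone F') : ∃ d : c'.pt ⟶ Z.pt, ∀ i, c'.ι.app ⟨i⟩ ≫ d = Z.ι.app ⟨i⟩ := by
    refine h.exists_desc hcov (fun i ↦ Z.ι.app ⟨i⟩) (fun i j T x y e ↦ ?_)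
    have e' : (x ≫ α.app ⟨i⟩) ≫ u i = (y ≫ α.app ⟨j⟩) ≫ u j := by
      rw [Category.assoc, Category.assoc, hα1, hα1, reassoc_of% e]
    by_cases hij : i = j
    · subst hij
      have hm := hu.mono i
      have : x = y := (hc' ⟨i⟩).hom_ext e (by rwa [cancel_mono] at e')
      rw [this]
    · exact h.hom_ext_of_bot (hu.disjoint i j _ _ e' hij) _ _
  choose d hd using hd
  exact ⟨⟨d, fun Z ⟨i⟩ ↦ hd Z i,
    fun Z m hm ↦ h.hom_ext_of_cover hcov (fun i ↦ (hm ⟨i⟩).trans (hd Z i).symm)⟩⟩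

theorem IsSubcanonical.isInitial_of_bot (h : IsSubcanonical τ) {T : C}
    (hT : (⊥ : Sieve T) ∈ τ.toGrothendieck T) : Nonempty (IsInitial T) :=
  ⟨IsInitial.ofUniqueHom (fun Z ↦ (h.exists_hom_of_bot hT Z).some)
    (fun _ _ ↦ h.hom_ext_of_bot hT _ _)⟩

theorem IsDisjointCover.coproductDisjoint (h : IsDGPresite τ) {ι : Type w} {U : ι → C} {X : C}
    {u : ∀ i, U i ⟶ X} (hu : IsDisjointCover τ u) (hu' : ∀ i, clopen τ (u i)) :
    CoproductDisjoint U := by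
  have (i : ι) : Mono ((Cofan.mk X u).inj i) := hu.mono i
  have hp (i j : ι) : HasPullback (u i) (u j) := clopen.hasPullback h.isPresite (hu' i) _
  exact CoproductDisjoint.of_cofan (hu.isUniversalColimit h.subcanonical).isColimit
    (fun {i j} _ ↦ PullbackCone.mk (W := pullback (u i) (u j)) (pullback.fst _ _)
      (pullback.snd _ _) pullback.condition)
    (fun {i j} _ ↦ pullbackIsPullback (u i) (u j))
    (fun {i j} hij ↦ (h.subcanonical.isInitial_of_bot
      (hu.disjoint i j _ _ (pullback.condition (f := u i) (g := u j)) hij)).some)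

end Coproducts

/-! ### The exactness axioms of a glutos for étale arrows -/

section EtaleGlutos

variable {C : Type u₁} [Category.{v₁} C] {τ : Precoverage C}

theorem etale.isClopos (h : IsDGUPresite.{w} τ) (hg : HasGluing.{w} τ) : IsClopos (etale τ) := by
  have hτ := h.isPresite
  have h1 : (etale τ).IsMultiplicative :=
    { id_mem := fun X ↦ etale_of_clopen hτ (clopen_of_isIso hτ _)
      comp_mem := fun f g hf hg ↦ hf.comp hτ hg }
  have h2 : (etale τ).IsStableUnderBaseChange :=
    ⟨fun hP hf ↦ etale.of_isPullback hτ hP hf⟩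
  have h3 : (etale τ).HasPullbacks := ⟨fun f hf ↦ hf.hasPullback h hg _⟩
  exact { h1, h2, h3 with }

/-- Any coproduct is isomorphic to the glued one, whose injections are clopen and cover; being étale
is local on the source. -/
theorem etale.desc_mem (h : IsDGUPresite.{w} τ) (hg : HasGluing.{w} τ) {ι : Type w} {U : ι → C}
    {X : C} (u : ∀ i, U i ⟶ X) (hu : ∀ i, etale τ (u i)) (c : Cofan U) (hc : IsColimit c) :
    etale τ (Cofan.IsColimit.desc hc u) := by
  have hτ := h.isPresite
  obtain ⟨Y, v, hv, hY⟩ := hg.exists_coproduct h.toIsDGPresite U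
  have hY' := (hY.isUniversalColimit h.subcanonical).isColimit
  have e : c.pt ≅ Y := hc.coconePointUniqueUpToIso hY'
  have e2 : etale τ (Cofan.IsColimit.desc hY' u) := by
    refine etale_of_source hτ hY.cover (fun i ↦ etale_of_clopen hτ (hv i)) (fun i ↦ ?_)
    have : v i ≫ Cofan.IsColimit.desc hY' u = u i := Cofan.IsColimit.fac hY' u i
    rw [this]
    exact hu i
  have : Cofan.IsColimit.desc hc u = (hc.coconePointUniqueUpToIso hY').hom ≫
      Cofan.IsColimit.desc hY' u := by
    refine Cofan.IsColimit.hom_ext hc _ _ (fun i ↦ ?_)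
    have e1 : c.inj i ≫ (hc.coconePointUniqueUpToIso hY').hom = v i :=
      hc.comp_coconePointUniqueUpToIso_hom hY' ⟨i⟩
    have e2 : v i ≫ Cofan.IsColimit.desc hY' u = u i := Cofan.IsColimit.fac hY' u i
    rw [Cofan.IsColimit.fac, ← Category.assoc, e1, e2]
  rw [this]
  exact (etale_of_clopen hτ (clopen_of_isIso hτ _)).comp hτ e2

/-- An étale epimorphism covers its target, and being étale is local on the source. -/
theorem etale.of_epi_comp (h : IsDGUPresite.{w} τ) (hg : HasGluing.{w} τ) {X Y Z : C}
    (p : X ⟶ Y) (f : Y ⟶ Z) (hpf : etale τ (p ≫ f)) (hp : etale τ p) (hp' : Epi p) :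
    etale τ f :=
  etale_of_source h.isPresite (ofArrows_mem_of_generate_singleton
    (hg.generate_mem_of_epi h.toIsDGPresite hp hp')) (fun _ ↦ hp) (fun _ ↦ hpf)

/-- An étale arrow coequalizing the induced relation is monic locally on its source. Hence the
relation becomes trivial on a sufficiently fine covering of X, and `HasGluing.exists_quotient`
applies. -/
theorem etale.exists_coequalizer (h : IsDGUPresite.{w} τ) (hg : HasGluing.{w} τ) {R X : C}
    (r s : R ⟶ X) (hrs : IsEquivRel r s) (hr : etale τ r)
    (hl : IsLocallyCoequalizable (etale τ) r s) :
    ∃ (Q : C) (q : X ⟶ Q) (h : r ≫ q = s ≫ q), etale τ q ∧ IsPullback r s q q ∧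
      IsUniversalColimit (Cofork.ofπ q h) := by
  have hτ := h.isPresite
  obtain ⟨S, hS, hS'⟩ := hl
  have hS2 := hg.generate_mem_of_isEpiSink h.toIsDGPresite (fun Y f hf ↦ (hS' f hf).1) hS
  obtain ⟨κ, Y, f, rfl⟩ := S.exists_eq_ofArrows
  have h1 (k : κ) := (hS' (f k) (Presieve.ofArrows.mk k)).1
  choose Q q hq hq' using fun k ↦ (hS' (f k) (Presieve.ofArrows.mk k)).2
  choose ι A a ha haf using fun k ↦ (h1 k).exists_cover
  choose ι' B b hb hbq using fun k ↦ (hq k).exists_cover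
  have hca (k : κ) (i : ι k) : clopen τ (a k i) := (hτ.ofArrows_mem_iff.1 (ha k)).1 i
  have hcb (k : κ) (i : ι' k) : clopen τ (b k i) := (hτ.ofArrows_mem_iff.1 (hb k)).1 i
  have hpb (k : κ) (i : ι k) (j : ι' k) : HasPullback (a k i) (b k j) :=
    clopen.hasPullback hτ (hca k i) _
  have hP (k : κ) (i : ι k) (j : ι' k) := IsPullback.of_hasPullback (a k i) (b k j)
  -- On Y k a covering making f k clopen is intersected with one making q k clopen.
  have hcov : Presieve.ofArrows (fun t : Σ k, ι k × ι' k ↦ pullback (a t.1 t.2.1) (b t.1 t.2.2))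
      (fun t ↦ pullback.fst _ _ ≫ a t.1 t.2.1 ≫ f t.1) ∈ τ X := by
    refine hτ.ofArrows_mem_iff.2 ⟨fun t ↦ ?_, ?_⟩
    · exact clopen.comp hτ (clopen.of_isPullback hτ (hP _ _ _).flip (hcb _ _)) (haf _ _)
    · refine ofArrows_mem_of_local hS2 (fun V k hk ↦ ?_)
      obtain ⟨k, x, rfl⟩ := (Sieve.mem_ofArrows_iff _ _ _).1 hk
      obtain ⟨R, hR, hR'⟩ := IsPresite.exists_sieve (hτ.ofArrows_mem_iff.1 (ha k)).2 x
      obtain ⟨R₂, hR₂, hR₂'⟩ := IsPresite.exists_sieve (hτ.ofArrows_mem_iff.1 (hb k)).2 x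
      refine ⟨R ⊓ R₂, τ.toGrothendieck.intersection_covering hR hR₂, fun V' l hl ↦ ?_⟩
      obtain ⟨i, y, hy⟩ := hR' l hl.1
      obtain ⟨j, y', hy'⟩ := hR₂' l hl.2
      refine ⟨⟨k, i, j⟩, (hP k i j).lift y y' (by rw [hy, hy']), ?_⟩
      rw [IsPullback.lift_fst_assoc, reassoc_of% hy]
  obtain ⟨I, c, hc⟩ := h.exists_small_cover hcov
  obtain ⟨Z, z, hz, hz1, hz2, hz3⟩ := hg.exists_quotient h.toIsDGPresite hrs hr hc
    (fun T i x y t e1 e2 ↦ by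
      have hab : pullback.fst (a (c i).1 (c i).2.1) (b (c i).1 (c i).2.2) ≫ a (c i).1 (c i).2.1 =
        pullback.snd _ _ ≫ b (c i).1 (c i).2.2 := pullback.condition
      have e3 := hq' (c i).1 (x ≫ pullback.snd _ _ ≫ b (c i).1 (c i).2.2)
        (y ≫ pullback.snd _ _ ≫ b (c i).1 (c i).2.2) t
        (by rw [e1, reassoc_of% hab, Category.assoc, Category.assoc])
        (by rw [e2, reassoc_of% hab, Category.assoc, Category.assoc])
      have m1 := h.mono _ (hbq (c i).1 (c i).2.2)
      have m2 := h.mono _ (clopen.of_isPullback hτ (hP (c i).1 (c i).2.1 (c i).2.2)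
        (hca (c i).1 (c i).2.1))
      simp only [Category.assoc] at e3
      rw [← cancel_mono (pullback.snd (a (c i).1 (c i).2.1) (b (c i).1 (c i).2.2)),
        ← cancel_mono (b (c i).1 (c i).2.2 ≫ q (c i).1)]
      simpa only [Category.assoc] using e3)
  exact ⟨Z, z, hz, hz1, hz2, isUniversalColimit_cofork h.subcanonical hz hz2 hz3⟩

/-- Locally on X the étale epimorphism r gives a covering of R by clopen pieces that factor through
X. Over these, pullbacks of f are restrictions of V; they are glued. -/
theorem etale.hasPullback_of_epi (h : IsDGUPresite.{w} τ) (hg : HasGluing.{w} τ) {V X Y R S : C}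
    (a : V ⟶ X) (b : V ⟶ Y) (r : X ⟶ R) (g : R ⟶ S) (f : Y ⟶ S)
    (hab : IsPullback a b (r ≫ g) f) (hr : etale τ r) (hr' : Epi r) : HasPullback g f := by
  obtain ⟨ι, U, u, hu, hur⟩ := hr.exists_small_cover_of_epi h
    (hg.generate_mem_of_epi h.toIsDGPresite hr hr')
  have hp (i : ι) : HasPullback (u i) a :=
    clopen.hasPullback h.isPresite ((h.isPresite.ofArrows_mem_iff.1 hu).1 i) _
  have hP (i : ι) : IsPullback (pullback.fst (u i) a) (pullback.snd (u i) a ≫ b)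
      ((u i ≫ r) ≫ g) f := by
    have := ((IsPullback.of_hasPullback (u i) a).flip.paste_horiz hab.flip).flip
    rwa [Category.assoc]
  obtain ⟨V, a, b, c, hV, -⟩ := exists_isPullback_of_cover h.toIsDGPresite hg hur g f hP
  exact hV.hasPullback

/-- Coverings by monic étale arrows are the original coverings. -/
theorem monoCoverings_etale (h : IsDGPresite τ) (hg : HasGluing.{w} τ) :
    monoCoverings (epiCoverings (etale τ)) = τ := by
  ext X S
  rw [h.isPresite.mem_iff]
  constructor
  · rintro ⟨⟨h1, h2⟩, h3⟩
    refine ⟨fun Y f hf ↦ ?_, hg.generate_mem_of_isEpiSink h h1 h2⟩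
    have := h3 f hf
    exact h.clopen_of_etale (h1 f hf)
  · rintro ⟨h1, h2⟩
    exact ⟨⟨fun Y f hf ↦ etale_of_clopen h.isPresite (h1 f hf),
      isEpiSink_of_generate_mem h.subcanonical h2⟩, fun Y f hf ↦ h.mono _ (h1 f hf)⟩

theorem clopen_epiCoverings {O : MorphismProperty C} [O.ContainsIdentities] {X Y : C}
    {f : X ⟶ Y} : clopen (epiCoverings O) f ↔ O f := by
  constructor
  · rintro ⟨S, hS, hf⟩
    exact hS.1 _ hf
  · intro hf
    -- All arrows of O into Y form an epi sink, since the identity is among them.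
    refine ⟨fun Z g ↦ O g, ⟨fun _ _ h ↦ h, fun Z a b e ↦ ?_⟩, hf⟩
    simpa using e (𝟙 Y) (O.id_mem Y)

/-- For étale sinks, gluing makes "epi" equivalent to "generates a covering sieve", so the axioms
become those of a Grothendieck topology. -/
theorem epiCoverings_etale_isPresite (h : IsDGUPresite.{w} τ) (hg : HasGluing.{w} τ) :
    IsPresite (epiCoverings (etale τ)) := by
  have hτ := h.isPresite
  have hO := etale.isClopos h hg
  have key {X : C} (S : Presieve X) : S ∈ epiCoverings (etale τ) X ↔
      (∀ ⦃Y : C⦄ (f : Y ⟶ X), S f → etale τ f) ∧ Sieve.generate S ∈ τ.toGrothendieck X :=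
    and_congr_right fun h1 ↦ ⟨fun h2 ↦ hg.generate_mem_of_isEpiSink h.toIsDGPresite h1 h2,
      fun h2 ↦ isEpiSink_of_generate_mem h.subcanonical h2⟩
  refine { hasPullbacks_of_mem := ?_, mem_coverings_of_isPullback := ?_, comp_mem_coverings := ?_,
           mem_coverings_of_isIso := ?_, mem_of_refinement := ?_ }
  · intro X Y R f hR
    exact ⟨fun {Z g} hg' ↦ (hR.1 g hg').hasPullback h hg f⟩
  · intro ι S X f hR Y g P p q hP
    rw [key] at hR ⊢
    refine ⟨?_, ofArrows_mem_of_local (τ.toGrothendieck.pullback_stable g hR.2)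
      (fun V k hk ↦ ⟨⊤, τ.toGrothendieck.top_mem _, fun V' l _ ↦ ?_⟩)⟩
    · rintro _ _ ⟨i⟩
      exact etale.of_isPullback hτ (hP i).flip (hR.1 _ (Presieve.ofArrows.mk i))
    · obtain ⟨i, x, e⟩ := (Sieve.mem_ofArrows_iff _ _ _).1 hk
      exact ⟨i, l ≫ (hP i).lift k x e, by simp⟩
  · intro ι S X f hf κ Y g hg
    rw [key] at hf ⊢
    refine ⟨?_, ofArrows_mem_of_local hf.2 (fun V k hk ↦ ?_)⟩
    · rintro _ _ ⟨i⟩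
      exact ((hg _).1 _ (Presieve.ofArrows.mk _)).comp hτ (hf.1 _ (Presieve.ofArrows.mk _))
    · obtain ⟨i, x, rfl⟩ := (Sieve.mem_ofArrows_iff _ _ _).1 hk
      obtain ⟨R, hR, hR'⟩ := IsPresite.exists_sieve ((key _).1 (hg i)).2 x
      refine ⟨R, hR, fun V' l hl ↦ ?_⟩
      obtain ⟨j, y, hy⟩ := hR' l hl
      exact ⟨⟨i, j⟩, y, by rw [reassoc_of% hy]⟩
  · intro S T f _
    rw [key]
    refine ⟨?_, Precoverage.generate_mem_toGrothendieck (τ.mem_coverings_of_isIso f)⟩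
    rintro _ _ ⟨⟩
    exact etale_of_clopen hτ (clopen_of_isIso hτ f)
  · intro X S R hS hR hRS
    rw [key] at hR ⊢
    refine ⟨fun Y f hf ↦ clopen_epiCoverings.1 (hS f hf), ?_⟩
    refine τ.toGrothendieck.superset_covering ?_ hR.2
    rintro V _ ⟨Y, g, f, hf, rfl⟩
    obtain ⟨Z, s, g', hs, rfl⟩ := hRS f hf
    exact ⟨Z, g ≫ g', s, hs, by rw [Category.assoc]⟩

/-- The generators for τ still suffice: the source of an étale arrow is covered by clopens of X, and
these by generators. -/
theorem epiCoverings_etale_isUPresite (h : IsDGUPresite.{w} τ) (hg : HasGluing.{w} τ) :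
    IsUPresite.{w} (epiCoverings (etale τ)) := by
  have hO := etale.isClopos h hg
  refine ⟨epiCoverings_etale_isPresite h hg, h.isUPresite.isUCategory, fun X ↦ ?_⟩
  obtain ⟨G, hG, hGX⟩ := h.isUPresite.exists_generators X
  refine ⟨G, hG, fun U f hf ↦ ?_⟩
  obtain ⟨ι, V, v, hv, hvf⟩ := (clopen_epiCoverings.1 hf).exists_cover
  have hv' := h.isPresite.ofArrows_mem_iff.1 hv
  choose S hS hSG using fun i ↦ hGX _ (hvf i)
  refine ⟨fun Y g ↦ ∃ i k, S i k ∧ k ≫ v i = g, ⟨?_, ?_⟩, ?_⟩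
  · rintro Y _ ⟨i, k, hk, rfl⟩
    exact etale_of_clopen h.isPresite (clopen.comp h.isPresite ⟨_, hS i, hk⟩ (hv'.1 i))
  · intro Z a b e
    refine h.subcanonical.hom_ext_of_cover hv'.2 (fun i ↦ ?_)
    refine isEpiSink_of_generate_mem h.subcanonical
      (Precoverage.generate_mem_toGrothendieck (hS i)) _ _ (fun Y k hk ↦ ?_)
    rw [← Category.assoc, ← Category.assoc]
    exact e _ ⟨i, k, hk, rfl⟩
  · rintro Y _ ⟨i, k, hk, rfl⟩
    exact hSG i k hk

end EtaleGlutos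

/-! ### Sheaves on the clopen subobjects of an object -/

section Basis

variable {C : Type u₁} [Category.{v₁} C]

/-- A small set of representatives for the clopen subobjects of `X`. -/
structure ClopenBasis (τ : Precoverage C) (X : C) where
  /-- The index set. -/
  I : Type w
  /-- The clopen subobjects. -/
  U : I → C
  /-- Their inclusions. -/
  u : ∀ i, U i ⟶ X
  clopen_u : ∀ i, clopen τ (u i)
  exists_iso : ∀ ⦃V : C⦄ (v : V ⟶ X), clopen τ v → ∃ i, ∃ e : V ≅ U i, e.hom ≫ u i = v

variable {τ : Precoverage C} {X : C}

theorem IsDGUPresite.nonempty_clopenBasis (h : IsDGUPresite.{w} τ) (X : C) :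
    Nonempty (ClopenBasis.{w} τ X) := by
  obtain ⟨I, U, u, h1, h2⟩ := h.exists_small_clopens X
  exact ⟨⟨I, U, u, h1, h2⟩⟩

namespace ClopenBasis

variable (B : ClopenBasis.{w} τ X)

instance : Preorder B.I where
  le i j := ∃ f : B.U i ⟶ B.U j, f ≫ B.u j = B.u i
  le_refl i := ⟨𝟙 _, Category.id_comp _⟩
  le_trans i j k := fun ⟨f, hf⟩ ⟨g, hg⟩ ↦ ⟨f ≫ g, by rw [Category.assoc, hg, hf]⟩

/-- The inclusion between two clopen subobjects. -/
noncomputable def map {i j : B.I} (f : i ⟶ j) : B.U i ⟶ B.U j := (leOfHom f).choose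

@[simp]
theorem map_u {i j : B.I} (f : i ⟶ j) : B.map f ≫ B.u j = B.u i := (leOfHom f).choose_spec

theorem mono_u (h : IsDGPresite τ) (i : B.I) : Mono (B.u i) := h.mono _ (B.clopen_u i)

theorem map_id (h : IsDGPresite τ) (i : B.I) : B.map (𝟙 i) = 𝟙 _ := by
  have := B.mono_u h i
  rw [← cancel_mono (B.u i), map_u, Category.id_comp]

theorem map_comp (h : IsDGPresite τ) {i j k : B.I} (f : i ⟶ j) (g : j ⟶ k) :
    B.map (f ≫ g) = B.map f ≫ B.map g := by
  have := B.mono_u h k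
  rw [← cancel_mono (B.u k), map_u, Category.assoc, map_u, map_u]

theorem clopen_map (h : IsDGPresite τ) {i j : B.I} (f : i ⟶ j) : clopen τ (B.map f) :=
  h.clopen_of_comp (f := B.u j) (by rw [map_u]; exact B.clopen_u i) (B.clopen_u j)

/-- Every clopen subobject of `X` which is contained in `U i` and `U j` is isomorphic to some
`U m`. -/
theorem exists_index₂ {i j : B.I} {V : C} (a : V ⟶ B.U i) (b : V ⟶ B.U j)
    (hab : a ≫ B.u i = b ≫ B.u j) (hV : clopen τ (a ≫ B.u i)) :
    ∃ (m : B.I) (_ : m ⟶ i) (_ : m ⟶ j) (e : V ≅ B.U m), e.hom ≫ B.u m = a ≫ B.u i := by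
  obtain ⟨m, e, he⟩ := B.exists_iso _ hV
  exact ⟨m, homOfLE ⟨e.inv ≫ a, by rw [Category.assoc, ← he]; simp⟩,
    homOfLE ⟨e.inv ≫ b, by rw [Category.assoc, ← hab, ← he]; simp⟩, e, he⟩

theorem hom_ext (h : IsDGPresite τ) {i : B.I} {T : C} {x y : T ⟶ B.U i}
    (e : x ≫ B.u i = y ≫ B.u i) : x = y := by
  have := B.mono_u h i
  rwa [cancel_mono] at e

theorem exists_inf (h : IsDGPresite τ) (i j : B.I) : ∃ (m : B.I) (_ : m ⟶ i) (_ : m ⟶ j),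
    ∀ ⦃T : C⦄ (x : T ⟶ B.U i) (y : T ⟶ B.U j), x ≫ B.u i = y ≫ B.u j →
      ∃ t : T ⟶ B.U m, t ≫ B.u m = x ≫ B.u i := by
  have := clopen.hasPullback h.isPresite (B.clopen_u i) (B.u j)
  have hP := IsPullback.of_hasPullback (B.u i) (B.u j)
  obtain ⟨m, f, g, e, he⟩ := B.exists_index₂ _ _ hP.w (by
    rw [hP.w]
    exact clopen.comp h.isPresite (clopen.of_isPullback h.isPresite hP (B.clopen_u i))
      (B.clopen_u j))
  refine ⟨m, f, g, fun T x y hxy ↦ ⟨hP.lift x y hxy ≫ e.hom, ?_⟩⟩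
  rw [Category.assoc, he, hP.lift_fst_assoc]

theorem exists_hom_inf (h : IsDGPresite τ) {i j k : B.I} (f : j ⟶ i) (g : k ⟶ i) :
    ∃ (m : B.I) (a : m ⟶ j) (b : m ⟶ k), a ≫ f = b ≫ g ∧
    ∀ ⦃T : C⦄ (x : T ⟶ B.U j) (y : T ⟶ B.U k), x ≫ B.map f = y ≫ B.map g →
      ∃ t : T ⟶ B.U m, t ≫ B.map a = x ∧ t ≫ B.map b = y := by
  obtain ⟨m, a, b, hm⟩ := B.exists_inf h j k
  refine ⟨m, a, b, Subsingleton.elim _ _, fun T x y e ↦ ?_⟩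
  have e' : x ≫ B.u j = y ≫ B.u k := by rw [← B.map_u f, reassoc_of% e, B.map_u]
  obtain ⟨t, ht⟩ := hm x y e'
  exact ⟨t, B.hom_ext h (by rw [Category.assoc, map_u, ht]),
    B.hom_ext h (by rw [Category.assoc, map_u, ht, e'])⟩

/-- The topology on the clopen subobjects. -/
def topology (h : IsDGPresite τ) : GrothendieckTopology B.I where
  sieves i := {S | Sieve.ofArrows (fun t : Σ j, {f : j ⟶ i // S f} ↦ B.U t.1)
    (fun t ↦ B.map t.2.1) ∈ τ.toGrothendieck (B.U i)}
  top_mem' i := by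
    refine τ.toGrothendieck.superset_covering (fun V k _ ↦ ?_) (τ.toGrothendieck.top_mem _)
    exact (Sieve.mem_ofArrows_iff _ _ _).2 ⟨⟨i, 𝟙 i, trivial⟩, k, by
      rw [map_id B h, Category.comp_id]⟩
  pullback_stable' i j S f hS := by
    refine τ.toGrothendieck.superset_covering (fun V k hk ↦ ?_)
      (τ.toGrothendieck.pullback_stable (B.map f) hS)
    obtain ⟨⟨l, g, hg⟩, x, e⟩ := (Sieve.mem_ofArrows_iff _ _ _).1 hk
    obtain ⟨m, a, b, hab, hm⟩ := B.exists_hom_inf h f g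
    obtain ⟨t, h1, h2⟩ := hm k x e
    refine (Sieve.mem_ofArrows_iff _ _ _).2 ⟨⟨m, a, ?_⟩, t, h1.symm⟩
    change S (a ≫ f)
    rw [hab]
    exact S.downward_closed hg b
  transitive' i S hS R hR := by
    refine ofArrows_mem_of_local hS (fun V k hk ↦ ?_)
    obtain ⟨⟨l, g, hg⟩, x, rfl⟩ := (Sieve.mem_ofArrows_iff _ _ _).1 hk
    obtain ⟨Q, hQ, hQ'⟩ := IsPresite.exists_sieve (hR hg) x
    refine ⟨Q, hQ, fun V' k hk ↦ ?_⟩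
    obtain ⟨⟨m, f, hf⟩, y, hy⟩ := hQ' k hk
    exact ⟨⟨m, f ≫ g, hf⟩, y, by rw [map_comp B h, reassoc_of% hy]⟩

theorem mem_topology (h : IsDGPresite τ) {i : B.I} {S : Sieve i} : S ∈ B.topology h i ↔
    Sieve.ofArrows (fun t : Σ j, {f : j ⟶ i // S f} ↦ B.U t.1)
    (fun t ↦ B.map t.2.1) ∈ τ.toGrothendieck (B.U i) := Iff.rfl

/-- The sieve of all `j ≤ i` with a property which covers locally. -/
theorem mem_topology_of_local (h : IsDGPresite τ) {i : B.I} {S : Sieve i} {R : Sieve (B.U i)}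
    (hR : R ∈ τ.toGrothendieck (B.U i))
    (hS : ∀ ⦃V : C⦄ (k : V ⟶ B.U i), R k → ∃ (j : B.I) (f : j ⟶ i) (y : V ⟶ B.U j), S f ∧
      y ≫ B.map f = k) : S ∈ B.topology h i := by
  refine τ.toGrothendieck.superset_covering (fun V k hk ↦ ?_) hR
  obtain ⟨j, f, y, hf, e⟩ := hS k hk
  exact (Sieve.mem_ofArrows_iff _ _ _).2 ⟨⟨j, f, hf⟩, y, e.symm⟩

variable {F : B.Iᵒᵖ ⥤ Type w}

/-- The largest subobject on which two sections of a sheaf agree. -/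
theorem exists_eqLocus (h : IsDGPresite τ) (hF : Presieve.IsSheaf (B.topology h) F)
    {i j : B.I} (x : F.obj (op i)) (y : F.obj (op j)) :
    ∃ (m : B.I) (f : m ⟶ i) (g : m ⟶ j), F.map f.op x = F.map g.op y ∧
      ∀ (m' : B.I) (f' : m' ⟶ i) (g' : m' ⟶ j), F.map f'.op x = F.map g'.op y →
        Nonempty (m' ⟶ m) := by
  -- The locus is the union of all basis members on which x and y agree. These members cover it, so
  -- x and y agree on the union because F is separated.
  let K := {m : B.I // ∃ (f : m ⟶ i) (g : m ⟶ j), F.map f.op x = F.map g.op y}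
  obtain ⟨T, t, r, ht, -, hr, hrt⟩ := h.exists_union (fun m : K ↦ B.u m.1) (fun m ↦ B.clopen_u _)
  have := h.mono t ht
  have (k : B.I) (hk : ∀ m : K, Nonempty (m.1 ⟶ k)) : ∃ l, l ≫ B.u k = t := by
    have := B.mono_u h k
    refine h.subcanonical.exists_lift_of_local hr (B.u k) t (fun V l hl ↦ ?_)
    obtain ⟨m, y, rfl⟩ := (Sieve.mem_ofArrows_iff _ _ _).1 hl
    obtain ⟨f⟩ := hk m
    exact ⟨y ≫ B.map f, by rw [Category.assoc, map_u, Category.assoc, hrt]⟩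
  obtain ⟨a, ha⟩ := this i (fun m ↦ ⟨m.2.choose⟩)
  obtain ⟨b, hb⟩ := this j (fun m ↦ ⟨m.2.choose_spec.choose⟩)
  obtain ⟨m, f, g, e, he⟩ := B.exists_index₂ a b (ha.trans hb.symm) (by rw [ha]; exact ht)
  have hm (m' : K) : Nonempty (m'.1 ⟶ m) :=
    ⟨homOfLE ⟨r m' ≫ e.hom, by rw [Category.assoc, he, ha, hrt]⟩⟩
  refine ⟨m, f, g, ?_, fun m' f' g' e ↦ hm ⟨m', f', g', e⟩⟩
  let S : Sieve m :=
    { arrows := fun k l ↦ F.map l.op (F.map f.op x) = F.map l.op (F.map g.op y)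
      downward_closed := fun {k k'} l hl p ↦ by
        rw [op_comp, Functor.map_comp, types_comp_apply, types_comp_apply, hl] }
  have hS : S ∈ B.topology h m := by
    refine B.mem_topology_of_local h (τ.toGrothendieck.pullback_stable e.inv hr)
      (fun V k hk ↦ ?_)
    obtain ⟨m', y', hy⟩ := (Sieve.mem_ofArrows_iff _ _ _).1 hk
    obtain ⟨l⟩ := hm m'
    refine ⟨m'.1, l, y', ?_, B.hom_ext h ?_⟩
    · obtain ⟨f', g', e'⟩ := m'.2
      change F.map l.op (F.map f.op x) = F.map l.op (F.map g.op y)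
      rw [← types_comp_apply (F.map f.op), ← types_comp_apply (F.map g.op), ← F.map_comp,
        ← F.map_comp, Subsingleton.elim (f.op ≫ l.op) f'.op, Subsingleton.elim (g.op ≫ l.op) g'.op,
        e']
    · rw [Category.assoc, map_u, ← hrt, ← Category.assoc, ← hy, Category.assoc, ← ha, ← he]
      simp
  exact (hF S hS).isSeparatedFor.ext (fun k l hl ↦ hl)

end ClopenBasis

end Basis

/-! ### Étale objects, their sections, and the étale space of a sheaf -/

section Sections

variable {C : Type u₁} [Category.{v₁} C] {τ : Precoverage C} {X : C}

namespace ClopenBasis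

variable (B : ClopenBasis.{w} τ X)

/-- An étale object over `X` is covered by its sections over clopen subobjects of `X`. -/
theorem sections_cover (h : IsDGPresite τ) {Z : C} {z : Z ⟶ X} (hz : etale τ z) :
    Sieve.ofArrows (fun s : Σ i, {x : B.U i ⟶ Z // x ≫ z = B.u i} ↦ B.U s.1) (fun s ↦ s.2.1) ∈
      τ.toGrothendieck Z := by
  obtain ⟨κ, V, v, hv, hvz⟩ := hz.exists_cover
  refine τ.toGrothendieck.superset_covering (fun T k hk ↦ ?_) (h.isPresite.ofArrows_mem_iff.1 hv).2
  obtain ⟨i, a, rfl⟩ := (Sieve.mem_ofArrows_iff _ _ _).1 hk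
  obtain ⟨m, e, he⟩ := B.exists_iso _ (hvz i)
  refine (Sieve.mem_ofArrows_iff _ _ _).2 ⟨⟨m, e.inv ≫ v i, ?_⟩, a ≫ e.hom, ?_⟩
  · rw [Category.assoc, ← he]; simp
  · simp

/-- A section of z over a clopen subobject is monic and étale, hence clopen. So the locus where two
sections coincide is a clopen subobject of X and occurs in the basis. -/
theorem exists_overlap (h : IsDGPresite τ) {Z : C} {z : Z ⟶ X} (hz : etale τ z) {i j : B.I}
    {x : B.U i ⟶ Z} {y : B.U j ⟶ Z} (hx : x ≫ z = B.u i) (hy : y ≫ z = B.u j) {T : C}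
    (a : T ⟶ B.U i) (b : T ⟶ B.U j) (hab : a ≫ x = b ≫ y) :
    ∃ (m : B.I) (f : m ⟶ i) (g : m ⟶ j) (t : T ⟶ B.U m), B.map f ≫ x = B.map g ≫ y ∧
      t ≫ B.map f = a ∧ t ≫ B.map g = b := by
  have hτ := h.isPresite
  have hm : Mono y := by
    have := B.mono_u h j
    rw [← hy] at this
    exact mono_of_mono y z
  have hyc : clopen τ y := h.clopen_of_etale (etale.of_comp h
    (by rw [hy]; exact etale_of_clopen hτ (B.clopen_u j)) hz)
  have := clopen.hasPullback hτ hyc x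
  have hP := (IsPullback.of_hasPullback y x).flip
  have e1 : pullback.snd y x ≫ B.u i = pullback.fst y x ≫ B.u j := by
    rw [← hx, ← hy, reassoc_of% hP.w]
  obtain ⟨m, f, g, e, he⟩ := B.exists_index₂ _ _ e1
    (clopen.comp hτ (clopen.of_isPullback hτ hP.flip hyc) (B.clopen_u i))
  have hf : e.hom ≫ B.map f = pullback.snd y x :=
    B.hom_ext h (by rw [Category.assoc, map_u, he])
  have hg : e.hom ≫ B.map g = pullback.fst y x :=
    B.hom_ext h (by rw [Category.assoc, map_u, he, e1])
  refine ⟨m, f, g, hP.lift a b hab ≫ e.hom, ?_, ?_, ?_⟩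
  · rw [← cancel_epi e.hom, reassoc_of% hf, reassoc_of% hg, hP.w]
  · rw [Category.assoc, hf, hP.lift_fst]
  · rw [Category.assoc, hg, hP.lift_snd]

section Pullback

variable {X' : C} {f : X' ⟶ X} {Z : C} {z : Z ⟶ X} {W : C} {w₁ : W ⟶ Z} {w₂ : W ⟶ X'}
  {P : B.I → C} {p : ∀ i, P i ⟶ B.U i} {q : ∀ i, P i ⟶ X'}

/-- The sections cover Z; base change along w₁ turns them into a covering of W. Taking f to be the
identity recovers statements about Z itself. -/
theorem pullback_cover (h : IsDGPresite τ) (hz : etale τ z) (hW : IsPullback w₁ w₂ z f)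
    (hP : ∀ i, IsPullback (p i) (q i) (B.u i) f) :
    Sieve.ofArrows (fun s : Σ i, {x : B.U i ⟶ Z // x ≫ z = B.u i} ↦ P s.1)
      (fun s ↦ hW.lift (p s.1 ≫ s.2.1) (q s.1) (by rw [Category.assoc, s.2.2, (hP _).w])) ∈
      τ.toGrothendieck W := by
  refine τ.toGrothendieck.superset_covering (fun T k hk ↦ ?_)
    (τ.toGrothendieck.pullback_stable w₁ (B.sections_cover h hz))
  obtain ⟨s, y, e⟩ := (Sieve.mem_ofArrows_iff _ _ _).1 hk
  have e' : y ≫ B.u s.1 = (k ≫ w₂) ≫ f := by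
    rw [← s.2.2, ← Category.assoc, ← e, Category.assoc, hW.w, Category.assoc]
  refine (Sieve.mem_ofArrows_iff _ _ _).2 ⟨s, (hP _).lift y (k ≫ w₂) e', hW.hom_ext ?_ ?_⟩
  · rw [Category.assoc, hW.lift_fst, (hP _).lift_fst_assoc, e]
  · rw [Category.assoc, hW.lift_snd, (hP _).lift_snd]

/-- Arrows out of the base change of an étale object are determined by the base changes of
sections. -/
theorem pullback_hom_ext (h : IsDGPresite τ) (hz : etale τ z) (hW : IsPullback w₁ w₂ z f)
    (hP : ∀ i, IsPullback (p i) (q i) (B.u i) f) {E : C} {g g' : W ⟶ E}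
    (H : ∀ i (x : B.U i ⟶ Z), x ≫ z = B.u i → ∀ l : P i ⟶ W, l ≫ w₁ = p i ≫ x → l ≫ w₂ = q i →
      l ≫ g = l ≫ g') : g = g' :=
  h.subcanonical.hom_ext_of_cover (B.pullback_cover h hz hW hP)
    (fun s ↦ H s.1 s.2.1 s.2.2 _ (hW.lift_fst _ _ _) (hW.lift_snd _ _ _))

/-- Arrows out of the base change of an étale object can be glued from arrows on the base changes
of sections. -/
theorem exists_pullback_desc (h : IsDGPresite τ) (hz : etale τ z) (hW : IsPullback w₁ w₂ z f)
    (hP : ∀ i, IsPullback (p i) (q i) (B.u i) f) {E : C}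
    (θ : ∀ i (x : B.U i ⟶ Z), x ≫ z = B.u i → (P i ⟶ E))
    (nat : ∀ m i (φ : m ⟶ i) (x : B.U i ⟶ Z) (hx : x ≫ z = B.u i)
      (hx' : (B.map φ ≫ x) ≫ z = B.u m) (l : P m ⟶ P i), l ≫ p i = p m ≫ B.map φ → l ≫ q i = q m →
      l ≫ θ i x hx = θ m (B.map φ ≫ x) hx') :
    ∃ g : W ⟶ E, ∀ i (x : B.U i ⟶ Z) (hx : x ≫ z = B.u i) (l : P i ⟶ W), l ≫ w₁ = p i ≫ x →
      l ≫ w₂ = q i → l ≫ g = θ i x hx := by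
  obtain ⟨g, hg⟩ := h.subcanonical.exists_desc (B.pullback_cover h hz hW hP)
    (fun s ↦ θ s.1 s.2.1 s.2.2) (by
      rintro ⟨i, x, hx⟩ ⟨j, y, hy⟩ Q a b e
      dsimp only at e a b ⊢
      have e1 := congrArg (· ≫ w₁) e
      have e2 := congrArg (· ≫ w₂) e
      simp only [Category.assoc, hW.lift_fst, hW.lift_snd] at e1 e2
      simp only [← Category.assoc] at e1
      -- Where two base changed sections meet, the sections agree over some U m; naturality of θ
      -- reduces both values to the common one over P m.
      obtain ⟨m, φ, ψ, t, hm, h1, h2⟩ := B.exists_overlap h hz hx hy _ _ e1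
      have ht : t ≫ B.u m = (a ≫ q i) ≫ f := by
        rw [← B.map_u φ, reassoc_of% h1, (hP i).w, Category.assoc]
      let t' := (hP m).lift t (a ≫ q i) ht
      let li := (hP i).lift (p m ≫ B.map φ) (q m) (by rw [Category.assoc, map_u, (hP m).w])
      let lj := (hP j).lift (p m ≫ B.map ψ) (q m) (by rw [Category.assoc, map_u, (hP m).w])
      have ha : t' ≫ li = a := (hP i).hom_ext (by simp [t', li, h1]) (by simp [t', li])
      have hb : t' ≫ lj = b := (hP j).hom_ext (by simp [t', lj, h2]) (by simp [t', lj, e2])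
      have n1 := nat m i φ x hx (by rw [Category.assoc, hx, map_u]) li (by simp [li])
        (by simp [li])
      have n2 := nat m j ψ y hy (by rw [Category.assoc, hy, map_u]) lj (by simp [lj])
        (by simp [lj])
      rw [← ha, ← hb, Category.assoc, Category.assoc, n1, n2]
      congr 2)
  refine ⟨g, fun i x hx l h1 h2 ↦ ?_⟩
  rw [← hg ⟨i, x, hx⟩]
  congr 1
  exact hW.hom_ext (by rw [h1, hW.lift_fst]) (by rw [h2, hW.lift_snd])

end Pullback

/-- Every sheaf on the clopen subobjects of `X` is the sheaf of sections of an étale object. -/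
theorem exists_etale_of_isSheaf (h : IsDGPresite τ) (hg : HasGluing.{w} τ)
    {F : B.Iᵒᵖ ⥤ Type w} (hF : Presieve.IsSheaf (B.topology h) F) :
    ∃ (Z : C) (z : Z ⟶ X) (c : ∀ i, F.obj (op i) → (B.U i ⟶ Z)), etale τ z ∧
      (∀ i x, c i x ≫ z = B.u i) ∧
      (∀ (i j : B.I) (f : j ⟶ i) (x : F.obj (op i)), c j (F.map f.op x) = B.map f ≫ c i x) ∧
      (∀ i, Function.Injective (c i)) ∧ ∀ i (s : B.U i ⟶ Z), s ≫ z = B.u i → ∃ x, c i x = s := by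
  have hτ := h.isPresite
  have hcomp {i j k : B.I} (f : j ⟶ i) (g : k ⟶ j) (x : F.obj (op i)) :
      F.map g.op (F.map f.op x) = F.map (g ≫ f).op x := by
    rw [op_comp, F.map_comp, types_comp_apply]
  -- The étale space: one copy of U i for each section of F over U i. Two copies are glued along the
  -- largest subobject on which the sections agree, supplied by `exists_eqLocus`.
  obtain ⟨Z, c, hc, hZ⟩ := hg (fun s : Σ i, F.obj (op i) ↦ B.U s.1)
    (fun T s t a b ↦ ∃ (m : B.I) (f : m ⟶ s.1) (g : m ⟶ t.1) (k : T ⟶ B.U m),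
      F.map f.op s.2 = F.map g.op t.2 ∧ k ≫ B.map f = a ∧ k ≫ B.map g = b) <| by
      refine .of_left h ?_ ?_ ?_ ?_
      · rintro T ⟨i, x⟩ a b
        constructor
        · rintro ⟨m, f, g, k, -, rfl, rfl⟩
          rw [Subsingleton.elim f g]
        · rintro rfl
          exact ⟨i, 𝟙 i, 𝟙 i, a, rfl, by rw [B.map_id h, Category.comp_id],
            by rw [B.map_id h, Category.comp_id]⟩
      · rintro T s t a b ⟨m, f, g, k, h1, h2, h3⟩
        exact ⟨m, g, f, k, h1.symm, h3, h2⟩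
      · rintro T s t r a b c ⟨m, f, g, k, h1, h2, h3⟩ ⟨m', f', g', k', h1', h2', h3'⟩
        obtain ⟨n, α, β, hαβ, hn⟩ := B.exists_hom_inf h g f'
        obtain ⟨l, hl, hl'⟩ := hn k k' (h3.trans h2'.symm)
        refine ⟨n, α ≫ f, β ≫ g', l, ?_, ?_, ?_⟩
        · rw [← hcomp, ← hcomp, h1, ← h1', hcomp, hcomp, hαβ]
        · rw [B.map_comp h, reassoc_of% hl, h2]
        · rw [B.map_comp h, reassoc_of% hl', h3']
      · rintro ⟨i, x⟩ ⟨j, y⟩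
        obtain ⟨m, f, g, e, hm⟩ := B.exists_eqLocus h hF x y
        refine ⟨B.U m, B.map f, B.map g, B.clopen_map h f, fun T a b ↦ ⟨?_, ?_⟩⟩
        · rintro ⟨m', f', g', k, h1, rfl, rfl⟩
          obtain ⟨l⟩ := hm m' f' g' h1
          refine ⟨k ≫ B.map l, ?_, ?_⟩
          · rw [Category.assoc, ← B.map_comp h, Subsingleton.elim (l ≫ f) f']
          · rw [Category.assoc, ← B.map_comp h, Subsingleton.elim (l ≫ g) g']
        · rintro ⟨t, rfl, rfl⟩
          exact ⟨m, f, g, t, e, rfl, rfl⟩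
  obtain ⟨hc1, hc2⟩ := hτ.ofArrows_mem_iff.1 hc
  obtain ⟨z, hz⟩ := h.subcanonical.exists_desc hc2 (fun s ↦ B.u s.1) (by
    rintro s t T a b e
    obtain ⟨m, f, g, k, -, rfl, rfl⟩ := (hZ s t a b).2 e
    simp)
  have hze : etale τ z := etale_of_cover hc (fun s ↦ by rw [hz]; exact B.clopen_u _)
  have hnat (i j : B.I) (f : j ⟶ i) (x : F.obj (op i)) :
      c ⟨j, F.map f.op x⟩ = B.map f ≫ c ⟨i, x⟩ := by
    rw [← Category.id_comp (c _)]
    refine (hZ ⟨j, _⟩ ⟨i, x⟩ (𝟙 _) (B.map f)).1 ⟨j, 𝟙 j, f, 𝟙 _, ?_, ?_, ?_⟩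
    · rw [hcomp, Category.id_comp]
    · rw [B.map_id h, Category.comp_id]
    · rw [Category.id_comp]
  have hinj (i : B.I) (x y : F.obj (op i)) (e : c ⟨i, x⟩ = c ⟨i, y⟩) : x = y := by
    obtain ⟨m, f, g, k, h1, h2, h3⟩ := (hZ ⟨i, x⟩ ⟨i, y⟩ (𝟙 _) (𝟙 _)).2 (by rw [e])
    -- The identity of U i factors through U m, so the two sections agree on all of U i.
    have l : i ⟶ m := homOfLE ⟨k, by rw [← B.map_u f, reassoc_of% h2]⟩
    have h4 := congrArg (fun t ↦ F.map l.op t) h1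
    dsimp only at h4
    rw [hcomp, hcomp, Subsingleton.elim (l ≫ f) (𝟙 _), Subsingleton.elim (l ≫ g) (𝟙 _)] at h4
    simpa using h4
  refine ⟨Z, z, fun i x ↦ c ⟨i, x⟩, hze, fun i x ↦ hz _, hnat, hinj, fun i s hs ↦ ?_⟩
  -- The basis members over which s comes from a section of F. They cover because s meets the copies
  -- of the U j in clopen subobjects; uniqueness by `hinj` makes the sections compatible, so they
  -- glue.
  let S : Sieve i :=
    { arrows := fun j f ↦ ∃ x : F.obj (op j), c ⟨j, x⟩ = B.map f ≫ s
      downward_closed := by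
        rintro j k f ⟨x, hx⟩ g
        exact ⟨F.map g.op x, by rw [hnat, hx, B.map_comp h, Category.assoc]⟩ }
  have hS : S ∈ B.topology h i := by
    refine B.mem_topology_of_local h (τ.toGrothendieck.pullback_stable s hc2) (fun V k hk ↦ ?_)
    obtain ⟨t, y, e⟩ := (Sieve.mem_ofArrows_iff _ _ _).1 hk
    obtain ⟨m, f, g, a, e1, e2, e3⟩ := B.exists_overlap h hze hs (hz t) k y e
    exact ⟨m, f, a, ⟨F.map g.op t.2, by rw [hnat, e1]⟩, e2⟩
  choose ξ hξ using fun j (f : j ⟶ i) (hf : S f) ↦ hf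
  obtain ⟨x, hx, -⟩ := hF S hS (fun j f hf ↦ ξ j f hf) (by
    intro j₁ j₂ k g₁ g₂ f₁ f₂ hf₁ hf₂ e
    refine hinj _ _ _ ?_
    rw [hnat, hnat, hξ, hξ, ← Category.assoc, ← Category.assoc, ← B.map_comp h, ← B.map_comp h, e])
  refine ⟨x, ?_⟩
  refine h.subcanonical.hom_ext_of_cover ((B.mem_topology h).1 hS) (fun t ↦ ?_)
  rw [← hnat, hx _ t.2.2, hξ]

end ClopenBasis

end Sections

/-! ### Étale objects over X as a topos of sheaves -/

section Topos

variable {C : Type u₁} [Category.{v₁} C] {τ : Precoverage C} {X : C}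

namespace ClopenBasis

variable (B : ClopenBasis.{w} τ X)

section

variable {X' : C} {f : X' ⟶ X} {P : B.I → C} {p : ∀ i, P i ⟶ B.U i} {q : ∀ i, P i ⟶ X'}
  (hP : ∀ i, IsPullback (p i) (q i) (B.u i) f)

include hP in
theorem pullback_hom_ext' (h : IsDGPresite τ) {i : B.I} {T : C} {x y : T ⟶ P i}
    (e : x ≫ q i = y ≫ q i) : x = y := by
  refine (hP i).hom_ext (B.hom_ext h ?_) e
  rw [Category.assoc, Category.assoc, (hP i).w, reassoc_of% e]

/-- The inclusion between the base changes of two clopen subobjects. -/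
noncomputable def pullbackMap {i j : B.I} (φ : i ⟶ j) : P i ⟶ P j :=
  (hP j).lift (p i ≫ B.map φ) (q i) (by rw [Category.assoc, map_u, (hP i).w])

@[simp]
theorem pullbackMap_fst {i j : B.I} (φ : i ⟶ j) : B.pullbackMap hP φ ≫ p j = p i ≫ B.map φ :=
  (hP j).lift_fst _ _ _

@[simp]
theorem pullbackMap_fst_assoc {i j : B.I} (φ : i ⟶ j) {Z : C} (z : B.U j ⟶ Z) :
    B.pullbackMap hP φ ≫ p j ≫ z = p i ≫ B.map φ ≫ z := by
  rw [← Category.assoc, pullbackMap_fst, Category.assoc]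

@[simp]
theorem pullbackMap_snd {i j : B.I} (φ : i ⟶ j) : B.pullbackMap hP φ ≫ q j = q i :=
  (hP j).lift_snd _ _ _

variable [LocallySmall.{w} C]

/-- The presheaf of sections of the direct image of `t : T ⟶ X'`. -/
noncomputable def sections (h : IsDGPresite τ) {T : C} (t : T ⟶ X') : B.Iᵒᵖ ⥤ Type w where
  obj i := Shrink.{w} {x : P i.unop ⟶ T // x ≫ t = q i.unop}
  map {i j} φ := ↾fun x ↦ equivShrink _ ⟨B.pullbackMap hP φ.unop ≫ ((equivShrink _).symm x).1, by
    rw [Category.assoc, ((equivShrink _).symm x).2, pullbackMap_snd]⟩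
  map_id i := by
    refine ConcreteCategory.hom_ext _ _ fun x ↦ ?_
    change equivShrink _ _ = x
    rw [← Equiv.eq_symm_apply]
    ext
    change B.pullbackMap hP (𝟙 i.unop) ≫ _ = _
    rw [B.pullback_hom_ext' hP h (x := B.pullbackMap hP (𝟙 i.unop)) (y := 𝟙 _) (by simp),
      Category.id_comp]
  map_comp {i j k} φ ψ := by
    refine ConcreteCategory.hom_ext _ _ fun x ↦ ?_
    change equivShrink _ _ = equivShrink _ _
    congr 1
    ext
    change B.pullbackMap hP (ψ.unop ≫ φ.unop) ≫ _ =
      B.pullbackMap hP ψ.unop ≫ Subtype.val ((equivShrink _).symm (equivShrink _ _))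
    rw [Equiv.symm_apply_apply, ← Category.assoc]
    congr 1
    exact B.pullback_hom_ext' hP h (by simp)

/-- The arrow which corresponds to a section. -/
noncomputable def sectionHom (h : IsDGPresite τ) {T : C} {t : T ⟶ X'} {i : B.I}
    (x : (B.sections hP h t).obj (op i)) : P i ⟶ T :=
  ((equivShrink {x : P i ⟶ T // x ≫ t = q i}).symm x).1

variable (h : IsDGPresite τ) {T : C} {t : T ⟶ X'}

@[simp]
theorem sectionHom_comp {i : B.I} (x : (B.sections hP h t).obj (op i)) :
    B.sectionHom hP h x ≫ t = q i :=
  ((equivShrink {x : P i ⟶ T // x ≫ t = q i}).symm x).2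

theorem sectionHom_injective {i : B.I} {x y : (B.sections hP h t).obj (op i)}
    (e : B.sectionHom hP h x = B.sectionHom hP h y) : x = y :=
  (equivShrink {x : P i ⟶ T // x ≫ t = q i}).symm.injective (Subtype.ext e)

theorem exists_sectionHom {i : B.I} (x : P i ⟶ T) (hx : x ≫ t = q i) :
    ∃ y : (B.sections hP h t).obj (op i), B.sectionHom hP h y = x :=
  ⟨equivShrink _ ⟨x, hx⟩, congrArg Subtype.val (Equiv.symm_apply_apply _ _)⟩

@[simp]
theorem sectionHom_map {i j : B.I} (φ : j ⟶ i) (x : (B.sections hP h t).obj (op i)) :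
    B.sectionHom hP h ((B.sections hP h t).map φ.op x) =
      B.pullbackMap hP φ ≫ B.sectionHom hP h x :=
  congrArg Subtype.val (Equiv.symm_apply_apply _ _)

/-- Coverings of U i stay coverings after base change to P i, and arrows into T glue by
subcanonicity; two pieces meet in the base change of the intersection. -/
theorem isSheaf_sections : Presieve.IsSheaf (B.topology h) (B.sections hP h t) := by
  intro i S hS ξ hξ
  have hc : Sieve.ofArrows (fun s : Σ j, {g : j ⟶ i // S g} ↦ P s.1)
      (fun s ↦ B.pullbackMap hP s.2.1) ∈ τ.toGrothendieck (P i) := by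
    refine τ.toGrothendieck.superset_covering (fun V k hk ↦ ?_)
      (τ.toGrothendieck.pullback_stable (p i) ((B.mem_topology h).1 hS))
    obtain ⟨s, y, e⟩ := (Sieve.mem_ofArrows_iff _ _ _).1 hk
    have e' : y ≫ B.u s.1 = (k ≫ q i) ≫ f := by
      rw [← B.map_u s.2.1, ← Category.assoc, ← e, Category.assoc, (hP i).w, Category.assoc]
    exact (Sieve.mem_ofArrows_iff _ _ _).2 ⟨s, (hP _).lift y (k ≫ q i) e',
      B.pullback_hom_ext' hP h (by simp)⟩
  obtain ⟨x, hx⟩ := h.subcanonical.exists_desc hc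
    (fun s ↦ B.sectionHom hP h (ξ s.2.1 s.2.2)) (by
      rintro ⟨j, g, hg⟩ ⟨k, g', hg'⟩ T' a b e
      dsimp only at a b e ⊢
      have e1 : a ≫ q j = b ≫ q k := by
        rw [← B.pullbackMap_snd hP g, reassoc_of% e, pullbackMap_snd]
      have e2 : (a ≫ p j) ≫ B.map g = (b ≫ p k) ≫ B.map g' := by
        have := congrArg (· ≫ p i) e
        simpa using this
      obtain ⟨m, α, β, hαβ, hm⟩ := B.exists_hom_inf h g g'
      obtain ⟨y, hy1, hy2⟩ := hm _ _ e2
      have e3 := congrArg (B.sectionHom hP h) (hξ α β hg hg' hαβ)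
      rw [sectionHom_map, sectionHom_map] at e3
      let l := (hP m).lift y (a ≫ q j) (by
        rw [← B.map_u α, reassoc_of% hy1, (hP j).w, Category.assoc])
      have h1 : l ≫ B.pullbackMap hP α = a := B.pullback_hom_ext' hP h (by simp [l])
      have h2 : l ≫ B.pullbackMap hP β = b := B.pullback_hom_ext' hP h (by simp [l, e1])
      rw [← h1, ← h2, Category.assoc, Category.assoc, e3])
  have hxt : x ≫ t = q i := by
    refine h.subcanonical.hom_ext_of_cover hc (fun s ↦ ?_)
    rw [reassoc_of% (hx s), sectionHom_comp, pullbackMap_snd]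
  obtain ⟨y, rfl⟩ := B.exists_sectionHom hP h x hxt
  refine ⟨y, fun j g hg ↦ B.sectionHom_injective hP h ?_, fun z hz ↦
    B.sectionHom_injective hP h ?_⟩
  · rw [sectionHom_map, hx ⟨j, g, hg⟩]
  · refine h.subcanonical.hom_ext_of_cover hc (fun s ↦ ?_)
    rw [hx s, ← hz _ s.2.2, sectionHom_map]

end


/-- This square and the next are the base changes along the identity of X; with them the results on
base changes apply to étale objects over X themselves. -/
theorem isPullback_self {Z : C} (z : Z ⟶ X) : IsPullback (𝟙 Z) z z (𝟙 X) :=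
  IsPullback.of_horiz_isIso ⟨by simp⟩

theorem isPullback_id (i : B.I) : IsPullback (𝟙 (B.U i)) (B.u i) (B.u i) (𝟙 X) :=
  IsPullback.of_horiz_isIso ⟨by simp⟩

theorem pullbackMap_id (h : IsDGPresite τ) {i j : B.I} (φ : i ⟶ j) :
    B.pullbackMap B.isPullback_id φ = B.map φ :=
  B.pullback_hom_ext' B.isPullback_id h (by simp)

variable [LocallySmall.{w} C] (h : IsDGPresite τ)

/-- The sheaf of sections of an étale object. -/
noncomputable def sectionsFunctor : (etale τ).Over ⊤ X ⥤ Sheaf (B.topology h) (Type w) :=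
  ObjectProperty.lift _
    { obj T := B.sections B.isPullback_id h T.hom
      map {T T'} g :=
        { app i := ↾fun x ↦ equivShrink _ ⟨B.sectionHom B.isPullback_id h x ≫ g.left, by
            rw [Category.assoc, MorphismProperty.Over.w, sectionHom_comp]⟩
          naturality i j φ := by
            refine ConcreteCategory.hom_ext _ _ fun x ↦ ?_
            refine B.sectionHom_injective B.isPullback_id h ?_
            refine Eq.trans ?_ (B.sectionHom_map B.isPullback_id h φ.unop _).symm
            refine (congrArg Subtype.val (Equiv.symm_apply_apply _ _)).trans ?_
            refine Eq.trans ?_ (congrArg _ (congrArg Subtype.val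
              (Equiv.symm_apply_apply _ _))).symm
            exact (congrArg (· ≫ g.left) (B.sectionHom_map B.isPullback_id h φ.unop x)).trans
              (Category.assoc _ _ _) }
      map_id T := by
        ext i : 2
        refine ConcreteCategory.hom_ext _ _ fun x ↦ ?_
        refine B.sectionHom_injective B.isPullback_id h ?_
        refine (congrArg Subtype.val (Equiv.symm_apply_apply _ _)).trans ?_
        exact Category.comp_id _
      map_comp g g' := by
        ext i : 2
        refine ConcreteCategory.hom_ext _ _ fun x ↦ ?_
        refine B.sectionHom_injective B.isPullback_id h ?_
        refine (congrArg Subtype.val (Equiv.symm_apply_apply _ _)).trans ?_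
        refine Eq.trans ?_ (congrArg Subtype.val (Equiv.symm_apply_apply _ _)).symm
        refine Eq.trans ?_ (congrArg (· ≫ g'.left)
          (congrArg Subtype.val (Equiv.symm_apply_apply _ _))).symm
        exact (Category.assoc _ _ _).symm }
    (fun T ↦ (isSheaf_iff_isSheaf_of_type _ _).2 (B.isSheaf_sections B.isPullback_id h))

theorem sectionHom_sectionsFunctor_map {T T' : (etale τ).Over ⊤ X} (g : T ⟶ T') {i : B.I}
    (x : (B.sections B.isPullback_id h T.hom).obj (op i)) :
    B.sectionHom B.isPullback_id h (((B.sectionsFunctor h).map g).hom.app (op i) x) =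
      B.sectionHom B.isPullback_id h x ≫ g.left :=
  congrArg Subtype.val (Equiv.symm_apply_apply _ _)

/-- Étale objects are glued from their sections, so arrows between them amount to natural maps of
sections; every sheaf arises from its étale space. -/
theorem isEquivalence_sectionsFunctor (hg : HasGluing.{w} τ) :
    (B.sectionsFunctor h).IsEquivalence where
  faithful := by
    constructor
    intro T T' g g' e
    refine MorphismProperty.Over.Hom.ext ?_
    refine B.pullback_hom_ext h T.prop (isPullback_self T.hom) B.isPullback_id
      (fun i x hx l hl _ ↦ ?_)
    obtain ⟨y, rfl⟩ := B.exists_sectionHom B.isPullback_id h x hx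
    rw [Category.comp_id, Category.id_comp] at hl
    rw [hl, ← sectionHom_sectionsFunctor_map, ← sectionHom_sectionsFunctor_map, e]
  full := by
    constructor
    intro T T' η
    choose s hs using fun i (x : B.U i ⟶ T.left) (hx : x ≫ T.hom = B.u i) ↦
      B.exists_sectionHom B.isPullback_id h x hx
    -- Prescribe g on each section of T by η; naturality of η is the compatibility needed for
    -- gluing.
    obtain ⟨g, hg⟩ := B.exists_pullback_desc h T.prop (isPullback_self T.hom) B.isPullback_id
      (E := T'.left) (fun i x hx ↦ B.sectionHom B.isPullback_id h (η.hom.app (op i) (s i x hx))) (by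
        intro m i φ x hx hx' l hl _
        rw [Category.comp_id, Category.id_comp] at hl
        rw [hl]
        refine ((congrArg (· ≫ B.sectionHom B.isPullback_id h _)
          (B.pullbackMap_id h φ)).symm.trans (B.sectionHom_map B.isPullback_id h φ _).symm).trans ?_
        refine congrArg _ ?_
        have e : s m (B.map φ ≫ x) hx' =
            (B.sections B.isPullback_id h T.hom).map φ.op (s i x hx) :=
          B.sectionHom_injective B.isPullback_id h (by
            rw [sectionHom_map, hs, hs, pullbackMap_id _ h])
        refine Eq.trans ?_ (congrArg (η.hom.app (op m)) e).symm
        exact (ConcreteCategory.congr_hom (η.hom.naturality φ.op) (s i x hx)).symm)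
    have hg' i (x : B.U i ⟶ T.left) (hx : x ≫ T.hom = B.u i) :
        x ≫ g = B.sectionHom B.isPullback_id h (η.hom.app (op i) (s i x hx)) :=
      hg i x hx x (by simp) hx
    refine ⟨MorphismProperty.Over.homMk g ?_, ?_⟩
    · refine B.pullback_hom_ext h T.prop (isPullback_self T.hom) B.isPullback_id
        (fun i x hx l hl _ ↦ ?_)
      rw [Category.comp_id, Category.id_comp] at hl
      rw [hl, ← Category.assoc]
      exact (congrArg (· ≫ T'.hom) (hg' i x hx)).trans
        ((B.sectionHom_comp B.isPullback_id h _).trans hx.symm)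
    · ext i : 3
      refine ConcreteCategory.hom_ext _ _ fun x ↦ ?_
      refine B.sectionHom_injective B.isPullback_id h ?_
      refine (B.sectionHom_sectionsFunctor_map h _ _).trans ?_
      refine (hg' _ _ (B.sectionHom_comp B.isPullback_id h x)).trans ?_
      congr 2
      exact B.sectionHom_injective B.isPullback_id h (hs _ _ _)
  essSurj := by
    constructor
    intro F
    obtain ⟨Z, z, c, hz, h1, h2, h3, h4⟩ := B.exists_etale_of_isSheaf h hg
      ((isSheaf_iff_isSheaf_of_type _ _).1 F.property)
    choose s hs using fun i (x : F.obj.obj (op i)) ↦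
      B.exists_sectionHom B.isPullback_id h (c i x) (h1 i x)
    refine ⟨MorphismProperty.Over.mk _ z hz, ⟨ObjectProperty.isoMk _ (Iso.symm ?_)⟩⟩
    have hbij i : Function.Bijective (s i) := by
      constructor
      · intro x y e
        exact h3 i (by rw [← hs, e, hs])
      · intro y
        obtain ⟨x, hx⟩ := h4 i (B.sectionHom B.isPullback_id h y) (B.sectionHom_comp _ h y)
        exact ⟨x, B.sectionHom_injective B.isPullback_id h (by rw [hs, hx])⟩
    refine NatIso.ofComponents (fun i ↦ (Equiv.ofBijective _ (hbij i.unop)).toIso) ?_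
    intro i j φ
    refine ConcreteCategory.hom_ext _ _ fun x ↦ ?_
    refine B.sectionHom_injective B.isPullback_id h ?_
    refine (hs _ _).trans ?_
    refine Eq.trans ?_ (B.sectionHom_map B.isPullback_id h φ.unop _).symm
    refine (h2 _ _ φ.unop _).trans ?_
    rw [pullbackMap_id _ h]
    exact congrArg _ (hs _ _).symm

end ClopenBasis

theorem etale.isUTopos_over (h : IsDGUPresite.{w} τ) (hg : HasGluing.{w} τ) (X : C) :
    IsUTopos.{w} ((etale τ).Over ⊤ X) := by
  obtain ⟨B⟩ := h.nonempty_clopenBasis X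
  have : LocallySmall.{w} C := ⟨h.isUPresite.isUCategory.small_hom⟩
  have := B.isEquivalence_sectionsFunctor h.toIsDGPresite hg
  exact ⟨B.I, inferInstance, B.topology h.toIsDGPresite,
    ⟨(B.sectionsFunctor h.toIsDGPresite).asEquivalence⟩⟩

end Topos

/-! ### The direct image, right adjoint to base change -/

section InverseImage

variable {C : Type u₁} [Category.{v₁} C] {τ : Precoverage C} {X : C}

/-- The direct image of an étale object. -/
theorem ClopenBasis.exists_directImage (B : ClopenBasis.{w} τ X) [LocallySmall.{w} C]
    (h : IsDGPresite τ) (hg : HasGluing.{w} τ) {X' : C} (f : X' ⟶ X) {T : C} (t : T ⟶ X') :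
    ∃ (Z : C) (z : Z ⟶ X), etale τ z ∧
      ∀ ⦃W : C⦄ (w₁ : W ⟶ Z) (w₂ : W ⟶ X'), IsPullback w₁ w₂ z f →
        ∃ ε : W ⟶ T, ε ≫ t = w₂ ∧
          ∀ ⦃A : C⦄ (a : A ⟶ X), etale τ a → ∀ ⦃V : C⦄ (v₁ : V ⟶ A) (v₂ : V ⟶ X'),
            IsPullback v₁ v₂ a f →
            (∀ α : V ⟶ T, α ≫ t = v₂ → ∃ g : A ⟶ Z, g ≫ z = a ∧
              ∀ l : V ⟶ W, l ≫ w₁ = v₁ ≫ g → l ≫ w₂ = v₂ → l ≫ ε = α) ∧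
            ∀ g g' : A ⟶ Z, g ≫ z = a → g' ≫ z = a →
              (∀ l l' : V ⟶ W, l ≫ w₁ = v₁ ≫ g → l ≫ w₂ = v₂ → l' ≫ w₁ = v₁ ≫ g' →
                l' ≫ w₂ = v₂ → l ≫ ε = l' ≫ ε) → g = g' := by
  have (i : B.I) := clopen.hasPullback h.isPresite (B.clopen_u i) f
  have hP (i : B.I) := IsPullback.of_hasPullback (B.u i) f
  -- Z is the étale space of the sheaf sending U i to the arrows P i ⟶ T over X', where P i is the
  -- base change of U i along f.
  obtain ⟨Z, z, c, hz, h1, h2, h3, h4⟩ := B.exists_etale_of_isSheaf h hg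
    (B.isSheaf_sections hP h (t := t))
  refine ⟨Z, z, hz, fun W w₁ w₂ hW ↦ ?_⟩
  choose y hy using h4
  -- The counit: a section of Z over U i is an arrow P i ⟶ T, and these arrows glue on the base
  -- change W of Z.
  obtain ⟨ε, hε⟩ := B.exists_pullback_desc h hz hW hP
    (fun i s hs ↦ B.sectionHom hP h (y i s hs)) (by
      intro m i φ s hs hs' l hl1 hl2
      have e : l = B.pullbackMap hP φ := B.pullback_hom_ext' hP h (by rw [hl2, pullbackMap_snd])
      rw [e, ← sectionHom_map]
      congr 1
      exact h3 _ (by rw [h2, hy, hy]))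
  have hε' i (x : (B.sections hP h t).obj (op i)) (l : pullback (B.u i) f ⟶ W)
      (e1 : l ≫ w₁ = pullback.fst _ _ ≫ c i x) (e2 : l ≫ w₂ = pullback.snd _ _) :
      l ≫ ε = B.sectionHom hP h x := by
    rw [hε i (c i x) (h1 _ _) l e1 e2]
    congr 1
    exact h3 _ (hy _ _ _)
  refine ⟨ε, B.pullback_hom_ext h hz hW hP (fun i x hx l e1 e2 ↦ ?_),
    fun A a ha V v₁ v₂ hV ↦ ⟨fun α hα ↦ ?_, fun g g' hg hg' H ↦ ?_⟩⟩
  · rw [reassoc_of% (hε i x hx l e1 e2), sectionHom_comp, e2]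
  · have hl i (x : B.U i ⟶ A) (hx : x ≫ a = B.u i) :
        ∃ (l : pullback (B.u i) f ⟶ V) (s : (B.sections hP h t).obj (op i)),
        l ≫ v₁ = pullback.fst _ _ ≫ x ∧ l ≫ v₂ = pullback.snd _ _ ∧
          B.sectionHom hP h s = l ≫ α := by
      refine ⟨hV.lift (pullback.fst _ _ ≫ x) (pullback.snd _ _)
        (by rw [Category.assoc, hx, pullback.condition]), ?_⟩
      obtain ⟨s, hs⟩ := B.exists_sectionHom hP h
        (hV.lift (pullback.fst _ _ ≫ x) (pullback.snd _ _)
          (by rw [Category.assoc, hx, pullback.condition]) ≫ α) (by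
            rw [Category.assoc, hα, hV.lift_snd])
      exact ⟨s, hV.lift_fst _ _ _, hV.lift_snd _ _ _, hs⟩
    choose l s hl1 hl2 hs using hl
    -- The transpose of α sends a section x of A to the section of Z given by restricting α along
    -- the base change of x.
    obtain ⟨g, hg⟩ := B.exists_pullback_desc h ha (isPullback_self a) B.isPullback_id
      (fun i x hx ↦ c i (s i x hx)) (by
        intro m i φ x hx hx' k hk1 hk2
        rw [Category.comp_id, Category.id_comp] at hk1
        rw [hk1, ← h2]
        congr 1
        refine B.sectionHom_injective hP h ?_
        rw [sectionHom_map, hs, hs, ← Category.assoc]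
        congr 1
        refine hV.hom_ext ?_ ?_
        · rw [Category.assoc, hl1, hl1, pullbackMap_fst_assoc]
        · rw [Category.assoc, hl2, hl2, pullbackMap_snd])
    have hg' i x (hx : x ≫ a = B.u i) : x ≫ g = c i (s i x hx) :=
      hg i x hx x (by simp) hx
    refine ⟨g, ?_, fun k hk1 hk2 ↦ ?_⟩
    · refine B.pullback_hom_ext h ha (isPullback_self a) B.isPullback_id
        (fun i x hx k hk _ ↦ ?_)
      rw [Category.comp_id, Category.id_comp] at hk
      rw [hk, reassoc_of% (hg' i x hx), h1, hx]
    · refine B.pullback_hom_ext h ha hV hP (fun i x hx m hm1 hm2 ↦ ?_)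
      have em : m = l i x hx :=
        hV.hom_ext (by rw [hm1, hl1]) (by rw [hm2, hl2])
      rw [← Category.assoc, hε' i (s i x hx) (m ≫ k), hs, em]
      · rw [Category.assoc, hk1, reassoc_of% hm1, hg' i x hx]
      · rw [Category.assoc, hk2, hm2]
  · have hl {g : A ⟶ Z} (hg : g ≫ z = a) : ∃ l : V ⟶ W, l ≫ w₁ = v₁ ≫ g ∧ l ≫ w₂ = v₂ :=
      ⟨hW.lift (v₁ ≫ g) v₂ (by rw [Category.assoc, hg, hV.w]), hW.lift_fst _ _ _,
        hW.lift_snd _ _ _⟩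
    obtain ⟨l, hl1, hl2⟩ := hl hg
    obtain ⟨l', hl1', hl2'⟩ := hl hg'
    refine B.pullback_hom_ext h ha (isPullback_self a) B.isPullback_id (fun i x hx k hk _ ↦ ?_)
    rw [Category.comp_id, Category.id_comp] at hk
    subst hk
    have e1 : (k ≫ g) ≫ z = B.u i := by rw [Category.assoc, hg, hx]
    have e2 : (k ≫ g') ≫ z = B.u i := by rw [Category.assoc, hg', hx]
    let m := hV.lift (pullback.fst (B.u i) f ≫ k) (pullback.snd _ _)
      (by rw [Category.assoc, hx, pullback.condition])
    have hm1 : m ≫ v₁ = _ := hV.lift_fst _ _ _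
    have hm2 : m ≫ v₂ = _ := hV.lift_snd _ _ _
    rw [← hy _ _ e1, ← hy _ _ e2]
    congr 1
    refine B.sectionHom_injective hP h ?_
    rw [← hε' i _ (m ≫ l), ← hε' i _ (m ≫ l'), Category.assoc, Category.assoc,
      H l l' hl1 hl2 hl1' hl2']
    · rw [hy, Category.assoc, hl1', reassoc_of% hm1]
    · rw [Category.assoc, hl2', hm2]
    · rw [hy, Category.assoc, hl1, reassoc_of% hm1]
    · rw [Category.assoc, hl2, hm2]

/-- The direct image with its counit is terminal among the arrows from base changes to T; a functor
all of whose such comma categories have terminal objects is a left adjoint. -/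
theorem isLeftAdjoint_overPullback (h : IsDGUPresite.{w} τ) (hg : HasGluing.{w} τ) [IsClopos (etale τ)]
    {X' : C} (f : X' ⟶ X) : (MorphismProperty.Over.pullback (etale τ) ⊤ f).IsLeftAdjoint := by
  obtain ⟨B⟩ := h.nonempty_clopenBasis X
  have : LocallySmall.{w} C := ⟨h.isUPresite.isUCategory.small_hom⟩
  have (T : (etale τ).Over ⊤ X') :
      HasTerminal (CostructuredArrow (MorphismProperty.Over.pullback (etale τ) ⊤ f) T) := by
    obtain ⟨Z, z, hz, H⟩ := B.exists_directImage h.toIsDGPresite hg f T.hom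
    have hpb {A : C} (a : A ⟶ X) (ha : etale τ a) : HasPullback a f := ha.hasPullback h hg f
    have := hpb z hz
    obtain ⟨ε, hε, H⟩ := H _ _ (IsPullback.of_hasPullback z f)
    let Z' : (etale τ).Over ⊤ X := MorphismProperty.Over.mk _ z hz
    let ε' : (MorphismProperty.Over.pullback (etale τ) ⊤ f).obj Z' ⟶ T :=
      MorphismProperty.Over.homMk ε hε
    refine IsTerminal.hasTerminal (X := CostructuredArrow.mk ε') ?_
    have hex (A : CostructuredArrow (MorphismProperty.Over.pullback (etale τ) ⊤ f) T) :
        ∃ g : A ⟶ CostructuredArrow.mk ε', ∀ g', g' = g := by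
      have := hpb _ A.left.prop
      obtain ⟨H1, H2⟩ := H A.left.hom A.left.prop _ _
        (IsPullback.of_hasPullback A.left.hom f)
      obtain ⟨g, hg1, hg2⟩ := H1 A.hom.left (MorphismProperty.Over.w A.hom)
      refine ⟨CostructuredArrow.homMk (MorphismProperty.Over.homMk g hg1) ?_, fun g' ↦ ?_⟩
      · refine MorphismProperty.Over.Hom.ext (hg2 _ ?_ ?_)
        · exact pullback.lift_fst (f := z) (g := f) _ _ _
        · exact pullback.lift_snd (f := z) (g := f) _ _ _
      · refine CostructuredArrow.hom_ext _ _ (MorphismProperty.Over.Hom.ext ?_)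
        refine H2 _ _ (MorphismProperty.Over.w g'.left) hg1 (fun l l' h1 h2 h1' h2' ↦ ?_)
        refine Eq.trans ?_ (hg2 l' h1' h2').symm
        have e := congrArg (fun k ↦ k.left) (CostructuredArrow.w g')
        refine Eq.trans ?_ e
        refine congrArg (· ≫ ε) ?_
        refine pullback.hom_ext (f := z) (g := f) ?_ ?_
        · exact h1.trans (pullback.lift_fst (f := z) (g := f) _ _ _).symm
        · exact h2.trans (pullback.lift_snd (f := z) (g := f) _ _ _).symm
    choose g hg using hex
    exact IsTerminal.ofUniqueHom g hg
  exact isLeftAdjoint_of_costructuredArrowTerminals _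

end InverseImage

/-! ### Left exactness of base change -/

section FiniteLimits

variable {C : Type u₁} [Category.{v₁} C] {O : MorphismProperty C} [IsClopos O]

omit [IsClopos O] in
theorem isPullback_over {X : C} {P A B Z : O.Over ⊤ X} {p : P ⟶ A} {q : P ⟶ B} {f : A ⟶ Z}
    {g : B ⟶ Z} (h : IsPullback p.left q.left f.left g.left) : IsPullback p q f g := by
  have w : p ≫ f = q ≫ g := MorphismProperty.Over.Hom.ext h.w
  refine ⟨⟨w⟩, ⟨PullbackCone.IsLimit.mk _
    (fun s ↦ MorphismProperty.Over.homMk (h.lift s.fst.left s.snd.left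
      (congrArg (fun k ↦ k.left) s.condition)) ?_) (fun s ↦ ?_) (fun s ↦ ?_) (fun s m h1 h2 ↦ ?_)⟩⟩
  · rw [← MorphismProperty.Over.w p]
    refine (h.lift_fst_assoc _ _ _ _).trans (MorphismProperty.Over.w s.fst)
  · exact MorphismProperty.Over.Hom.ext (h.lift_fst _ _ _)
  · exact MorphismProperty.Over.Hom.ext (h.lift_snd _ _ _)
  · refine MorphismProperty.Over.Hom.ext (h.hom_ext ?_ ?_)
    · exact (congrArg (fun k ↦ k.left) h1).trans (h.lift_fst _ _ _).symm
    · exact (congrArg (fun k ↦ k.left) h2).trans (h.lift_snd _ _ _).symm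

omit [IsClopos O] in
theorem isPullback_of_comp_eq {X Y A B PA PB : C} {f : X ⟶ Y} {a : A ⟶ Y} {b : B ⟶ Y} {p : PA ⟶ A}
    {q : PA ⟶ X} {p' : PB ⟶ B} {q' : PB ⟶ X} (h1 : IsPullback p q a f) (h2 : IsPullback p' q' b f)
    {g : A ⟶ B} (hg : g ≫ b = a) {k : PA ⟶ PB} (e : k ≫ p' = p ≫ g) (e' : k ≫ q' = q) :
    IsPullback k p p' g := by
  refine IsPullback.of_right (h₁₂ := q') (h₂₂ := b) (v₁₃ := f) ?_ e h2.flip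
  rw [e', hg]
  exact h1.flip

theorem isPullback_overPullback {X Y : C} (f : X ⟶ Y) {A B : O.Over ⊤ Y} (g : A ⟶ B) :
    IsPullback ((MorphismProperty.Over.pullback O ⊤ f).map g).left (pullback.fst A.hom f)
      (pullback.fst B.hom f) g.left :=
  isPullback_of_comp_eq (IsPullback.of_hasPullback A.hom f) (IsPullback.of_hasPullback B.hom f)
    (MorphismProperty.Over.w g) (pullback.lift_fst _ _ _) (pullback.lift_snd _ _ _)

/-- By cancellation all arrows between objects of O over Y lie in O, so pullbacks exist there and
are computed in C. Base change preserves them by pasting, and it preserves the terminal object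
because isomorphisms are stable under pullback. -/
theorem preservesFiniteLimits_overPullback
    (hO : ∀ {X Y Z : C} (g : X ⟶ Y) (f : Y ⟶ Z), O (g ≫ f) → O f → O g) {X Y : C} (f : X ⟶ Y) :
    PreservesFiniteLimits (MorphismProperty.Over.pullback O ⊤ f) := by
  have key {A B Z : O.Over ⊤ Y} (a : A ⟶ Z) (b : B ⟶ Z) : ∃ (P : O.Over ⊤ Y) (p : P ⟶ A)
      (q : P ⟶ B), IsPullback p.left q.left a.left b.left := by
    have hb : O b.left := hO b.left Z.hom (by rw [MorphismProperty.Over.w]; exact B.prop) Z.prop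
    have ha : O a.left := hO a.left Z.hom (by rw [MorphismProperty.Over.w]; exact A.prop) Z.prop
    have : HasPullback a.left b.left := MorphismProperty.HasPullbacks.hasPullback _ ha
    have hP := IsPullback.of_hasPullback a.left b.left
    refine ⟨MorphismProperty.Over.mk _ (pullback.fst a.left b.left ≫ A.hom)
      (O.comp_mem _ _ (O.of_isPullback hP.flip hb) A.prop),
      MorphismProperty.Over.homMk (pullback.fst a.left b.left) rfl,
      MorphismProperty.Over.homMk (pullback.snd a.left b.left) ?_, hP⟩
    refine (congrArg (_ ≫ ·) (MorphismProperty.Over.w b)).symm.trans ?_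
    refine Eq.trans ?_ (congrArg (_ ≫ ·) (MorphismProperty.Over.w a))
    exact (pullback.condition_assoc _).symm
  have (A B Z : O.Over ⊤ Y) (a : A ⟶ Z) (b : B ⟶ Z) : HasLimit (cospan a b) := by
    obtain ⟨P, p, q, hP⟩ := key a b
    exact (isPullback_over hP).hasPullback
  have h1 : PreservesLimitsOfShape (Discrete PEmpty.{1})
      (MorphismProperty.Over.pullback O ⊤ f) := by
    have : HasPullback (𝟙 Y) f := MorphismProperty.HasPullbacks.hasPullback _ (O.id_mem Y)
    obtain ⟨r, hr1, hr2⟩ : IsIso (pullback.snd (𝟙 Y) f) :=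
      (IsPullback.of_hasPullback (𝟙 Y) f).isIso_snd_of_isIso
    refine @preservesLimitsOfShape_pempty_of_preservesTerminal _ _ _ _ _ ?_
    refine preservesLimit_of_preserves_limit_cone
      (h := (MorphismProperty.Over.mkIdTerminal O Y : IsLimit (asEmptyCone _)))
      ((isLimitMapConeEmptyConeEquiv _ _).symm ?_)
    refine IsTerminal.ofUniqueHom (fun A ↦ MorphismProperty.Over.homMk
      (A.hom ≫ r) ?_) (fun A g ↦ MorphismProperty.Over.Hom.ext ?_)
    · exact (Category.assoc _ _ _).trans ((congrArg _ hr2).trans (Category.comp_id _))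
    · refine Eq.trans ?_ (congrArg (· ≫ r) (MorphismProperty.Over.w g))
      exact ((Category.assoc _ _ _).trans ((congrArg _ hr1).trans (Category.comp_id _))).symm
  have h2 : PreservesLimitsOfShape WalkingCospan (MorphismProperty.Over.pullback O ⊤ f) := by
    constructor
    intro K
    suffices H : ∀ {A B Z : O.Over ⊤ Y} (a : A ⟶ Z) (b : B ⟶ Z),
        PreservesLimit (cospan a b) (MorphismProperty.Over.pullback O ⊤ f) by
      have := H (K.map WalkingCospan.Hom.inl) (K.map WalkingCospan.Hom.inr)
      exact preservesLimit_of_iso_diagram _ (diagramIsoCospan K).symm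
    intro A B Z a b
    obtain ⟨P, p, q, hP⟩ := key a b
    refine preservesLimit_of_preserves_limit_cone (isPullback_over hP).isLimit
      ((isLimitMapConePullbackConeEquiv _ (isPullback_over hP).w).symm
        (IsPullback.isLimit (isPullback_over ?_)))
    have e1 := isPullback_overPullback f p
    have e2 : (fun k ↦ k.left) ((MorphismProperty.Over.pullback O ⊤ f).map p ≫
        (MorphismProperty.Over.pullback O ⊤ f).map a) = (fun k ↦ k.left)
        ((MorphismProperty.Over.pullback O ⊤ f).map q ≫
          (MorphismProperty.Over.pullback O ⊤ f).map b) := by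
      rw [← Functor.map_comp, ← Functor.map_comp, (isPullback_over hP).w]
    -- In the cube, the three squares comparing base changes with the original objects are
    -- pullbacks. Stacking them on the square hP shows that the base changed square is one.
    refine IsPullback.of_bot ?_ e2 (isPullback_overPullback f b)
    rw [(isPullback_overPullback f q).w, (isPullback_overPullback f a).w]
    exact e1.paste_vert hP
  have := hasPullbacks_of_hasLimit_cospan (O.Over ⊤ Y)
  exact preservesFiniteLimits_of_preservesTerminal_and_pullbacks _

end FiniteLimits

/-! ### Presites with gluing are nearly glutoses -/

section Glutos

variable {C : Type u₁} [Category.{v₁} C] {τ : Precoverage C}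

/-- The étale arrows of a DG-`U`-presite with gluing form a glutos. -/
theorem etale.isGlutos (h : IsDGUPresite.{w} τ) (hg : HasGluing.{w} τ) :
    IsGlutos.{w} (etale τ) where
  isUCategory := h.isUPresite.isUCategory
  isClopos := etale.isClopos h hg
  of_comp _ _ h1 h2 := h1.of_comp h.toIsDGPresite h2
  isUTopos_over := etale.isUTopos_over h hg
  isInverseImage_pullback f := by
    have := etale.isClopos h hg
    exact ⟨preservesFiniteLimits_overPullback (fun _ _ h1 h2 ↦ h1.of_comp h.toIsDGPresite h2) f,
      isLeftAdjoint_overPullback h hg f⟩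
  exists_coproduct X := by
    obtain ⟨Y, u, hu, hY⟩ := hg.exists_coproduct h.toIsDGPresite X
    exact ⟨hY.coproductDisjoint h.toIsDGPresite hu, Cofan.mk Y u,
      hY.isUniversalColimit h.subcanonical, fun i ↦ etale_of_clopen h.isPresite (hu i)⟩
  desc_mem u hu c hc := etale.desc_mem h hg u hu c hc
  effectiveEpi _ h1 h2 := effectiveEpi_of_generate_mem h.subcanonical
    (hg.generate_mem_of_epi h.toIsDGPresite h1 h2)
  of_epi_comp p f h1 h2 h3 := etale.of_epi_comp h hg p f h1 h2 h3
  exists_coequalizer r s hrs hr _ hl := etale.exists_coequalizer h hg r s hrs hr hl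
  hasPullback_of_epi a b r g f h1 h2 h3 := etale.hasPullback_of_epi h hg a b r g f h1 h2 h3

theorem isContinuous_id (τ : Precoverage C) : IsContinuous τ τ (𝟭 C) where
  map_mem {X} S hS := by
    have e : S.map (𝟭 C) = S := by
      funext Y
      ext f
      constructor
      · rintro ⟨hf⟩
        exact hf
      · intro hf
        exact Presieve.map.of (F := 𝟭 C) hf
    rwa [e]
  map_isPullback _ h := h

theorem isEquivalence_precomp_id {E : Type u₂} [Category.{v₂} E] (ρ : Precoverage E) :
    (precomp (isContinuous_id τ) ρ).IsEquivalence :=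
  Functor.isEquivalence_of_iso (F := 𝟭 _) (NatIso.ofComponents (fun F ↦
    ObjectProperty.isoMk _ (Functor.leftUnitor F.obj).symm) (fun {F G} f ↦ by
      ext X
      change f.hom.app X ≫ 𝟙 _ = 𝟙 _ ≫ f.hom.app X
      rw [Category.comp_id, Category.id_comp]))

/-- A DG-`U`-presite with gluing is a nearly `U`-glutos. -/
theorem HasGluing.isNearlyGlutos (h : IsDGUPresite.{w} τ) (hg : HasGluing.{w} τ) :
    IsNearlyGlutos.{w} τ :=
  -- C with its étale arrows is a universal glutos for its own presite of étale coverings, along the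
  -- identity functor; restricting to monic coverings gives back τ.
  ⟨h.isUPresite, C, inferInstance, epiCoverings (etale τ), C, inferInstance, etale τ, 𝟭 C,
    epiCoverings_etale_isUPresite h hg,
    ⟨etale.isGlutos h hg, isContinuous_id _, fun _ _ _ _ ↦ isEquivalence_precomp_id _⟩,
    by
      rw [monoCoverings_etale h.toIsDGPresite hg]
      exact ⟨.refl, isContinuous_id _, isContinuous_id _⟩⟩

end Glutos

/-! ### Gluing in a glutos -/

section GlutosGluing

variable {C : Type u₁} [Category.{v₁} C]

/-- The family `u` exhibits `X` as the coproduct of the objects `U i`. -/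
def IsSum {ι : Type*} {U : ι → C} {X : C} (u : ∀ i, U i ⟶ X) : Prop :=
  ∀ ⦃Z : C⦄ (f : ∀ i, U i ⟶ Z), ∃! g : X ⟶ Z, ∀ i, u i ≫ g = f i

theorem IsSum.hom_ext {ι : Type*} {U : ι → C} {X : C} {u : ∀ i, U i ⟶ X} (hu : IsSum u) {Z : C}
    {f g : X ⟶ Z} (h : ∀ i, u i ≫ f = u i ≫ g) : f = g :=
  (hu (fun i ↦ u i ≫ g)).unique h (fun _ ↦ rfl)

theorem IsSum.exists_desc {ι : Type*} {U : ι → C} {X : C} {u : ∀ i, U i ⟶ X} (hu : IsSum u)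
    {Z : C} (f : ∀ i, U i ⟶ Z) : ∃ g : X ⟶ Z, ∀ i, u i ≫ g = f i :=
  (hu f).exists

/-- The coproducts of a glutos. -/
structure IsDisjointSum (O : MorphismProperty C) {ι : Type*} {U : ι → C} {X : C}
    (u : ∀ i, U i ⟶ X) : Prop where
  isSum : IsSum u
  mem : ∀ i, O (u i)
  mono : ∀ i, Mono (u i)
  exists_isSum : ∀ ⦃T : C⦄ (x : T ⟶ X), ∃ (V : ι → C) (v : ∀ i, V i ⟶ T) (y : ∀ i, V i ⟶ U i),
    IsSum v ∧ ∀ i, v i ≫ x = y i ≫ u i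
  initial : ∀ ⦃i j : ι⦄ ⦃T : C⦄ (a : T ⟶ U i) (b : T ⟶ U j), a ≫ u i = b ≫ u j → i ≠ j →
    ∀ Z : C, Nonempty (Unique (T ⟶ Z))
  desc_mem : ∀ ⦃Z : C⦄ (g : X ⟶ Z), (∀ i, O (u i ≫ g)) → O g

variable {O : MorphismProperty C}

theorem isSum_of_isColimit {ι : Type*} {U : ι → C} {c : Cofan U} (hc : IsColimit c) :
    IsSum c.inj := fun _ f ↦
  ⟨Cofan.IsColimit.desc hc f, fun i ↦ Cofan.IsColimit.fac hc f i, fun _ hg ↦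
    Cofan.IsColimit.hom_ext hc _ _ (fun i ↦ (hg i).trans (Cofan.IsColimit.fac hc f i).symm)⟩

/-- Universality of the coproduct, in elementwise form: the pullbacks of the injections along x
exhibit T as their coproduct. -/
theorem IsGlutos.exists_isSum (h : IsGlutos.{w} O) {ι : Type w} {U : ι → C} {c : Cofan U}
    (hc : IsUniversalColimit c) (hO : ∀ i, O (c.inj i)) {T : C} (x : T ⟶ c.pt) :
    ∃ (V : ι → C) (v : ∀ i, V i ⟶ T) (y : ∀ i, V i ⟶ U i),
    IsSum v ∧ ∀ i, v i ≫ x = y i ≫ c.inj i := by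
  have := h.isClopos
  have (i : ι) : HasPullback (c.inj i) x := MorphismProperty.HasPullbacks.hasPullback _ (hO i)
  have hP (i : ι) := IsPullback.of_hasPullback (c.inj i) x
  obtain ⟨hl⟩ := hc (F' := Discrete.functor fun i ↦ pullback (c.inj i) x)
    (Cofan.mk T (fun i ↦ pullback.snd (c.inj i) x))
    (Discrete.natTrans fun ⟨i⟩ ↦ pullback.fst (c.inj i) x) x (by
      ext ⟨i⟩
      exact (hP i).w) (NatTrans.Equifibered.of_discrete _) (fun ⟨i⟩ ↦ (hP i).flip)
  exact ⟨_, _, _, isSum_of_isColimit hl, fun i ↦ (hP i).w.symm⟩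

theorem IsGlutos.exists_isDisjointSum (h : IsGlutos.{w} O) {ι : Type w} (U : ι → C) :
    ∃ (X : C) (u : ∀ i, U i ⟶ X), IsDisjointSum O u := by
  have := h.isClopos
  obtain ⟨hd, c, hc, hO⟩ := h.exists_coproduct U
  have hc' := hc.isColimit
  refine ⟨c.pt, c.inj, isSum_of_isColimit hc', hO, hd.mono_inj hc', fun _ x ↦ h.exists_isSum hc hO x,
    fun i j T a b e hij Z ↦ ?_, fun Z g hg ↦ ?_⟩
  · have : HasPullback (c.inj i) (c.inj j) := MorphismProperty.HasPullbacks.hasPullback _ (hO i)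
    obtain ⟨hI⟩ := hd.nonempty_isInitial_of_ne hc' hij _ (pullbackIsPullback (c.inj i) (c.inj j))
    -- The initial object is strict: T maps to the empty coproduct c₀, and universality makes T
    -- itself an empty coproduct.
    obtain ⟨-, c₀, hc₀, hO₀⟩ := h.exists_coproduct (fun i : PEmpty.{w + 1} ↦ (i.elim : C))
    have hs := isSum_of_isColimit hc₀.isColimit
    obtain ⟨g, -⟩ := hs.exists_desc (Z := c₀.pt) (fun i ↦ i.elim)
    obtain ⟨V, v, y, hv, -⟩ := h.exists_isSum hc₀ hO₀
      (pullback.lift a b e ≫ hI.to c₀.pt)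
    obtain ⟨g, -, hg⟩ := hv (Z := Z) (fun i ↦ i.elim)
    exact ⟨⟨⟨g⟩, fun g' ↦ hg g' (fun i ↦ i.elim)⟩⟩
  · have := h.desc_mem _ hg c hc'
    rwa [show Cofan.IsColimit.desc hc' (fun i ↦ c.inj i ≫ g) = g from
      Cofan.IsColimit.hom_ext hc' _ _ (fun i ↦ Cofan.IsColimit.fac hc' _ i)] at this

variable {ι : Type w} {U : ι → C} {X : C} {u : ∀ i, U i ⟶ X}

/-- An arrow which is local on its source. -/
theorem IsGlutos.mem_of_isEpiSink (h : IsGlutos.{w} O) (hu : ∀ i, O (u i))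
    (hu' : IsEpiSink (Presieve.ofArrows U u)) {Y : C} {f : X ⟶ Y} (hf : ∀ i, O (u i ≫ f)) :
    O f := by
  obtain ⟨S, s, hs⟩ := h.exists_isDisjointSum U
  obtain ⟨d, hd⟩ := hs.isSum.exists_desc u
  refine h.of_epi_comp d f (hs.desc_mem _ fun i ↦ ?_) (hs.desc_mem _ fun i ↦ ?_) ⟨fun a b e ↦ ?_⟩
  · rw [reassoc_of% (hd i)]
    exact hf i
  · rw [hd]
    exact hu i
  · refine hu' a b ?_
    rintro _ _ ⟨i⟩
    rw [← hd, Category.assoc, e, Category.assoc]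

/-- The arrow from the coproduct of the U i to X is an epimorphism in O, hence effective. The
condition for descent is checked on the summands into which its test object decomposes. -/
theorem IsGlutos.exists_desc_of_isEpiSink (h : IsGlutos.{w} O) (hu : ∀ i, O (u i))
    (hu' : IsEpiSink (Presieve.ofArrows U u)) {Z : C} (f : ∀ i, U i ⟶ Z)
    (hf : ∀ i j (Q : C) (a : Q ⟶ U i) (b : Q ⟶ U j), a ≫ u i = b ≫ u j → a ≫ f i = b ≫ f j) :
    ∃ g : X ⟶ Z, ∀ i, u i ≫ g = f i := by
  obtain ⟨S, s, hs⟩ := h.exists_isDisjointSum U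
  obtain ⟨d, hd⟩ := hs.isSum.exists_desc u
  obtain ⟨e, he⟩ := hs.isSum.exists_desc f
  have := h.effectiveEpi d (hs.desc_mem _ fun i ↦ by rw [hd]; exact hu i) ⟨fun a b e ↦ by
    refine hu' a b ?_
    rintro _ _ ⟨i⟩
    rw [← hd, Category.assoc, e, Category.assoc]⟩
  refine ⟨EffectiveEpi.desc d e (fun {T} g₁ g₂ hg ↦ ?_), fun i ↦ ?_⟩
  · obtain ⟨V, v, x, hv, hx⟩ := hs.exists_isSum g₁
    refine hv.hom_ext fun i ↦ ?_
    obtain ⟨V', v', y, hv', hy⟩ := hs.exists_isSum (v i ≫ g₂)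
    refine hv'.hom_ext fun j ↦ ?_
    rw [reassoc_of% (hx i), he, reassoc_of% (hy j), he, ← Category.assoc]
    refine hf _ _ _ _ _ ?_
    rw [← hd, ← hd, Category.assoc, ← reassoc_of% (hx i), hg, reassoc_of% (hy j)]
  · rw [← hd, Category.assoc, EffectiveEpi.fac, he]

theorem clopen_monoCoverings_iff [O.ContainsIdentities] {X Y : C} {f : X ⟶ Y} :
    clopen (monoCoverings (epiCoverings O)) f ↔ O f ∧ Mono f := by
  constructor
  · rintro ⟨S, hS, hf⟩
    exact ⟨hS.1.1 _ hf, hS.2 _ hf⟩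
  · intro hf
    refine ⟨fun Z g ↦ O g ∧ Mono g, ⟨⟨fun _ _ h ↦ h.1, fun Z a b e ↦ ?_⟩, fun _ _ h ↦ h.2⟩, hf⟩
    simpa using e (𝟙 Y) ⟨O.id_mem Y, inferInstance⟩

section

variable {ρ : Precoverage C} {rel : ∀ ⦃T : C⦄ (i j : ι), (T ⟶ U i) → (T ⟶ U j) → Prop}

theorem IsGlueRel.comp (hr : IsGlueRel ρ U rel) {i j : ι} {T T' : C} (k : T' ⟶ T)
    {x : T ⟶ U i} {y : T ⟶ U j} (h : rel i j x y) : rel i j (k ≫ x) (k ≫ y) := by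
  obtain ⟨W, a, b, -, -, hW⟩ := hr.exists_rep i j
  obtain ⟨t, rfl, rfl⟩ := (hW _ _).1 h
  exact (hW _ _).2 ⟨k ≫ t, Category.assoc _ _ _, Category.assoc _ _ _⟩

theorem IsGlueRel.of_isSum (hr : IsGlueRel ρ U rel) {i j : ι} {κ : Type*} {T : C} {V : κ → C}
    {v : ∀ k, V k ⟶ T} (hv : IsSum v) {x : T ⟶ U i} {y : T ⟶ U j}
    (h : ∀ k, rel i j (v k ≫ x) (v k ≫ y)) : rel i j x y := by
  obtain ⟨W, a, b, -, -, hW⟩ := hr.exists_rep i j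
  choose t ht ht' using fun k ↦ (hW _ _).1 (h k)
  obtain ⟨g, hg⟩ := hv.exists_desc t
  exact (hW _ _).2 ⟨g, hv.hom_ext fun k ↦ by rw [reassoc_of% (hg k), ht],
    hv.hom_ext fun k ↦ by rw [reassoc_of% (hg k), ht']⟩

/-- By disjointness either i = j, and u i is monic, or T is initial, and every relation holds over
it. -/
theorem IsGlueRel.of_comp_eq (hr : IsGlueRel ρ U rel) (hu : IsDisjointSum O u) {i j : ι}
    {T : C} {x : T ⟶ U i} {y : T ⟶ U j} (h : x ≫ u i = y ≫ u j) : rel i j x y := by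
  by_cases hij : i = j
  · subst hij
    have := hu.mono i
    rw [hr.self_iff]
    rwa [cancel_mono] at h
  · obtain ⟨W, a, b, -, -, hW⟩ := hr.exists_rep i j
    have hT := hu.initial x y h hij
    refine (hW _ _).2 ⟨(hT W).some.default, ?_, ?_⟩
    · obtain ⟨hT⟩ := hT (U i)
      exact Subsingleton.elim _ _
    · obtain ⟨hT⟩ := hT (U j)
      exact Subsingleton.elim _ _

end

/-- Objects can be glued in a glutos. -/
theorem IsGlutos.exists_isGlue (h : IsGlutos.{w} O) {U : ι → C}
    {rel : ∀ ⦃T : C⦄ (i j : ι), (T ⟶ U i) → (T ⟶ U j) → Prop}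
    (hr : IsGlueRel (monoCoverings (epiCoverings O)) U rel) :
    ∃ (Q : C) (c : ∀ i, U i ⟶ Q), IsGlue (monoCoverings (epiCoverings O)) U rel Q c := by
  have := h.isClopos
  obtain ⟨X, u, hu⟩ := h.exists_isDisjointSum U
  choose W a b ha hb hW using hr.exists_rep
  -- X is the coproduct of the objects, R that of the overlaps; r and s become an equivalence
  -- relation on X whose quotient is the glued object.
  obtain ⟨R, p, hp⟩ := h.exists_isDisjointSum (fun k : ι × ι ↦ W k.1 k.2)
  obtain ⟨r, hr'⟩ := hp.isSum.exists_desc (fun k ↦ a k.1 k.2 ≫ u k.1)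
  obtain ⟨s, hs⟩ := hp.isSum.exists_desc (fun k ↦ b k.1 k.2 ≫ u k.2)
  have hO {i} : O (u i) := hu.mem i
  have hrO : O r := hp.desc_mem _ fun k ↦ by
    rw [hr']
    exact O.comp_mem _ _ (clopen_monoCoverings_iff.1 (ha _ _)).1 hO
  have hsO : O s := hp.desc_mem _ fun k ↦ by
    rw [hs]
    exact O.comp_mem _ _ (clopen_monoCoverings_iff.1 (hb _ _)).1 hO
  have hrel i j : rel i j (a i j) (b i j) := (hW i j _ _).2 ⟨𝟙 _, by simp, by simp⟩
  -- The relation on X described by components: wherever both elements lie in summands, the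
  -- components are related. It is shown to be the relation represented by R, and the equivalence
  -- axioms are read off from those of `rel`.
  let P : ∀ ⦃T : C⦄, (T ⟶ X) → (T ⟶ X) → Prop := fun T x y ↦
    ∀ i j (T' : C) (k : T' ⟶ T) (x' : T' ⟶ U i) (y' : T' ⟶ U j), k ≫ x = x' ≫ u i →
      k ≫ y = y' ≫ u j → rel i j x' y'
  have hP {T : C} (x y : T ⟶ X) : (∃ t : T ⟶ R, t ≫ r = x ∧ t ≫ s = y) ↔ P x y := by
    constructor
    · rintro ⟨t, rfl, rfl⟩ i j T' k x' y' hx hy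
      obtain ⟨V, v, z, hv, hz⟩ := hp.exists_isSum (k ≫ t)
      refine hr.of_isSum hv fun l ↦ ?_
      have e1 : rel i l.1 (v l ≫ x') (z l ≫ a l.1 l.2) := hr.of_comp_eq hu (by
        rw [Category.assoc, ← hx, reassoc_of% (hz l), hr', Category.assoc])
      have e2 : rel l.2 j (z l ≫ b l.1 l.2) (v l ≫ y') := hr.of_comp_eq hu (by
        rw [Category.assoc, Category.assoc, ← hy, reassoc_of% (hz l), hs])
      exact hr.trans _ _ _ _ _ _ e1 (hr.trans _ _ _ _ _ _ (hr.comp _ (hrel _ _)) e2)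
    · intro H
      obtain ⟨V, v, x', hv, hx⟩ := hu.exists_isSum x
      have h1 (i) : ∃ t : V i ⟶ R, t ≫ r = v i ≫ x ∧ t ≫ s = v i ≫ y := by
        obtain ⟨V', v', y', hv', hy⟩ := hu.exists_isSum (v i ≫ y)
        have h2 (j) := (hW i j _ _).1 (H i j (V' j) (v' j ≫ v i) (v' j ≫ x' i) (y' j)
          (by rw [Category.assoc, hx, Category.assoc]) (by rw [Category.assoc, hy]))
        choose t ht ht' using h2
        obtain ⟨g, hg⟩ := hv'.exists_desc (fun j ↦ t j ≫ p (i, j))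
        refine ⟨g, hv'.hom_ext fun j ↦ ?_, hv'.hom_ext fun j ↦ ?_⟩
        · rw [reassoc_of% (hg j), hr', reassoc_of% (ht j), hx]
        · rw [reassoc_of% (hg j), hs, reassoc_of% (ht' j), hy]
      choose t ht ht' using h1
      obtain ⟨g, hg⟩ := hv.exists_desc t
      exact ⟨g, hv.hom_ext fun j ↦ by rw [reassoc_of% (hg j), ht],
        hv.hom_ext fun j ↦ by rw [reassoc_of% (hg j), ht']⟩
  have heq : IsEquivRel r s := by
    refine ⟨fun T x y hx hy ↦ ?_, fun T ↦ ⟨fun x ↦ ?_, fun {x y} h ↦ ?_, fun {x y z} h1 h2 ↦ ?_⟩⟩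
    · obtain ⟨V, v, x', hv, hx'⟩ := hp.exists_isSum x
      refine hv.hom_ext fun k ↦ ?_
      obtain ⟨V', v', y', hv', hy'⟩ := hp.exists_isSum (v k ≫ y)
      refine hv'.hom_ext fun l ↦ ?_
      have e1 : (v' l ≫ x' k ≫ a k.1 k.2) ≫ u k.1 = (y' l ≫ a l.1 l.2) ≫ u l.1 := by
        simp only [Category.assoc]
        rw [← hr', ← hr', ← reassoc_of% (hy' l), ← reassoc_of% (hx' k), hx]
      have e2 : (v' l ≫ x' k ≫ b k.1 k.2) ≫ u k.2 = (y' l ≫ b l.1 l.2) ≫ u l.2 := by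
        simp only [Category.assoc]
        rw [← hs, ← hs, ← reassoc_of% (hy' l), ← reassoc_of% (hx' k), hy]
      by_cases hkl : k = l
      · subst hkl
        have := hu.mono k.1
        have := (clopen_monoCoverings_iff.1 (ha k.1 k.2)).2
        rw [cancel_mono, ← Category.assoc, cancel_mono] at e1
        rw [hx' k, hy' k, reassoc_of% e1]
      -- In distinct summands of R, equal first or second projections force the test object to be
      -- initial, by disjointness of X.
      · have : k.1 ≠ l.1 ∨ k.2 ≠ l.2 := by
          by_contra! H
          exact hkl (Prod.ext H.1 H.2)
        obtain hk | hk := this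
        · obtain ⟨hT⟩ := hu.initial _ _ e1 hk R
          exact Subsingleton.elim _ _
        · obtain ⟨hT⟩ := hu.initial _ _ e2 hk R
          exact Subsingleton.elim _ _
    · exact (hP x x).2 fun i j T' k x' y' hx hy ↦ hr.of_comp_eq hu (by rw [← hx, hy])
    · rw [hP] at h ⊢
      exact fun i j T' k x' y' hx hy ↦ hr.symm _ _ _ _ (h _ _ _ k _ _ hy hx)
    · rw [hP] at h1 h2 ⊢
      intro i j T' k x' y' hx hy
      obtain ⟨V, v, z, hv, hz⟩ := hu.exists_isSum (k ≫ y)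
      refine hr.of_isSum hv fun l ↦ ?_
      exact hr.trans _ _ _ _ _ _
        (h1 _ _ _ (v l ≫ k) _ (z l) (by rw [Category.assoc, hx, Category.assoc])
          (by rw [Category.assoc, hz]))
        (h2 _ _ _ (v l ≫ k) (z l) _ (by rw [Category.assoc, hz])
          (by rw [Category.assoc, hy, Category.assoc]))
  have hPu {T : C} {i j : ι} (x : T ⟶ U i) (y : T ⟶ U j) :
      rel i j x y ↔ P (x ≫ u i) (y ≫ u j) := by
    constructor
    · intro H i' j' T' k x' y' hx hy
      exact hr.trans _ _ _ _ _ _ (hr.of_comp_eq hu (by rw [← hx, Category.assoc]))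
        (hr.trans _ _ _ _ _ _ (hr.comp k H) (hr.of_comp_eq hu (by rw [← hy, Category.assoc])))
    · intro H
      exact H i j T (𝟙 _) x y (Category.id_comp _) (Category.id_comp _)
  -- On each U i the induced relation is equality, so the identity coequalizes it.
  have hloc : IsLocallyCoequalizable O r s := by
    refine ⟨Presieve.ofArrows U u, fun Z f g e ↦ hu.isSum.hom_ext fun i ↦ e _ (.mk i), ?_⟩
    rintro _ _ ⟨i⟩
    refine ⟨hO, U i, 𝟙 _, O.id_mem _, fun T x y t e1 e2 ↦ ?_⟩
    rw [(hr.self_iff i x y).1 ((hPu x y).2 ((hP _ _).1 ⟨t, e1, e2⟩))]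
  obtain ⟨Q, q, hq, hqO, hQ, hcol⟩ := h.exists_coequalizer r s heq hrO hsO hloc
  have hrel_iff {T : C} (i j : ι) (x : T ⟶ U i) (y : T ⟶ U j) :
      rel i j x y ↔ x ≫ u i ≫ q = y ≫ u j ≫ q := by
    rw [hPu, ← hP]
    constructor
    · rintro ⟨t, e1, e2⟩
      rw [← Category.assoc, ← e1, ← Category.assoc y, ← e2, Category.assoc, hq, Category.assoc]
    · intro e
      exact ⟨hQ.lift (x ≫ u i) (y ≫ u j) (by simpa using e), hQ.lift_fst _ _ _, hQ.lift_snd _ _ _⟩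
  refine ⟨Q, fun i ↦ u i ≫ q, ⟨⟨?_, fun Z f g e ↦ ?_⟩, ?_⟩, fun T i j x y ↦ hrel_iff i j x y⟩
  · rintro _ _ ⟨i⟩
    exact O.comp_mem _ _ hO hqO
  · refine Cofork.IsColimit.hom_ext hcol.isColimit (hu.isSum.hom_ext fun i ↦ ?_)
    simpa using e _ (.mk i)
  · rintro _ _ ⟨i⟩
    exact ⟨fun x y e ↦ (hr.self_iff i x y).1 ((hrel_iff i i x y).2 e)⟩

end GlutosGluing

/-! ### Nearly glutoses are DG-presites with gluing -/

section Small

variable {C : Type u₁} [Category.{v₁} C] {τ : Precoverage C}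

/-- Every family of clopen arrows can be refined by a small subfamily. -/
theorem IsUPresite.exists_small_family (h : IsUPresite.{w} τ) {X : C} {κ : Type*} {U : κ → C}
    (u : ∀ k, U k ⟶ X) (hu : ∀ k, clopen τ (u k)) : ∃ (I : Type w) (c : I → κ), ∀ k,
      ∃ (L : Type w) (V : L → C) (r : ∀ l, V l ⟶ U k), Presieve.ofArrows V r ∈ τ (U k) ∧
        ∀ l, ∃ i, ∃ a : V l ⟶ U (c i), a ≫ u (c i) = r l ≫ u k := by
  obtain ⟨G, hG, hG'⟩ := h.exists_generators X
  have hs (V W : C) := h.isUCategory.small_hom V W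
  choose R hR hRG using fun k ↦ hG' (u k) (hu k)
  -- S collects the arrows from generators to X that arise by covering the members of the family.
  -- For each of them one member through which it factors is selected; these members form the small
  -- subfamily.
  let S := {s : Σ V : G, ((V : C) ⟶ X) // ∃ k, ∃ f : (s.1 : C) ⟶ U k, R k f ∧ f ≫ u k = s.2}
  have : Small.{w} S := inferInstance
  let c : Shrink.{w} S → κ := fun i ↦ ((equivShrink S).symm i).2.choose
  refine ⟨Shrink.{w} S, c, fun k ↦ ?_⟩
  let L := {s : Σ V : G, ((V : C) ⟶ U k) // R k s.2}
  have : Small.{w} L := inferInstance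
  refine ⟨Shrink.{w} L, fun l ↦ ((equivShrink L).symm l).1.1, fun l ↦ ((equivShrink L).symm l).1.2,
    ?_, fun l ↦ ?_⟩
  · have e : Presieve.ofArrows (fun l ↦ (((equivShrink L).symm l).1.1 : C))
        (fun l ↦ ((equivShrink L).symm l).1.2) = R k := by
      refine le_antisymm ?_ ?_
      · rintro _ _ ⟨l⟩
        exact ((equivShrink L).symm l).2
      · intro V f hf
        let l : L := ⟨⟨⟨V, hRG k f hf⟩, f⟩, hf⟩
        suffices ∀ l' : L, l' = l → Presieve.ofArrows (fun l ↦ (((equivShrink L).symm l).1.1 : C))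
            (fun l ↦ ((equivShrink L).symm l).1.2) l'.1.2 from this l rfl
        intro l' _
        obtain ⟨m, rfl⟩ := (equivShrink L).symm.surjective l'
        exact Presieve.ofArrows.mk (Y := fun l ↦ (((equivShrink L).symm l).1.1 : C))
          (f := fun l ↦ ((equivShrink L).symm l).1.2) m
    rw [e]
    exact hR k
  · set l' := (equivShrink L).symm l
    let s : S := ⟨⟨l'.1.1, l'.1.2 ≫ u k⟩, k, l'.1.2, l'.2, rfl⟩
    obtain ⟨f, -, hf⟩ := ((equivShrink S).symm (equivShrink S s)).2.choose_spec
    generalize hm : equivShrink S s = m at f hf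
    have hm' : (equivShrink S).symm m = s := by rw [← hm, Equiv.symm_apply_apply]
    refine ⟨m, ?_⟩
    change ∃ a : l'.1.1.1 ⟶ U ((equivShrink S).symm m).2.choose, _
    have key (s' : S) (e : s' = s) (k' : κ) (f : (s'.1.1 : C) ⟶ U k') (hf : f ≫ u k' = s'.1.2) :
        ∃ a : (l'.1.1 : C) ⟶ U k', a ≫ u k' = l'.1.2 ≫ u k := by
      subst e
      exact ⟨f, hf⟩
    exact key _ hm' _ f hf

end Small

section Nearly

variable {C : Type u₁} [Category.{v₁} C] {τ : Precoverage C} {G : Type u₂} [Category.{v₂} G]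
  {O : MorphismProperty G} {e : C ≌ G}

theorem clopen_iff_of_equivalence [O.ContainsIdentities] (hτ : IsPresite τ)
    (h1 : IsContinuous τ (monoCoverings (epiCoverings O)) e.functor)
    (h2 : IsContinuous (monoCoverings (epiCoverings O)) τ e.inverse) {X Y : C} {f : X ⟶ Y} :
    clopen τ f ↔ O (e.functor.map f) ∧ Mono f := by
  constructor
  · intro hf
    obtain ⟨h3, h4⟩ := clopen_monoCoverings_iff.1 (h1.map_clopen hf)
    exact ⟨h3, e.functor.mono_of_mono_map h4⟩
  · rintro ⟨h3, h4⟩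
    have := h2.map_clopen (clopen_monoCoverings_iff.2 ⟨h3, inferInstance⟩)
    have e1 : f = e.unit.app X ≫ e.inverse.map (e.functor.map f) ≫ e.unitInv.app Y := by simp
    rw [e1]
    exact clopen.comp hτ (clopen_of_isIso hτ _) (clopen.comp hτ this (clopen_of_isIso hτ _))

theorem isEpiSink_map_iff {X : C} {S : Presieve X} :
    IsEpiSink (S.map e.functor) ↔ IsEpiSink S := by
  constructor
  · intro h Z a b hab
    refine e.functor.map_injective (h _ _ ?_)
    rintro _ _ ⟨hf⟩
    rw [← e.functor.map_comp, hab _ hf, e.functor.map_comp]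
  · intro h Z a b hab
    rw [← cancel_mono (e.counitInv.app Z)]
    obtain ⟨a', ha⟩ := e.functor.map_surjective (a ≫ e.counitInv.app Z)
    obtain ⟨b', hb⟩ := e.functor.map_surjective (b ≫ e.counitInv.app Z)
    rw [← ha, ← hb]
    congr 1
    refine h _ _ fun Y f hf ↦ e.functor.map_injective ?_
    rw [e.functor.map_comp, e.functor.map_comp, ha, hb, ← Category.assoc, ← Category.assoc,
      hab _ (Presieve.map_map hf)]

theorem mem_iff_of_equivalence [O.ContainsIdentities] (hτ : IsPresite τ)
    (h1 : IsContinuous τ (monoCoverings (epiCoverings O)) e.functor)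
    (h2 : IsContinuous (monoCoverings (epiCoverings O)) τ e.inverse) {X : C} {S : Presieve X} :
    S ∈ τ X ↔ IsClopenSink τ S ∧ IsEpiSink S := by
  constructor
  · intro hS
    exact ⟨fun _ _ hf ↦ ⟨S, hS, hf⟩, isEpiSink_map_iff.1 (h1.map_mem S hS).1.2⟩
  · rintro ⟨h3, h4⟩
    have h5 : S.map e.functor ∈ monoCoverings (epiCoverings O) (e.functor.obj X) := by
      refine ⟨⟨?_, isEpiSink_map_iff.2 h4⟩, ?_⟩
      · rintro _ _ ⟨hf⟩
        exact ((clopen_iff_of_equivalence hτ h1 h2).1 (h3 _ hf)).1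
      · rintro _ _ ⟨hf⟩
        have := ((clopen_iff_of_equivalence hτ h1 h2).1 (h3 _ hf)).2
        infer_instance
    have h6 := h2.map_mem _ h5
    obtain ⟨ι, U, u, rfl⟩ := S.exists_eq_ofArrows
    rw [Presieve.map_ofArrows, Presieve.map_ofArrows] at h6
    -- Going to G and back yields a covering of an object only isomorphic to X; base change along
    -- the unit returns the original sink.
    refine Precoverage.mem_coverings_of_isPullback _ h6 (e.unit.app X)
      (fun i ↦ u i) (fun i ↦ e.unit.app (U i)) (fun i ↦ ?_)
    exact (IsPullback.of_vert_isIso ⟨by simp⟩)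

theorem IsGlutos.exists_desc_of_equivalence (h : IsGlutos.{w} O) (e : C ≌ G) {ι : Type w}
    {U : ι → C} {X : C} {u : ∀ i, U i ⟶ X} (hu : ∀ i, O (e.functor.map (u i)))
    (hu' : IsEpiSink (Presieve.ofArrows U u)) {Z : C} (f : ∀ i, U i ⟶ Z)
    (hf : ∀ i j (Q : C) (a : Q ⟶ U i) (b : Q ⟶ U j), a ≫ u i = b ≫ u j → a ≫ f i = b ≫ f j) :
    ∃ g : X ⟶ Z, ∀ i, u i ≫ g = f i := by
  rw [← isEpiSink_map_iff (e := e), Presieve.map_ofArrows] at hu'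
  obtain ⟨g, hg⟩ := h.exists_desc_of_isEpiSink hu hu' (fun i ↦ e.functor.map (f i)) (by
    intro i j Q a b hab
    obtain ⟨a', ha⟩ := e.functor.map_surjective (e.counit.app Q ≫ a)
    obtain ⟨b', hb⟩ := e.functor.map_surjective (e.counit.app Q ≫ b)
    rw [← cancel_epi (e.counit.app Q), ← Category.assoc, ← ha, ← Category.assoc, ← hb,
      ← e.functor.map_comp, ← e.functor.map_comp, hf]
    refine e.functor.map_injective ?_
    rw [e.functor.map_comp, e.functor.map_comp, ha, hb, Category.assoc, Category.assoc, hab])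
  obtain ⟨g', rfl⟩ := e.functor.map_surjective g
  exact ⟨g', fun i ↦ e.functor.map_injective (by rw [e.functor.map_comp, hg])⟩

theorem IsGlutos.mem_of_equivalence (h : IsGlutos.{w} O) (e : C ≌ G) {ι : Type w}
    {U : ι → C} {X : C} {u : ∀ i, U i ⟶ X} (hu : ∀ i, O (e.functor.map (u i)))
    (hu' : IsEpiSink (Presieve.ofArrows U u)) {Y : C} {f : X ⟶ Y}
    (hf : ∀ i, O (e.functor.map (u i ≫ f))) : O (e.functor.map f) := by
  rw [← isEpiSink_map_iff (e := e), Presieve.map_ofArrows] at hu'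
  exact h.mem_of_isEpiSink hu hu' (fun i ↦ by rw [← e.functor.map_comp]; exact hf i)

/-- A glutos provides descent for small families only. A small refining subfamily gives the arrow,
and the remaining members are compared on the coverings that map them into the subfamily. -/
theorem IsGlutos.isSubcanonical_of_equivalence (h : IsGlutos.{w} O) (hτ : IsUPresite.{w} τ)
    (h1 : IsContinuous τ (monoCoverings (epiCoverings O)) e.functor)
    (h2 : IsContinuous (monoCoverings (epiCoverings O)) τ e.inverse) : IsSubcanonical τ := by
  have := h.isClopos
  have hp := hτ.isPresite
  refine hp.isSubcanonical fun {ι X} U u hu {Z} ↦ ⟨fun f g hfg ↦ ?_, fun f hf ↦ ?_⟩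
  · refine ((mem_iff_of_equivalence hp h1 h2).1 hu).2 f g ?_
    rintro _ _ ⟨i⟩
    exact hfg i
  · have hc := (hp.ofArrows_mem_iff.1 hu).1
    obtain ⟨I, c, H⟩ := hτ.exists_small_family u hc
    have hIc : Presieve.ofArrows (fun i ↦ U (c i)) (fun i ↦ u (c i)) ∈ τ X := by
      refine hp.ofArrows_mem_iff.2 ⟨fun i ↦ hc _, ofArrows_mem_of_local
        (hp.ofArrows_mem_iff.1 hu).2 fun V k hk ↦ ?_⟩
      obtain ⟨k, x, rfl⟩ := (Sieve.mem_ofArrows_iff _ _ _).1 hk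
      obtain ⟨L, W, r, hr, hr'⟩ := H k
      obtain ⟨Q, hQ, hQ'⟩ := IsPresite.exists_sieve (hp.ofArrows_mem_iff.1 hr).2 x
      refine ⟨Q, hQ, fun V' m hm ↦ ?_⟩
      obtain ⟨l, y, e1⟩ := hQ' m hm
      obtain ⟨i, a, e2⟩ := hr' l
      exact ⟨i, y ≫ a, by rw [Category.assoc, e2, reassoc_of% e1]⟩
    obtain ⟨g, hg⟩ := h.exists_desc_of_equivalence e
      (fun i ↦ ((clopen_iff_of_equivalence hp h1 h2).1 (hc (c i))).1)
      ((mem_iff_of_equivalence hp h1 h2).1 hIc).2 (fun i ↦ f (c i)) (fun i j Q a b ↦ hf _ _ Q a b)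
    refine ⟨g, fun k ↦ ?_⟩
    obtain ⟨L, W, r, hr, hr'⟩ := H k
    refine ((mem_iff_of_equivalence hp h1 h2).1 hr).2 _ _ ?_
    rintro _ _ ⟨l⟩
    obtain ⟨i, a, e2⟩ := hr' l
    rw [← reassoc_of% e2, hg]
    exact hf _ _ _ _ _ e2

/-- The gluing relation is transported to G through the adjunction, which turns elements of the
image of U i into elements of U i; the object glued there is brought back by the inverse functor. -/
theorem IsGlutos.hasGluing_of_equivalence (h : IsGlutos.{w} O) (hτ : IsUPresite.{w} τ)
    (h1 : IsContinuous τ (monoCoverings (epiCoverings O)) e.functor)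
    (h2 : IsContinuous (monoCoverings (epiCoverings O)) τ e.inverse) : HasGluing.{w} τ := by
  have := h.isClopos
  have hp := hτ.isPresite
  intro ι U rel hr
  let A := e.symm.toAdjunction
  have hcomp ⦃T T' : C⦄ (k : T' ⟶ T) (i j : ι) (x : T ⟶ U i) (y : T ⟶ U j) (H : rel i j x y) :
      rel i j (k ≫ x) (k ≫ y) := hr.comp k H
  obtain ⟨Q, c, hc, hQ⟩ := h.exists_isGlue (U := fun i ↦ e.functor.obj (U i))
    (rel := fun T i j x y ↦ rel i j ((A.homEquiv _ _).symm x) ((A.homEquiv _ _).symm y))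
    { self_iff := fun T i x y ↦ (hr.self_iff _ _ _).trans (A.homEquiv _ _).symm.injective.eq_iff
      symm := fun T i j x y H ↦ hr.symm _ _ _ _ H
      trans := fun T i j k x y z H H' ↦ hr.trans _ _ _ _ _ _ H H'
      exists_rep := fun i j ↦ by
        obtain ⟨W, a, b, ha, hb, hW⟩ := hr.exists_rep i j
        refine ⟨e.functor.obj W, e.functor.map a, e.functor.map b, h1.map_clopen ha,
          h1.map_clopen hb, fun T x y ↦ (hW _ _).trans ?_⟩
        have key {V : C} (t : T ⟶ e.functor.obj W) (a : W ⟶ V) (x : T ⟶ e.functor.obj V) :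
            (A.homEquiv _ _).symm t ≫ a = (A.homEquiv _ _).symm x ↔ t ≫ e.functor.map a = x := by
          have : (A.homEquiv _ _).symm t ≫ a = (A.homEquiv _ _).symm (t ≫ e.functor.map a) :=
            (A.homEquiv_naturality_right_symm t a).symm
          rw [this]
          exact (A.homEquiv _ _).symm.injective.eq_iff
        constructor
        · rintro ⟨t, ht, ht'⟩
          obtain ⟨t, rfl⟩ := (A.homEquiv _ _).symm.surjective t
          exact ⟨t, (key _ _ _).1 ht, (key _ _ _).1 ht'⟩
        · rintro ⟨t, ht, ht'⟩
          exact ⟨_, (key _ _ _).2 ht, (key _ _ _).2 ht'⟩ }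
  have hclop i := clopen_monoCoverings_iff.1 ⟨_, hc, Presieve.ofArrows.mk i⟩
  refine ⟨e.inverse.obj Q, fun i ↦ e.unit.app (U i) ≫ e.inverse.map (c i), ?_, ?_⟩
  · have := h2.map_mem _ hc
    rw [Presieve.map_ofArrows, hp.ofArrows_mem_iff] at this
    refine hp.ofArrows_mem_iff.2 ⟨fun i ↦ clopen.comp hp (clopen_of_isIso hp _) (this.1 i), ?_⟩
    refine τ.toGrothendieck.superset_covering (fun V k hk ↦ ?_) this.2
    obtain ⟨i, x, rfl⟩ := (Sieve.mem_ofArrows_iff _ _ _).1 hk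
    exact (Sieve.mem_ofArrows_iff _ _ _).2 ⟨i, x ≫ e.unitInv.app _, by simp⟩
  · intro T i j x y
    have e1 : x ≫ e.unit.app (U i) ≫ e.inverse.map (c i) =
        y ≫ e.unit.app (U j) ≫ e.inverse.map (c j) ↔
        e.functor.map x ≫ c i = e.functor.map y ≫ c j := by
      rw [← e.inverse.map_injective.eq_iff, e.inverse.map_comp, e.inverse.map_comp,
        ← cancel_epi (e.unit.app T)]
      simp
    rw [e1, ← hQ]
    have e2 {V : C} (x : T ⟶ V) :
        (A.homEquiv _ _).symm (e.functor.map x) = e.unitInv.app T ≫ x := by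
      simp [A, Adjunction.homEquiv_counit]
    rw [e2, e2]
    refine ⟨hcomp _ _ _ _ _, fun H ↦ ?_⟩
    simpa using hcomp (e.unit.app T) _ _ _ _ H

theorem IsGlutos.isDGPresite_of_equivalence (h : IsGlutos.{w} O) (hτ : IsUPresite.{w} τ)
    (h1 : IsContinuous τ (monoCoverings (epiCoverings O)) e.functor)
    (h2 : IsContinuous (monoCoverings (epiCoverings O)) τ e.inverse) : IsDGPresite τ := by
  have := h.isClopos
  have hp := hτ.isPresite
  have hs := h.isSubcanonical_of_equivalence hτ h1 h2
  have hg := h.hasGluing_of_equivalence hτ h1 h2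
  have hiff {X Y : C} {f : X ⟶ Y} : clopen τ f ↔ O (e.functor.map f) ∧ Mono f :=
    clopen_iff_of_equivalence hp h1 h2
  refine ⟨hp, fun f hf ↦ (hiff.1 hf).2, hs, fun {X} S hS ↦ ?_⟩
  obtain ⟨κ, U, u, rfl⟩ := S.exists_eq_ofArrows
  have hu k : clopen τ (u k) := hS _ (Presieve.ofArrows.mk k)
  have hum k : Mono (u k) := (hiff.1 (hu k)).2
  obtain ⟨I, c, H⟩ := hτ.exists_small_family u hu
  -- The union of the sink: a small refining subfamily is glued along the intersections in X. Since
  -- elements are identified exactly when they agree in X, the resulting arrow to X is monic.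
  obtain ⟨V, r, hr, hV⟩ := hg (fun i ↦ U (c i)) (fun T i j x y ↦ x ≫ u (c i) = y ≫ u (c j))
    { self_iff := fun T i x y ↦ cancel_mono _
      symm := fun T i j x y e ↦ e.symm
      trans := fun T i j k x y z e e' ↦ e.trans e'
      exists_rep := fun i j ↦ by
        have := clopen.hasPullback hp (hu (c i)) (u (c j))
        have hP := IsPullback.of_hasPullback (u (c i)) (u (c j))
        refine ⟨_, pullback.fst _ _, pullback.snd _ _, clopen.of_isPullback hp hP.flip (hu _),
          clopen.of_isPullback hp hP (hu _), fun T x y ↦ ⟨fun e ↦ ?_, ?_⟩⟩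
        · exact ⟨hP.lift x y e, hP.lift_fst _ _ _, hP.lift_snd _ _ _⟩
        · rintro ⟨t, rfl, rfl⟩
          rw [Category.assoc, hP.w, Category.assoc] }
  obtain ⟨hr1, hr2⟩ := hp.ofArrows_mem_iff.1 hr
  obtain ⟨v, hv⟩ := hs.exists_desc hr2 (fun i ↦ u (c i)) (fun i j Q a b e ↦ (hV _ _ _ _).2 e)
  have hvm : Mono v := ⟨fun {T} x y e ↦ by
    obtain ⟨R, hR, hR'⟩ := IsPresite.exists_sieve hr2 x
    refine hs.hom_ext_of_sieve hR fun W k hk ↦ ?_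
    obtain ⟨i, x', hx⟩ := hR' k hk
    obtain ⟨R', hR, hR'⟩ := IsPresite.exists_sieve hr2 (k ≫ y)
    refine hs.hom_ext_of_sieve hR fun W k' hk' ↦ ?_
    obtain ⟨j, y', hy⟩ := hR' k' hk'
    rw [← hx, ← hy, ← Category.assoc]
    refine (hV _ _ _ _).1 ?_
    rw [← hv, ← hv, Category.assoc, reassoc_of% hx, e, reassoc_of% hy]⟩
  have hvc : clopen τ v := hiff.2 ⟨h.mem_of_equivalence e (fun i ↦ (hiff.1 (hr1 i)).1)
    ((mem_iff_of_equivalence hp h1 h2).1 hr).2 (fun i ↦ by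
      rw [hv]
      exact (hiff.1 (hu _)).1), hvm⟩
  have hl (k : κ) : ∃ l : U k ⟶ V, l ≫ v = u k := by
    obtain ⟨L, W, s, hs', H⟩ := H k
    refine hs.exists_lift_of_local (hp.ofArrows_mem_iff.1 hs').2 v _ fun T x hx ↦ ?_
    obtain ⟨l, y, rfl⟩ := (Sieve.mem_ofArrows_iff _ _ _).1 hx
    obtain ⟨i, a, ha⟩ := H l
    exact ⟨y ≫ a ≫ r i, by rw [Category.assoc, Category.assoc, hv, ha, Category.assoc]⟩
  choose l hl using hl
  have hlc (k : κ) : clopen τ (l k) := by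
    refine hiff.2 ⟨h.of_comp _ (e.functor.map v) ?_ (hiff.1 hvc).1, ?_⟩
    · rw [← e.functor.map_comp, hl]
      exact (hiff.1 (hu k)).1
    · have := hum k
      rw [← hl] at this
      exact mono_of_mono _ v
  refine ⟨V, v, Presieve.ofArrows U l, hvc, ?_, fun Y f ↦ ⟨?_, ?_⟩⟩
  · refine hp.mem_of_refinement _ _ (by rintro _ _ ⟨k⟩; exact hlc k) hr ?_
    rintro _ _ ⟨i⟩
    exact ⟨_, l (c i), 𝟙 _, Presieve.ofArrows.mk _, by
      rw [← cancel_mono v, Category.assoc, hl, hv, Category.id_comp]⟩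
  · rintro ⟨k⟩
    exact ⟨l k, Presieve.ofArrows.mk k, hl k⟩
  · rintro ⟨g, ⟨k⟩, rfl⟩
    rw [hl]
    exact Presieve.ofArrows.mk k

theorem IsNearlyGlutos.isDGUPresite {ρ : Precoverage C} (h : IsNearlyGlutos.{w} ρ) :
    IsDGUPresite.{w} ρ := by
  obtain ⟨h1, B, _, β, G, _, O, Y, -, ⟨h2, -⟩, e, he, he'⟩ := h
  exact ⟨h2.isDGPresite_of_equivalence h1 he he', h1⟩

theorem IsNearlyGlutos.hasGluing {ρ : Precoverage C} (h : IsNearlyGlutos.{w} ρ) :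
    HasGluing.{w} ρ := by
  obtain ⟨h1, B, _, β, G, _, O, Y, -, ⟨h2, -⟩, e, he, he'⟩ := h
  exact h2.hasGluing_of_equivalence h1 he he'

end Nearly

/-! ### Extension of continuous functors along a dense embedding -/

section Dense

variable {C : Type u₁} [Category.{v₁} C] {N : Type u₂} [Category.{v₂} N]

/-- A fully faithful continuous functor, such that all objects of the target are covered by small
families of objects of the source, and such that clopen arrows into objects of the source
and their coverings come from the source. -/
structure IsDenseEmbedding (τ : Precoverage C) (ν : Precoverage N) (K : C ⥤ N) : Prop where
  source : IsDGPresite τ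
  target : IsDGPresite ν
  full : K.Full
  faithful : K.Faithful
  isContinuous : IsContinuous τ ν K
  exists_charts : ∀ P : N, ∃ (ι : Type w) (U : ι → C) (u : ∀ i, K.obj (U i) ⟶ P),
    Presieve.ofArrows (fun i ↦ K.obj (U i)) u ∈ ν P
  exists_clopen : ∀ ⦃U : C⦄ ⦃V : N⦄ (v : V ⟶ K.obj U), clopen ν v →
    ∃ (W : C) (x : W ⟶ U) (e : K.obj W ≅ V), clopen τ x ∧ e.hom ≫ v = K.map x
  reflectsCoverings : ReflectsCoverings τ ν K

namespace IsDenseEmbedding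

variable {τ : Precoverage C} {ν : Precoverage N} {K : C ⥤ N} (h : IsDenseEmbedding.{w} τ ν K)

include h

/-- The pullback of a clopen arrow to an object of the source. -/
theorem exists_isPullback {P V : N} {U : C} (m : K.obj U ⟶ P) {v : V ⟶ P} (hv : clopen ν v) :
    ∃ (W : C) (a : W ⟶ U) (r : K.obj W ⟶ V), clopen τ a ∧ IsPullback (K.map a) r m v := by
  have := clopen.hasPullback h.target.isPresite hv m
  have hP := IsPullback.of_hasPullback v m
  obtain ⟨W, x, e, hx, hex⟩ := h.exists_clopen _ (clopen.of_isPullback h.target.isPresite hP hv)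
  refine ⟨W, x, e.hom ≫ pullback.fst v m, hx, hP.flip.of_iso' e (Iso.refl _) (Iso.refl _)
    (Iso.refl _) ?_ ?_ ?_ ?_⟩
  · simpa using hex
  all_goals simp

/-- Clopen arrows into K U come from C, and since K is fully faithful the comparison isomorphism
comes from C as well. -/
theorem clopen_iff {U V : C} {f : U ⟶ V} : clopen τ f ↔ clopen ν (K.map f) := by
  have := h.full
  have := h.faithful
  refine ⟨fun hf ↦ h.isContinuous.map_clopen hf, fun hf ↦ ?_⟩
  obtain ⟨W, x, e, hx, hex⟩ := h.exists_clopen _ hf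
  obtain ⟨φ, hφ⟩ := K.map_surjective e.hom
  obtain ⟨ψ, hψ⟩ := K.map_surjective e.inv
  have h1 : ψ ≫ x = f := K.map_injective (by rw [K.map_comp, hψ, ← hex, Iso.inv_hom_id_assoc])
  have : IsIso ψ := ⟨φ, K.map_injective (by rw [K.map_comp, hφ, hψ]; simp),
    K.map_injective (by rw [K.map_comp, hφ, hψ]; simp)⟩
  rw [← h1]
  exact clopen.comp h.source.isPresite (clopen_of_isIso h.source.isPresite _) hx

theorem exists_isPullback_chart {P : N} {U V : C} (m : K.obj U ⟶ P) {v : K.obj V ⟶ P}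
    (hv : clopen ν v) : ∃ (W : C) (a : W ⟶ U) (b : W ⟶ V), clopen τ a ∧
      (clopen ν m → clopen τ b) ∧ IsPullback (K.map a) (K.map b) m v := by
  have := h.full
  obtain ⟨W, a, r, ha, hP⟩ := h.exists_isPullback m hv
  obtain ⟨b, rfl⟩ := K.map_surjective r
  exact ⟨W, a, b, ha, fun hm ↦ h.clopen_iff.2 (clopen.of_isPullback h.target.isPresite hP hm), hP⟩

theorem cover_of_map {ι : Type*} {U : C} {V : ι → C} {v : ∀ i, V i ⟶ U}
    (hv : ∀ i, clopen τ (v i)) (h1 : Sieve.ofArrows (fun i ↦ K.obj (V i)) (fun i ↦ K.map (v i)) ∈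
      ν.toGrothendieck (K.obj U)) : Sieve.ofArrows V v ∈ τ.toGrothendieck U := by
  refine (h.source.isPresite.ofArrows_mem_iff.1 (h.reflectsCoverings _ ?_ ?_)).2
  · rintro _ _ ⟨i⟩
    exact hv i
  · rw [Presieve.map_ofArrows, h.target.isPresite.ofArrows_mem_iff]
    exact ⟨fun i ↦ h.isContinuous.map_clopen (hv i), h1⟩

/-- Arrows from an object of the source are covered by the pullbacks of a covering. -/
theorem exists_cover {P : N} {ι : Type*} {V : ι → N} {v : ∀ i, V i ⟶ P}
    (hv : Presieve.ofArrows V v ∈ ν P) {U : C} (m : K.obj U ⟶ P) :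
    ∃ (W : ι → C) (a : ∀ i, W i ⟶ U) (r : ∀ i, K.obj (W i) ⟶ V i), (∀ i, clopen τ (a i)) ∧
      (∀ i, IsPullback (K.map (a i)) (r i) m (v i)) ∧
      Sieve.ofArrows W a ∈ τ.toGrothendieck U := by
  choose W a r ha hP using fun i ↦ h.exists_isPullback m
    ((h.target.isPresite.ofArrows_mem_iff.1 hv).1 i)
  have hν := h.target.isPresite
  refine ⟨W, a, r, ha, hP, h.cover_of_map ha ?_⟩
  exact (h.target.isPresite.ofArrows_mem_iff.1
    (Precoverage.mem_coverings_of_isPullback _ hv m _ _ (fun i ↦ hP i))).2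

theorem exists_cover_chart {P : N} {ι : Type*} {V : ι → C} {v : ∀ i, K.obj (V i) ⟶ P}
    (hv : Presieve.ofArrows (fun i ↦ K.obj (V i)) v ∈ ν P) {U : C} (m : K.obj U ⟶ P) :
    ∃ (W : ι → C) (a : ∀ i, W i ⟶ U) (b : ∀ i, W i ⟶ V i), (∀ i, clopen τ (a i)) ∧
      (∀ i, IsPullback (K.map (a i)) (K.map (b i)) m (v i)) ∧
      Sieve.ofArrows W a ∈ τ.toGrothendieck U := by
  have := h.full
  obtain ⟨W, a, r, ha, hP, hc⟩ := h.exists_cover hv m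
  choose b hb using fun i ↦ K.map_surjective (r i)
  exact ⟨W, a, b, ha, fun i ↦ by rw [hb]; exact hP i, hc⟩

end IsDenseEmbedding

section Precomp

variable {E : Type u₃} [Category.{v₃} E] {τ : Precoverage C} {ν : Precoverage N} {K : C ⥤ N}
  {ρ : Precoverage E} {F F' : N ⥤ E}

theorem IsDenseEmbedding.hom_ext (h : IsDenseEmbedding.{w} τ ν K) (hρ : IsDGPresite ρ)
    (hF : IsContinuous ν ρ F) {P : N} {Z : E} {a b : F.obj P ⟶ Z}
    (hab : ∀ (U : C) (m : K.obj U ⟶ P), F.map m ≫ a = F.map m ≫ b) : a = b := by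
  obtain ⟨ι, U, u, hu⟩ := h.exists_charts P
  exact hρ.subcanonical.hom_ext_of_cover (hF.cover_map hρ.isPresite h.target.isPresite
    (h.target.isPresite.ofArrows_mem_iff.1 hu).2) (fun i ↦ hab _ _)

/-- F P is covered by the values of F on charts. F preserves the overlaps, which lie in C, so
naturality of α there lets the components glue; the same comparison gives the formula for arbitrary
K U ⟶ P. -/
theorem IsDenseEmbedding.exists_app (h : IsDenseEmbedding.{w} τ ν K) (hρ : IsDGPresite ρ)
    (hF : IsContinuous ν ρ F) (α : K ⋙ F ⟶ K ⋙ F') (P : N) :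
    ∃ g : F.obj P ⟶ F'.obj P, ∀ (U : C) (m : K.obj U ⟶ P),
      F.map m ≫ g = α.app U ≫ F'.map m := by
  have hν := h.target.isPresite
  have hα {U V : C} (f : U ⟶ V) : F.map (K.map f) ≫ α.app V = α.app U ≫ F'.map (K.map f) :=
    α.naturality f
  obtain ⟨ι, U, u, hu⟩ := h.exists_charts P
  obtain ⟨hu1, hu2⟩ := hν.ofArrows_mem_iff.1 hu
  obtain ⟨g, hg⟩ := hρ.subcanonical.exists_desc (hF.cover_map hρ.isPresite hν hu2)
    (fun i ↦ α.app (U i) ≫ F'.map (u i)) (fun i j Q a b e ↦ by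
      obtain ⟨W, x, y, -, -, hP⟩ := h.exists_isPullback_chart (u i) (hu1 j)
      have hP' := hF.map_isPullback (hu1 j) hP
      obtain ⟨t, rfl, rfl⟩ : ∃ t, t ≫ F.map (K.map x) = a ∧ t ≫ F.map (K.map y) = b :=
        ⟨hP'.lift a b e, hP'.lift_fst _ _ _, hP'.lift_snd _ _ _⟩
      rw [Category.assoc, Category.assoc,
        reassoc_of% (hα x), reassoc_of% (hα y), ← F'.map_comp, ← F'.map_comp, hP.w])
  refine ⟨g, fun V m ↦ ?_⟩
  obtain ⟨W, a, b, ha, hP, hc⟩ := h.exists_cover_chart hu m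
  refine hρ.subcanonical.hom_ext_of_cover (hF.cover_map hρ.isPresite hν
    (h.isContinuous.cover_map hν h.source.isPresite hc)) (fun i ↦ ?_)
  rw [← Category.assoc, ← F.map_comp, (hP i).w, F.map_comp, Category.assoc, hg,
    reassoc_of% (hα (b i)), reassoc_of% (hα (a i)), ← F'.map_comp, ← F'.map_comp, (hP i).w]

theorem IsDenseEmbedding.faithful_precomp (h : IsDenseEmbedding.{w} τ ν K) (hρ : IsDGPresite ρ) :
    (precomp h.isContinuous ρ).Faithful where
  map_injective {F F'} α β e := by
    ext P
    refine h.hom_ext hρ F.property fun U m ↦ ?_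
    rw [α.hom.naturality, β.hom.naturality]
    have e' : α.hom.app (K.obj U) = β.hom.app (K.obj U) :=
      congrArg (fun γ ↦ γ.hom.app U) e
    rw [e']

theorem IsDenseEmbedding.full_precomp (h : IsDenseEmbedding.{w} τ ν K) (hρ : IsDGPresite ρ) :
    (precomp h.isContinuous ρ).Full where
  map_surjective {F F'} α := by
    choose g hg using h.exists_app (F' := F'.obj) hρ F.property α.hom
    refine ⟨ObjectProperty.homMk ⟨g, fun {P Q} f ↦ h.hom_ext hρ F.property fun U m ↦ ?_⟩, ?_⟩
    · rw [← Category.assoc, ← Functor.map_comp, hg, reassoc_of% (hg P U m), ← Functor.map_comp]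
    · ext U
      have := hg (K.obj U) U (𝟙 _)
      rw [CategoryTheory.Functor.map_id, CategoryTheory.Functor.map_id] at this
      exact (Category.id_comp _).symm.trans (this.trans (Category.comp_id _))

end Precomp

end Dense

/-! ### Values of the extension of a continuous functor -/

section Extension

variable {C : Type u₁} [Category.{v₁} C] {N : Type u₂} [Category.{v₂} N]
  {E : Type u₃} [Category.{v₃} E] {τ : Precoverage C} {ν : Precoverage N} {K : C ⥤ N}
  {ρ : Precoverage E} {G : C ⥤ E}

/-- Two generalized elements of `G U` and `G V`, which are identified by arrows `K U ⟶ P` and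
`K V ⟶ P`. -/
def ExtRel (K : C ⥤ N) (G : C ⥤ E) {P : N} {U V : C} (m : K.obj U ⟶ P) (v : K.obj V ⟶ P) {T : E}
    (x : T ⟶ G.obj U) (y : T ⟶ G.obj V) : Prop :=
  ∃ (Z : C) (p : Z ⟶ U) (q : Z ⟶ V) (t : T ⟶ G.obj Z), K.map p ≫ m = K.map q ≫ v ∧
    t ≫ G.map p = x ∧ t ≫ G.map q = y

theorem ExtRel.symm {P : N} {U V : C} {m : K.obj U ⟶ P} {v : K.obj V ⟶ P} {T : E}
    {x : T ⟶ G.obj U} {y : T ⟶ G.obj V} (H : ExtRel K G m v x y) : ExtRel K G v m y x := by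
  obtain ⟨Z, p, q, t, h1, h2, h3⟩ := H
  exact ⟨Z, q, p, t, h1.symm, h3, h2⟩

theorem ExtRel.eq [K.Faithful] {P : N} {U : C} {u : K.obj U ⟶ P} [Mono u] {T : E}
    {x y : T ⟶ G.obj U} (H : ExtRel K G u u x y) : x = y := by
  obtain ⟨Z, p, q, t, h1, rfl, rfl⟩ := H
  rw [cancel_mono] at h1
  rw [K.map_injective h1]

theorem extRel_refl {P : N} {U : C} (u : K.obj U ⟶ P) {T : E} (x : T ⟶ G.obj U) :
    ExtRel K G u u x x :=
  ⟨U, 𝟙 U, 𝟙 U, x, rfl, by simp, by simp⟩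

variable (h : IsDenseEmbedding.{w} τ ν K) (hG : IsContinuous τ ρ G)

include h

/-- K is fully faithful, so every span of C identified over P factors through the pullback along a
clopen chart, and that pullback comes from C. -/
theorem IsDenseEmbedding.extRel_iff {P : N} {U V : C} (m : K.obj U ⟶ P) {v : K.obj V ⟶ P}
    (hv : clopen ν v) : ∃ (W : C) (a : W ⟶ U) (b : W ⟶ V), clopen τ a ∧ (clopen ν m → clopen τ b) ∧
      IsPullback (K.map a) (K.map b) m v ∧
      ∀ ⦃T : E⦄ (x : T ⟶ G.obj U) (y : T ⟶ G.obj V), ExtRel K G m v x y ↔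
        ∃ t : T ⟶ G.obj W, t ≫ G.map a = x ∧ t ≫ G.map b = y := by
  have := h.full
  have := h.faithful
  obtain ⟨W, a, b, ha, hb, hP⟩ := h.exists_isPullback_chart m hv
  refine ⟨W, a, b, ha, hb, hP, fun T x y ↦ ⟨?_, ?_⟩⟩
  · rintro ⟨Z, p, q, t, e, rfl, rfl⟩
    obtain ⟨l, hl⟩ := K.map_surjective (hP.lift _ _ e)
    have h1 : l ≫ a = p := K.map_injective (by rw [K.map_comp, hl, hP.lift_fst])
    have h2 : l ≫ b = q := K.map_injective (by rw [K.map_comp, hl, hP.lift_snd])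
    exact ⟨t ≫ G.map l, by rw [← h1, G.map_comp, Category.assoc],
      by rw [← h2, G.map_comp, Category.assoc]⟩
  · rintro ⟨t, rfl, rfl⟩
    exact ⟨W, a, b, t, hP.w, rfl, rfl⟩

include hG in
-- The two spans are composed over the pullback of a clopen leg, which G preserves; for this the
-- second relation is first put into its representable form.
theorem ExtRel.trans {P : N} {U V V' : C} {m : K.obj U ⟶ P} {v : K.obj V ⟶ P}
    {v' : K.obj V' ⟶ P} (hv' : clopen ν v') {T : E} {x : T ⟶ G.obj U} {y : T ⟶ G.obj V}
    {z : T ⟶ G.obj V'} (h1 : ExtRel K G m v x y) (h2 : ExtRel K G v v' y z) :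
    ExtRel K G m v' x z := by
  obtain ⟨W, a, b, ha, -, hP, hW⟩ := h.extRel_iff (G := G) v hv'
  obtain ⟨Z, p, q, t, e, rfl, rfl⟩ := h1
  obtain ⟨s, hs, rfl⟩ := (hW _ _).1 h2
  have := clopen.hasPullback h.source.isPresite ha q
  have hP' := IsPullback.of_hasPullback a q
  have hP'' := (hG.map_isPullback ha hP'.flip).flip
  refine ⟨_, pullback.snd a q ≫ p, pullback.fst a q ≫ b, hP''.lift s t hs, ?_, ?_, ?_⟩
  · rw [K.map_comp, Category.assoc, e, K.map_comp, Category.assoc, ← hP.w, ← Category.assoc,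
      ← Category.assoc, ← K.map_comp, ← K.map_comp, hP'.w]
  · rw [G.map_comp, hP''.lift_snd_assoc]
  · rw [G.map_comp, hP''.lift_fst_assoc]

omit h in
variable (τ ν K ρ G) in
/-- The value at `P` of the extension of `G`: an object with compatible arrows from the objects
`G U`, for all `K U ⟶ P`. -/
structure IsExtAt (P : N) (X : E) (c : ∀ ⦃U : C⦄, (K.obj U ⟶ P) → (G.obj U ⟶ X)) : Prop where
  map_comp : ∀ ⦃U V : C⦄ (f : U ⟶ V) (m : K.obj V ⟶ P), G.map f ≫ c m = c (K.map f ≫ m)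
  extRel : ∀ ⦃U V : C⦄ (m : K.obj U ⟶ P) (v : K.obj V ⟶ P), clopen ν v → ∀ ⦃T : E⦄
    (x : T ⟶ G.obj U) (y : T ⟶ G.obj V), x ≫ c m = y ≫ c v → ExtRel K G m v x y
  exists_cover : ∃ (ι : Type w) (U : ι → C) (u : ∀ i, K.obj (U i) ⟶ P),
    Presieve.ofArrows (fun i ↦ K.obj (U i)) u ∈ ν P ∧
    Presieve.ofArrows (fun i ↦ G.obj (U i)) (fun i ↦ c (u i)) ∈ ρ X

include hG

/-- The value at P is glued from the G U i, for a small covering by charts, along `ExtRel`, which is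
represented by G of the overlaps. -/
theorem IsDenseEmbedding.exists_isExtAt (hρ : IsDGPresite ρ) (hg : HasGluing.{w} ρ) (P : N) :
    ∃ (X : E) (c : ∀ ⦃U : C⦄, (K.obj U ⟶ P) → (G.obj U ⟶ X)), IsExtAt.{w} ν K ρ G P X c := by
  have := h.faithful
  have hν := h.target.isPresite
  obtain ⟨ι, U, u, hu⟩ := h.exists_charts P
  have hu1 := (hν.ofArrows_mem_iff.1 hu).1
  have hum (i : ι) := h.target.mono _ (hu1 i)
  obtain ⟨X, c₀, hc₀, hX⟩ := hg (fun i ↦ G.obj (U i)) (fun T i j x y ↦ ExtRel K G (u i) (u j) x y)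
    { self_iff := fun T i x y ↦ ⟨ExtRel.eq, by rintro rfl; exact extRel_refl _ _⟩
      symm := fun T i j x y H ↦ H.symm
      trans := fun T i j k x y z H H' ↦ H.trans h hG (hu1 k) H'
      exists_rep := fun i j ↦ by
        obtain ⟨W, a, b, ha, hb, hP, hW⟩ := h.extRel_iff (G := G) (u i) (hu1 j)
        exact ⟨G.obj W, G.map a, G.map b, hG.map_clopen ha, hG.map_clopen (hb (hu1 i)), hW⟩ }
  obtain ⟨hc1, hc2⟩ := hρ.isPresite.ofArrows_mem_iff.1 hc₀
  -- For an arbitrary m, G V is covered by the images of the base changes of the charts. There the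
  -- arrow to X is forced by `ExtRel`, and transitivity makes the local arrows unique, so they glue.
  have hex ⦃V : C⦄ (m : K.obj V ⟶ P) : ∃ g : G.obj V ⟶ X, ∀ ⦃T : E⦄ (i : ι) (x : T ⟶ G.obj V)
      (y : T ⟶ G.obj (U i)), ExtRel K G m (u i) x y → x ≫ g = y ≫ c₀ i := by
    obtain ⟨W, a, b, ha, hP, hc⟩ := h.exists_cover_chart hu m
    have hGc := hG.cover_map hρ.isPresite h.source.isPresite hc
    have hrel i : ExtRel K G m (u i) (G.map (a i)) (G.map (b i)) :=
      ⟨W i, a i, b i, 𝟙 _, (hP i).w, by simp, by simp⟩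
    obtain ⟨g, hg⟩ := hρ.subcanonical.exists_of_local hGc
      (fun T x z ↦ ∃ i y, ExtRel K G m (u i) x y ∧ y ≫ c₀ i = z)
      (fun T T' x z l ⟨i, y, ⟨Z, p, q, t, h1, h2, h3⟩, e⟩ ↦ ⟨i, l ≫ y, ⟨Z, p, q, l ≫ t, h1,
        by rw [Category.assoc, h2], by rw [Category.assoc, h3]⟩, by rw [Category.assoc, e]⟩)
      (fun T x z z' ⟨i, y, H, e⟩ ⟨j, y', H', e'⟩ ↦ by
        rw [← e, ← e', ← hX]
        exact H.symm.trans h hG (hu1 j) H')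
      (fun T x hx ↦ by
        obtain ⟨i, y, rfl⟩ := (Sieve.mem_ofArrows_iff _ _ _).1 hx
        obtain ⟨Z, p, q, t, h1, h2, h3⟩ := hrel i
        exact ⟨_, i, y ≫ G.map (b i), ⟨Z, p, q, y ≫ t, h1, by rw [Category.assoc, h2],
          by rw [Category.assoc, h3]⟩, rfl⟩)
    exact ⟨g, fun T i x y H ↦ hg _ _ ⟨i, y, H, rfl⟩⟩
  choose c hc using hex
  have hcu (i : ι) : c (u i) = c₀ i := by
    have := hc (u i) i (𝟙 _) (𝟙 _) (extRel_refl _ _)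
    rwa [Category.id_comp, Category.id_comp] at this
  have hloc {V : C} (m : K.obj V ⟶ P) {T : E} (x : T ⟶ G.obj V) : ∃ R ∈ ρ.toGrothendieck T,
      ∀ ⦃T' : E⦄ (k : T' ⟶ T), R k → ∃ i, ∃ y : T' ⟶ G.obj (U i),
        ExtRel K G m (u i) (k ≫ x) y := by
    obtain ⟨W, a, b, ha, hP, hcov⟩ := h.exists_cover_chart hu m
    obtain ⟨R, hR, hR'⟩ := IsPresite.exists_sieve
      (hG.cover_map hρ.isPresite h.source.isPresite hcov) x
    refine ⟨R, hR, fun T' k hk ↦ ?_⟩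
    obtain ⟨i, y, e⟩ := hR' k hk
    exact ⟨i, y ≫ G.map (b i), W i, a i, b i, y, (hP i).w, e, rfl⟩
  refine ⟨X, c, fun V V' f m ↦ ?_, fun V V' m v hv T x y e ↦ ?_, ι, U, u, hu, ?_⟩
  · obtain ⟨R, hR, hR'⟩ := hloc (K.map f ≫ m) (𝟙 (G.obj V))
    refine hρ.subcanonical.hom_ext_of_sieve hR fun T k hk ↦ ?_
    obtain ⟨i, y, H⟩ := hR' k hk
    rw [Category.comp_id] at H
    rw [hc _ i k y H, ← Category.assoc]
    refine hc _ i _ y ?_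
    obtain ⟨Z, p, q, t, h1, rfl, rfl⟩ := H
    exact ⟨Z, p ≫ f, q, t, by rw [K.map_comp, Category.assoc, h1],
      by rw [G.map_comp, Category.assoc], rfl⟩
  · obtain ⟨W, a, b, ha, hb, hP, hW⟩ := h.extRel_iff (G := G) m hv
    have := hρ.mono _ (hG.map_clopen ha)
    rw [hW]
    obtain ⟨R, hR, hR'⟩ := hloc m x
    obtain ⟨R', hRR', hR''⟩ := hloc v y
    -- Locally x and y are related to elements of charts with equal images in X. The gluing relation
    -- joins these, so x and y are related by transitivity; as the overlap is clopen in G V, the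
    -- local factorizations glue.
    have key ⦃T' : E⦄ (k : T' ⟶ T) (hk : (R ⊓ R') k) :
        ∃ t : T' ⟶ G.obj W, t ≫ G.map a = k ≫ x ∧ t ≫ G.map b = k ≫ y := by
      obtain ⟨i, x', hx⟩ := hR' k hk.1
      obtain ⟨j, y', hy⟩ := hR'' k hk.2
      rw [← hW]
      refine ExtRel.trans h hG hv (ExtRel.trans h hG (hu1 j) hx ((hX _ _ _ _).2 ?_)) hy.symm
      rw [← hc _ _ _ _ hx, ← hc _ _ _ _ hy, Category.assoc, e, Category.assoc]
    have hRR := ρ.toGrothendieck.intersection_covering hR hRR'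
    obtain ⟨t, ht⟩ := hρ.subcanonical.exists_lift_of_local hRR (G.map a) x
      (fun T' k hk ↦ (key k hk).imp fun _ ↦ And.left)
    refine ⟨t, ht, hρ.subcanonical.hom_ext_of_sieve hRR fun T' k hk ↦ ?_⟩
    obtain ⟨s, h1, h2⟩ := key k hk
    have : k ≫ t = s := by rw [← cancel_mono (G.map a), Category.assoc, ht, h1]
    rw [← h2, ← Category.assoc, this]
  · simp only [hcu]
    exact hc₀

end Extension

/-! ### The universal property of the extension at an object -/

section ExtAt

variable {C : Type u₁} [Category.{v₁} C] {N : Type u₂} [Category.{v₂} N]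
  {E : Type u₃} [Category.{v₃} E] {τ : Precoverage C} {ν : Precoverage N} {K : C ⥤ N}
  {ρ : Precoverage E} {G : C ⥤ E}

theorem IsExtAt.comp_eq {P : N} {X : E} {c : ∀ ⦃U : C⦄, (K.obj U ⟶ P) → (G.obj U ⟶ X)}
    (hc : IsExtAt.{w} ν K ρ G P X c) {U V : C} {m : K.obj U ⟶ P} {v : K.obj V ⟶ P} {T : E}
    {x : T ⟶ G.obj U} {y : T ⟶ G.obj V} (H : ExtRel K G m v x y) : x ≫ c m = y ≫ c v := by
  obtain ⟨Z, p, q, t, h1, rfl, rfl⟩ := H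
  rw [Category.assoc, Category.assoc, hc.map_comp, hc.map_comp, h1]

theorem IsExtAt.hom_ext (hρ : IsDGPresite ρ) {P : N} {X : E}
    {c : ∀ ⦃U : C⦄, (K.obj U ⟶ P) → (G.obj U ⟶ X)} (hc : IsExtAt.{w} ν K ρ G P X c) {Z : E}
    {f g : X ⟶ Z} (hfg : ∀ ⦃U : C⦄ (m : K.obj U ⟶ P), c m ≫ f = c m ≫ g) : f = g := by
  obtain ⟨ι, U, u, -, hu⟩ := hc.exists_cover
  exact hρ.subcanonical.hom_ext_of_cover (hρ.isPresite.ofArrows_mem_iff.1 hu).2 fun i ↦ hfg _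

/-- Generalized elements of the extension come locally from the charts. -/
theorem IsExtAt.exists_local (hν : IsPresite ν) (hρ : IsPresite ρ) {P : N} {X : E}
    {c : ∀ ⦃U : C⦄, (K.obj U ⟶ P) → (G.obj U ⟶ X)} (hc : IsExtAt.{w} ν K ρ G P X c)
    {T : E} (x : T ⟶ X) : ∃ R ∈ ρ.toGrothendieck T, ∀ ⦃T' : E⦄ (k : T' ⟶ T), R k →
      ∃ (U : C) (u : K.obj U ⟶ P) (y : T' ⟶ G.obj U), clopen ν u ∧ y ≫ c u = k ≫ x := by
  obtain ⟨ι, U, u, hu, hu'⟩ := hc.exists_cover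
  obtain ⟨R, hR, hR'⟩ := IsPresite.exists_sieve (hρ.ofArrows_mem_iff.1 hu').2 x
  refine ⟨R, hR, fun T' k hk ↦ ?_⟩
  obtain ⟨i, y, e⟩ := hR' k hk
  exact ⟨U i, u i, y, (hν.ofArrows_mem_iff.1 hu).1 i, e⟩

variable (h : IsDenseEmbedding.{w} τ ν K) (hG : IsContinuous τ ρ G)

include h hG

/-- The extension at P is the colimit of the G U over all K U ⟶ P. A compatible family is glued from
its members on a covering by charts, and the formula at the other m follows on base changed charts.
-/
theorem IsExtAt.exists_desc (hρ : IsDGPresite ρ) {P : N} {X : E}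
    {c : ∀ ⦃U : C⦄, (K.obj U ⟶ P) → (G.obj U ⟶ X)} (hc : IsExtAt.{w} ν K ρ G P X c) {Z : E}
    (f : ∀ ⦃U : C⦄, (K.obj U ⟶ P) → (G.obj U ⟶ Z))
    (hf : ∀ ⦃U V : C⦄ (g : U ⟶ V) (m : K.obj V ⟶ P), G.map g ≫ f m = f (K.map g ≫ m)) :
    ∃ g : X ⟶ Z, ∀ ⦃U : C⦄ (m : K.obj U ⟶ P), c m ≫ g = f m := by
  obtain ⟨ι, U, u, hu, hu'⟩ := hc.exists_cover
  have hu1 := (h.target.isPresite.ofArrows_mem_iff.1 hu).1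
  have key {U V : C} {m : K.obj U ⟶ P} {v : K.obj V ⟶ P} {T : E}
      {x : T ⟶ G.obj U} {y : T ⟶ G.obj V} (H : ExtRel K G m v x y) : x ≫ f m = y ≫ f v := by
    obtain ⟨Z, p, q, t, h1, rfl, rfl⟩ := H
    rw [Category.assoc, Category.assoc, hf, hf, h1]
  obtain ⟨g, hg⟩ := hρ.subcanonical.exists_desc (hρ.isPresite.ofArrows_mem_iff.1 hu').2
    (fun i ↦ f (u i)) (fun i j Q a b e ↦ key (hc.extRel _ _ (hu1 j) _ _ e))
  refine ⟨g, fun V m ↦ ?_⟩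
  obtain ⟨W, a, b, ha, hP, hcov⟩ := h.exists_cover_chart hu m
  refine hρ.subcanonical.hom_ext_of_cover
    (hG.cover_map hρ.isPresite h.source.isPresite hcov) fun i ↦ ?_
  rw [← Category.assoc, hc.map_comp, (hP i).w, ← hc.map_comp, Category.assoc, hg, hf, hf,
    (hP i).w]

/-- Monicity comes from `ExtRel`, since v is monic and K faithful. Clopenness is local on the
source, where c v becomes a clopen arrow followed by a member of the covering. -/
theorem IsExtAt.clopen_chart (hρ : IsDGPresite ρ) {P : N} {X : E}
    {c : ∀ ⦃U : C⦄, (K.obj U ⟶ P) → (G.obj U ⟶ X)} (hc : IsExtAt.{w} ν K ρ G P X c) {V : C}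
    {v : K.obj V ⟶ P} (hv : clopen ν v) : clopen ρ (c v) := by
  have := h.faithful
  have := h.target.mono v hv
  have hm : Mono (c v) := ⟨fun x y e ↦ (hc.extRel v v hv x y e).eq⟩
  obtain ⟨ι, U, u, hu, hu'⟩ := hc.exists_cover
  choose W a b ha hb hP using fun i ↦ h.exists_isPullback_chart v
    ((h.target.isPresite.ofArrows_mem_iff.1 hu).1 i)
  have hν := h.target.isPresite
  have hcov := h.cover_of_map ha (hν.ofArrows_mem_iff.1
    (Precoverage.mem_coverings_of_isPullback _ hu v _ _ (fun i ↦ hP i))).2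
  refine hρ.clopen_of_source (hG.cover_map hρ.isPresite h.source.isPresite hcov) _ fun i ↦ ?_
  rw [hc.map_comp, (hP i).w, ← hc.map_comp]
  exact clopen.comp hρ.isPresite (hG.map_clopen (hb i hv))
    ((hρ.isPresite.ofArrows_mem_iff.1 hu').1 i)

end ExtAt

/-! ### The extension as a continuous functor -/

section ExtFunctor

variable {C : Type u₁} [Category.{v₁} C] {N : Type u₂} [Category.{v₂} N]
  {E : Type u₃} [Category.{v₃} E] {τ : Precoverage C} {ν : Precoverage N} {K : C ⥤ N}
  {ρ : Precoverage E} {G : C ⥤ E} (h : IsDenseEmbedding.{w} τ ν K) (hG : IsContinuous τ ρ G)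
  (hρ : IsDGPresite ρ) {F : N ⥤ E} {c : ∀ (P : N) ⦃U : C⦄, (K.obj U ⟶ P) → (G.obj U ⟶ F.obj P)}

include h hG in
theorem IsDenseEmbedding.exists_extension (hρ : IsDGPresite ρ) (hg : HasGluing.{w} ρ) :
    ∃ (F : N ⥤ E) (c : ∀ (P : N) ⦃U : C⦄, (K.obj U ⟶ P) → (G.obj U ⟶ F.obj P)),
      (∀ P, IsExtAt.{w} ν K ρ G P (F.obj P) (c P)) ∧
      ∀ ⦃P Q : N⦄ (f : P ⟶ Q) ⦃U : C⦄ (m : K.obj U ⟶ P), c P m ≫ F.map f = c Q (m ≫ f) := by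
  choose X c hc using h.exists_isExtAt hG hρ hg
  choose g hg using fun (P Q : N) (f : P ⟶ Q) ↦ (hc P).exists_desc h hG hρ
    (fun U m ↦ c Q (m ≫ f)) (fun U V k m ↦ by rw [(hc Q).map_comp, Category.assoc])
  exact ⟨{ obj := X
           map := fun {P Q} f ↦ g P Q f
           map_id := fun P ↦ (hc P).hom_ext hρ fun U m ↦ by
            rw [hg, Category.comp_id, Category.comp_id]
           map_comp := fun f f' ↦ (hc _).hom_ext hρ fun U m ↦ by
            rw [hg, reassoc_of% (hg _ _ f m), hg, Category.assoc] }, c, hc, hg⟩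

variable (hc : ∀ P, IsExtAt.{w} ν K ρ G P (F.obj P) (c P))
  (hF : ∀ ⦃P Q : N⦄ (f : P ⟶ Q) ⦃U : C⦄ (m : K.obj U ⟶ P), c P m ≫ F.map f = c Q (m ≫ f))

include h hG hρ hc hF

omit hG in
-- Elements of F P lie locally in clopen charts. If they agree in F Q, `ExtRel` gives a span
-- identified over Q, hence over P because v is monic.
theorem IsDenseEmbedding.mono_extension {P Q : N} {v : P ⟶ Q} (hv : clopen ν v) :
    Mono (F.map v) := by
  have hν := h.target.isPresite
  have := h.target.mono v hv
  refine ⟨fun {T} x y e ↦ ?_⟩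
  obtain ⟨R, hR, hR'⟩ := (hc P).exists_local hν hρ.isPresite x
  refine hρ.subcanonical.hom_ext_of_sieve hR fun T k hk ↦ ?_
  obtain ⟨U, u, x', hu, hx⟩ := hR' k hk
  obtain ⟨R, hR, hR'⟩ := (hc P).exists_local hν hρ.isPresite (k ≫ y)
  refine hρ.subcanonical.hom_ext_of_sieve hR fun T k' hk' ↦ ?_
  obtain ⟨V, v', y', hv', hy⟩ := hR' k' hk'
  obtain ⟨Z, p, q, t, e1, e2, e3⟩ := (hc Q).extRel (u ≫ v) (v' ≫ v) (clopen.comp hν hv' hv)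
    (k' ≫ x') y' (by
      rw [← hF, ← hF, Category.assoc, reassoc_of% hx, reassoc_of% hy, e])
  rw [← Category.assoc, ← Category.assoc, cancel_mono] at e1
  rw [← hy, ← hx, ← Category.assoc]
  exact (hc P).comp_eq ⟨Z, p, q, t, e1, e2, e3⟩

theorem IsDenseEmbedding.clopen_extension {P Q : N} {v : P ⟶ Q} (hv : clopen ν v) :
    clopen ρ (F.map v) := by
  have hν := h.target.isPresite
  have := h.mono_extension hρ hc hF hv
  obtain ⟨ι, U, u, hu, hu'⟩ := (hc P).exists_cover
  refine hρ.clopen_of_source (hρ.isPresite.ofArrows_mem_iff.1 hu').2 _ fun i ↦ ?_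
  rw [hF]
  exact (hc Q).clopen_chart h hG hρ (clopen.comp hν ((hν.ofArrows_mem_iff.1 hu).1 i) hv)

theorem IsDenseEmbedding.isContinuous_extension : IsContinuous ν ρ F where
  map_mem {P} S hS := by
    have hν := h.target.isPresite
    obtain ⟨κ, V, v, rfl⟩ := S.exists_eq_ofArrows
    rw [Presieve.map_ofArrows, hρ.isPresite.ofArrows_mem_iff]
    refine ⟨fun k ↦ h.clopen_extension hG hρ hc hF ((hν.ofArrows_mem_iff.1 hS).1 k), ?_⟩
    obtain ⟨ι, U, u, hu, hu'⟩ := (hc P).exists_cover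
    refine ofArrows_mem_of_local (hρ.isPresite.ofArrows_mem_iff.1 hu').2 fun T k hk ↦ ?_
    obtain ⟨i, x, rfl⟩ := (Sieve.mem_ofArrows_iff _ _ _).1 hk
    -- The covering of P is pulled back to a chart, where it becomes a covering in C; this one G
    -- preserves.
    obtain ⟨W, a, r, ha, hP, hcov⟩ := h.exists_cover hS (u i)
    obtain ⟨Q, hQ, hQ'⟩ := IsPresite.exists_sieve
      (hG.cover_map hρ.isPresite h.source.isPresite hcov) x
    refine ⟨Q, hQ, fun T' l hl ↦ ?_⟩
    obtain ⟨j, y, e⟩ := hQ' l hl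
    refine ⟨j, y ≫ c _ (r j), ?_⟩
    rw [Category.assoc, hF, ← (hP j).w, ← (hc P).map_comp, reassoc_of% e]
  map_isPullback {P₀ X Y Z p q f u} hu hP := by
    have hν := h.target.isPresite
    have hp := clopen.of_isPullback hν hP.flip hu
    have := h.mono_extension hρ hc hF hu
    have := h.mono_extension hρ hc hF hp
    have w : F.map p ≫ F.map f = F.map q ≫ F.map u := by
      rw [← F.map_comp, hP.w, F.map_comp]
    refine isPullback_of_exists_lift w fun T x y e ↦ ?_
    obtain ⟨R, hR, hR'⟩ := (hc X).exists_local hν hρ.isPresite x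
    obtain ⟨R', hRR, hR''⟩ := (hc Y).exists_local hν hρ.isPresite y
    obtain ⟨l, hl⟩ := hρ.subcanonical.exists_lift_of_local
      (ρ.toGrothendieck.intersection_covering hR hRR) (F.map p) x (fun T' k hk ↦ by
        obtain ⟨U, m, x', hm, hx⟩ := hR' k hk.1
        obtain ⟨V, n, y', hn, hy⟩ := hR'' k hk.2
        obtain ⟨Z, a, b, t, e1, e2, e3⟩ := (hc _).extRel (m ≫ f) (n ≫ u)
          (clopen.comp hν hn hu) x' y' (by
            rw [← hF, ← hF, reassoc_of% hx, reassoc_of% hy, e])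
        -- Locally x and y come from one element t of some G Z, with Z mapping compatibly to X and Y
        -- in N; the pullback in N turns these maps into an arrow K Z ⟶ P₀.
        refine ⟨t ≫ c _ (hP.lift (K.map a ≫ m) (K.map b ≫ n) (by simpa using e1)), ?_⟩
        rw [Category.assoc, hF, hP.lift_fst, ← hx, ← e2, ← (hc _).map_comp, Category.assoc])
    exact ⟨l, hl, by rw [← cancel_mono (F.map u), Category.assoc, ← w, reassoc_of% hl, e]⟩

omit hρ in
-- The identity of K U is terminal among the arrows K V ⟶ K U, so the colimit defining F (K U) is G
-- U: the inverse of c (𝟙 _) is glued from the arrows G (K⁻¹ m).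
theorem IsDenseEmbedding.nonempty_iso_extension (hρ : IsDGPresite ρ) : Nonempty (K ⋙ F ≅ G) := by
  have := h.full
  have := h.faithful
  choose f hf using fun U ↦ (hc (K.obj U)).exists_desc h hG hρ
    (fun V m ↦ G.map (K.preimage m)) (fun V V' k m ↦ by
      rw [← G.map_comp]
      congr 1
      exact K.map_injective (by simp))
  refine ⟨(NatIso.ofComponents (F := G) (G := K ⋙ F)
    (fun U ↦ ⟨c (K.obj U) (𝟙 _), f U, ?_, ?_⟩) fun {U V} k ↦ ?_).symm⟩
  · rw [hf, K.preimage_id, G.map_id]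
  · refine (hc _).hom_ext hρ fun V m ↦ ?_
    rw [reassoc_of% (hf U m), (hc _).map_comp, K.map_preimage, Category.comp_id]
    exact (Category.comp_id _).symm
  · change G.map k ≫ c _ (𝟙 _) = c _ (𝟙 _) ≫ F.map (K.map k)
    rw [hF, (hc _).map_comp, Category.comp_id, Category.id_comp]

end ExtFunctor

section

variable {C : Type u₁} [Category.{v₁} C] {N : Type u₂} [Category.{v₂} N]
  {E : Type u₃} [Category.{v₃} E] {τ : Precoverage C} {ν : Precoverage N} {K : C ⥤ N}
  {ρ : Precoverage E}

/-- Continuous functors extend uniquely along dense embeddings, if the target has gluing. -/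
theorem IsDenseEmbedding.isEquivalence_precomp (h : IsDenseEmbedding.{w} τ ν K)
    (hρ : IsDGPresite ρ) (hg : HasGluing.{w} ρ) :
    (precomp h.isContinuous ρ).IsEquivalence where
  faithful := h.faithful_precomp hρ
  full := h.full_precomp hρ
  essSurj := ⟨fun G ↦ by
    obtain ⟨F, c, hc, hF⟩ := h.exists_extension G.property hρ hg
    obtain ⟨e⟩ := h.nonempty_iso_extension G.property hc hF hρ
    exact ⟨⟨F, h.isContinuous_extension G.property hρ hc hF⟩, ⟨ObjectProperty.isoMk _ e⟩⟩⟩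

end

/-! ### Local representability of arrows of D by arrows of C -/

section Representable

variable {C : Type u₁} [Category.{v₁} C] {D : Type u₂} [Category.{v₂} D]
  {τ : Precoverage C} {σ : Precoverage D} {J : C ⥤ D}

variable (τ J) in
/-- The pullback of `e` along `m` is the image of a clopen arrow of `C`. -/
def IsRepr {U E : C} {Z : D} (m : J.obj U ⟶ Z) (e : J.obj E ⟶ Z) : Prop :=
  ∃ (W : C) (a : W ⟶ U) (g : W ⟶ E), clopen τ a ∧ IsPullback (J.map a) (J.map g) m e

variable (τ J) in
/-- The pullback of `m` and `e` is the image of a span of clopen arrows of `C`. -/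
def IsClopenRepr {U E : C} {Z : D} (m : J.obj U ⟶ Z) (e : J.obj E ⟶ Z) : Prop :=
  ∃ (W : C) (a : W ⟶ U) (g : W ⟶ E), clopen τ a ∧ clopen τ g ∧
    IsPullback (J.map a) (J.map g) m e

theorem IsClopenRepr.isRepr {U E : C} {Z : D} {m : J.obj U ⟶ Z} {e : J.obj E ⟶ Z}
    (h : IsClopenRepr τ J m e) : IsRepr τ J m e := by
  obtain ⟨W, a, g, ha, -, hP⟩ := h
  exact ⟨W, a, g, ha, hP⟩

theorem IsClopenRepr.symm {U E : C} {Z : D} {m : J.obj U ⟶ Z} {e : J.obj E ⟶ Z}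
    (h : IsClopenRepr τ J m e) : IsClopenRepr τ J e m := by
  obtain ⟨W, a, g, ha, hg, hP⟩ := h
  exact ⟨W, g, a, hg, ha, hP.flip⟩

variable (h : Setting τ σ J)
include h

theorem Setting.mono_map {U V : C} {w : U ⟶ V} (hw : clopen τ w) : Mono (J.map w) :=
  h.target.mono _ (h.admitsAtlases.isContinuous.map_clopen hw)

/-- Since J reflects coverings, the inverse of J w yields a factorization of the identity through
the monic w. -/
theorem Setting.isIso_of_map {U V : C} {w : U ⟶ V} (hw : clopen τ w) [IsIso (J.map w)] :
    IsIso w := by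
  have := h.source.mono w hw
  obtain ⟨l, hl⟩ := h.admitsAtlases.exists_factorization hw (𝟙 V) (inv (J.map w)) (by simp)
  exact ⟨l, by rw [← cancel_mono w, Category.assoc, hl]; simp, hl⟩

/-- A clopen arrow of `C` representing the pullback of a monic arrow `e` exists as soon as it is
covered by such arrows. -/
theorem Setting.exists_isPullback_of_local {U : C} {Z V : D} (m : J.obj U ⟶ Z) (e : V ⟶ Z) [Mono e]
    {κ : Type*} {W : κ → C} (w : ∀ k, W k ⟶ U) (hw : ∀ k, clopen τ (w k))
    (z : ∀ k, J.obj (W k) ⟶ V) (hz : ∀ k, z k ≫ e = J.map (w k) ≫ m)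
    (hloc : ∀ ⦃T : D⦄ (x : T ⟶ J.obj U) (y : T ⟶ V), y ≫ e = x ≫ m →
      ∃ R ∈ σ.toGrothendieck T, ∀ ⦃T' : D⦄ (l : T' ⟶ T), R l →
        ∃ k, ∃ t : T' ⟶ J.obj (W k), t ≫ J.map (w k) = l ≫ x) :
    ∃ (T : C) (t : T ⟶ U) (y : J.obj T ⟶ V) (r : ∀ k, W k ⟶ T), clopen τ t ∧
      (∀ k, clopen τ (r k)) ∧ Sieve.ofArrows W r ∈ τ.toGrothendieck T ∧ (∀ k, r k ≫ t = w k) ∧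
      IsPullback (J.map t) y m e := by
  have hJ := h.admitsAtlases.isContinuous
  -- The union in C of the pieces W k. J preserves the covering of T by them, so the arrow to V is
  -- obtained locally, e being monic.
  obtain ⟨T, t, r, ht, hr, hcov, hrt⟩ := h.source.exists_union w hw
  have hJcov := hJ.cover_map h.target.isPresite h.source.isPresite hcov
  have := h.mono_map ht
  obtain ⟨y, hy⟩ := h.target.subcanonical.exists_lift_of_local hJcov e (J.map t ≫ m)
    (fun T' k hk ↦ by
      obtain ⟨i, x, rfl⟩ := (Sieve.mem_ofArrows_iff _ _ _).1 hk
      exact ⟨x ≫ z i, by rw [Category.assoc, hz, ← hrt, J.map_comp]; simp⟩)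
  refine ⟨T, t, y, r, ht, hr, hcov, hrt, isPullback_of_exists_lift hy.symm fun Q a b hab ↦ ?_⟩
  obtain ⟨R, hR, hR'⟩ := hloc a b hab.symm
  obtain ⟨l, hl⟩ := h.target.subcanonical.exists_lift_of_local hR (J.map t) a (fun Q' k hk ↦ by
    obtain ⟨i, s, hs⟩ := hR' k hk
    exact ⟨s ≫ J.map (r i), by rw [Category.assoc, ← J.map_comp, hrt, hs]⟩)
  exact ⟨l, hl, by rw [← cancel_mono e, Category.assoc, hy, reassoc_of% hl, hab]⟩

/-- The pullback square exists by `Setting.exists_isPullback_of_local`. Its second leg lies in the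
image of J because the arrows c k glue in C: their compatibility may be tested after applying the
faithful J. -/
theorem Setting.isRepr_of_local {U E : C} {Z : D} (m : J.obj U ⟶ Z) (e : J.obj E ⟶ Z) [Mono e]
    {κ : Type*} {W : κ → C} (w : ∀ k, W k ⟶ U) (hw : ∀ k, clopen τ (w k))
    (c : ∀ k, W k ⟶ E) (hc : ∀ k, J.map (c k) ≫ e = J.map (w k) ≫ m)
    (hloc : ∀ ⦃T : D⦄ (x : T ⟶ J.obj U) (y : T ⟶ J.obj E), y ≫ e = x ≫ m →
      ∃ R ∈ σ.toGrothendieck T, ∀ ⦃T' : D⦄ (l : T' ⟶ T), R l →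
        ∃ k, ∃ t : T' ⟶ J.obj (W k), t ≫ J.map (w k) = l ≫ x) :
    IsRepr τ J m e ∧ (Mono m → (∀ k, clopen τ (c k)) → IsClopenRepr τ J m e) := by
  have := h.admitsAtlases.faithful
  obtain ⟨T, t, y, r, ht, hr, hcov, hrt, hP⟩ :=
    h.exists_isPullback_of_local m e w hw (fun k ↦ J.map (c k)) hc hloc
  have hry (k : κ) : J.map (r k) ≫ y = J.map (c k) := by
    rw [← cancel_mono e, Category.assoc, ← hP.w, ← J.map_comp_assoc, hrt, hc]
  obtain ⟨g, hg⟩ := h.source.subcanonical.exists_desc hcov c (fun i j Q a b hab ↦ by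
    apply J.map_injective
    rw [J.map_comp, J.map_comp, ← hry, ← hry, ← J.map_comp_assoc, hab, J.map_comp_assoc])
  have hgy : J.map g = y := by
    refine h.target.subcanonical.hom_ext_of_cover
      (h.admitsAtlases.isContinuous.cover_map h.target.isPresite h.source.isPresite hcov)
      fun k ↦ ?_
    rw [← J.map_comp, hg, hry]
  subst hgy
  refine ⟨⟨T, t, g, ht, hP⟩, fun hm hc' ↦ ⟨T, t, g, ht, ?_, hP⟩⟩
  have : Mono (J.map g) :=
    MorphismProperty.of_isPullback (P := MorphismProperty.monomorphisms D) hP hm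
  have : Mono g := J.mono_of_mono_map this
  exact h.source.clopen_of_source hcov g fun k ↦ by rw [hg]; exact hc' k

/-- Representability along `m` can be checked through a cover `β` of the target of `f`. -/
theorem Setting.isRepr_of_cover {U E : C} {Y Z : D} (m : J.obj U ⟶ Z) (e : J.obj E ⟶ Z) [Mono e]
    (f : J.obj U ⟶ Y) {κ : Type*} {B O : κ → C} {β : ∀ k, J.obj (B k) ⟶ Y}
    (hβ : Sieve.ofArrows (fun k ↦ J.obj (B k)) β ∈ σ.toGrothendieck Y)
    (p : ∀ k, O k ⟶ B k) (hp : ∀ k, clopen τ (p k)) (o : ∀ k, O k ⟶ E)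
    (comm : ∀ k ⦃T : C⦄ (x : T ⟶ U) (y : T ⟶ O k),
      J.map x ≫ f = J.map (y ≫ p k) ≫ β k → J.map x ≫ m = J.map (y ≫ o k) ≫ e)
    (lift : ∀ k ⦃T : D⦄ (x : T ⟶ J.obj U) (z : T ⟶ J.obj E) (t : T ⟶ J.obj (B k)),
      x ≫ m = z ≫ e → x ≫ f = t ≫ β k → ∃ y : T ⟶ J.obj (O k), y ≫ J.map (p k) = t) :
    ((∀ k, IsRepr τ J f (β k)) → IsRepr τ J m e) ∧
    (Mono m → (∀ k, IsClopenRepr τ J f (β k)) → (∀ k, clopen τ (o k)) →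
      IsClopenRepr τ J m e) := by
  have hτ := h.source.isPresite
  have hJ := h.admitsAtlases.isContinuous
  have key (W : κ → C) (a : ∀ k, W k ⟶ U) (g : ∀ k, W k ⟶ B k) (ha : ∀ k, clopen τ (a k))
      (hP : ∀ k, IsPullback (J.map (a k)) (J.map (g k)) f (β k)) :
      IsRepr τ J m e ∧
        (Mono m → (∀ k, clopen τ (g k)) → (∀ k, clopen τ (o k)) → IsClopenRepr τ J m e) := by
    -- The pieces are intersections inside the chart B k: of W k, the part of U lying over it
    -- through f, with O k, the part relevant for E.
    have (k : κ) : HasPullback (p k) (g k) := clopen.hasPullback hτ (hp k) (g k)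
    have hQ (k : κ) := IsPullback.of_hasPullback (p k) (g k)
    have := h.isRepr_of_local m e (fun k ↦ pullback.snd (p k) (g k) ≫ a k)
      (fun k ↦ clopen.comp hτ (clopen.of_isPullback hτ (hQ k) (hp k)) (ha k))
      (fun k ↦ pullback.fst (p k) (g k) ≫ o k) (fun k ↦ by
        refine (comm k _ _ ?_).symm
        rw [pullback.condition, J.map_comp, Category.assoc, (hP k).w, J.map_comp_assoc])
      (fun T x y hxy ↦ by
        obtain ⟨R, hR, hR'⟩ := IsPresite.exists_sieve hβ (x ≫ f)
        refine ⟨R, hR, fun T' l hl ↦ ?_⟩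
        obtain ⟨k, t, ht⟩ := hR' l hl
        obtain ⟨y', hy'⟩ := lift k (l ≫ x) (l ≫ y) t (by simp [hxy]) (by simp [ht])
        refine ⟨k, (hJ.map_isPullback (hp k) (hQ k).flip).lift
          ((hP k).lift (l ≫ x) t (by simp [ht])) y' (by simp [hy']), ?_⟩
        rw [J.map_comp, IsPullback.lift_fst_assoc, IsPullback.lift_fst])
    exact ⟨this.1, fun hm hg ho ↦ this.2 hm fun k ↦
      clopen.comp hτ (clopen.of_isPullback hτ (hQ k).flip (hg k)) (ho k)⟩
  refine ⟨fun hf ↦ ?_, fun hm hf ho ↦ ?_⟩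
  · choose W a g ha hP using hf
    exact (key W a g ha hP).1
  · choose W a g ha hg hP using hf
    exact (key W a g ha hP).2 hm hg ho

theorem Setting.isRepr_comp {U E : C} {Y Z : D} (f : J.obj U ⟶ Y) (g : Y ⟶ Z) (e : J.obj E ⟶ Z)
    [Mono e] {κ : Type*} {B : κ → C} {β : ∀ k, J.obj (B k) ⟶ Y}
    (hβ : Sieve.ofArrows (fun k ↦ J.obj (B k)) β ∈ σ.toGrothendieck Y)
    (hf : ∀ k, IsRepr τ J f (β k)) (hg : ∀ k, IsRepr τ J (β k ≫ g) e) :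
    IsRepr τ J (f ≫ g) e := by
  choose O p o hp hP using hg
  refine (h.isRepr_of_cover (f ≫ g) e f hβ p hp o (fun k T x y hxy ↦ ?_)
    (fun k T x z t h1 h2 ↦ ?_)).1 hf
  · rw [reassoc_of% hxy, J.map_comp, J.map_comp, Category.assoc, Category.assoc, (hP k).w]
  · exact ⟨(hP k).lift t z (by rw [← reassoc_of% h2, h1]), (hP k).lift_fst _ _ _⟩

theorem Setting.isClopenRepr_comp {U E : C} {Y Z : D} (f : J.obj U ⟶ Y) (g : Y ⟶ Z)
    (e : J.obj E ⟶ Z) [Mono e] [Mono f] [Mono g] {κ : Type*} {B : κ → C}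
    {β : ∀ k, J.obj (B k) ⟶ Y}
    (hβ : Sieve.ofArrows (fun k ↦ J.obj (B k)) β ∈ σ.toGrothendieck Y)
    (hf : ∀ k, IsClopenRepr τ J f (β k)) (hg : ∀ k, IsClopenRepr τ J (β k ≫ g) e) :
    IsClopenRepr τ J (f ≫ g) e := by
  choose O p o hp ho hP using hg
  refine (h.isRepr_of_cover (f ≫ g) e f hβ p hp o (fun k T x y hxy ↦ ?_)
    (fun k T x z t h1 h2 ↦ ?_)).2 inferInstance hf ho
  · rw [reassoc_of% hxy, J.map_comp, J.map_comp, Category.assoc, Category.assoc, (hP k).w]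
  · exact ⟨(hP k).lift t z (by rw [← reassoc_of% h2, h1]), (hP k).lift_fst _ _ _⟩

/-- For monic v the overlap of m and e can be computed after composing with v; the pieces O k are
the overlaps of e ≫ v with the charts of Y. -/
theorem Setting.isRepr_lift {U E : C} {Y Z : D} (m : J.obj U ⟶ Z) (e : J.obj E ⟶ Z) [Mono e]
    (v : Z ⟶ Y) [Mono v] {κ : Type*} {B : κ → C} {β : ∀ k, J.obj (B k) ⟶ Y}
    (hβ : Sieve.ofArrows (fun k ↦ J.obj (B k)) β ∈ σ.toGrothendieck Y)
    (hf : ∀ k, IsRepr τ J (m ≫ v) (β k)) (hv : ∀ k, IsClopenRepr τ J (e ≫ v) (β k)) :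
    IsRepr τ J m e := by
  choose O o p ho hp hP using hv
  refine (h.isRepr_of_cover m e (m ≫ v) hβ p hp o (fun k T x y hxy ↦ ?_)
    (fun k T x z t h1 h2 ↦ ?_)).1 hf
  · rw [← cancel_mono v, Category.assoc, hxy, J.map_comp, J.map_comp, Category.assoc,
      Category.assoc, Category.assoc, (hP k).w]
  · exact ⟨(hP k).lift z t (by rw [← h2, reassoc_of% h1]), (hP k).lift_snd _ _ _⟩

/-- Arrows representable along each other are clopen representable. -/
theorem Setting.isClopenRepr_of_isRepr {U E : C} {Z : D} {m : J.obj U ⟶ Z} {e : J.obj E ⟶ Z}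
    [Mono m] [Mono e] (h1 : IsRepr τ J m e) (h2 : IsRepr τ J e m) : IsClopenRepr τ J m e := by
  have hτ := h.source.isPresite
  have := h.admitsAtlases.faithful
  obtain ⟨W, a, g, ha, hag⟩ := h1
  obtain ⟨V, b, g', hb, hbg⟩ := h2
  have := h.source.mono _ ha
  have := h.source.mono _ hb
  -- W and V represent the same pullback. The two comparison arrows of D factor arrows of C through
  -- clopen arrows, so they come from C; hence g is an isomorphism followed by the clopen arrow b.
  obtain ⟨l, hl⟩ := h.admitsAtlases.exists_factorization hb g
    (hbg.lift (J.map g) (J.map a) hag.w.symm) (hbg.lift_fst _ _ _)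
  obtain ⟨l', hl'⟩ := h.admitsAtlases.exists_factorization ha g'
    (hag.lift (J.map g') (J.map b) hbg.w.symm) (hag.lift_fst _ _ _)
  have e1 : l ≫ g' = a := by
    apply J.map_injective
    rw [← cancel_mono m, J.map_comp, Category.assoc, ← hbg.w, ← J.map_comp_assoc, hl, hag.w]
  have e2 : l' ≫ g = b := by
    apply J.map_injective
    rw [← cancel_mono e, J.map_comp, Category.assoc, ← hag.w, ← J.map_comp_assoc, hl', hbg.w]
  have : IsIso l := ⟨l', by rw [← cancel_mono a, Category.assoc, hl', e1, Category.id_comp],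
    by rw [← cancel_mono b, Category.assoc, hl, e2, Category.id_comp]⟩
  exact ⟨W, a, g, ha, hl ▸ clopen.comp hτ (clopen_of_isIso hτ l) hb, hag⟩

/-- Restriction of the chart `m` to a clopen part. -/
theorem Setting.isClopenRepr_restrict {U U' E : C} {Z : D} {m : J.obj U ⟶ Z} {e : J.obj E ⟶ Z}
    {w : U' ⟶ U} (hw : clopen τ w) (hm : IsClopenRepr τ J m e) :
    IsClopenRepr τ J (J.map w ≫ m) e := by
  have hτ := h.source.isPresite
  obtain ⟨W, a, g, ha, hg, hP⟩ := hm
  have : HasPullback w a := clopen.hasPullback hτ hw a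
  have hQ := IsPullback.of_hasPullback w a
  exact ⟨_, pullback.fst w a, pullback.snd w a ≫ g, clopen.of_isPullback hτ hQ.flip ha,
    clopen.comp hτ (clopen.of_isPullback hτ hQ hw) hg, by
      rw [J.map_comp]
      exact ((h.admitsAtlases.isContinuous.map_isPullback ha hQ).flip.paste_horiz hP.flip).flip⟩

end Representable

/-! ### Arrows and J-clopen arrows of C_J -/

section ChartCat

variable {C : Type u₁} [Category.{v₁} C] {D : Type u₂} [Category.{v₂} D]
  {τ : Precoverage C} {σ : Precoverage D} {J : C ⥤ D} {h : Setting τ σ J}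

/-- An atlas representing the class of atlases of an object of `C_J`. -/
noncomputable def ChartCat.atlas (P : ChartCat.{w} h) : Atlas.{w} τ σ J P.X := P.cls.out

theorem ChartCat.mk_atlas (P : ChartCat.{w} h) :
    Quotient.mk (atlasSetoid.{w} h P.X) P.atlas = P.cls :=
  Quotient.out_eq _

/-- The underlying arrow of `D`. -/
def ChartCat.val {P Q : ChartCat.{w} h} (f : P ⟶ Q) : P.X ⟶ Q.X := ChartCat.Hom.f f

theorem ChartCat.val_comp {P Q R : ChartCat.{w} h} (f : P ⟶ Q) (g : Q ⟶ R) :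
    val (f ≫ g) = val f ≫ val g := rfl

theorem ChartCat.val_id (P : ChartCat.{w} h) : val (𝟙 P) = 𝟙 P.X := rfl

theorem ChartCat.val_injective {P Q : ChartCat.{w} h} {f g : P ⟶ Q} (e : val f = val g) : f = g :=
  ChartCat.Hom.ext e

instance ChartCat.isIso_val {P Q : ChartCat.{w} h} (f : P ⟶ Q) [IsIso f] : IsIso (val f) :=
  ⟨val (inv f), by rw [← val_comp, IsIso.hom_inv_id, val_id],
    by rw [← val_comp, IsIso.inv_hom_id, val_id]⟩

/-- The underlying arrow of `D` of an arrow on an object of `C`. -/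
def ChartCat.pt {U : C} {Q : ChartCat.{w} h} (f : (chartFunctor h).obj U ⟶ Q) : J.obj U ⟶ Q.X :=
  ChartCat.Hom.f f

theorem ChartCat.pt_comp {U : C} {Q R : ChartCat.{w} h} (f : (chartFunctor h).obj U ⟶ Q)
    (g : Q ⟶ R) : pt (f ≫ g) = pt f ≫ val g := rfl

theorem ChartCat.isAdmissible_iff {P Q : ChartCat.{w} h} {A : Atlas.{w} τ σ J P.X}
    {B : Atlas.{w} τ σ J Q.X} (hA : Quotient.mk (atlasSetoid.{w} h P.X) A = P.cls)
    (hB : Quotient.mk (atlasSetoid.{w} h Q.X) B = Q.cls) (f : P.X ⟶ Q.X) :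
    P.IsAdmissible Q f ↔ ∀ i k, IsRepr τ J (A.u i ≫ f) (B.u k) := by
  unfold ChartCat.IsAdmissible
  rw [← hA, ← hB]
  exact Iff.rfl

theorem ChartCat.exists_val_of_atlas {P Q : ChartCat.{w} h} {A : Atlas.{w} τ σ J P.X}
    {B : Atlas.{w} τ σ J Q.X} (hA : Quotient.mk (atlasSetoid.{w} h P.X) A = P.cls)
    (hB : Quotient.mk (atlasSetoid.{w} h Q.X) B = Q.cls) (f : P.X ⟶ Q.X)
    (hf : ∀ i k, IsRepr τ J (A.u i ≫ f) (B.u k)) : ∃ f' : P ⟶ Q, val f' = f :=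
  ⟨⟨f, (ChartCat.isAdmissible_iff hA hB f).2 hf⟩, rfl⟩

theorem ChartCat.exists_val {P Q : ChartCat.{w} h} (f : P.X ⟶ Q.X)
    (hf : ∀ i k, IsRepr τ J (P.atlas.u i ≫ f) (Q.atlas.u k)) : ∃ f' : P ⟶ Q, val f' = f :=
  exists_val_of_atlas P.mk_atlas Q.mk_atlas f hf

theorem ChartCat.isRepr_val {P Q : ChartCat.{w} h} (f : P ⟶ Q) (i : P.atlas.ι)
    (k : Q.atlas.ι) : IsRepr τ J (P.atlas.u i ≫ val f) (Q.atlas.u k) :=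
  (ChartCat.isAdmissible_iff P.mk_atlas Q.mk_atlas _).1 (ChartCat.Hom.admissible f) i k

theorem ChartCat.exists_pt_of_atlas {U : C} {Q : ChartCat.{w} h}
    {B : Atlas.{w} τ σ J Q.X} (hB : Quotient.mk (atlasSetoid.{w} h Q.X) B = Q.cls)
    (f : J.obj U ⟶ Q.X) (hf : ∀ k, IsRepr τ J f (B.u k)) :
    ∃ f' : (chartFunctor h).obj U ⟶ Q, pt f' = f := by
  refine exists_val_of_atlas (P := (chartFunctor h).obj U) (A := idAtlas h U) rfl hB f
    fun _ k ↦ ?_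
  have e : 𝟙 _ ≫ f = f := Category.id_comp f
  have := hf k
  rwa [← e] at this

theorem ChartCat.exists_pt {U : C} {Q : ChartCat.{w} h} (f : J.obj U ⟶ Q.X)
    (hf : ∀ k, IsRepr τ J f (Q.atlas.u k)) : ∃ f' : (chartFunctor h).obj U ⟶ Q, pt f' = f :=
  exists_pt_of_atlas Q.mk_atlas f hf

theorem ChartCat.isRepr_pt {U : C} {Q : ChartCat.{w} h} (f : (chartFunctor h).obj U ⟶ Q)
    (k : Q.atlas.ι) : IsRepr τ J (pt f) (Q.atlas.u k) := by
  have := (ChartCat.isAdmissible_iff (P := (chartFunctor h).obj U) (A := idAtlas h U) rfl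
    Q.mk_atlas _).1 (ChartCat.Hom.admissible f) PUnit.unit k
  have e : 𝟙 _ ≫ pt f = pt f := Category.id_comp _
  rw [← e]
  exact this

instance ChartCat.mono_chart (P : ChartCat.{w} h) (i : P.atlas.ι) : Mono (P.atlas.u i) :=
  h.target.mono _ (P.atlas.clopen_chart i)

theorem ChartCat.cover_atlas (P : ChartCat.{w} h) :
    Sieve.ofArrows (fun i ↦ J.obj (P.atlas.U i)) P.atlas.u ∈ σ.toGrothendieck P.X :=
  (h.target.isPresite.ofArrows_mem_iff.1 P.atlas.isAtlas.covering).2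

theorem ChartCat.exists_chart (P : ChartCat.{w} h) (i : P.atlas.ι) :
    ∃ u : (chartFunctor h).obj (P.atlas.U i) ⟶ P, pt u = P.atlas.u i :=
  exists_pt _ fun k ↦ IsClopenRepr.isRepr (P.atlas.isAtlas.overlap i k)

/-- The charts of an object, as arrows of `C_J`. -/
noncomputable def ChartCat.chart (P : ChartCat.{w} h) (i : P.atlas.ι) :
    (chartFunctor h).obj (P.atlas.U i) ⟶ P :=
  (P.exists_chart i).choose

theorem ChartCat.pt_chart (P : ChartCat.{w} h) (i : P.atlas.ι) : pt (P.chart i) = P.atlas.u i :=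
  (P.exists_chart i).choose_spec

theorem Compatible.isClopenRepr {X : D} {A B : Atlas.{w} τ σ J X} (hAB : Compatible A B)
    (i : A.ι) (k : B.ι) : IsClopenRepr τ J (A.u i) (B.u k) :=
  hAB.overlap (Sum.inl i) (Sum.inr k)

/-- The atlases are exchanged one after the other by composing clopen representable arrows: on the
target with the identity of Y, on the source with that of X. -/
theorem ChartClopen.congr (h : Setting τ σ J) {X Y : D} {A A₁ : Atlas.{w} τ σ J X}
    {B B₁ : Atlas.{w} τ σ J Y} {f : X ⟶ Y} (hA : Compatible A₁ A) (hB : Compatible B B₁)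
    (hf : ChartClopen A B f) : ChartClopen A₁ B₁ f := by
  have hσ := h.target.isPresite
  obtain ⟨hm, hf⟩ := hf
  have (B : Atlas.{w} τ σ J Y) (k : B.ι) : Mono (B.u k) := h.target.mono _ (B.clopen_chart k)
  have (B : Atlas.{w} τ σ J X) (k : B.ι) : Mono (B.u k) := h.target.mono _ (B.clopen_chart k)
  have h1 (i : A.ι) (k : B₁.ι) : IsClopenRepr τ J (A.u i ≫ f) (B₁.u k) := by
    have := h.isClopenRepr_comp (A.u i ≫ f) (𝟙 Y) (B₁.u k)
      (hσ.ofArrows_mem_iff.1 B.isAtlas.covering).2 (fun l ↦ hf i l) (fun l ↦ by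
        simpa using hB.isClopenRepr l k)
    simpa using this
  exact ⟨hm, fun i k ↦ h.isClopenRepr_comp (A₁.u i) f (B₁.u k)
    (hσ.ofArrows_mem_iff.1 A.isAtlas.covering).2 (fun l ↦ hA.isClopenRepr i l)
    (fun l ↦ h1 l k)⟩

open ChartCat

theorem isJClopen_iff_of_atlas {P Q : ChartCat.{w} h} (f : P ⟶ Q) {A : Atlas.{w} τ σ J P.X}
    {B : Atlas.{w} τ σ J Q.X} (hA : Quotient.mk (atlasSetoid.{w} h P.X) A = P.cls)
    (hB : Quotient.mk (atlasSetoid.{w} h Q.X) B = Q.cls) :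
    IsJClopen f ↔ Mono (val f) ∧ ∀ i k, IsClopenRepr τ J (A.u i ≫ val f) (B.u k) :=
  ⟨fun hf ↦ hf A B hA hB, fun hf _ _ hA' hB' ↦
    ChartClopen.congr h (Quotient.exact (hA'.trans hA.symm))
      (Quotient.exact (hB.trans hB'.symm)) hf⟩

theorem isJClopen_iff {P Q : ChartCat.{w} h} (f : P ⟶ Q) :
    IsJClopen f ↔ Mono (val f) ∧
      ∀ i k, IsClopenRepr τ J (P.atlas.u i ≫ val f) (Q.atlas.u k) :=
  isJClopen_iff_of_atlas f P.mk_atlas Q.mk_atlas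

theorem isJClopen_iff_pt {U : C} {Q : ChartCat.{w} h} (f : (chartFunctor h).obj U ⟶ Q) :
    IsJClopen f ↔ Mono (pt f) ∧ ∀ k, IsClopenRepr τ J (pt f) (Q.atlas.u k) := by
  rw [isJClopen_iff_of_atlas f (A := idAtlas h U) rfl Q.mk_atlas]
  have e : 𝟙 _ ≫ pt f = pt f := Category.id_comp _
  refine and_congr_right fun _ ↦ ⟨fun hf k ↦ ?_, fun hf _ k ↦ ?_⟩
  · rw [← e]
    exact hf PUnit.unit k
  · have := hf k
    rw [← e] at this
    exact this

theorem ChartCat.isJClopen_chart (P : ChartCat.{w} h) (i : P.atlas.ι) : IsJClopen (P.chart i) := by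
  rw [isJClopen_iff_pt, pt_chart]
  exact ⟨inferInstance, fun k ↦ P.atlas.isAtlas.overlap i k⟩

theorem IsJClopen.mono_val {P Q : ChartCat.{w} h} {f : P ⟶ Q} (hf : IsJClopen f) : Mono (val f) :=
  ((isJClopen_iff f).1 hf).1

theorem IsJClopen.mono_pt {U : C} {Q : ChartCat.{w} h} {f : (chartFunctor h).obj U ⟶ Q}
    (hf : IsJClopen f) : Mono (pt f) :=
  ((isJClopen_iff f).1 hf).1

theorem IsJClopen.mono {P Q : ChartCat.{w} h} {f : P ⟶ Q} (hf : IsJClopen f) : Mono f :=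
  have := hf.mono_val
  ⟨fun x y e ↦ val_injective (by rw [← cancel_mono (val f), ← val_comp, e, val_comp])⟩

theorem IsJClopen.comp {P Q R : ChartCat.{w} h} {f : P ⟶ Q} {g : Q ⟶ R} (hf : IsJClopen f)
    (hg : IsJClopen g) : IsJClopen (f ≫ g) := by
  have := hf.mono_val
  have := hg.mono_val
  refine (isJClopen_iff _).2 ⟨by rw [val_comp]; infer_instance, fun i k ↦ ?_⟩
  rw [val_comp, ← Category.assoc]
  exact h.isClopenRepr_comp _ _ _ Q.cover_atlas (fun l ↦ ((isJClopen_iff f).1 hf).2 i l)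
    (fun l ↦ ((isJClopen_iff g).1 hg).2 l k)

/-- Being clopen is checked on the charts of the source, by locality on the source, and then over
the charts of the target. -/
theorem IsJClopen.clopen_val {P Q : ChartCat.{w} h} {f : P ⟶ Q} (hf : IsJClopen f) :
    clopen σ (val f) := by
  have hJ := h.admitsAtlases.isContinuous
  have := hf.mono_val
  refine h.target.clopen_of_source P.cover_atlas _ fun i ↦ ?_
  choose W a g ha hg hP using ((isJClopen_iff f).1 hf).2 i
  exact h.target.clopen_of_target Q.atlas.isAtlas.covering _ hP fun k ↦ hJ.map_clopen (hg k)

theorem IsJClopen.clopen_pt {U : C} {Q : ChartCat.{w} h} {f : (chartFunctor h).obj U ⟶ Q}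
    (hf : IsJClopen f) : clopen σ (pt f) :=
  hf.clopen_val

/-- The pullback of a `J`-clopen chart along any arrow is representable. -/
theorem IsJClopen.isRepr {U V : C} {P : ChartCat.{w} h} {u : (chartFunctor h).obj U ⟶ P}
    (hu : IsJClopen u) (f : (chartFunctor h).obj V ⟶ P) : IsRepr τ J (pt f) (pt u) := by
  have := hu.mono_pt
  exact h.isRepr_lift (pt f) (pt u) (𝟙 _) P.cover_atlas
    (by simpa using P.isRepr_pt f) (by simpa using ((isJClopen_iff_pt u).1 hu).2)

theorem IsJClopen.isClopenRepr {U V : C} {P : ChartCat.{w} h} {u : (chartFunctor h).obj U ⟶ P}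
    (hu : IsJClopen u) {v : (chartFunctor h).obj V ⟶ P} (hv : IsJClopen v) :
    IsClopenRepr τ J (pt v) (pt u) := by
  have h1 := hu.mono_pt
  have h2 := hv.mono_pt
  exact h.isClopenRepr_of_isRepr (hu.isRepr v) (hv.isRepr u)

/-- Arrows which factor through a `J`-clopen arrow in `D` do so in `C_J`. -/
theorem IsJClopen.exists_lift {P Q T : ChartCat.{w} h} {v : P ⟶ Q} (hv : IsJClopen v) (f : T ⟶ Q)
    (g : T.X ⟶ P.X) (hg : g ≫ val v = val f) : ∃ l : T ⟶ P, l ≫ v = f ∧ val l = g := by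
  have := hv.mono_val
  obtain ⟨l, hl⟩ := ChartCat.exists_val g fun i j ↦
    h.isRepr_lift _ _ (val v) Q.cover_atlas (fun k ↦ by
      rw [Category.assoc, hg]
      exact ChartCat.isRepr_val f i k)
    (fun k ↦ ((isJClopen_iff v).1 hv).2 j k)
  exact ⟨l, val_injective (by rw [val_comp, hl, hg]), hl⟩

theorem IsJClopen.isIso {P Q : ChartCat.{w} h} {v : P ⟶ Q} (hv : IsJClopen v)
    [IsIso (val v)] : IsIso v := by
  have := hv.mono
  obtain ⟨l, hl, -⟩ := hv.exists_lift (𝟙 Q) (inv (val v)) (by rw [val_id, IsIso.inv_hom_id])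
  exact ⟨l, by rw [← cancel_mono v, Category.assoc, hl, Category.id_comp, Category.comp_id], hl⟩

/-- Both f and its inverse are admissible, and two-sided representability gives clopen
representability by `Setting.isClopenRepr_of_isRepr`. -/
theorem isJClopen_of_isIso {P Q : ChartCat.{w} h} (f : P ⟶ Q) [IsIso f] : IsJClopen f := by
  refine (isJClopen_iff f).2 ⟨inferInstance, fun i k ↦
    h.isClopenRepr_of_isRepr (ChartCat.isRepr_val f i k) ?_⟩
  obtain ⟨W, a, g, ha, hP⟩ := ChartCat.isRepr_val (inv f) k i
  have e : val (inv f) ≫ val f = 𝟙 _ := by rw [← val_comp, IsIso.inv_hom_id, val_id]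
  refine ⟨W, a, g, ha, ⟨⟨?_⟩, ⟨PullbackCone.IsLimit.mk _
    (fun s ↦ hP.lift s.fst s.snd ?_) (fun s ↦ hP.lift_fst _ _ _) (fun s ↦ hP.lift_snd _ _ _)
    fun s m h1 h2 ↦ hP.hom_ext (by rw [h1, hP.lift_fst]) (by rw [h2, hP.lift_snd])⟩⟩⟩
  · rw [← reassoc_of% hP.w, e, Category.comp_id]
  · rw [← cancel_mono (val f), Category.assoc, Category.assoc, Category.assoc, e,
      Category.comp_id, s.condition]

/-- Coverings of `C_J` given by families. -/
theorem ofArrows_mem_chartCoverings_iff {ι : Type*} {Q : ChartCat.{w} h} {P : ι → ChartCat.{w} h}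
    {u : ∀ i, P i ⟶ Q} : Presieve.ofArrows P u ∈ chartCoverings h Q ↔ (∀ i, IsJClopen (u i)) ∧
      Sieve.ofArrows (fun i ↦ (P i).X) (fun i ↦ val (u i)) ∈ σ.toGrothendieck Q.X := by
  have e : (Presieve.ofArrows P u).map (chartForget h) =
    Presieve.ofArrows (fun i ↦ (P i).X) (fun i ↦ val (u i)) := Presieve.map_ofArrows _
  constructor
  · rintro ⟨h1, h2⟩
    rw [e] at h2
    exact ⟨fun i ↦ h1 _ ⟨i⟩, (h.target.isPresite.ofArrows_mem_iff.1 h2).2⟩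
  · rintro ⟨h1, h2⟩
    refine ⟨by rintro _ _ ⟨i⟩; exact h1 i, ?_⟩
    rw [e]
    exact h.target.isPresite.ofArrows_mem_iff.2 ⟨fun i ↦ (h1 i).clopen_val, h2⟩

theorem clopen_chartCoverings_iff {P Q : ChartCat.{w} h} {f : P ⟶ Q} :
    clopen (chartCoverings h) f ↔ IsJClopen f := by
  refine ⟨fun ⟨S, hS, hf⟩ ↦ hS.1 f hf, fun hf ↦ ?_⟩
  -- Together with the identity of Q, any J-clopen arrow is part of a covering.
  refine ⟨Presieve.ofArrows (fun b : Bool ↦ if b then P else Q)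
    (fun b ↦ match b with
      | true => f
      | false => 𝟙 Q), ?_, Presieve.ofArrows.mk (Y := fun b : Bool ↦ if b then P else Q) true⟩
  refine ofArrows_mem_chartCoverings_iff.2 ⟨?_, ?_⟩
  · rintro (_ | _)
    · exact isJClopen_of_isIso (𝟙 Q)
    · exact hf
  · refine σ.toGrothendieck.superset_covering ?_ (σ.toGrothendieck.top_mem Q.X)
    intro T k _
    exact (Sieve.mem_ofArrows_iff _ _ _).2 ⟨false, k, (Category.comp_id k).symm⟩

end ChartCat

/-! ### C_J as a DG-presite -/

section ChartPresite

variable {C : Type u₁} [Category.{v₁} C] {D : Type u₂} [Category.{v₂} D]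
  {τ : Precoverage C} {σ : Precoverage D} {J : C ⥤ D} {h : Setting τ σ J}

open ChartCat

theorem isPullback_of_comp_mono {P X Y Z Z' : D} {p : P ⟶ X} {q : P ⟶ Y} {f : X ⟶ Z} {g : Y ⟶ Z}
    (v : Z ⟶ Z') [Mono v] (hP : IsPullback p q (f ≫ v) (g ≫ v)) : IsPullback p q f g :=
  ⟨⟨by rw [← cancel_mono v, Category.assoc, Category.assoc, hP.w]⟩,
    ⟨PullbackCone.IsLimit.mk _
      (fun s ↦ hP.lift s.fst s.snd (by rw [← Category.assoc, s.condition, Category.assoc]))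
      (fun s ↦ hP.lift_fst _ _ _) (fun s ↦ hP.lift_snd _ _ _)
      fun s m h1 h2 ↦ hP.hom_ext (by rw [h1, hP.lift_fst]) (by rw [h2, hP.lift_snd])⟩⟩

/-- A clopen arrow of `D` which is representable over the charts underlies a `J`-clopen arrow. -/
theorem exists_isJClopen_of_isPullback {P : ChartCat.{w} h} {X : D} (v : X ⟶ P.X)
    (hv : clopen σ v) (hw : ∀ k, ∃ (W : C) (w : W ⟶ P.atlas.U k) (y : J.obj W ⟶ X),
      clopen τ w ∧ IsPullback (J.map w) y (P.atlas.u k) v) :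
    ∃ (V : ChartCat.{w} h) (e : V.X ≅ X) (v' : V ⟶ P), IsJClopen v' ∧ e.hom ≫ v = val v' := by
  have hσ := h.target.isPresite
  have := h.target.mono v hv
  choose W w y hw hP using hw
  have hcl (k l) : IsClopenRepr τ J (y k ≫ v) (P.atlas.u l) := by
    rw [← (hP k).w]
    exact h.isClopenRepr_restrict (hw k) (P.atlas.isAtlas.overlap k l)
  have hA : IsAtlas τ σ J W y := by
    refine ⟨Precoverage.mem_coverings_of_isPullback _ P.atlas.isAtlas.covering v _ _
      (fun i ↦ (hP i).flip), fun k l ↦ ?_⟩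
    have := (h.isClopenRepr_restrict (hw l) (hcl k l).symm).symm
    rw [(hP l).w] at this
    obtain ⟨O, a, b, ha, hb, hO⟩ := this
    exact ⟨O, a, b, ha, hb, isPullback_of_comp_mono v hO⟩
  -- The atlas of X consists of the charts of P restricted to X.
  let A : Atlas.{w} τ σ J X := ⟨P.atlas.ι, W, y, hA⟩
  obtain ⟨v', hv'⟩ := exists_val_of_atlas (P := ⟨X, Quotient.mk (atlasSetoid.{w} h X) A⟩) (A := A)
    rfl P.mk_atlas v fun k l ↦ (hcl k l).isRepr
  refine ⟨_, Iso.refl X, v', (isJClopen_iff_of_atlas v' (A := A) rfl P.mk_atlas).2 ?_, ?_⟩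
  · rw [hv']
    exact ⟨inferInstance, hcl⟩
  · rw [hv', Iso.refl_hom]
    exact Category.id_comp _

/-- The union is formed in D. Inside a chart of P it is the union of the overlaps with the given
charts, and these are clopen in C, so this union comes from C. -/
theorem exists_union_charts {P : ChartCat.{w} h} {κ : Type*} {U : κ → C}
    (u : ∀ s, (chartFunctor h).obj (U s) ⟶ P) (hu : ∀ s, IsJClopen (u s)) :
    ∃ (T : ChartCat.{w} h) (t : T ⟶ P) (r : ∀ s, (chartFunctor h).obj (U s) ⟶ T),
      IsJClopen t ∧ (∀ s, r s ≫ t = u s) ∧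
      Sieve.ofArrows (fun s ↦ J.obj (U s)) (fun s ↦ pt (r s)) ∈ σ.toGrothendieck T.X := by
  obtain ⟨X, v, r, hv, hr, hcov, hrv⟩ := h.target.exists_union (fun s ↦ pt (u s))
    fun s ↦ (hu s).clopen_pt
  have := h.target.mono v hv
  obtain ⟨T, e, t, ht, het⟩ := exists_isJClopen_of_isPullback v hv fun k ↦ by
    choose W a g ha hg hP using fun s ↦ (hu s).isClopenRepr (P.isJClopen_chart k)
    rw [pt_chart] at hP
    obtain ⟨T, t, y, -, ht, -, -, -, hPT⟩ := h.exists_isPullback_of_local (P.atlas.u k) v a ha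
      (fun s ↦ J.map (g s) ≫ r s) (fun s ↦ by rw [Category.assoc, hrv, (hP s).w])
      (fun T x y hxy ↦ by
        obtain ⟨R, hR, hR'⟩ := IsPresite.exists_sieve hcov y
        refine ⟨R, hR, fun T' l hl ↦ ?_⟩
        obtain ⟨s, t, ht⟩ := hR' l hl
        exact ⟨s, (hP s).lift (l ≫ x) t (by rw [Category.assoc, ← hxy, ← reassoc_of% ht, hrv]),
          (hP s).lift_fst _ _ _⟩)
    exact ⟨T, t, y, ht, hPT⟩
  have hrv' (s) : r s ≫ v = val (u s) := hrv s
  choose r' hr' hr'' using fun s ↦ ht.exists_lift (u s) (r s ≫ e.inv) (by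
    rw [← het, ← hrv']
    exact (Category.assoc _ _ _).trans (by rw [e.inv_hom_id_assoc]; rfl))
  refine ⟨T, t, r', ht, hr', ?_⟩
  refine ofArrows_mem_of_local (σ.toGrothendieck.pullback_stable e.hom hcov) fun V k hk ↦ ?_
  obtain ⟨s, a, ha⟩ := (Sieve.mem_ofArrows_iff _ _ _).1 hk
  refine ⟨⊤, σ.toGrothendieck.top_mem _, fun V' l _ ↦ ⟨s, l ≫ a, ?_⟩⟩
  have : pt (r' s) = r s ≫ e.inv := hr'' s
  rw [this, Category.assoc, ← reassoc_of% ha, e.hom_inv_id, Category.comp_id]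

theorem isPullback_of_val {P X Y Z : ChartCat.{w} h} {p : P ⟶ X} {q : P ⟶ Y} {f : X ⟶ Z}
    {g : Y ⟶ Z} (hp : IsJClopen p) (hP : IsPullback (val p) (val q) (val f) (val g)) :
    IsPullback p q f g := by
  have := hp.mono
  refine isPullback_of_exists_lift (val_injective hP.w) fun T a b hab ↦ ?_
  have hab' : val a ≫ val f = val b ≫ val g := congrArg val hab
  obtain ⟨l, hl, hl'⟩ := hp.exists_lift a (hP.lift (val a) (val b) hab') (hP.lift_fst _ _ _)
  exact ⟨l, hl, val_injective (by rw [val_comp, hl', hP.lift_snd])⟩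

/-- `J`-clopen arrows have pullbacks, which are `J`-clopen and preserved by the forgetful
functor. -/
theorem IsJClopen.exists_isPullback {X Y Z : ChartCat.{w} h} {g : Y ⟶ Z} (hg : IsJClopen g)
    (f : X ⟶ Z) : ∃ (P : ChartCat.{w} h) (p : P ⟶ X) (q : P ⟶ Y), IsJClopen p ∧
      IsPullback p q f g ∧ IsPullback (val p) (val q) (val f) (val g) := by
  have hσ := h.target.isPresite
  have := hg.mono_val
  have : HasPullback (val g) (val f) := clopen.hasPullback hσ hg.clopen_val _
  have hP := (IsPullback.of_hasPullback (val g) (val f)).flip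
  have hv := clopen.of_isPullback hσ hP.flip hg.clopen_val
  have := h.target.mono _ hv
  obtain ⟨T, e, t, ht, het⟩ := exists_isJClopen_of_isPullback _ hv fun k ↦ by
    -- Inside a chart of X the pullback is covered by the base changes of the charts of Y, which are
    -- represented in C.
    choose W a c ha hQ using fun j ↦ ((Y.isJClopen_chart j).comp hg).isRepr (X.chart k ≫ f)
    simp only [pt_comp, pt_chart] at hQ
    obtain ⟨T, t, y, -, ht, -, -, -, hPT⟩ := h.exists_isPullback_of_local (X.atlas.u k) _ a ha
      (fun j ↦ hP.lift (J.map (a j) ≫ X.atlas.u k) (J.map (c j) ≫ Y.atlas.u j)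
        (by rw [Category.assoc, (hQ j).w, Category.assoc]))
      (fun j ↦ hP.lift_fst _ _ _)
      (fun T x y hxy ↦ by
        obtain ⟨R, hR, hR'⟩ := IsPresite.exists_sieve Y.cover_atlas
          (y ≫ pullback.fst (val g) (val f))
        refine ⟨R, hR, fun T' l hl ↦ ?_⟩
        obtain ⟨j, t, ht⟩ := hR' l hl
        exact ⟨j, (hQ j).lift (l ≫ x) t (by
          rw [reassoc_of% ht, hP.flip.w, reassoc_of% hxy, Category.assoc]), (hQ j).lift_fst _ _ _⟩)
    exact ⟨T, t, y, ht, hPT⟩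
  have hP' : IsPullback (val t) (e.hom ≫ pullback.fst (val g) (val f)) (val f) (val g) :=
    IsPullback.of_iso hP e.symm (Iso.refl _) (Iso.refl _) (Iso.refl _) (by simp [← het])
      (by simp) (by simp) (by simp)
  obtain ⟨q, hq, hq'⟩ := hg.exists_lift (t ≫ f) (e.hom ≫ pullback.fst (val g) (val f)) hP'.w.symm
  rw [← hq'] at hP'
  exact ⟨T, t, q, ht, isPullback_of_val ht hP', hP'⟩

/-- Pullbacks are unique up to isomorphism, and the one constructed above is preserved by the
forgetful functor. -/
theorem IsJClopen.isPullback_val {P X Y Z : ChartCat.{w} h} {p : P ⟶ X} {q : P ⟶ Y} {f : X ⟶ Z}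
    {g : Y ⟶ Z} (hg : IsJClopen g) (hP : IsPullback p q f g) :
    IsPullback (val p) (val q) (val f) (val g) := by
  obtain ⟨P', p', q', -, hP', hP''⟩ := hg.exists_isPullback f
  exact IsPullback.of_iso hP'' (asIso (val (hP.isoIsPullback _ _ hP').hom)).symm (Iso.refl _)
    (Iso.refl _) (Iso.refl _) (by simp [← val_comp]) (by simp [← val_comp]) (by simp) (by simp)

theorem IsJClopen.of_isPullback {P X Y Z : ChartCat.{w} h} {p : P ⟶ X} {q : P ⟶ Y} {f : X ⟶ Z}
    {g : Y ⟶ Z} (hg : IsJClopen g) (hP : IsPullback p q f g) : IsJClopen p := by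
  obtain ⟨P', p', q', hp', hP', -⟩ := hg.exists_isPullback f
  rw [← hP.isoIsPullback_hom_fst _ _ hP']
  exact (isJClopen_of_isIso _).comp hp'

theorem IsJClopen.of_comp {X Y Z : ChartCat.{w} h} {f : X ⟶ Y} {g : Y ⟶ Z}
    (hfg : IsJClopen (f ≫ g)) (hg : IsJClopen g) : IsJClopen f := by
  have := hg.mono
  exact hfg.of_isPullback (f := g) (q := 𝟙 X) ((isPullback_of_exists_lift (p := 𝟙 X) (by simp)
    fun T a b e ↦ ⟨a, by simp, by rw [← cancel_mono g, Category.assoc, e]⟩).flip)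

theorem isPresite_chartCoverings (h : Setting τ σ J) : IsPresite (chartCoverings.{w} h) where
  hasPullbacks_of_mem {X Y R} f hR := ⟨fun {Z g} hg ↦ by
    obtain ⟨P, p, q, -, hP, -⟩ := IsJClopen.exists_isPullback (hR.1 _ hg) f
    exact hP.flip.hasPullback⟩
  mem_coverings_of_isPullback {ι S X} f hf Y g P p q hP := by
    obtain ⟨h1, h2⟩ := ofArrows_mem_chartCoverings_iff.1 hf
    refine ofArrows_mem_chartCoverings_iff.2 ⟨fun i ↦ (h1 i).of_isPullback (hP i), ?_⟩
    obtain ⟨R, hR, hR'⟩ := IsPresite.exists_sieve h2 (val g)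
    refine σ.toGrothendieck.superset_covering (fun T k hk ↦ ?_) hR
    obtain ⟨i, y, hy⟩ := hR' k hk
    exact (Sieve.mem_ofArrows_iff _ _ _).2 ⟨i, ((h1 i).isPullback_val (hP i)).lift k y hy.symm,
      (((h1 i).isPullback_val (hP i)).lift_fst _ _ _).symm⟩
  comp_mem_coverings {ι S X} f hf κ Y g hg := by
    obtain ⟨h1, h2⟩ := ofArrows_mem_chartCoverings_iff.1 hf
    refine ofArrows_mem_chartCoverings_iff.2 ⟨fun i ↦
      ((ofArrows_mem_chartCoverings_iff.1 (hg i.1)).1 i.2).comp (h1 i.1), ?_⟩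
    refine ofArrows_mem_of_local h2 fun T k hk ↦ ?_
    obtain ⟨i, x, rfl⟩ := (Sieve.mem_ofArrows_iff _ _ _).1 hk
    obtain ⟨R, hR, hR'⟩ := IsPresite.exists_sieve (ofArrows_mem_chartCoverings_iff.1 (hg i)).2 x
    refine ⟨R, hR, fun T' l hl ↦ ?_⟩
    obtain ⟨j, y, hy⟩ := hR' l hl
    exact ⟨⟨i, j⟩, y, by rw [val_comp, reassoc_of% hy]⟩
  mem_coverings_of_isIso {S T} f _ := by
    rw [← Presieve.ofArrows_pUnit.{0}]
    refine ofArrows_mem_chartCoverings_iff.2 ⟨fun _ ↦ isJClopen_of_isIso f, ?_⟩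
    refine σ.toGrothendieck.superset_covering (fun T k _ ↦ ?_) (σ.toGrothendieck.top_mem _)
    exact (Sieve.mem_ofArrows_iff _ _ _).2 ⟨PUnit.unit, k ≫ inv (val f), by simp⟩
  mem_of_refinement {X} S R hS hR hRS := by
    obtain ⟨ι, U, u, rfl⟩ := S.exists_eq_ofArrows
    obtain ⟨κ, V, v, rfl⟩ := R.exists_eq_ofArrows
    obtain ⟨h1, h2⟩ := ofArrows_mem_chartCoverings_iff.1 hR
    refine ofArrows_mem_chartCoverings_iff.2
      ⟨fun i ↦ clopen_chartCoverings_iff.1 (hS _ ⟨i⟩), ?_⟩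
    refine σ.toGrothendieck.superset_covering (fun T k hk ↦ ?_) h2
    obtain ⟨i, x, rfl⟩ := (Sieve.mem_ofArrows_iff _ _ _).1 hk
    obtain ⟨Z, s, g, ⟨j⟩, hg⟩ := hRS (v i) ⟨i⟩
    exact (Sieve.mem_ofArrows_iff _ _ _).2 ⟨j, x ≫ val g, by
      rw [← hg, val_comp, Category.assoc]⟩

/-- Admissibility of an arrow can be checked on a covering of its source. -/
theorem exists_val_of_cover {P Q : ChartCat.{w} h} {ι : Type*} {U : ι → ChartCat.{w} h}
    {u : ∀ i, U i ⟶ P} (hu : Presieve.ofArrows U u ∈ chartCoverings h P) (g : P.X ⟶ Q.X)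
    (hg : ∀ i, ∃ f : U i ⟶ Q, val f = val (u i) ≫ g) : ∃ f : P ⟶ Q, val f = g := by
  obtain ⟨h1, h2⟩ := ofArrows_mem_chartCoverings_iff.1 hu
  choose f hf using hg
  have hcov : Sieve.ofArrows (fun s : Σ i, (U i).atlas.ι ↦ J.obj ((U s.1).atlas.U s.2))
      (fun s ↦ pt ((U s.1).chart s.2 ≫ u s.1)) ∈ σ.toGrothendieck P.X := by
    refine ofArrows_mem_of_local h2 fun T k hk ↦ ?_
    obtain ⟨i, x, rfl⟩ := (Sieve.mem_ofArrows_iff _ _ _).1 hk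
    obtain ⟨R, hR, hR'⟩ := IsPresite.exists_sieve (U i).cover_atlas x
    refine ⟨R, hR, fun T' l hl ↦ ?_⟩
    obtain ⟨j, y, hy⟩ := hR' l hl
    exact ⟨⟨i, j⟩, y, by rw [pt_comp, pt_chart, reassoc_of% hy]⟩
  -- The charts of the U i cover P. Those of P are representable along them, and on them g is
  -- admissible; representability composes.
  refine exists_val g fun l k ↦ h.isRepr_comp _ _ _ hcov (fun s ↦ ?_) fun s ↦ ?_
  · have := (((U s.1).isJClopen_chart s.2).comp (h1 s.1)).isRepr (P.chart l)
    rwa [pt_chart] at this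
  · rw [pt_comp, Category.assoc, ← hf, ← pt_comp]
    exact isRepr_pt _ k

theorem isSubcanonical_chartCoverings (h : Setting τ σ J) :
    IsSubcanonical (chartCoverings.{w} h) := by
  refine (isPresite_chartCoverings h).isSubcanonical fun U u hu Z ↦ ⟨fun f g hfg ↦ ?_,
    fun f hf ↦ ?_⟩
  · exact val_injective (h.target.subcanonical.hom_ext_of_cover
      (ofArrows_mem_chartCoverings_iff.1 hu).2 fun i ↦ by rw [← val_comp, hfg, val_comp])
  · obtain ⟨h1, h2⟩ := ofArrows_mem_chartCoverings_iff.1 hu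
    obtain ⟨g, hg⟩ := h.target.subcanonical.exists_desc h2 (fun i ↦ val (f i))
      fun i j Q a b hab ↦ by
        -- Compatibility is known for test objects of C_J only. The intersection is such an object,
        -- and its underlying object is the intersection in D, so this one case implies all others.
        obtain ⟨P, p, q, -, hP, hP'⟩ := (h1 j).exists_isPullback (u i)
        have := congrArg val (hf i j P p q hP.w)
        rw [val_comp, val_comp] at this
        rw [← hP'.lift_fst a b hab, Category.assoc, this, ← Category.assoc, hP'.lift_snd]
    obtain ⟨f', hf'⟩ := exists_val_of_cover hu g fun i ↦ ⟨f i, (hg i).symm⟩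
    exact ⟨f', fun i ↦ val_injective (by rw [val_comp, hf', hg])⟩

theorem isDGPresite_chartCoverings (h : Setting τ σ J) : IsDGPresite (chartCoverings.{w} h) where
  isPresite := isPresite_chartCoverings h
  mono f hf := (clopen_chartCoverings_iff.1 hf).mono
  subcanonical := isSubcanonical_chartCoverings h
  exists_factorization {X} S hS := by
    obtain ⟨ι, U, u, rfl⟩ := S.exists_eq_ofArrows
    have hu (i) : IsJClopen (u i) := clopen_chartCoverings_iff.1 (hS _ ⟨i⟩)
    -- The union of the sink is the union of all charts of its members; each member maps to it
    -- because it does so on its charts and t is monic.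
    obtain ⟨T, t, r, ht, hr, hcov⟩ := exists_union_charts
      (fun s : Σ i, (U i).atlas.ι ↦ (U s.1).chart s.2 ≫ u s.1)
      fun s ↦ ((U s.1).isJClopen_chart s.2).comp (hu s.1)
    have := ht.mono_val
    have := ht.mono
    have hl (i) : ∃ l : U i ⟶ T, l ≫ t = u i := by
      obtain ⟨l, hl⟩ := h.target.subcanonical.exists_lift_of_local (U i).cover_atlas (val t)
        (val (u i)) fun V k hk ↦ by
          obtain ⟨j, x, rfl⟩ := (Sieve.mem_ofArrows_iff _ _ _).1 hk
          refine ⟨x ≫ pt (r ⟨i, j⟩), ?_⟩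
          rw [Category.assoc, ← pt_comp, hr, pt_comp, pt_chart, Category.assoc]
      obtain ⟨l', hl', -⟩ := ht.exists_lift (u i) l hl
      exact ⟨l', hl'⟩
    choose l hl using hl
    refine ⟨T, t, Presieve.ofArrows U l, clopen_chartCoverings_iff.2 ht,
      ofArrows_mem_chartCoverings_iff.2 ⟨fun i ↦ IsJClopen.of_comp (g := t)
        (by rw [hl]; exact hu i) ht, ?_⟩, fun Y f ↦ ⟨?_, ?_⟩⟩
    · refine ofArrows_mem_of_local hcov fun V k hk ↦ ?_
      obtain ⟨⟨i, j⟩, x, rfl⟩ := (Sieve.mem_ofArrows_iff _ _ _).1 hk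
      refine ⟨⊤, σ.toGrothendieck.top_mem _, fun V' y _ ↦ ⟨i, y ≫ x ≫ (U i).atlas.u j, ?_⟩⟩
      rw [← cancel_mono (val t), Category.assoc, ← val_comp, hl, Category.assoc, Category.assoc,
        Category.assoc, Category.assoc, ← pt_comp, hr, pt_comp, pt_chart]
    · rintro ⟨i⟩
      exact ⟨l i, ⟨i⟩, hl i⟩
    · rintro ⟨g, ⟨i⟩, rfl⟩
      rw [hl]
      exact ⟨i⟩

end ChartPresite

/-! ### Density of C in C_J, and gluing in C_J -/

section ChartDense

variable {C : Type u₁} [Category.{v₁} C] {D : Type u₂} [Category.{v₂} D]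
  {τ : Precoverage C} {σ : Precoverage D} {J : C ⥤ D} {h : Setting τ σ J}

open ChartCat

theorem isJClopen_map {U V : C} {w : V ⟶ U} (hw : clopen τ w) :
    IsJClopen ((chartFunctor.{w} h).map w) := by
  have := h.mono_map hw
  refine (isJClopen_iff_of_atlas _ (A := idAtlas h V) (B := idAtlas h U) rfl rfl).2 ⟨this, ?_⟩
  have e : IsPullback (J.map (𝟙 V)) (J.map w) (𝟙 (J.obj V) ≫ J.map w) (𝟙 (J.obj U)) := by
    rw [J.map_id]
    exact IsPullback.of_horiz_isIso ⟨by simp⟩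
  have : IsClopenRepr τ J (𝟙 (J.obj V) ≫ J.map w) (𝟙 (J.obj U)) :=
    ⟨V, 𝟙 V, w, clopen_of_isIso h.source.isPresite _, hw, e⟩
  exact fun _ _ ↦ this

theorem isContinuous_chartFunctor (h : Setting τ σ J) :
    IsContinuous τ (chartCoverings.{w} h) (chartFunctor.{w} h) where
  map_mem {X} S hS := by
    obtain ⟨ι, U, u, rfl⟩ := S.exists_eq_ofArrows
    obtain ⟨h1, h2⟩ := h.source.isPresite.ofArrows_mem_iff.1 hS
    rw [Presieve.map_ofArrows]
    exact ofArrows_mem_chartCoverings_iff.2 ⟨fun i ↦ isJClopen_map (h1 i),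
      h.admitsAtlases.isContinuous.cover_map h.target.isPresite h.source.isPresite h2⟩
  map_isPullback {P X Y Z p q f u} hu hP :=
    isPullback_of_val (isJClopen_map (clopen.of_isPullback h.source.isPresite hP.flip hu))
      (h.admitsAtlases.isContinuous.map_isPullback hu hP)

theorem faithful_chartFunctor (h : Setting τ σ J) : (chartFunctor.{w} h).Faithful where
  map_injective e :=
    have := h.admitsAtlases.faithful
    J.map_injective (congrArg val e)

theorem full_chartFunctor (h : Setting τ σ J) : (chartFunctor.{w} h).Full where
  map_surjective {U V} f := by
    let f₀ : J.obj U ⟶ J.obj V := pt f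
    have hf : IsRepr τ J (𝟙 (J.obj U) ≫ f₀) (𝟙 (J.obj V)) :=
      (isAdmissible_iff (P := (chartFunctor.{w} h).obj U)
        (Q := (chartFunctor.{w} h).obj V) (A := idAtlas h U) (B := idAtlas h V) rfl rfl _).1
        (ChartCat.Hom.admissible f) PUnit.unit PUnit.unit
    rw [Category.id_comp] at hf
    obtain ⟨W, a, g, ha, hP⟩ := hf
    -- Admissibility with respect to the identity charts represents the base change of an identity,
    -- so a is invertible after applying J, hence in C.
    have : IsIso (J.map a) := hP.isIso_fst_of_isIso
    have := h.isIso_of_map ha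
    refine ⟨inv a ≫ g, val_injective ?_⟩
    have e : J.map (inv a ≫ g) = f₀ := by
      rw [J.map_comp, Functor.map_inv, IsIso.inv_comp_eq, hP.w, Category.comp_id]
    exact e

/-- The charts of V are clopen in U, so V is a union of clopen subobjects of U, which can be formed
in C. -/
theorem IsJClopen.exists_iso {U : C} {V : ChartCat.{w} h} {v : V ⟶ (chartFunctor h).obj U}
    (hv : IsJClopen v) : ∃ (W : C) (x : W ⟶ U) (e : (chartFunctor h).obj W ≅ V),
      clopen τ x ∧ e.hom ≫ v = (chartFunctor h).map x := by
  obtain ⟨hm, hv'⟩ := (isJClopen_iff_of_atlas v (B := idAtlas h U) V.mk_atlas rfl).1 hv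
  let v₀ : V.X ⟶ J.obj U := val v
  have : Mono v₀ := hm
  have hv'' (j) : IsClopenRepr τ J (V.atlas.u j ≫ v₀) (𝟙 (J.obj U)) := hv' j PUnit.unit
  choose W g a hg ha hP using hv''
  obtain ⟨T, t, y, -, ht, -, -, -, hPT⟩ := h.exists_isPullback_of_local (𝟙 _) v₀ a ha
    (fun j ↦ J.map (g j) ≫ V.atlas.u j) (fun j ↦ by rw [Category.assoc, (hP j).w])
    (fun T x y hxy ↦ by
      obtain ⟨R, hR, hR'⟩ := IsPresite.exists_sieve V.cover_atlas y
      refine ⟨R, hR, fun T' l hl ↦ ?_⟩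
      obtain ⟨j, t, ht⟩ := hR' l hl
      exact ⟨j, (hP j).lift t (l ≫ x) (by rw [reassoc_of% ht, hxy, Category.assoc]),
        (hP j).lift_snd _ _ _⟩)
  have : IsIso y := hPT.isIso_snd_of_isIso
  obtain ⟨l, hl, hly⟩ := hv.exists_lift ((chartFunctor h).map t) y
    (by
      have := hPT.w
      rw [Category.comp_id] at this
      exact this.symm)
  have : IsIso (val l) := by
    rw [hly]
    assumption
  have := (IsJClopen.of_comp (f := l) (hl ▸ isJClopen_map ht) hv).isIso
  exact ⟨T, t, asIso l, ht, hl⟩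

theorem isDenseEmbedding_chartFunctor (h : Setting τ σ J) :
    IsDenseEmbedding.{w} τ (chartCoverings.{w} h) (chartFunctor.{w} h) where
  source := h.source
  target := isDGPresite_chartCoverings h
  full := full_chartFunctor h
  faithful := faithful_chartFunctor h
  isContinuous := isContinuous_chartFunctor h
  exists_charts P := ⟨P.atlas.ι, P.atlas.U, P.chart, ofArrows_mem_chartCoverings_iff.2
    ⟨P.isJClopen_chart, by
      have e (i) : val (P.chart i) = P.atlas.u i := P.pt_chart i
      simp only [e]
      exact P.cover_atlas⟩⟩
  exists_clopen _ _ _ hv := (clopen_chartCoverings_iff.1 hv).exists_iso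
  reflectsCoverings {X} S hS hS' := by
    obtain ⟨ι, U, u, rfl⟩ := S.exists_eq_ofArrows
    rw [Presieve.map_ofArrows] at hS'
    refine h.admitsAtlases.reflectsCoverings _ hS ?_
    rw [Presieve.map_ofArrows]
    exact h.target.isPresite.ofArrows_mem_iff.2
      ⟨fun i ↦ h.admitsAtlases.isContinuous.map_clopen (hS _ ⟨i⟩),
        (ofArrows_mem_chartCoverings_iff.1 hS').2⟩

theorem HasGluing.of_max (hg : HasGluing.{max w w'} σ) : HasGluing.{w} σ := by
  intro ι U rel hrel
  obtain ⟨X, u, hu⟩ := hg (ι := ULift.{w'} ι) (fun i ↦ U i.down)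
    (fun T i j x y ↦ rel i.down j.down x y)
    ⟨fun T i ↦ hrel.self_iff _, fun T i j ↦ hrel.symm _ _, fun T i j k ↦ hrel.trans _ _ _,
      fun i j ↦ hrel.exists_rep _ _⟩
  refine ⟨X, fun i ↦ u ⟨i⟩, ⟨?_, fun T i j ↦ hu.rel_iff ⟨i⟩ ⟨j⟩⟩⟩
  have := Presieve.ofArrows_comp_eq_of_surjective u (a := fun i : ι ↦ ULift.up i)
    (fun i ↦ ⟨i.down, rfl⟩)
  have e := hu.mem
  rw [← this] at e
  exact e

/-- The underlying objects are glued in D, and the charts of all pieces together form an atlas of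
the result. -/
theorem hasGluing_chartCoverings (h : Setting τ σ J) (hg : HasGluing.{w} σ) :
    HasGluing.{w} (chartCoverings.{w} h) := by
  intro ι U rel hrel
  have hσ := h.target.isPresite
  choose W a b ha hb hW using hrel.exists_rep
  replace ha (i j) : IsJClopen (a i j) := clopen_chartCoverings_iff.1 (ha i j)
  replace hb (i j) : IsJClopen (b i j) := clopen_chartCoverings_iff.1 (hb i j)
  have hab (i j) : rel i j (a i j) (b i j) := (hW i j _ _).2 ⟨𝟙 _, by simp, by simp⟩
  -- Since `rel` speaks of elements over objects of C_J only, the relation in D is defined by the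
  -- representing overlaps W i j. Its properties are verified on the universal elements.
  obtain ⟨X, u, hu⟩ := hg (fun i ↦ (U i).X)
    (fun T i j x y ↦ ∃ t : T ⟶ (W i j).X, t ≫ val (a i j) = x ∧ t ≫ val (b i j) = y)
    { self_iff := fun T i x y ↦ by
        constructor
        · rintro ⟨t, rfl, rfl⟩
          rw [(hrel.self_iff i _ _).1 (hab i i)]
        · rintro rfl
          obtain ⟨t, h1, h2⟩ := (hW i i _ _).1 ((hrel.self_iff i (𝟙 _) _).2 rfl)
          exact ⟨x ≫ val t, by rw [Category.assoc, ← val_comp, h1, val_id, Category.comp_id],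
            by rw [Category.assoc, ← val_comp, h2, val_id, Category.comp_id]⟩
      symm := fun T i j x y ↦ by
        rintro ⟨t, rfl, rfl⟩
        obtain ⟨s, h1, h2⟩ := (hW j i _ _).1 (hrel.symm _ _ _ _ (hab i j))
        exact ⟨t ≫ val s, by rw [Category.assoc, ← val_comp, h1],
          by rw [Category.assoc, ← val_comp, h2]⟩
      trans := fun T i j k x y z ↦ by
        rintro ⟨t, rfl, rfl⟩ ⟨t', h1, rfl⟩
        obtain ⟨P, p, q, -, hP, hP'⟩ := (ha j k).exists_isPullback (b i j)
        obtain ⟨s, hs1, hs2⟩ := (hW i k _ _).1 (hrel.trans i j k (p ≫ a i j) (p ≫ b i j)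
          (q ≫ b j k) ((hW _ _ _ _).2 ⟨p, rfl, rfl⟩) ((hW _ _ _ _).2 ⟨q, hP.w.symm, rfl⟩))
        refine ⟨hP'.lift t t' h1.symm ≫ val s, ?_, ?_⟩
        · rw [Category.assoc, ← val_comp, hs1, val_comp, hP'.lift_fst_assoc]
        · rw [Category.assoc, ← val_comp, hs2, val_comp, hP'.lift_snd_assoc]
      exists_rep := fun i j ↦ ⟨(W i j).X, val (a i j), val (b i j), (ha i j).clopen_val,
        (hb i j).clopen_val, fun T x y ↦ Iff.rfl⟩ }
  obtain ⟨hu1, hu2⟩ := hσ.ofArrows_mem_iff.1 hu.mem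
  have hm (i) : Mono (u i) := h.target.mono _ (hu1 i)
  -- Restricted to W i j, a chart of U i and a chart of U j become J-clopen charts of one object of
  -- C_J, and such charts have a representable intersection.
  have key (i k j l) : IsClopenRepr τ J ((U i).atlas.u k ≫ u i) ((U j).atlas.u l ≫ u j) := by
    obtain ⟨P₁, p₁, q₁, hp₁, hP₁, -⟩ := (ha i j).exists_isPullback ((U i).chart k)
    obtain ⟨P₂, p₂, q₂, hp₂, hP₂, -⟩ := (hb i j).exists_isPullback ((U j).chart l)
    obtain ⟨W₁, w₁, e₁, hw₁, he₁⟩ := hp₁.exists_iso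
    obtain ⟨W₂, w₂, e₂, hw₂, he₂⟩ := hp₂.exists_iso
    have hQ₁ : IsPullback ((chartFunctor h).map w₁) (e₁.hom ≫ q₁) ((U i).chart k) (a i j) :=
      IsPullback.of_iso hP₁ e₁.symm (Iso.refl _) (Iso.refl _) (Iso.refl _) (by simp [← he₁])
        (by simp) (by simp) (by simp)
    have hQ₂ : IsPullback ((chartFunctor h).map w₂) (e₂.hom ≫ q₂) ((U j).chart l) (b i j) :=
      IsPullback.of_iso hP₂ e₂.symm (Iso.refl _) (Iso.refl _) (Iso.refl _) (by simp [← he₂])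
        (by simp) (by simp) (by simp)
    have hr₁ := ((U i).isJClopen_chart k).of_isPullback hQ₁.flip
    have hr₂ := ((U j).isJClopen_chart l).of_isPullback hQ₂.flip
    have hv₁ : IsPullback (J.map w₁) (pt (e₁.hom ≫ q₁)) (pt ((U i).chart k)) (val (a i j)) :=
      (ha i j).isPullback_val hQ₁
    have hv₂ : IsPullback (J.map w₂) (pt (e₂.hom ≫ q₂)) (pt ((U j).chart l)) (val (b i j)) :=
      (hb i j).isPullback_val hQ₂
    rw [pt_chart] at hv₁ hv₂
    obtain ⟨O, o₁, o₂, ho₁, ho₂, hO⟩ := hr₂.isClopenRepr hr₁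
    have hc₁ := clopen.comp h.source.isPresite ho₁ hw₁
    have := h.mono_map hc₁
    refine ⟨O, o₁ ≫ w₁, o₂ ≫ w₂, hc₁, clopen.comp h.source.isPresite ho₂ hw₂,
      isPullback_of_exists_lift ?_ fun T x y hxy ↦ ?_⟩
    · rw [J.map_comp, J.map_comp, Category.assoc, Category.assoc, reassoc_of% hv₁.w,
        reassoc_of% hv₂.w, reassoc_of% hO.w]
      congr 2
      exact (hu.rel_iff i j _ _).1 ⟨𝟙 _, by simp, by simp⟩
    · rw [← Category.assoc, ← Category.assoc] at hxy
      obtain ⟨t, h1, h2⟩ := (hu.rel_iff i j _ _).2 hxy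
      refine ⟨hO.lift (hv₁.lift x t h1.symm) (hv₂.lift y t h2.symm)
        (by rw [hv₁.lift_snd, hv₂.lift_snd]), ?_, ?_⟩
      · rw [J.map_comp, hO.lift_fst_assoc, hv₁.lift_fst]
      · rw [J.map_comp, hO.lift_snd_assoc, hv₂.lift_fst]
  let A : Atlas.{w} τ σ J X :=
    { ι := Σ i, (U i).atlas.ι
      U := fun s ↦ (U s.1).atlas.U s.2
      u := fun s ↦ (U s.1).atlas.u s.2 ≫ u s.1
      isAtlas :=
        { covering := by
            refine hσ.ofArrows_mem_iff.2 ⟨fun s ↦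
              clopen.comp hσ ((U s.1).atlas.clopen_chart s.2) (hu1 s.1), ?_⟩
            refine ofArrows_mem_of_local hu2 fun T k hk ↦ ?_
            obtain ⟨i, x, rfl⟩ := (Sieve.mem_ofArrows_iff _ _ _).1 hk
            obtain ⟨R, hR, hR'⟩ := IsPresite.exists_sieve (U i).cover_atlas x
            refine ⟨R, hR, fun T' l hl ↦ ?_⟩
            obtain ⟨j, y, hy⟩ := hR' l hl
            exact ⟨⟨i, j⟩, y, by rw [reassoc_of% hy]⟩
          overlap := fun s t ↦ key s.1 s.2 t.1 t.2 } }
  let Q : ChartCat.{w} h := ⟨X, Quotient.mk (atlasSetoid.{w} h X) A⟩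
  choose f hf using fun i ↦ exists_val_of_atlas (P := U i) (Q := Q) (B := A) (U i).mk_atlas rfl
    (u i) fun k s ↦ (key i k s.1 s.2).isRepr
  refine ⟨Q, f, ⟨ofArrows_mem_chartCoverings_iff.2 ⟨fun i ↦ ?_, ?_⟩, fun T i j x y ↦ ?_⟩⟩
  · refine (isJClopen_iff_of_atlas (f i) (B := A) (U i).mk_atlas rfl).2 ?_
    rw [hf]
    exact ⟨hm i, fun k s ↦ key i k s.1 s.2⟩
  · simp only [hf]
    exact hu2
  · have e : x ≫ f i = y ≫ f j ↔ val x ≫ u i = val y ≫ u j := by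
      rw [← hf, ← hf]
      exact ⟨congrArg val, fun e ↦ val_injective e⟩
    rw [e, ← hu.rel_iff, hW]
    constructor
    · rintro ⟨t, rfl, rfl⟩
      exact ⟨val t, rfl, rfl⟩
    · rintro ⟨t, h1, h2⟩
      obtain ⟨l, hl, hl'⟩ := (ha i j).exists_lift x t h1
      exact ⟨l, hl, val_injective (by rw [val_comp, hl', h2])⟩

end ChartDense

/-! ### Coding small data by sets of the universe -/

section SetCodes

/-- A type which embeds into the class of sets in the universe. -/
def HasCodes (T : Type u₀) : Prop := ∃ f : T → ZFSet.{w}, Function.Injective f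

/-- A small set embeds into the cardinals of the universe, these into the ordinals, and ordinals are
sets. -/
theorem hasCodes_of_small (T : Type u₀) [Small.{w} T] : HasCodes.{w} T := by
  obtain ⟨e⟩ := nonempty_embedding_to_cardinal (α := Shrink.{w} T)
  exact ⟨fun t ↦ (e (equivShrink T t)).ord.toZFSet, fun x y hxy ↦
    (equivShrink T).injective (e.injective
      (Cardinal.ord_injective (Ordinal.toZFSet_injective hxy)))⟩

theorem HasCodes.sigma {S : Type u₀} {T : S → Type u₁} (hS : HasCodes.{w} S)
    (hT : ∀ s, HasCodes.{w} (T s)) : HasCodes.{w} (Σ s, T s) := by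
  obtain ⟨f, hf⟩ := hS
  choose g hg using hT
  refine ⟨fun t ↦ (f t.1).pair (g t.1 t.2), ?_⟩
  rintro ⟨s, t⟩ ⟨s', t'⟩ e
  obtain ⟨e1, e2⟩ := ZFSet.pair_injective e
  obtain rfl := hf e1
  exact congrArg (Sigma.mk _) (hg _ e2)

/-- A function on a small set is coded by its graph. -/
theorem HasCodes.pi {S : Type u₀} [Small.{w} S] {T : S → Type u₁}
    (hT : ∀ s, HasCodes.{w} (T s)) : HasCodes.{w} (∀ s, T s) := by
  obtain ⟨f, hf⟩ := hasCodes_of_small.{w} S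
  choose g hg using hT
  refine ⟨fun t ↦ ZFSet.range fun s ↦ (f s).pair (g s (t s)), fun t t' e ↦ funext fun s ↦ ?_⟩
  have hs := ZFSet.mem_range_self (f := fun s ↦ (f s).pair (g s (t s))) s
  dsimp only at e
  rw [e, ZFSet.mem_range] at hs
  obtain ⟨s', hs'⟩ := hs
  obtain ⟨e1, e2⟩ := ZFSet.pair_injective hs'
  obtain rfl := hf e1
  exact (hg _ e2).symm

end SetCodes

/-! ### Recognizing U-categories -/

section UCategory

variable {C : Type u₁} [Category.{v₁} C]

/-- A category with small hom-sets is a `U`-category if its isomorphism classes can be encoded by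
sets. -/
theorem isUCategory_of_codes [LocallySmall.{w} C] {T : Type u₀} (hT : HasCodes.{w} T)
    (R : C → T → Prop) (ex : ∀ X, ∃ t, R X t)
    (uniq : ∀ X Y t, R X t → R Y t → Nonempty (X ≅ Y)) : IsUCategory.{w} C := by
  obtain ⟨f, hf⟩ := hT
  choose t ht using ex
  let A : Set ZFSet.{w} := Set.range fun X ↦ f (t X)
  choose G hG using fun a : A ↦ a.2
  let F : A → ShrinkHoms C := fun a ↦ ShrinkHoms.toShrinkHoms (G a)
  have : (inducedFunctor F).EssSurj := ⟨fun X ↦ by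
    let a : A := ⟨f (t (ShrinkHoms.fromShrinkHoms X)), Set.mem_range_self _⟩
    have e : t (G a) = t (ShrinkHoms.fromShrinkHoms X) := hf (hG a)
    obtain ⟨i⟩ := uniq _ _ _ (ht (G a)) (e ▸ ht (ShrinkHoms.fromShrinkHoms X))
    exact ⟨a, ⟨(ShrinkHoms.equivalence C).functor.mapIso i⟩⟩⟩
  have : (inducedFunctor F).IsEquivalence := {}
  have e : InducedCategory (ShrinkHoms C) F ≌ C :=
    (inducedFunctor F).asEquivalence.trans (ShrinkHoms.equivalence C).symm
  exact ⟨A, _, ⟨e.symm⟩⟩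

/-- Objects glued from the same data are isomorphic. -/
theorem IsSubcanonical.nonempty_iso {ν : Precoverage C} (hν : IsPresite ν)
    (hs : IsSubcanonical ν) {P Q : C} {ι : Type*} {U : ι → C} {u : ∀ i, U i ⟶ P}
    {v : ∀ i, U i ⟶ Q} (hu : Presieve.ofArrows U u ∈ ν P) (hv : Presieve.ofArrows U v ∈ ν Q)
    (huv : ∀ i j, ∃ (W : C) (a : W ⟶ U i) (b : W ⟶ U j),
      IsPullback a b (u i) (u j) ∧ IsPullback a b (v i) (v j)) : Nonempty (P ≅ Q) := by
  have hu' := (hν.ofArrows_mem_iff.1 hu).2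
  have hv' := (hν.ofArrows_mem_iff.1 hv).2
  choose W a b hP hQ using huv
  obtain ⟨f, hf⟩ := hs.exists_desc hu' v fun i j T x y e ↦ by
    rw [← (hP i j).lift_fst x y e, Category.assoc, (hQ i j).w, ← Category.assoc,
      (hP i j).lift_snd]
  obtain ⟨g, hg⟩ := hs.exists_desc hv' u fun i j T x y e ↦ by
    rw [← (hQ i j).lift_fst x y e, Category.assoc, (hP i j).w, ← Category.assoc,
      (hQ i j).lift_snd]
  exact ⟨⟨f, g, hs.hom_ext_of_cover hu' fun i ↦ by rw [reassoc_of% (hf i), hg, Category.comp_id],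
    hs.hom_ext_of_cover hv' fun i ↦ by rw [reassoc_of% (hg i), hf, Category.comp_id]⟩⟩

end UCategory

/-! ### Smallness of a densely covered presite -/

section Dense

variable {C : Type u₁} [Category.{v₁} C] {N : Type u₂} [Category.{v₂} N]
  {τ : Precoverage C} {ν : Precoverage N} {K : C ⥤ N}

/-- An arrow K U ⟶ Q is determined by the base changes of the charts of Q, each of which is a clopen
subobject of U with an arrow of C. A general arrow is determined on the charts of its source. -/
theorem IsDenseEmbedding.locallySmall (h : IsDenseEmbedding.{w} τ ν K) (hC : IsDGUPresite.{w} τ) :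
    LocallySmall.{w} N where
  hom_small P Q := by
    have hν := h.target.isPresite
    have := h.full
    have := h.faithful
    have (X Y : C) : Small.{w} (X ⟶ Y) := hC.isUPresite.isUCategory.small_hom X Y
    have key (U : C) : Small.{w} (K.obj U ⟶ Q) := by
      obtain ⟨ι, B, β, hβ⟩ := h.exists_charts Q
      obtain ⟨hβ1, hβ2⟩ := hν.ofArrows_mem_iff.1 hβ
      obtain ⟨I, W, w, hw, hW⟩ := hC.exists_small_clopens U
      have ex (f : K.obj U ⟶ Q) (k) : ∃ s : Σ i : I, W i ⟶ B k,
          IsPullback (K.map (w s.1)) (K.map s.2) f (β k) := by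
        obtain ⟨V, x, y, hx, -, hP⟩ := h.exists_isPullback_chart f (hβ1 k)
        obtain ⟨i, e, he⟩ := hW x hx
        refine ⟨⟨i, e.inv ≫ y⟩, IsPullback.of_iso hP (K.mapIso e) (Iso.refl _) (Iso.refl _)
          (Iso.refl _) ?_ ?_ (by simp) (by simp)⟩
        · simp [← he]
        · simp
      choose s hs using ex
      refine small_of_injective (f := s) fun f g e ↦ ?_
      refine h.target.subcanonical.hom_ext_of_cover (hν.ofArrows_mem_iff.1
        (Precoverage.mem_coverings_of_isPullback _ hβ f _ _ (fun i ↦ hs f i))).2 fun k ↦ ?_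
      have := (hs g k).w
      rw [← e] at this
      rw [this, (hs f k).w]
    obtain ⟨ι, U, u, hu⟩ := h.exists_charts P
    exact small_of_injective (f := fun (f : P ⟶ Q) i ↦ u i ≫ f) fun f g e ↦
      h.target.subcanonical.hom_ext_of_cover (hν.ofArrows_mem_iff.1 hu).2 fun i ↦ congrFun e i

/-- An object is determined up to isomorphism by its charts and their overlaps, that is, by small
data in C. -/
theorem IsDenseEmbedding.isUCategory (h : IsDenseEmbedding.{w} τ ν K)
    (hC : IsDGUPresite.{w} τ) : IsUCategory.{w} N := by
  have hν := h.target.isPresite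
  have := h.locallySmall hC
  have := h.full
  have := h.faithful
  obtain ⟨A, _, ⟨e⟩⟩ := hC.isUPresite.isUCategory
  let L : A ⥤ N := e.inverse ⋙ K
  -- Gluing data: a set z of indices, charts, and for each pair of indices an overlap with its two
  -- projections, all in the set-coded model A of C.
  let T := Σ z : ZFSet.{w}, Σ U : z → A, ∀ i j, Σ W : A, (W ⟶ U i) × (W ⟶ U j)
  have hA : HasCodes.{w} A := ⟨Subtype.val, Subtype.val_injective⟩
  have hT : HasCodes.{w} T := HasCodes.sigma ⟨id, Function.injective_id⟩ fun z ↦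
    (HasCodes.pi fun _ ↦ hA).sigma fun U ↦ .pi fun i ↦ .pi fun j ↦ hA.sigma fun W ↦
      hasCodes_of_small _
  refine isUCategory_of_codes hT (fun P t ↦ ∃ u : ∀ i, L.obj (t.2.1 i) ⟶ P,
    Presieve.ofArrows _ u ∈ ν P ∧ ∀ i j,
      IsPullback (L.map (t.2.2 i j).2.1) (L.map (t.2.2 i j).2.2) (u i) (u j)) (fun P ↦ ?_) ?_
  · obtain ⟨ι, U, u, hu⟩ := h.exists_charts P
    obtain ⟨hu1, hu2⟩ := hν.ofArrows_mem_iff.1 hu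
    -- The index set of the charts is replaced by a set of the universe.
    obtain ⟨f, hf⟩ := hasCodes_of_small.{w} ι
    choose p hp using fun i : ZFSet.range f ↦ ZFSet.mem_range.1 i.2
    have hp' (i : ι) : p ⟨f i, ZFSet.mem_range_self i⟩ = i := hf (hp _)
    have hv (i : ZFSet.range f) : clopen ν (K.map (e.unitIso.inv.app (U (p i))) ≫ u (p i)) :=
      clopen.comp hν (clopen_of_isIso hν _) (hu1 (p i))
    choose W x y hx hy hP using fun i j ↦
      h.exists_isPullback_chart (K.map (e.unitIso.inv.app (U (p i))) ≫ u (p i)) (hv j)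
    refine ⟨⟨ZFSet.range f, fun i ↦ e.functor.obj (U (p i)), fun i j ↦ ⟨e.functor.obj (W i j),
      e.inverse.preimage (e.unitIso.inv.app _ ≫ x i j),
      e.inverse.preimage (e.unitIso.inv.app _ ≫ y i j)⟩⟩, fun i ↦ _,
      hν.ofArrows_mem_iff.2 ⟨hv, ?_⟩, fun i j ↦ ?_⟩
    · refine ν.toGrothendieck.superset_covering (fun V k hk ↦ ?_) hu2
      obtain ⟨i, x, rfl⟩ := (Sieve.mem_ofArrows_iff _ _ _).1 hk
      refine (Sieve.mem_ofArrows_iff _ _ _).2 ⟨⟨f i, ZFSet.mem_range_self i⟩, ?_⟩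
      dsimp only
      rw [hp' i]
      exact ⟨x ≫ K.map (e.unitIso.hom.app (U i)), by
        rw [Category.assoc, ← K.map_comp_assoc, Iso.hom_inv_id_app]
        simp⟩
    · exact IsPullback.of_iso (hP i j) (K.mapIso (e.unitIso.app (W i j))) (Iso.refl _)
        (Iso.refl _) (Iso.refl _) (by
          change K.map _ ≫ 𝟙 _ = K.map (e.unitIso.hom.app _) ≫ K.map (e.inverse.map _)
          rw [Functor.map_preimage, ← K.map_comp, Iso.hom_inv_id_app_assoc, Category.comp_id]) (by
          change K.map _ ≫ 𝟙 _ = K.map (e.unitIso.hom.app _) ≫ K.map (e.inverse.map _)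
          rw [Functor.map_preimage, ← K.map_comp, Iso.hom_inv_id_app_assoc, Category.comp_id])
        (by simp) (by simp)
  · rintro P Q ⟨z, U, t⟩ ⟨u, hu, hu'⟩ ⟨v, hv, hv'⟩
    exact h.target.subcanonical.nonempty_iso hν hu hv fun i j ↦ ⟨_, _, _, hu' i j, hv' i j⟩

/-- A presite covered by small families of charts in a DG-`U`-presite is one itself. -/
theorem IsDenseEmbedding.isDGUPresite (h : IsDenseEmbedding.{w} τ ν K)
    (hC : IsDGUPresite.{w} τ) : IsDGUPresite.{w} ν where
  toIsDGPresite := h.target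
  isUPresite :=
    { isPresite := h.target.isPresite
      isUCategory := h.isUCategory hC
      exists_generators := fun P ↦ by
        have hν := h.target.isPresite
        obtain ⟨ι, U, u, hu⟩ := h.exists_charts P
        obtain ⟨hu1, hu2⟩ := hν.ofArrows_mem_iff.1 hu
        choose G hG hG' using fun i ↦ hC.isUPresite.exists_generators (U i)
        refine ⟨⋃ i, K.obj '' G i, inferInstance, fun V v hv ↦ ?_⟩
        have (i : ι) : HasPullback v (u i) := clopen.hasPullback hν hv _
        have hP (i) := IsPullback.of_hasPullback v (u i)
        -- A clopen subobject of P meets each chart in a clopen subobject from C, which is covered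
        -- by generators for that chart; the generators of all charts together form a small set.
        choose W w e hw he using fun i ↦ h.exists_clopen _ (clopen.of_isPullback hν (hP i) hv)
        choose S hS hSG using fun i ↦ hG' i (w i) (hw i)
        choose κ X x hx using fun i ↦ (S i).exists_eq_ofArrows
        have hcov (i) : Presieve.ofArrows (X i) (x i) ∈ τ (W i) := hx i ▸ hS i
        have hcov' (i) := h.source.isPresite.ofArrows_mem_iff.1 (hcov i)
        refine ⟨Presieve.ofArrows (fun s : Σ i, κ i ↦ K.obj (X s.1 s.2)) (fun s ↦
          K.map (x s.1 s.2) ≫ (e s.1).hom ≫ pullback.fst v (u s.1)),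
          hν.ofArrows_mem_iff.2 ⟨fun s ↦ ?_, ?_⟩, ?_⟩
        · exact clopen.comp hν (h.isContinuous.map_clopen ((hcov' s.1).1 s.2)) (clopen.comp hν
            (clopen_of_isIso hν _) (clopen.of_isPullback hν (hP s.1).flip (hu1 s.1)))
        · have hc := hν.ofArrows_mem_iff.1
            (Precoverage.mem_coverings_of_isPullback _ hu v _ _ fun i ↦ hP i)
          refine ofArrows_mem_of_local hc.2 fun T k hk ↦ ?_
          obtain ⟨i, y, rfl⟩ := (Sieve.mem_ofArrows_iff _ _ _).1 hk
          obtain ⟨R, hR, hR'⟩ := IsPresite.exists_sieve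
            (h.isContinuous.cover_map hν h.source.isPresite (hcov' i).2) (y ≫ (e i).inv)
          refine ⟨R, hR, fun T' l hl ↦ ?_⟩
          obtain ⟨j, t, ht⟩ := hR' l hl
          exact ⟨⟨i, j⟩, t, by rw [reassoc_of% ht, Iso.inv_hom_id_assoc]⟩
        · rintro Y f ⟨s⟩
          exact Set.mem_iUnion.2 ⟨s.1, _, hSG s.1 (x s.1 s.2) (hx s.1 ▸ ⟨s.2⟩), rfl⟩ }

end Dense

end Charts

/-! ### The main theorem -/

theorem mainTheorem3 {C : Type u₁} [Category.{v₁} C] {D : Type u₂} [Category.{v₂} D]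
    (τ : Precoverage C) (σ : Precoverage D) (J : C ⥤ D)
    (hC : Charts.IsDGUPresite.{w} τ) (hD : Charts.IsDGUPresite.{max w w'} σ)
    (hJ : Charts.AdmitsAtlases τ σ J) :
    Charts.IsDGUPresite.{w} (Charts.chartCoverings.{w}
      (⟨hC.toIsDGPresite, hD.toIsDGPresite, hJ⟩ : Charts.Setting τ σ J)) ∧
    (Charts.IsNearlyGlutos.{max w w'} σ →
      Charts.IsUniversalNearlyGlutos.{w} τ
        (Charts.chartCoverings.{w}
          (⟨hC.toIsDGPresite, hD.toIsDGPresite, hJ⟩ : Charts.Setting τ σ J))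
        (Charts.chartFunctor.{w}
          (⟨hC.toIsDGPresite, hD.toIsDGPresite, hJ⟩ : Charts.Setting τ σ J))) := by
  have h : Charts.Setting τ σ J := ⟨hC.toIsDGPresite, hD.toIsDGPresite, hJ⟩
  have hd := Charts.isDenseEmbedding_chartFunctor.{w} h
  have hN := hd.isDGUPresite hC
  refine ⟨hN, fun hσ ↦ ⟨?_, hd.isContinuous, fun E _ ρ hρ ↦ ?_⟩⟩
  -- The hypothesis on D enters only here, through gluing of families small for the larger universe,
  -- which include those indexed in the smaller one.
  · exact (Charts.hasGluing_chartCoverings h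
      (Charts.HasGluing.of_max.{w, w'} hσ.hasGluing)).isNearlyGlutos hN
  · exact hd.isEquivalence_precomp hρ.isDGUPresite.toIsDGPresite hρ.hasGluing
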